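/- **Theorem 4.1.** Fix $p\in\mathbb N$, $0<\alpha<p$, and an $\alpha$-Hölder function $f_0:[0,1]^p\to\mathbb R$ (with $k$ the largest integer strictly smaller than $\alpha$, $f_0\in C^k([0,1]^p)$ and its $k$-th derivative is $(\alpha-k)$-Hölder; in particular $f_0$ is bounded). For each $n$ let $x_1,\dots,x_n\in[0,1]^p$ be fixed (they may depend on $n$), and let $\mathbb P_0^n$ be the law of $Y^{(n)}=(Y_1,\dots,Y_n)$, $Y_i=f_0(x_i)+\epsilon_i$, $\epsilon_i$ i.i.d. $N(0,1)$. Write $\langle g,h\rangle_L=\frac1n\sum_{i=1}^n g(x_i)h(x_i)$, $\|g\|_L^2=\langle g,g\rangle_L$ and $W_n(g)=\frac1n\sum_{i=1}^n\sqrt n\,\epsilon_i\,g(x_i)$. *Prior.* Let $\lambda>0$, $\lambda_s>0$, and let $L=L_n\in\mathbb N$ satisfy $L\asymp\log n$. Given $N\ge 1$, consider ReLU networks $$f_B(x)=W_{L+1}Z_L(x)+b_{L+1},\quad Z_0(x)=x,\quad Z_l(x)=\max\bigl(W_lZ_{l-1}(x)+b_l,\,0\bigr)\ (1\le l\le L),$$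 with widths $(p_0,\dots,p_{L+1})=(p,12pN,\dots,12pN,1)$; let $T=\sum_{l=0}^{L}p_{l+1}(p_l+1)$ be the number of coefficients of $B$, among them the $p_L+1$ top layer coefficients $(W_{L+1},b_{L+1})$. The prior $\Pi$ is the law of $f_B$ when * $N$ has probabilities $\pi(N)=\dfrac{\lambda^N}{(e^\lambda-1)N!}$, $N\ge1$; * given $N$, the sparsity $s$ has probabilities $\pi(s)\propto e^{-\lambda_s s}$, $p_L<s\le T$; * given $N,s$, the connectivity pattern $\gamma\in\{0,1\}^T$ is uniformly distributed on the patterns with exactly $s$ ones and $\gamma_j=1$ for all top layer coefficients $j$; * given $N,s,\gamma$, the coefficients of $B$ are independent: $\beta_j=0$ if $\gamma_j=0$; if $\gamma_j=1$, then $\beta_j\sim N(0,1)$ in the top layer and $\beta_j\sim\mathrm{Uniform}[-1,1]$ in the deeper layers. The prior does not depend on $\alpha$. Let $\Pi[\,\cdot\mid Y^{(n)}]$ be the posterior, whose density with respect to $\Pi$ is proportional to the likelihood $f\mapsto\prod_{i=1}^n\frac1{\sqrt{2\pi}}e^{-(Y_i-f(x_i))^2/2}$. For a functional $\Psi$, a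 centering $\hat\Psi=\hat\Psi(Y^{(n)})$ and a variance $V=V_n\geq 0$, write $\Pi(\sqrt n(\Psi(f)-\hat\Psi)\mid Y^{(n)})\rightsquigarrow N(0,V)$ if the bounded Lipschitz distance between the law of $\sqrt n(\Psi(f)-\hat\Psi)$ for $f\sim\Pi[\,\cdot\mid Y^{(n)}]$ and $N(0,V)$ tends to $0$ in $\mathbb P_0^n$-probability as $n\to\infty$ (where $N(0,0)$ is the point mass at $0$, and the bounded Lipschitz distance is $\sup|\int h\,d\mu-\int h\,d\nu|$ over $\|h\|_\infty+\mathrm{Lip}(h)\le1$). Then: (i) If $a$ is a constant function on $[0,1]^p$ and $\Psi(f)=\frac1n\sum_{i=1}^n a(x_i)f(x_i)$, then with $\hat\Psi=\Psi(f_0)+\frac1{\sqrt n}W_n(a)$, $$\Pi(\sqrt n(\Psi(f)-\hat\Psi)\mid Y^{(n)})\rightsquigarrow N(0,\|a\|_L^2).$$ (ii) If $\alpha\in(\frac p2,p)$ and $\Psi(f)=\|f\|_L^2$, then with $\hat\Psi=\Psi(f_0)+\frac2{\sqrt n}W_n(f_0)$, $$\Pi(\sqrt n(\Psi(f)-\hat\Psi)\mid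 Y^{(n)})\rightsquigarrow N(0,4\|f_0\|_L^2).$$ -/

import Mathlib

open MeasureTheory ProbabilityTheory Filter Topology Asymptotics
open scoped ENNReal NNReal BigOperators

noncomputable section

namespace SparseBvM

/-! ### Sparse deep ReLU networks -/

/-- Width of layer `l ≤ L` in the architecture `(p, 12pN, …, 12pN, 1)`: the input layer `l = 0` has
`p` units, the hidden layers have `12pN` units. (The output layer has one unit; it is built into
`network`.) -/
def width (p N : ℕ) : ℕ → ℕ
  | 0 => p
  | _ + 1 => 12 * p * N

/-- Positions of the deep coefficients `(W_{l+1}, b_{l+1})`, `0 ≤ l < L`: `(l, i, some j)` is the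
entry `(i, j)` of `W_{l+1}` and `(l, i, none)` is the entry `i` of the shift `b_{l+1}`. -/
abbrev DeepIdx (p L N : ℕ) : Type :=
  Σ l : Fin L, Fin (width p N (l + 1)) × Option (Fin (width p N l))

/-- Positions of the top layer coefficients: `some j` is the entry `j` of the row `W_{L+1}`, and
`none` is the shift `b_{L+1}`. There are `p_L + 1` of them. -/
abbrev TopIdx (p L N : ℕ) : Type := Option (Fin (width p N L))

/-- Positions of all coefficients; there are `T = ∑_{l ≤ L} p_{l+1} (p_l + 1)` of them. -/
abbrev CoeffIdx (p L N : ℕ) : Type := DeepIdx p L N ⊕ TopIdx p L N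

/-- The hidden nodes: `Z_0(u) = u` and `Z_l(u) = max (W_l Z_{l-1}(u) + b_l) 0` for `1 ≤ l ≤ L`. -/
def hidden {p L N : ℕ} (B : CoeffIdx p L N → ℝ) (u : Fin p → ℝ) :
    (l : ℕ) → l ≤ L → Fin (width p N l) → ℝ
  | 0, _ => u
  | l + 1, h => fun i =>
      max ((∑ j, B (Sum.inl ⟨⟨l, h⟩, i, some j⟩) * hidden B u l (Nat.le_of_succ_le h) j)
        + B (Sum.inl ⟨⟨l, h⟩, i, none⟩)) 0

/-- The network function `f_B(u) = W_{L+1} Z_L(u) + b_{L+1}`. -/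
def network {p L N : ℕ} (B : CoeffIdx p L N → ℝ) : (Fin p → ℝ) → ℝ := fun u =>
  (∑ j, B (Sum.inr (some j)) * hidden B u L le_rfl j) + B (Sum.inr none)

theorem measurable_hidden {p L N : ℕ} (u : Fin p → ℝ) :
    ∀ (l : ℕ) (h : l ≤ L) (i : Fin (width p N l)),
      Measurable fun B : CoeffIdx p L N → ℝ => hidden B u l h i
  | 0, _, _ => measurable_const
  | l + 1, h, i => by
      have ih := measurable_hidden (L := L) (N := N) u l (Nat.le_of_succ_le h)
      simp only [hidden]
      refine Measurable.max (Measurable.add (Finset.measurable_sum _ fun j _ => ?_)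
        (measurable_pi_apply _)) measurable_const
      exact (measurable_pi_apply _).mul (ih j)

/-- The map from coefficients to functions is measurable for the product `σ`-field on functions,
so that image measures under it are meaningful. -/
theorem measurable_network {p L N : ℕ} :
    Measurable (network : (CoeffIdx p L N → ℝ) → (Fin p → ℝ) → ℝ) := by
  refine measurable_pi_iff.2 fun u => ?_
  simp only [network]
  refine Measurable.add (Finset.measurable_sum _ fun j _ => ?_) (measurable_pi_apply _)
  exact (measurable_pi_apply _).mul (measurable_hidden u L le_rfl j)

/-! ### The adaptive spike-and-slab prior -/

/-- The slab: uniform on `[-1, 1]` for deep coefficients, standard normal for the top layer. -/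
def slab {p L N : ℕ} : CoeffIdx p L N → Measure ℝ
  | Sum.inl _ => ProbabilityTheory.cond volume (Set.Icc (-1 : ℝ) 1)
  | Sum.inr _ => gaussianReal 0 1

open scoped Classical in
/-- Law of the coefficients given the connectivity pattern `γ` (the set of active positions):
independent coordinates, slab on `γ` and a point mass at zero off `γ`. -/
def coeffPrior {p L N : ℕ} (γ : Finset (CoeffIdx p L N)) : Measure (CoeffIdx p L N → ℝ) :=
  Measure.pi fun j => if j ∈ γ then slab j else Measure.dirac 0

open scoped Classical in
/-- The connectivity patterns with `|γ| = s` and fully connected top layer. -/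
def patterns (p L N s : ℕ) : Finset (Finset (CoeffIdx p L N)) :=
  Finset.univ.filter fun γ => γ.card = s ∧ ∀ k : TopIdx p L N, Sum.inr k ∈ γ

/-- Prior on functions given `N` and `s`: `γ` is uniform on `patterns p L N s`, and the function is
the network with coefficients drawn from `coeffPrior γ`. -/
def shellPrior (p L N s : ℕ) : Measure ((Fin p → ℝ) → ℝ) :=
  ((patterns p L N s).card : ℝ≥0∞)⁻¹ •
    ∑ γ ∈ patterns p L N s, (coeffPrior γ).map network

/-- The sparsity levels `p_L < s ≤ T` for which there are networks with fully connected top layer. -/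
def sparsityLevels (p L N : ℕ) : Finset ℕ :=
  Finset.Icc (width p N L + 1) (Fintype.card (CoeffIdx p L N))

/-- Prior of the sparsity: `π(s) ∝ exp (-lamS * s)` on `sparsityLevels p L N`. -/
def sparsityWeight (lamS : ℝ) (p L N s : ℕ) : ℝ :=
  Real.exp (-lamS * s) / ∑ r ∈ sparsityLevels p L N, Real.exp (-lamS * r)

/-- Prior of the width parameter: `π(N) = lam ^ N / ((exp lam - 1) * N!)` for `N ≥ 1`. -/
def widthWeight (lam : ℝ) (N : ℕ) : ℝ :=
  if N = 0 then 0 else lam ^ N / ((Real.exp lam - 1) * (N.factorial : ℝ))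

/-- The adaptive prior on network functions with `L` hidden layers. -/
def prior (lam lamS : ℝ) (p L : ℕ) : Measure ((Fin p → ℝ) → ℝ) :=
  Measure.sum fun N : ℕ => ENNReal.ofReal (widthWeight lam N) •
    ∑ s ∈ sparsityLevels p L N, ENNReal.ofReal (sparsityWeight lamS p L N s) • shellPrior p L N s

/-! ### Regression model, posterior, functionals -/

/-- The law of the data `Y_i = f₀(x_i) + ε_i` with `ε_i` i.i.d. standard normal. -/
def dataLaw {p n : ℕ} (f₀ : (Fin p → ℝ) → ℝ) (x : Fin n → Fin p → ℝ) : Measure (Fin n → ℝ) :=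
  Measure.pi fun i => gaussianReal (f₀ (x i)) 1

/-- The Gaussian likelihood of the data `y` under the regression function `f`. -/
def likelihood {p n : ℕ} (x : Fin n → Fin p → ℝ) (y : Fin n → ℝ) (f : (Fin p → ℝ) → ℝ) : ℝ≥0∞ :=
  ∏ i, gaussianPDF (f (x i)) 1 (y i)

/-- The posterior distribution, `A ↦ ∫_A likelihood dΠ / ∫ likelihood dΠ`. -/
def posterior {p n : ℕ} (Pr : Measure ((Fin p → ℝ) → ℝ)) (x : Fin n → Fin p → ℝ)
    (y : Fin n → ℝ) : Measure ((Fin p → ℝ) → ℝ) :=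
  (∫⁻ f, likelihood x y f ∂Pr)⁻¹ • Pr.withDensity (likelihood x y)

/-- The inner product `⟨g, h⟩_L = n⁻¹ ∑ g(x_i) h(x_i)`. -/
def empInner {p n : ℕ} (x : Fin n → Fin p → ℝ) (g h : (Fin p → ℝ) → ℝ) : ℝ :=
  (1 / (n : ℝ)) * ∑ i, g (x i) * h (x i)

/-- The squared norm `‖g‖_L² = n⁻¹ ∑ g(x_i)²`. -/
def empNormSq {p n : ℕ} (x : Fin n → Fin p → ℝ) (g : (Fin p → ℝ) → ℝ) : ℝ :=
  (1 / (n : ℝ)) * ∑ i, g (x i) ^ 2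

/-- The noise functional `W_n(g) = n⁻¹ ∑ √n ε_i g(x_i)`, where `ε_i = y_i - f₀(x_i)`. -/
def noise {p n : ℕ} (f₀ : (Fin p → ℝ) → ℝ) (x : Fin n → Fin p → ℝ) (y : Fin n → ℝ)
    (g : (Fin p → ℝ) → ℝ) : ℝ :=
  (1 / (n : ℝ)) * ∑ i, Real.sqrt n * (y i - f₀ (x i)) * g (x i)

/-! ### Asymptotic normality in probability -/

/-- The bounded Lipschitz metric: the supremum of `|∫ h dμ - ∫ h dν|` over all `h` with
`‖h‖_∞ + Lip(h) ≤ 1`. -/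
def blDist (μ ν : Measure ℝ) : ℝ :=
  sSup {r : ℝ | ∃ (h : ℝ → ℝ) (M K : ℝ≥0), (∀ t, |h t| ≤ M) ∧ LipschitzWith K h ∧ M + K ≤ 1 ∧
    r = |∫ t, h t ∂μ - ∫ t, h t ∂ν|}

/-- The (random) distributions `post n y` of `f` are such that the law of
`√n (Ψ n f - center n y)` is asymptotically normal with mean zero and variance `V n`: its bounded
Lipschitz distance to `N(0, V n)` tends to zero in `P n`-probability. -/
def AsymptoticallyNormal {p : ℕ} (P : (n : ℕ) → Measure (Fin n → ℝ))
    (post : (n : ℕ) → (Fin n → ℝ) → Measure ((Fin p → ℝ) → ℝ))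
    (Ψ : ℕ → ((Fin p → ℝ) → ℝ) → ℝ) (center : (n : ℕ) → (Fin n → ℝ) → ℝ) (V : ℕ → ℝ) : Prop :=
  ∀ δ : ℝ, 0 < δ → Tendsto (fun n => P n {y | δ <
    blDist ((post n y).map fun f => Real.sqrt n * (Ψ n f - center n y))
      (gaussianReal 0 (V n).toNNReal)}) atTop (𝓝 0)

/-! ### Hölder smoothness -/

/-- `f` is `α`-Hölder smooth on `[0,1]^p`: with `k` the largest integer strictly smaller than `α`,
`f` is `k` times continuously differentiable on the cube and its `k`-th derivative is Hölder
continuous with exponent `α - k`. (Derivatives of order at most `k` are then bounded, by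
compactness.) -/
def IsHolder {p : ℕ} (α : ℝ) (f : (Fin p → ℝ) → ℝ) : Prop :=
  ∃ k : ℕ, (k : ℝ) < α ∧ α ≤ k + 1 ∧ ContDiffOn ℝ k f (Set.Icc 0 1) ∧
    ∃ C : ℝ, ∀ u ∈ Set.Icc (0 : Fin p → ℝ) 1, ∀ v ∈ Set.Icc (0 : Fin p → ℝ) 1,
      ‖iteratedFDerivWithin ℝ k f (Set.Icc 0 1) u - iteratedFDerivWithin ℝ k f (Set.Icc 0 1) v‖
        ≤ C * ‖u - v‖ ^ (α - k)

end SparseBvM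

end

open SparseBvM

namespace SparseBvM

/-! ### The bounded Lipschitz distance and Laplace transforms -/

/-! The posterior is studied through its Laplace transform. Write `ℓ` for the log likelihood ratio
against `f₀` and `X = √n (Ψ - Ψ̂)`. Completing the square shows that `t X - t² V / 2 + ℓ(f)` equals,
up to a remainder, `ℓ(f_t)` for a perturbed function: `f_t = f - t a / √n` when `a` is constant, and
`f_t = (1 - 2 t / √n) f` for the squared norm. Both perturbations act on the top layer alone: one
translates its bias, the other multiplies all its coefficients. Every connectivity pattern contains
the whole top layer, whose coefficients are standard normal, so the prior transported by such a map
has an explicit density, given by the same formula for every pattern. If the remainder and the log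
density vanish uniformly on sets that carry almost all posterior mass, then the Laplace transform on
those sets is asymptotically `exp (t² V / 2)`, which forces the Gaussian limit
(`tendsto_blDist_gibbs`).

It remains to see that the posterior neglects the complements of those sets. By Fubini, a set of
small prior mass has a small integrated likelihood ratio, so prior tails only have to beat a lower
bound `exp (-n ^ γ)` on the evidence (`EvidenceBound`). For the linear functional the identity for
`ℓ` is exact and only the top bias must be `o(√n)`; any `γ < 1` suffices and no contraction rate
enters (`asymptoticallyNormal_empInner`). For the squared norm, the width, the squared norm of the
top layer and the unnormalised squared error `∑ (f - f₀)(x_i)²` must all be `o(√n)`. The noise is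
controlled on a finite net of sparse networks, whose log cardinality is of smaller order than `√n`;
away from `f₀` the likelihood ratio is then too small to compete with the evidence. This needs `γ <
1/2` (`asymptoticallyNormal_empNormSq`).

The evidence bound comes from approximation. The cube is cut into about `n ^ (e p)` cells, and on
each cell `f₀` is close to a Taylor polynomial, written as a sum of powers of linear forms. A
network with four rectifier layers and a number of coefficients proportional to the number of cells
computes a small multiple of this piecewise polynomial. Only values at the design points matter, so
the cells may be told apart by a continuous staircase that climbs only where there is no design
coordinate. Deep coefficients are bounded by one, and the remaining layers, of order `log n` many,
serve to multiply the small value back up. Up to powers of `log n`, the prior mass near this network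
costs `n ^ (e p)` in the exponent and the approximation error costs `n ^ (1 - 2 α e)`
(`evidenceBound`). Some `e` makes both exponents less than one; some `e` makes both less than one
half exactly when `α > p / 2`. -/

theorem bddAbove_blDist_set (μ ν : Measure ℝ) [IsProbabilityMeasure μ] [IsProbabilityMeasure ν] :
    BddAbove {r : ℝ | ∃ (h : ℝ → ℝ) (M K : ℝ≥0), (∀ t, |h t| ≤ M) ∧ LipschitzWith K h ∧ M + K ≤ 1 ∧
    r = |∫ t, h t ∂μ - ∫ t, h t ∂ν|} := by
  refine ⟨2, ?_⟩
  rintro r ⟨h, M, K, hM, -, hMK, rfl⟩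
  have hM1 : (M : ℝ) ≤ 1 := by
    have : (M : ℝ) + K ≤ 1 := by exact_mod_cast hMK
    have := K.coe_nonneg
    linarith
  have key : ∀ (ρ : Measure ℝ) [IsProbabilityMeasure ρ], |∫ t, h t ∂ρ| ≤ 1 := by
    intro ρ _
    have := norm_integral_le_of_norm_le_const (μ := ρ) (f := h) (C := M)
      (Eventually.of_forall fun t => hM t)
    simp at this
    linarith
  calc |∫ t, h t ∂μ - ∫ t, h t ∂ν| ≤ |∫ t, h t ∂μ| + |∫ t, h t ∂ν| := abs_sub _ _
    _ ≤ 2 := by linarith [key μ, key ν]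

theorem blDist_nonneg (μ ν : Measure ℝ) : 0 ≤ blDist μ ν := by
  refine Real.sSup_nonneg ?_
  rintro r ⟨h, M, K, -, -, -, rfl⟩
  exact abs_nonneg _

theorem blDist_le {μ ν : Measure ℝ} {c : ℝ}
    (h : ∀ (h : ℝ → ℝ) (M K : ℝ≥0), (∀ t, |h t| ≤ M) → LipschitzWith K h → M + K ≤ 1 →
      |∫ t, h t ∂μ - ∫ t, h t ∂ν| ≤ c) : blDist μ ν ≤ c := by
  refine csSup_le ⟨_, fun _ => 0, 0, 0, by simp, LipschitzWith.const _, by simp, rfl⟩ ?_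
  rintro r ⟨g, M, K, h1, h2, h3, rfl⟩
  exact h g M K h1 h2 h3

theorem abs_integral_sub_le_blDist {μ ν : Measure ℝ} [IsProbabilityMeasure μ]
    [IsProbabilityMeasure ν] {h : ℝ → ℝ} {M K : ℝ≥0} (h1 : ∀ t, |h t| ≤ M)
    (h2 : LipschitzWith K h) (h3 : M + K ≤ 1) :
    |∫ t, h t ∂μ - ∫ t, h t ∂ν| ≤ blDist μ ν :=
  le_csSup (bddAbove_blDist_set μ ν) ⟨h, M, K, h1, h2, h3, rfl⟩

theorem blDist_triangle (μ ν ρ : Measure ℝ) [IsProbabilityMeasure μ] [IsProbabilityMeasure ν]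
    [IsProbabilityMeasure ρ] : blDist μ ρ ≤ blDist μ ν + blDist ν ρ := by
  refine blDist_le fun h M K h1 h2 h3 => ?_
  calc |∫ t, h t ∂μ - ∫ t, h t ∂ρ| ≤ |∫ t, h t ∂μ - ∫ t, h t ∂ν| + |∫ t, h t ∂ν - ∫ t, h t ∂ρ| :=
        abs_sub_le _ _ _
    _ ≤ _ := add_le_add (abs_integral_sub_le_blDist h1 h2 h3) (abs_integral_sub_le_blDist h1 h2 h3)

theorem blDist_comm (μ ν : Measure ℝ) : blDist μ ν = blDist ν μ := by
  unfold blDist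
  congr 1
  ext r
  constructor <;> rintro ⟨h, M, K, h1, h2, h3, rfl⟩ <;> exact ⟨h, M, K, h1, h2, h3, abs_sub_comm _ _⟩

/-- Layer cake argument: shift `h` to be nonnegative; the thickening by `ε` of a superlevel set of
`h` lies in the superlevel set lowered by `K * ε`, by the Lipschitz bound. The total error is `ε *
(K + 2 * M)`, which is less than `3 * ε`. -/
theorem integral_le_add_of_levyProkhorovEDist_lt {μ ν : Measure ℝ} [IsProbabilityMeasure μ]
    [IsProbabilityMeasure ν] {ε : ℝ} (hε : 0 < ε) (hlt : levyProkhorovEDist μ ν < ENNReal.ofReal ε)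
    {h : ℝ → ℝ} {M K : ℝ≥0} (h1 : ∀ t, |h t| ≤ M) (h2 : LipschitzWith K h) (h3 : M + K ≤ 1) :
    ∫ t, h t ∂μ ≤ ∫ t, h t ∂ν + 3 * ε := by
  have h3' : (M : ℝ) + K ≤ 1 := by exact_mod_cast h3
  have hM0 := M.coe_nonneg
  have hK0 := K.coe_nonneg
  have mk : ∀ c : ℝ, ∃ f : BoundedContinuousFunction ℝ ℝ, ∀ t, f t = h t + c := fun c =>
    ⟨BoundedContinuousFunction.ofNormedAddCommGroup (fun t => h t + c)
      (by have := h2.continuous; fun_prop) (M + |c|)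
      (fun t => (abs_add_le _ _).trans (by gcongr; exact h1 t)), fun t => rfl⟩
  obtain ⟨f, hf⟩ := mk M
  obtain ⟨g, hg⟩ := mk (M + K * ε)
  have fnn : ∀ t, 0 ≤ f t := fun t => by rw [hf]; linarith [neg_abs_le (h t), h1 t]
  have gnn : ∀ t, 0 ≤ g t := fun t => by
    rw [hg]; have := mul_nonneg hK0 hε.le; linarith [neg_abs_le (h t), h1 t]
  have hfn : ‖f‖ ≤ 2 * M := by
    refine (BoundedContinuousFunction.norm_le (by positivity)).2 fun t => ?_
    rw [Real.norm_eq_abs, abs_of_nonneg (fnn t), hf]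
    linarith [le_abs_self (h t), h1 t]
  have hfg : ‖f‖ ≤ ‖g‖ := by
    refine (BoundedContinuousFunction.norm_le (norm_nonneg _)).2 fun t => ?_
    refine le_trans ?_ (g.norm_coe_le_norm t)
    rw [Real.norm_eq_abs, Real.norm_eq_abs, abs_of_nonneg (fnn t), abs_of_nonneg (gnn t), hf, hg]
    have := mul_nonneg hK0 hε.le
    linarith
  have key := BoundedContinuousFunction.integral_le_of_levyProkhorovEDist_lt μ ν hε hlt f
    (Eventually.of_forall fnn)
  have hgi := BoundedContinuousFunction.integral_eq_integral_meas_le g ν (Eventually.of_forall gnn)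
  have hanti : ∀ F : ℝ → Set ℝ, (∀ s t, s ≤ t → F t ⊆ F s) → ∀ c : ℝ,
      IntegrableOn (fun t => ν.real (F t)) (Set.Ioc 0 c) := by
    intro F hF c
    apply Measure.integrableOn_of_bounded (M := 1) measure_Ioc_lt_top.ne
    · apply (Measurable.ennreal_toReal (Antitone.measurable ?_)).aestronglyMeasurable
      exact fun s t hst => measure_mono (hF s t hst)
    · refine Eventually.of_forall fun t => ?_
      simp only [Real.norm_eq_abs, abs_of_nonneg measureReal_nonneg]
      exact measureReal_le_one
  -- `g` is `f + K * ε`, so its superlevel sets absorb the thickened superlevel sets of `f`, and its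
  -- range of levels is the longer one.
  have step : (∫ t in Set.Ioc 0 ‖f‖, ν.real (Metric.thickening ε {a | t ≤ f a}))
      ≤ ∫ t in Set.Ioc 0 ‖g‖, ν.real {a | t ≤ g a} := by
    calc _ ≤ ∫ t in Set.Ioc 0 ‖f‖, ν.real {a | t ≤ g a} := by
          refine setIntegral_mono (hanti _ ?_ _) (hanti _ ?_ _) ?_
          · exact fun s t hst => Metric.thickening_subset_of_subset _ fun a ha => hst.trans ha
          · exact fun s t hst a ha => hst.trans ha
          · intro t
            refine measureReal_mono ?_
            intro a ha
            obtain ⟨b, hb, hab⟩ := Metric.mem_thickening_iff.1 ha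
            have hb' : t ≤ f b := hb
            have hl := h2.dist_le_mul b a
            rw [Real.dist_eq] at hl
            have : (K : ℝ) * dist b a ≤ K * ε := by rw [dist_comm]; gcongr
            show t ≤ g a
            rw [hg]
            rw [hf] at hb'
            linarith [le_abs_self (h b - h a)]
      _ ≤ _ := by
          refine setIntegral_mono_set (hanti _ ?_ _) ?_ ?_
          · exact fun s t hst a ha => hst.trans ha
          · exact Eventually.of_forall fun t => measureReal_nonneg
          · exact (Set.Ioc_subset_Ioc_right hfg).eventuallyLE
  rw [← hgi] at step
  have hint : ∀ (ρ : Measure ℝ) [IsProbabilityMeasure ρ], Integrable h ρ := by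
    intro ρ _
    refine Integrable.of_bound h2.continuous.aestronglyMeasurable M (Eventually.of_forall h1)
  have e1 : ∫ t, f t ∂μ = ∫ t, h t ∂μ + M := by
    simp_rw [hf]; rw [integral_add (hint μ) (integrable_const _)]; simp
  have e2 : ∫ t, g t ∂ν = ∫ t, h t ∂ν + (M + K * ε) := by
    simp_rw [hg]; rw [integral_add (hint ν) (integrable_const _)]; simp
  rw [e1] at key
  rw [e2] at step
  have h5 : ε * ‖f‖ ≤ ε * (2 * M) := by gcongr
  nlinarith [mul_nonneg hε.le hM0, mul_nonneg hε.le hK0]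

/-- The Lévy–Prokhorov distance metrizes weak convergence on the line, and the bounded Lipschitz
distance is at most three times as large. -/
theorem tendsto_blDist_of_tendsto {μ : ℕ → ProbabilityMeasure ℝ} {ν : ProbabilityMeasure ℝ}
    (h : Tendsto μ atTop (𝓝 ν)) :
    Tendsto (fun n => blDist (μ n : Measure ℝ) (ν : Measure ℝ)) atTop (𝓝 0) := by
  have h2 := (LevyProkhorov.continuous_ofMeasure_probabilityMeasure (Ω := ℝ)).tendsto ν |>.comp h
  rw [tendsto_iff_dist_tendsto_zero] at h2
  rw [Metric.tendsto_atTop] at h2 ⊢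
  intro ε hε
  obtain ⟨N, hN⟩ := h2 (ε / 4) (by positivity)
  refine ⟨N, fun n hn => ?_⟩
  have hlt := hN n hn
  rw [Real.dist_0_eq_abs, abs_of_nonneg dist_nonneg, LevyProkhorov.dist_probabilityMeasure_def,
    levyProkhorovDist] at hlt
  rw [Real.dist_0_eq_abs, abs_of_nonneg (blDist_nonneg _ _)]
  have hlt' : levyProkhorovEDist (μ n : Measure ℝ) (ν : Measure ℝ) < ENNReal.ofReal (ε / 4) := by
    rw [← ENNReal.ofReal_toReal (levyProkhorovEDist_ne_top (μ n : Measure ℝ) (ν : Measure ℝ))]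
    exact (ENNReal.ofReal_lt_ofReal_iff (by positivity)).2 hlt
  refine lt_of_le_of_lt (blDist_le (c := 3 * (ε / 4)) fun f M K h1 h2 h3 => ?_) (by linarith)
  rw [abs_le]
  have a1 := integral_le_add_of_levyProkhorovEDist_lt (by positivity) hlt' h1 h2 h3
  rw [levyProkhorovEDist_comm] at hlt'
  have a2 := integral_le_add_of_levyProkhorovEDist_lt (by positivity) hlt' h1 h2 h3
  constructor <;> linarith

/-! ### Laplace transforms and Gaussian limits -/

/-- Markov's inequality for `exp x + exp (-x)`, whose integrals converge by the cases `t = 1` and `t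
= -1`. -/
theorem isTightMeasureSet_range_of_laplace {μ : ℕ → ProbabilityMeasure ℝ} {v : ℝ≥0}
    (h : ∀ t : ℝ, Tendsto (fun n => ∫⁻ x, ENNReal.ofReal (Real.exp (t * x)) ∂(μ n : Measure ℝ)) atTop
      (𝓝 (ENNReal.ofReal (Real.exp (v * t ^ 2 / 2))))) :
    IsTightMeasureSet (Set.range fun n => (μ n : Measure ℝ)) := by
  apply isTightMeasureSet_range_of_tendsto_limsup_measure_norm_gt
  have hsum := (h 1).add (h (-1))
  set c := ENNReal.ofReal (Real.exp (v * 1 ^ 2 / 2)) + ENNReal.ofReal (Real.exp (v * (-1) ^ 2 / 2))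
  have hc : c < c + 1 := ENNReal.lt_add_right (by finiteness) one_ne_zero
  have hev := hsum.eventually (eventually_le_nhds hc)
  have h0 : Tendsto (fun r : ℝ => ENNReal.ofReal (Real.exp (-r)) * (c + 1)) atTop (𝓝 0) := by
    have h1 : Tendsto (fun r : ℝ => ENNReal.ofReal (Real.exp (-r))) atTop (𝓝 0) := by
      rw [← ENNReal.ofReal_zero]
      exact ENNReal.tendsto_ofReal (Real.tendsto_exp_neg_atTop_nhds_zero)
    simpa using ENNReal.Tendsto.mul_const (b := c + 1) h1 (Or.inr (by finiteness))
  refine tendsto_of_tendsto_of_tendsto_of_le_of_le tendsto_const_nhds h0 (fun _ => zero_le) ?_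
  intro r
  refine limsup_le_of_le (by isBoundedDefault) ?_
  filter_upwards [hev] with n hn
  have hm : ∀ t : ℝ, Measurable fun x : ℝ => ENNReal.ofReal (Real.exp (t * x)) := by fun_prop
  rw [← lintegral_add_left (hm 1)] at hn
  have hmk := mul_meas_ge_le_lintegral₀ (μ := (μ n : Measure ℝ))
    (((hm 1).add (hm (-1))).aemeasurable) (ENNReal.ofReal (Real.exp r))
  have hsub : (μ n : Measure ℝ) {x | r < ‖x‖} ≤ (μ n : Measure ℝ) {x | ENNReal.ofReal (Real.exp r) ≤
      (fun x => ENNReal.ofReal (Real.exp (1 * x)) + ENNReal.ofReal (Real.exp (-1 * x))) x} := by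
    refine measure_mono fun x hx => ?_
    have hx : r < |x| := hx
    rcases abs_cases x with ⟨h1, -⟩ | ⟨h1, -⟩
    · refine le_trans (ENNReal.ofReal_le_ofReal (Real.exp_le_exp.2 ?_)) le_self_add
      linarith
    · refine le_trans (ENNReal.ofReal_le_ofReal (Real.exp_le_exp.2 ?_)) le_add_self
      linarith
  calc (μ n : Measure ℝ) {x | r < ‖x‖} ≤ _ := hsub
    _ = ENNReal.ofReal (Real.exp (-r)) * (ENNReal.ofReal (Real.exp r) * (μ n : Measure ℝ)
        {x | ENNReal.ofReal (Real.exp r) ≤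
      (fun x => ENNReal.ofReal (Real.exp (1 * x)) + ENNReal.ofReal (Real.exp (-1 * x))) x}) := by
        rw [← mul_assoc, ← ENNReal.ofReal_mul (Real.exp_pos _).le, ← Real.exp_add]; simp
    _ ≤ _ := by gcongr; exact hmk.trans hn

/-- Weak convergence does not see the unbounded function `exp (t * x)`, but the moment at `2 * t`
makes it uniformly integrable: truncating at level `K` costs at most `exp (2 * t * x) / K`. The
filter is arbitrary so that ultrafilters are allowed. -/
theorem lintegral_exp_eq_of_tendsto {μ : ℕ → ProbabilityMeasure ℝ} {ν : ProbabilityMeasure ℝ}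
    {U : Filter ℕ} [U.NeBot] (hν : Tendsto μ U (𝓝 ν)) {t : ℝ} {c c2 : ℝ≥0∞} (hc2 : c2 ≠ ⊤)
    (h1 : Tendsto (fun n => ∫⁻ x, ENNReal.ofReal (Real.exp (t * x)) ∂(μ n : Measure ℝ)) U (𝓝 c))
    (h2 : Tendsto (fun n => ∫⁻ x, ENNReal.ofReal (Real.exp (2 * t * x)) ∂(μ n : Measure ℝ)) U
      (𝓝 c2)) :
    ∫⁻ x, ENNReal.ofReal (Real.exp (t * x)) ∂(ν : Measure ℝ) = c := by
  have mk : ∀ K : ℕ, ∃ f : BoundedContinuousFunction ℝ ℝ≥0, ∀ x, f x =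
      min (Real.exp (t * x)).toNNReal K := fun K =>
    ⟨BoundedContinuousFunction.mkOfBound ⟨fun x => min (Real.exp (t * x)).toNNReal (K : ℝ≥0),
        by fun_prop⟩ K (fun x y => by
          rw [NNReal.dist_eq]
          have a1 : ((min (Real.exp (t * x)).toNNReal (K : ℝ≥0) : ℝ≥0) : ℝ) ≤ K := by
            exact_mod_cast min_le_right _ _
          have a2 : ((min (Real.exp (t * y)).toNNReal (K : ℝ≥0) : ℝ≥0) : ℝ) ≤ K := by
            exact_mod_cast min_le_right _ _
          have b1 := NNReal.coe_nonneg (min (Real.exp (t * x)).toNNReal (K : ℝ≥0))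
          have b2 := NNReal.coe_nonneg (min (Real.exp (t * y)).toNNReal (K : ℝ≥0))
          rw [abs_le]
          constructor <;> simp only [ContinuousMap.coe_mk] <;> linarith), fun x => rfl⟩
  choose f hf using mk
  have hf' : ∀ K x, (f K x : ℝ≥0∞) = min (ENNReal.ofReal (Real.exp (t * x))) K := by
    intro K x; rw [hf]; simp [ENNReal.ofReal]
  have hlim : ∀ K, Tendsto (fun n => ∫⁻ x, f K x ∂(μ n : Measure ℝ)) U
      (𝓝 (∫⁻ x, f K x ∂(ν : Measure ℝ))) := fun K =>
    ProbabilityMeasure.tendsto_iff_forall_lintegral_tendsto.1 hν (f K)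
  have hle : ∀ K (ρ : Measure ℝ), ∫⁻ x, f K x ∂ρ ≤ ∫⁻ x, ENNReal.ofReal (Real.exp (t * x)) ∂ρ :=
    fun K ρ => lintegral_mono fun x => by rw [hf']; exact min_le_left _ _
  apply le_antisymm
  -- Monotone convergence in the truncation level gives lower semicontinuity, hence one inequality.
  · have hsup : ∀ x, ENNReal.ofReal (Real.exp (t * x)) = ⨆ K, (f K x : ℝ≥0∞) := by
      intro x
      apply le_antisymm
      · obtain ⟨K, hK⟩ := exists_nat_ge (Real.exp (t * x))
        refine le_trans ?_ (le_iSup _ K)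
        rw [hf', le_min_iff]
        exact ⟨le_rfl, by rw [← ENNReal.ofReal_natCast]; exact ENNReal.ofReal_le_ofReal hK⟩
      · exact iSup_le fun K => by rw [hf']; exact min_le_left _ _
    simp_rw [hsup]
    rw [lintegral_iSup (fun K => by have := (f K).continuous; fun_prop)]
    · refine iSup_le fun K => le_of_tendsto_of_tendsto (hlim K) h1 (Eventually.of_forall fun n => hle K _)
    · intro K K' hKK x
      simp only [hf']
      gcongr
  -- The reverse inequality uses the truncation error; level `K + 1` keeps the inverse finite.
  · have hK : ∀ K : ℕ, c ≤ ∫⁻ x, ENNReal.ofReal (Real.exp (t * x)) ∂(ν : Measure ℝ)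
        + ((K + 1 : ℕ) : ℝ≥0∞)⁻¹ * c2 := by
      intro K
      have hl : Tendsto (fun n => ∫⁻ x, f (K + 1) x ∂(μ n : Measure ℝ) + ((K + 1 : ℕ) : ℝ≥0∞)⁻¹ *
          ∫⁻ x, ENNReal.ofReal (Real.exp (2 * t * x)) ∂(μ n : Measure ℝ)) U
          (𝓝 (∫⁻ x, f (K + 1) x ∂(ν : Measure ℝ) + ((K + 1 : ℕ) : ℝ≥0∞)⁻¹ * c2)) :=
        (hlim (K + 1)).add (ENNReal.Tendsto.const_mul h2 (Or.inr (by simp)))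
      refine (le_of_tendsto_of_tendsto h1 hl (Eventually.of_forall fun n => ?_)).trans
        (add_le_add_left (hle _ _) _)
      dsimp only
      rw [← lintegral_const_mul _ (by fun_prop), ← lintegral_add_left (by
        have := (f (K + 1)).continuous; fun_prop)]
      refine lintegral_mono fun x => ?_
      dsimp only
      rw [hf']
      rcases le_total (ENNReal.ofReal (Real.exp (t * x))) ((K + 1 : ℕ) : ℝ≥0∞) with hx | hx
      · rw [min_eq_left hx]; exact le_self_add
      · refine le_trans ?_ le_add_self
        have : Real.exp (2 * t * x) = Real.exp (t * x) * Real.exp (t * x) := by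
          rw [← Real.exp_add]; ring_nf
        rw [this, ENNReal.ofReal_mul (Real.exp_pos _).le]
        calc ENNReal.ofReal (Real.exp (t * x))
            = (((K + 1 : ℕ) : ℝ≥0∞)⁻¹ * ((K + 1 : ℕ) : ℝ≥0∞)) * ENNReal.ofReal (Real.exp (t * x)) := by
              rw [ENNReal.inv_mul_cancel (by simp) (by simp), one_mul]
          _ ≤ _ := by rw [mul_assoc]; gcongr
    have hl : Tendsto (fun K : ℕ => ∫⁻ x, ENNReal.ofReal (Real.exp (t * x)) ∂(ν : Measure ℝ)
        + ((K + 1 : ℕ) : ℝ≥0∞)⁻¹ * c2) atTop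
        (𝓝 (∫⁻ x, ENNReal.ofReal (Real.exp (t * x)) ∂(ν : Measure ℝ) + 0 * c2)) := by
      refine tendsto_const_nhds.add (ENNReal.Tendsto.mul_const ?_ (Or.inr hc2))
      exact (ENNReal.tendsto_inv_nat_nhds_zero).comp (tendsto_add_atTop_nat 1)
    simpa using ge_of_tendsto' hl hK

/-- A moment generating function that is finite on the whole line has an analytic extension to the
complex plane, which contains the characteristic function. -/
theorem eq_gaussianReal_of_lintegral_exp {ν : Measure ℝ} [IsProbabilityMeasure ν] {v : ℝ≥0}
    (h : ∀ t : ℝ, ∫⁻ x, ENNReal.ofReal (Real.exp (t * x)) ∂ν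
      = ENNReal.ofReal (Real.exp (v * t ^ 2 / 2))) : ν = gaussianReal 0 v := by
  have hint : ∀ t : ℝ, Integrable (fun x => Real.exp (t * x)) ν := fun t =>
    ⟨by fun_prop, by
      rw [hasFiniteIntegral_iff_ofReal (Eventually.of_forall fun x => (Real.exp_pos _).le), h]
      finiteness⟩
  have hmgf : mgf id ν = mgf id (gaussianReal 0 v) := by
    ext t
    rw [mgf_id_gaussianReal]
    simp only [mgf, id]
    rw [integral_eq_lintegral_of_nonneg_ae (Eventually.of_forall fun x => (Real.exp_pos _).le)
      (by fun_prop), h, ENNReal.toReal_ofReal (Real.exp_pos _).le]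
    simp
  have hset : integrableExpSet id ν = Set.univ := by
    ext t; simpa [integrableExpSet] using hint t
  apply Measure.ext_of_complexMGF_id_eq
  ext z
  exact eqOn_complexMGF_of_mgf hmgf (by simp [hset])

/-- By tightness the sequence converges along every ultrafilter, and each such limit has the
Gaussian Laplace transform. -/
theorem tendsto_gaussianReal_of_laplace {μ : ℕ → ProbabilityMeasure ℝ} {v : ℝ≥0}
    (h : ∀ t : ℝ, Tendsto (fun n => ∫⁻ x, ENNReal.ofReal (Real.exp (t * x)) ∂(μ n : Measure ℝ)) atTop
      (𝓝 (ENNReal.ofReal (Real.exp (v * t ^ 2 / 2))))) :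
    Tendsto μ atTop (𝓝 ⟨gaussianReal 0 v, inferInstance⟩) := by
  have htight := isTightMeasureSet_range_of_laplace h
  refine (Filter.tendsto_iff_ultrafilter _ _ _).2 fun U hU => ?_
  have h_compact : IsCompact (closure {μ n | n}) := by
    apply isCompact_closure_of_isTightMeasureSet
    convert htight using 1
    ext; simp
  obtain ⟨μ', -, hμ'⟩ := h_compact.ultrafilter_le_nhds (U.map μ)
    (.trans (by simp) (monotone_principal subset_closure))
  have hμ'' : Tendsto μ U (𝓝 μ') := hμ'
  suffices (μ' : Measure ℝ) = gaussianReal 0 v by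
    have heq : (⟨gaussianReal 0 v, inferInstance⟩ : ProbabilityMeasure ℝ) = μ' :=
      Subtype.ext this.symm
    rw [heq]
    exact hμ'
  refine eq_gaussianReal_of_lintegral_exp fun t => ?_
  exact lintegral_exp_eq_of_tendsto hμ'' (by finiteness) ((h t).mono_left hU)
    ((h (2 * t)).mono_left hU)

theorem lintegral_exp_gaussianReal (v : ℝ≥0) (t : ℝ) :
    ∫⁻ x, ENNReal.ofReal (Real.exp (t * x)) ∂(gaussianReal 0 v)
      = ENNReal.ofReal (Real.exp (v * t ^ 2 / 2)) := by
  have h := congrFun (mgf_id_gaussianReal (μ := 0) (v := v)) t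
  simp only [mgf, id] at h
  rw [← ofReal_integral_eq_lintegral_ofReal (integrable_exp_mul_gaussianReal t)
    (Eventually.of_forall fun x => (Real.exp_pos _).le), h]
  simp

/-- The variances need not converge, but they stay in a compact interval. Along a subsequence on
which they converge, both the given laws and the comparison Gaussians approach one and the same
Gaussian. -/
theorem tendsto_blDist_of_laplace_of_prob {μ : ℕ → Measure ℝ} [∀ n, IsProbabilityMeasure (μ n)]
    {V : ℕ → ℝ} {C : ℝ} (hV0 : ∀ n, 0 ≤ V n) (hVC : ∀ n, V n ≤ C)
    (h : ∀ t : ℝ, Tendsto (fun n => ∫⁻ x, ENNReal.ofReal (Real.exp (t * x - t ^ 2 * V n / 2)) ∂μ n)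
      atTop (𝓝 1)) :
    Tendsto (fun n => blDist (μ n) (gaussianReal 0 (V n).toNNReal)) atTop (𝓝 0) := by
  refine tendsto_of_subseq_tendsto fun ns hns => ?_
  obtain ⟨V₀, hV₀, ms, hms, hlim⟩ := (isCompact_Icc (a := (0 : ℝ)) (b := C)).tendsto_subseq
    (x := fun k => V (ns k)) (fun k => ⟨hV0 _, hVC _⟩)
  refine ⟨ms, ?_⟩
  have hlim' : Tendsto (fun k => V (ns (ms k))) atTop (𝓝 V₀) := hlim
  have hnm : Tendsto (fun k => ns (ms k)) atTop atTop := hns.comp hms.tendsto_atTop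
  have hexp : ∀ t : ℝ, Tendsto (fun k => ENNReal.ofReal (Real.exp (t ^ 2 * V (ns (ms k)) / 2))) atTop
      (𝓝 (ENNReal.ofReal (Real.exp (V₀.toNNReal * t ^ 2 / 2)))) := by
    intro t
    refine ENNReal.tendsto_ofReal ((Real.continuous_exp.tendsto _).comp ?_)
    rw [Real.coe_toNNReal _ hV₀.1, mul_comm V₀]
    exact (hlim'.const_mul _).div_const _
  let M : ℕ → ProbabilityMeasure ℝ := fun k => ⟨μ (ns (ms k)), inferInstance⟩
  let G : ℕ → ProbabilityMeasure ℝ := fun k => ⟨gaussianReal 0 (V (ns (ms k))).toNNReal, inferInstance⟩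
  let g : ProbabilityMeasure ℝ := ⟨gaussianReal 0 V₀.toNNReal, inferInstance⟩
  have hM : Tendsto M atTop (𝓝 g) := by
    refine tendsto_gaussianReal_of_laplace fun t => ?_
    have h1 := ENNReal.Tendsto.mul (hexp t) (Or.inr (by simp)) ((h t).comp hnm)
      (Or.inr (by finiteness))
    rw [mul_one] at h1
    refine h1.congr fun k => ?_
    simp only [Function.comp, M, ProbabilityMeasure.coe_mk]
    rw [← lintegral_const_mul _ (by fun_prop)]
    refine lintegral_congr fun x => ?_
    rw [← ENNReal.ofReal_mul (Real.exp_pos _).le, ← Real.exp_add]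
    ring_nf
  have hG : Tendsto G atTop (𝓝 g) := by
    refine tendsto_gaussianReal_of_laplace fun t => ?_
    refine (hexp t).congr fun k => ?_
    simp only [G, ProbabilityMeasure.coe_mk]
    rw [lintegral_exp_gaussianReal, Real.coe_toNNReal _ (hV0 _)]
    ring_nf
  have hsum := (tendsto_blDist_of_tendsto hM).add (tendsto_blDist_of_tendsto hG)
  rw [add_zero] at hsum
  refine squeeze_zero (fun k => blDist_nonneg _ _) (fun k => ?_) hsum
  refine (blDist_triangle (μ (ns (ms k))) (g : Measure ℝ) _).trans ?_
  rw [blDist_comm (g : Measure ℝ)]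
  exact le_rfl

/-- If sub-probability measures `ν n ≤ μ n` have Laplace transforms that approach those of
`N(0, V n)`, then the bounded Lipschitz distance of `μ n` and `N(0, V n)` tends to zero. -/
theorem tendsto_blDist_of_laplace {μ ν : ℕ → Measure ℝ} [∀ n, IsProbabilityMeasure (μ n)]
    (hle : ∀ n, ν n ≤ μ n)
    {V : ℕ → ℝ} {C : ℝ} (hV0 : ∀ n, 0 ≤ V n) (hVC : ∀ n, V n ≤ C)
    (h : ∀ t : ℝ, Tendsto (fun n => ∫⁻ x, ENNReal.ofReal (Real.exp (t * x - t ^ 2 * V n / 2)) ∂ν n)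
      atTop (𝓝 1)) :
    Tendsto (fun n => blDist (μ n) (gaussianReal 0 (V n).toNNReal)) atTop (𝓝 0) := by
  have hmass : Tendsto (fun n => ν n Set.univ) atTop (𝓝 1) := by
    refine (h 0).congr fun n => ?_
    simp
  have hν1 : ∀ n, ν n Set.univ ≤ 1 := fun n => (hle n Set.univ).trans prob_le_one
  have hdef : Tendsto (fun n => 1 - ν n Set.univ) atTop (𝓝 0) := by
    simpa using ENNReal.Tendsto.sub (tendsto_const_nhds (x := (1 : ℝ≥0∞))) hmass (Or.inl (by simp))
  have hfin : ∀ n, IsFiniteMeasure (ν n) := fun n => ⟨(hν1 n).trans_lt (by simp)⟩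
  -- The missing mass tends to zero by the hypothesis at `t = 0`. Put at the origin, it changes the
  -- Laplace transforms by a vanishing amount, since the integrand there is at most one.
  let ρ : ℕ → Measure ℝ := fun n => ν n + (1 - ν n Set.univ) • Measure.dirac 0
  have hρ : ∀ n, IsProbabilityMeasure (ρ n) := fun n =>
    ⟨by simp [ρ, add_tsub_cancel_of_le (hν1 n)]⟩
  have hlap : ∀ t : ℝ, Tendsto (fun n => ∫⁻ x, ENNReal.ofReal (Real.exp (t * x - t ^ 2 * V n / 2))
      ∂ρ n) atTop (𝓝 1) := by
    intro t
    have h2 : Tendsto (fun n => (1 - ν n Set.univ) * ENNReal.ofReal (Real.exp (- (t ^ 2 * V n / 2))))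
        atTop (𝓝 0) := by
      refine tendsto_of_tendsto_of_tendsto_of_le_of_le tendsto_const_nhds hdef (fun _ => zero_le) ?_
      intro n
      refine mul_le_of_le_one_right' ?_
      rw [ENNReal.ofReal_le_one, Real.exp_le_one_iff]
      have := mul_nonneg (sq_nonneg t) (hV0 n)
      linarith
    have h3 := (h t).add h2
    rw [add_zero] at h3
    refine h3.congr fun n => ?_
    simp only [ρ]
    rw [lintegral_add_measure, lintegral_smul_measure, lintegral_dirac' _ (by fun_prop)]
    simp
  have hb := tendsto_blDist_of_laplace_of_prob hV0 hVC hlap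
  have hd : Tendsto (fun n => 2 * (1 - ν n Set.univ).toReal) atTop (𝓝 0) := by
    have := ((ENNReal.tendsto_toReal (by simp)).comp hdef).const_mul 2
    simpa using this
  have hsum := hd.add hb
  rw [add_zero] at hsum
  refine squeeze_zero (fun k => blDist_nonneg _ _) (fun n => ?_) hsum
  refine (blDist_triangle (μ n) (ρ n) _).trans (add_le_add_left ?_ _)
  refine blDist_le fun f M K h1 h2 h3 => ?_
  have hM1 : (M : ℝ) ≤ 1 := by
    have : (M : ℝ) + K ≤ 1 := by exact_mod_cast h3
    have := K.coe_nonneg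
    linarith
  -- `μ n` and `ρ n` both extend `ν n` by a measure of the same small mass, which accounts for the
  -- factor two.
  set τ : Measure ℝ := μ n - ν n
  have hτ : μ n = τ + ν n := (Measure.sub_add_cancel_of_le (hle n)).symm
  have hτm : τ Set.univ = 1 - ν n Set.univ := by
    rw [Measure.sub_apply MeasurableSet.univ (hle n)]; simp
  have hτf : IsFiniteMeasure τ := ⟨by rw [hτm]; exact lt_of_le_of_lt tsub_le_self (by simp)⟩
  have hint : ∀ (κ : Measure ℝ) [IsFiniteMeasure κ], Integrable f κ := by
    intro κ _
    exact Integrable.of_bound h2.continuous.aestronglyMeasurable M (Eventually.of_forall h1)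
  have hbd : ∀ (κ : Measure ℝ) [IsFiniteMeasure κ], |∫ t, f t ∂κ| ≤ κ.real Set.univ := by
    intro κ _
    have := norm_integral_le_of_norm_le_const (μ := κ) (f := f) (C := M)
      (Eventually.of_forall fun t => h1 t)
    have h4 : (M : ℝ) * κ.real Set.univ ≤ 1 * κ.real Set.univ := by gcongr
    rw [Real.norm_eq_abs] at this
    linarith
  have e1 : ∫ t, f t ∂μ n = ∫ t, f t ∂τ + ∫ t, f t ∂ν n := by
    conv_lhs => rw [hτ]
    exact integral_add_measure (hint _) (hint _)
  have hfs : IsFiniteMeasure ((1 - ν n Set.univ) • Measure.dirac (0 : ℝ)) :=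
    ⟨by simp; exact lt_of_le_of_lt tsub_le_self (by simp)⟩
  have e2 : ∫ t, f t ∂ρ n = ∫ t, f t ∂ν n + ∫ t, f t ∂((1 - ν n Set.univ) • Measure.dirac (0 : ℝ)) :=
    integral_add_measure (hint _) (hint _)
  rw [e1, e2]
  have b1 := hbd τ
  have b2 := hbd ((1 - ν n Set.univ) • Measure.dirac (0 : ℝ))
  have r1 : τ.real Set.univ = (1 - ν n Set.univ).toReal := by rw [measureReal_def, hτm]
  have r2 : ((1 - ν n Set.univ) • Measure.dirac (0 : ℝ)).real Set.univ = (1 - ν n Set.univ).toReal := by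
    simp [measureReal_def]
  rw [r1] at b1
  rw [r2] at b2
  rw [abs_le] at b1 b2 ⊢
  constructor <;> linarith [b1.1, b1.2, b2.1, b2.2]

/-! ### Product measures and Gaussian densities -/

theorem lintegral_pi_prod {ι : Type*} [Fintype ι] {X : ι → Type*} [∀ i, MeasurableSpace (X i)]
    (μ : (i : ι) → Measure (X i)) [∀ i, IsProbabilityMeasure (μ i)] {f : (i : ι) → X i → ℝ≥0∞}
    (hf : ∀ i, Measurable (f i)) :
    ∫⁻ x, ∏ i, f i (x i) ∂(Measure.pi μ) = ∏ i, ∫⁻ t, f i t ∂(μ i) := by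
  have hind := iIndepFun_pi (μ := μ) (X := f) (fun i => (hf i).aemeasurable)
  rw [lintegral_prod_eq_prod_lintegral_of_indepFun _ _ hind
    (fun i => (hf i).comp (measurable_pi_apply i))]
  refine Finset.prod_congr rfl fun i _ => ?_
  rw [← lintegral_map (hf i) (measurable_pi_apply i)]
  rw [(measurePreserving_eval μ i).map_eq]

/-- Coordinatewise maps that change each factor by a density change the product measure by the
product of the densities. -/
theorem pi_map_eq_withDensity_prod {ι : Type*} [Fintype ι] {X : ι → Type*}
    [∀ i, MeasurableSpace (X i)]
    (μ : (i : ι) → Measure (X i)) [∀ i, IsProbabilityMeasure (μ i)]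
    {τ : (i : ι) → X i → X i} (hτ : ∀ i, Measurable (τ i))
    {ρ : (i : ι) → X i → ℝ≥0∞} (hρ : ∀ i, Measurable (ρ i))
    (h : ∀ i, (μ i).map (τ i) = (μ i).withDensity (ρ i)) :
    (Measure.pi μ).map (fun x i => τ i (x i))
      = (Measure.pi μ).withDensity fun x => ∏ i, ρ i (x i) := by
  have : ∀ i, IsProbabilityMeasure ((μ i).map (τ i)) := fun i =>
    Measure.isProbabilityMeasure_map (hτ i).aemeasurable
  rw [Measure.pi_map_pi (fun i => (hτ i).aemeasurable)]
  refine Measure.pi_eq fun s hs => ?_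
  rw [withDensity_apply _ (MeasurableSet.univ_pi hs), ← lintegral_indicator (MeasurableSet.univ_pi hs)]
  have hind : ∀ x : (i : ι) → X i, (Set.univ.pi s).indicator (fun x => ∏ i, ρ i (x i)) x
      = ∏ i, (s i).indicator (ρ i) (x i) := by
    intro x
    by_cases hx : x ∈ Set.univ.pi s
    · rw [Set.indicator_of_mem hx]
      exact Finset.prod_congr rfl fun i _ => (Set.indicator_of_mem (hx i trivial) _).symm
    · rw [Set.indicator_of_notMem hx]
      simp only [Set.mem_pi, Set.mem_univ, true_implies, not_forall] at hx
      obtain ⟨i, hi⟩ := hx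
      exact (Finset.prod_eq_zero (Finset.mem_univ i) (Set.indicator_of_notMem hi _)).symm
  simp_rw [hind]
  rw [lintegral_pi_prod μ fun i => (hρ i).indicator (hs i)]
  refine Finset.prod_congr rfl fun i _ => ?_
  rw [lintegral_indicator (hs i), ← withDensity_apply _ (hs i), h i]

/-- The one-dimensional Cameron–Martin formula; it supplies the density for the translated bias. -/
theorem gaussianReal_map_add_eq_withDensity (c : ℝ) :
    (gaussianReal 0 1).map (fun b => b + c)
      = (gaussianReal 0 1).withDensity fun b => ENNReal.ofReal (Real.exp (c * b - c ^ 2 / 2)) := by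
  rw [gaussianReal_map_add_const, zero_add, gaussianReal_of_var_ne_zero _ one_ne_zero,
    gaussianReal_of_var_ne_zero _ one_ne_zero,
    ← withDensity_mul _ (measurable_gaussianPDF _ _) (by fun_prop)]
  congr 1
  ext x
  simp only [Pi.mul_apply, gaussianPDF]
  rw [← ENNReal.ofReal_mul (gaussianPDFReal_nonneg _ _ _)]
  congr 1
  simp only [gaussianPDFReal]
  have : Real.exp (-(x - c) ^ 2 / (2 * ((1 : ℝ≥0) : ℝ)))
      = Real.exp (-(x - 0) ^ 2 / (2 * ((1 : ℝ≥0) : ℝ))) * Real.exp (c * x - c ^ 2 / 2) := by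
    rw [← Real.exp_add]; congr 1; simp; ring
  rw [this]; ring

theorem gaussianReal_map_mul_eq_withDensity {r : ℝ} (hr : 0 < r) :
    (gaussianReal 0 1).map (fun b => r * b)
      = (gaussianReal 0 1).withDensity fun b =>
          ENNReal.ofReal (r⁻¹ * Real.exp (b ^ 2 / 2 * (1 - (r⁻¹) ^ 2))) := by
  have hv : NNReal.mk (r ^ 2) (sq_nonneg _) * 1 ≠ 0 := by
    rw [mul_one, ← NNReal.coe_ne_zero, NNReal.coe_mk]
    exact (pow_pos hr 2).ne'
  rw [gaussianReal_map_const_mul, mul_zero, gaussianReal_of_var_ne_zero _ one_ne_zero,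
    gaussianReal_of_var_ne_zero _ hv,
    ← withDensity_mul _ (measurable_gaussianPDF _ _) (by fun_prop)]
  congr 1
  ext x
  simp only [Pi.mul_apply, gaussianPDF]
  rw [← ENNReal.ofReal_mul (gaussianPDFReal_nonneg _ _ _)]
  congr 1
  simp only [gaussianPDFReal, mul_one, NNReal.coe_mk, NNReal.coe_one]
  rw [Real.sqrt_mul (by positivity), Real.sqrt_sq hr.le, mul_inv]
  have : Real.exp (-(x - 0) ^ 2 / (2 * r ^ 2))
      = Real.exp (-(x - 0) ^ 2 / 2) * Real.exp (x ^ 2 / 2 * (1 - r⁻¹ ^ 2)) := by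
    rw [← Real.exp_add]; congr 1; field_simp; ring
  rw [this]; ring

/-! ### Gaussian noise -/

/-- The law of independent normal variables with means `θ₀ i` and variance one. -/
noncomputable def gaussLaw {n : ℕ} (θ₀ : Fin n → ℝ) : Measure (Fin n → ℝ) :=
  Measure.pi fun i => gaussianReal (θ₀ i) 1

instance {n : ℕ} (θ₀ : Fin n → ℝ) : IsProbabilityMeasure (gaussLaw θ₀) := by
  unfold gaussLaw; infer_instance

/-- The log likelihood ratio of the means `θ` and `θ₀`. -/
noncomputable def logLR {n : ℕ} (θ₀ y θ : Fin n → ℝ) : ℝ :=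
  (y - θ₀) ⬝ᵥ (θ - θ₀) - (θ - θ₀) ⬝ᵥ (θ - θ₀) / 2

theorem measurable_dotProduct {Ω : Type*} [MeasurableSpace Ω] {n : ℕ} {f g : Ω → Fin n → ℝ}
    (hf : Measurable f) (hg : Measurable g) : Measurable fun ω => f ω ⬝ᵥ g ω := by
  unfold dotProduct
  refine Finset.measurable_sum _ fun i _ => ?_
  exact ((measurable_pi_apply i).comp hf).mul ((measurable_pi_apply i).comp hg)

theorem measurable_logLR {Ω : Type*} [MeasurableSpace Ω] {n : ℕ} (θ₀ : Fin n → ℝ)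
    {f g : Ω → Fin n → ℝ} (hf : Measurable f) (hg : Measurable g) :
    Measurable fun ω => logLR θ₀ (f ω) (g ω) := by
  unfold logLR
  exact (measurable_dotProduct (hf.sub_const _) (hg.sub_const _)).sub
    ((measurable_dotProduct (hg.sub_const _) (hg.sub_const _)).div_const _)

theorem lintegral_exp_mul_gaussianReal (m w : ℝ) :
    ∫⁻ y, ENNReal.ofReal (Real.exp ((y - m) * w)) ∂(gaussianReal m 1)
      = ENNReal.ofReal (Real.exp (w * w / 2)) := by
  have h := congrFun (mgf_id_gaussianReal (μ := m) (v := 1)) w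
  simp only [mgf, id] at h
  have h1 : ∫⁻ y, ENNReal.ofReal (Real.exp (w * y)) ∂(gaussianReal m 1)
      = ENNReal.ofReal (Real.exp (m * w + 1 * w ^ 2 / 2)) := by
    rw [← ofReal_integral_eq_lintegral_ofReal (integrable_exp_mul_gaussianReal w)
      (Eventually.of_forall fun x => (Real.exp_pos _).le), h]
    simp
  have h2 : ∀ y : ℝ, ENNReal.ofReal (Real.exp ((y - m) * w))
      = ENNReal.ofReal (Real.exp (-(m * w))) * ENNReal.ofReal (Real.exp (w * y)) := by
    intro y
    rw [← ENNReal.ofReal_mul (Real.exp_pos _).le, ← Real.exp_add]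
    ring_nf
  simp_rw [h2]
  rw [lintegral_const_mul _ (by fun_prop), h1, ← ENNReal.ofReal_mul (Real.exp_pos _).le,
    ← Real.exp_add]
  ring_nf

theorem lintegral_exp_dotProduct {n : ℕ} (θ₀ w : Fin n → ℝ) :
    ∫⁻ y, ENNReal.ofReal (Real.exp ((y - θ₀) ⬝ᵥ w)) ∂(gaussLaw θ₀)
      = ENNReal.ofReal (Real.exp (w ⬝ᵥ w / 2)) := by
  have h1 : ∀ y : Fin n → ℝ, ENNReal.ofReal (Real.exp ((y - θ₀) ⬝ᵥ w))
      = ∏ i, ENNReal.ofReal (Real.exp ((y i - θ₀ i) * w i)) := by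
    intro y
    rw [dotProduct, Real.exp_sum, ENNReal.ofReal_prod_of_nonneg fun i _ => (Real.exp_pos _).le]
    rfl
  simp_rw [h1]
  rw [gaussLaw, lintegral_pi_prod _ (f := fun i t => ENNReal.ofReal (Real.exp ((t - θ₀ i) * w i)))
    (fun i => by fun_prop)]
  simp_rw [lintegral_exp_mul_gaussianReal]
  rw [← ENNReal.ofReal_prod_of_nonneg fun i _ => (Real.exp_pos _).le, ← Real.exp_sum, dotProduct,
    Finset.sum_div]

theorem lintegral_exp_logLR {n : ℕ} (θ₀ θ : Fin n → ℝ) :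
    ∫⁻ y, ENNReal.ofReal (Real.exp (logLR θ₀ y θ)) ∂(gaussLaw θ₀) = 1 := by
  have h1 : ∀ y : Fin n → ℝ, ENNReal.ofReal (Real.exp (logLR θ₀ y θ))
      = ENNReal.ofReal (Real.exp (-((θ - θ₀) ⬝ᵥ (θ - θ₀) / 2)))
        * ENNReal.ofReal (Real.exp ((y - θ₀) ⬝ᵥ (θ - θ₀))) := by
    intro y
    rw [← ENNReal.ofReal_mul (Real.exp_pos _).le, ← Real.exp_add, logLR]
    ring_nf
  simp_rw [h1]
  have hm : Measurable fun y : Fin n → ℝ => ENNReal.ofReal (Real.exp ((y - θ₀) ⬝ᵥ (θ - θ₀))) := by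
    have := measurable_dotProduct (f := fun y : Fin n → ℝ => y - θ₀) (g := fun _ => θ - θ₀)
      (measurable_id.sub_const _) measurable_const
    fun_prop
  rw [lintegral_const_mul _ hm, lintegral_exp_dotProduct, ← ENNReal.ofReal_mul (Real.exp_pos _).le,
    ← Real.exp_add]
  simp

/-- Chernoff's bound with parameter `1/2`: the exponential moment `exp (v ⬝ᵥ v / 8)` is cancelled by
half of the drift `v ⬝ᵥ v / 4`. With the drift in the threshold, the bound does not depend on `v`,
so a union bound over vectors of all sizes is possible. -/
theorem gaussLaw_tail {n : ℕ} (θ₀ v : Fin n → ℝ) (u : ℝ) :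
    gaussLaw θ₀ {y | v ⬝ᵥ v / 4 + u < (y - θ₀) ⬝ᵥ v} ≤ ENNReal.ofReal (Real.exp (-u / 2)) := by
  have hm : Measurable fun y : Fin n → ℝ =>
      ENNReal.ofReal (Real.exp ((y - θ₀) ⬝ᵥ ((1 / 2 : ℝ) • v))) := by
    have := measurable_dotProduct (f := fun y : Fin n → ℝ => y - θ₀)
      (g := fun _ => (1 / 2 : ℝ) • v) (measurable_id.sub_const _) measurable_const
    fun_prop
  have hmk := mul_meas_ge_le_lintegral (μ := gaussLaw θ₀) hm
    (ENNReal.ofReal (Real.exp ((v ⬝ᵥ v / 4 + u) / 2)))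
  rw [lintegral_exp_dotProduct] at hmk
  have hsub : {y | v ⬝ᵥ v / 4 + u < (y - θ₀) ⬝ᵥ v} ⊆
      {y | ENNReal.ofReal (Real.exp ((v ⬝ᵥ v / 4 + u) / 2)) ≤
        ENNReal.ofReal (Real.exp ((y - θ₀) ⬝ᵥ ((1 / 2 : ℝ) • v)))} := by
    intro y hy
    refine ENNReal.ofReal_le_ofReal (Real.exp_le_exp.2 ?_)
    have hy : v ⬝ᵥ v / 4 + u < (y - θ₀) ⬝ᵥ v := hy
    rw [dotProduct_smul, smul_eq_mul]
    linarith
  refine (measure_mono hsub).trans ?_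
  have h3 : ∀ z : ℝ≥0∞, z = ENNReal.ofReal (Real.exp (-((v ⬝ᵥ v / 4 + u) / 2))) *
      (ENNReal.ofReal (Real.exp ((v ⬝ᵥ v / 4 + u) / 2)) * z) := by
    intro z
    rw [← mul_assoc, ← ENNReal.ofReal_mul (Real.exp_pos _).le, ← Real.exp_add]
    simp
  rw [h3 (gaussLaw θ₀ _)]
  refine (mul_le_mul_right hmk _).trans (le_of_eq ?_)
  rw [← ENNReal.ofReal_mul (Real.exp_pos _).le, ← Real.exp_add]
  congr 2
  simp only [dotProduct_smul, smul_dotProduct, smul_eq_mul]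
  ring

/-- The previous tail bound in the directions of plus and minus the unit vectors. So crude a bound
is enough, because it only multiplies polynomially small discretisation errors. -/
theorem gaussLaw_exists_abs_gt {n : ℕ} (θ₀ : Fin n → ℝ) :
    gaussLaw θ₀ {y | ¬ ∀ i, |y i - θ₀ i| ≤ n + 1} ≤ ENNReal.ofReal (2 * n * Real.exp (-n / 2)) := by
  have hsub : {y : Fin n → ℝ | ¬ ∀ i, |y i - θ₀ i| ≤ n + 1} ⊆ ⋃ i : Fin n,
      ({y | (Pi.single i 1 : Fin n → ℝ) ⬝ᵥ Pi.single i 1 / 4 + (n : ℝ) < (y - θ₀) ⬝ᵥ Pi.single i 1} ∪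
       {y | (Pi.single i (-1) : Fin n → ℝ) ⬝ᵥ Pi.single i (-1) / 4 + (n : ℝ) <
          (y - θ₀) ⬝ᵥ Pi.single i (-1)}) := by
    intro y hy
    simp only [Set.mem_ofPred_eq, not_forall, not_le] at hy
    obtain ⟨i, hi⟩ := hy
    refine Set.mem_iUnion.2 ⟨i, ?_⟩
    rcases abs_cases (y i - θ₀ i) with ⟨h1, -⟩ | ⟨h1, -⟩
    · left
      simp
      linarith
    · right
      simp
      linarith
  refine (measure_mono hsub).trans ((measure_iUnion_le _).trans ?_)
  rw [tsum_fintype]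
  calc _ ≤ ∑ i : Fin n, (ENNReal.ofReal (Real.exp (-n / 2)) + ENNReal.ofReal (Real.exp (-n / 2))) := by
        refine Finset.sum_le_sum fun i _ => (measure_union_le _ _).trans ?_
        exact add_le_add (gaussLaw_tail _ _ _) (gaussLaw_tail _ _ _)
    _ = _ := by
        rw [← ENNReal.ofReal_add (Real.exp_pos _).le (Real.exp_pos _).le, Finset.sum_const,
          Finset.card_univ, Fintype.card_fin, nsmul_eq_mul, ← ENNReal.ofReal_natCast,
          ← ENNReal.ofReal_mul (by positivity)]
        congr 1; ring

theorem measurable_ofReal_exp_logLR {Ω : Type*} [MeasurableSpace Ω] {n : ℕ} (θ₀ : Fin n → ℝ)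
    {f g : Ω → Fin n → ℝ} (hf : Measurable f) (hg : Measurable g) :
    Measurable fun ω => ENNReal.ofReal (Real.exp (logLR θ₀ (f ω) (g ω))) :=
  (Real.measurable_exp.comp (measurable_logLR θ₀ hf hg)).ennreal_ofReal

/-- Tonelli's theorem together with the fact that a likelihood ratio has mean one under the true
law. -/
theorem lintegral_setLIntegral_exp_logLR {Ω : Type*} [MeasurableSpace Ω] {n : ℕ} (θ₀ : Fin n → ℝ)
    (Q : Measure Ω) [SFinite Q] {θ : Ω → Fin n → ℝ} (hθ : Measurable θ) (F : Set Ω) :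
    ∫⁻ y, ∫⁻ ω in F, ENNReal.ofReal (Real.exp (logLR θ₀ y (θ ω))) ∂Q ∂(gaussLaw θ₀) = Q F := by
  rw [lintegral_lintegral_swap]
  · simp_rw [lintegral_exp_logLR]
    simp
  · exact (measurable_ofReal_exp_logLR θ₀ measurable_fst (hθ.comp measurable_snd)).aemeasurable

/-- Sets of small prior probability receive small integrated likelihood. -/
theorem gaussLaw_setLIntegral_ge_le {Ω : Type*} [MeasurableSpace Ω] {n : ℕ} (θ₀ : Fin n → ℝ)
    (Q : Measure Ω) [SFinite Q] {θ : Ω → Fin n → ℝ} (hθ : Measurable θ) (F : Set Ω)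
    (c : ℝ) :
    gaussLaw θ₀ {y | ENNReal.ofReal (Real.exp (-c)) ≤
      ∫⁻ ω in F, ENNReal.ofReal (Real.exp (logLR θ₀ y (θ ω))) ∂Q}
      ≤ ENNReal.ofReal (Real.exp c) * Q F := by
  have hm : Measurable fun y : Fin n → ℝ =>
      ∫⁻ ω in F, ENNReal.ofReal (Real.exp (logLR θ₀ y (θ ω))) ∂Q :=
    Measurable.lintegral_prod_right'
      (measurable_ofReal_exp_logLR θ₀ measurable_fst (hθ.comp measurable_snd))
  have hmk := mul_meas_ge_le_lintegral (μ := gaussLaw θ₀) hm (ENNReal.ofReal (Real.exp (-c)))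
  rw [lintegral_setLIntegral_exp_logLR θ₀ Q hθ] at hmk
  have h3 : ∀ z : ℝ≥0∞, z = ENNReal.ofReal (Real.exp c) * (ENNReal.ofReal (Real.exp (-c)) * z) := by
    intro z
    rw [← mul_assoc, ← ENNReal.ofReal_mul (Real.exp_pos _).le, ← Real.exp_add]
    simp
  rw [h3 (gaussLaw θ₀ _)]
  gcongr

/-! ### The prior on the parameter space -/

/-- Parameters of networks of all widths: the width parameter and the coefficients. -/
abbrev Param (p L : ℕ) : Type := Σ N : ℕ, (CoeffIdx p L N → ℝ)

/-- The network function of a parameter. -/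
noncomputable def paramNet {p L : ℕ} (ω : Param p L) : (Fin p → ℝ) → ℝ := network ω.2

/-- The parameter with given width parameter and coefficients. -/
abbrev mkParam {p L : ℕ} (N : ℕ) (B : CoeffIdx p L N → ℝ) : Param p L := ⟨N, B⟩

/-- The adaptive prior, as a law on the parameters. -/
noncomputable def paramPrior (lam lamS : ℝ) (p L : ℕ) : Measure (Param p L) :=
  Measure.sum fun N : ℕ => ENNReal.ofReal (widthWeight lam N) •
    ∑ s ∈ sparsityLevels p L N, ENNReal.ofReal (sparsityWeight lamS p L N s) •
      ((patterns p L N s).card : ℝ≥0∞)⁻¹ •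
        ∑ γ ∈ patterns p L N s, (coeffPrior γ).map (mkParam N)

theorem measurable_mkParam {p L : ℕ} (N : ℕ) :
    Measurable (mkParam N : (CoeffIdx p L N → ℝ) → Param p L) :=
  Measurable.of_le_map (iInf_le _ N)

theorem measurable_of_param {p L : ℕ} {β : Type*} [MeasurableSpace β] {f : Param p L → β}
    (h : ∀ N, Measurable fun B : CoeffIdx p L N → ℝ => f ⟨N, B⟩) : Measurable f := by
  intro s hs
  exact MeasurableSpace.measurableSet_iInf.2 fun N => h N hs

theorem measurable_paramNet {p L : ℕ} : Measurable (paramNet : Param p L → (Fin p → ℝ) → ℝ) :=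
  measurable_of_param fun _ => measurable_network

instance {p L N : ℕ} (j : CoeffIdx p L N) : IsProbabilityMeasure (slab j) := by
  rcases j with j | j
  · exact cond_isProbabilityMeasure_of_finite (by simp) (by simp)
  · simp only [slab]; infer_instance

open scoped Classical in
instance {p L N : ℕ} (γ : Finset (CoeffIdx p L N)) : IsProbabilityMeasure (coeffPrior γ) := by
  have : ∀ j, IsProbabilityMeasure (if j ∈ γ then slab j else Measure.dirac 0) := by
    intro j; split_ifs <;> infer_instance
  unfold coeffPrior; infer_instance

/-- The changes of variables act on coefficients and not on functions, so the argument takes place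
on the parameter space and is transported back only at the end. -/
theorem prior_eq_map (lam lamS : ℝ) (p L : ℕ) :
    prior lam lamS p L = (paramPrior lam lamS p L).map paramNet := by
  ext S hS
  rw [Measure.map_apply measurable_paramNet hS, paramPrior, prior,
    Measure.sum_apply _ (measurable_paramNet hS), Measure.sum_apply _ hS]
  refine tsum_congr fun N => ?_
  simp only [Measure.smul_apply, Measure.coe_finsetSum, Finset.sum_apply, shellPrior]
  congr 1
  refine Finset.sum_congr rfl fun s _ => ?_
  congr 2
  refine Finset.sum_congr rfl fun γ _ => ?_
  rw [Measure.map_apply measurable_network hS,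
    Measure.map_apply (measurable_mkParam N) (measurable_paramNet hS)]
  rfl

theorem lintegral_paramPrior (lam lamS : ℝ) (p L : ℕ) {g : Param p L → ℝ≥0∞} (hg : Measurable g) :
    ∫⁻ ω, g ω ∂(paramPrior lam lamS p L) = ∑' N : ℕ, ENNReal.ofReal (widthWeight lam N) *
      ∑ s ∈ sparsityLevels p L N, ENNReal.ofReal (sparsityWeight lamS p L N s) *
        (((patterns p L N s).card : ℝ≥0∞)⁻¹ *
          ∑ γ ∈ patterns p L N s, ∫⁻ B, g ⟨N, B⟩ ∂(coeffPrior γ)) := by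
  rw [paramPrior, lintegral_sum_measure]
  refine tsum_congr fun N => ?_
  rw [lintegral_smul_measure, lintegral_finsetSum_measure, smul_eq_mul]
  congr 1
  refine Finset.sum_congr rfl fun s _ => ?_
  rw [lintegral_smul_measure, lintegral_smul_measure, lintegral_finsetSum_measure, smul_eq_mul,
    smul_eq_mul]
  congr 2
  refine Finset.sum_congr rfl fun γ _ => ?_
  rw [lintegral_map hg (measurable_mkParam N)]

theorem widthWeight_nonneg {lam : ℝ} (hlam : 0 < lam) (N : ℕ) : 0 ≤ widthWeight lam N := by
  unfold widthWeight
  have : 0 < Real.exp lam - 1 := by linarith [Real.add_one_lt_exp hlam.ne']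
  split_ifs <;> positivity

/-- The exponential moment of a Poisson law conditioned to be positive, for use in Markov's
inequality for the width. -/
theorem tsum_widthWeight_mul_exp_le {lam : ℝ} (hlam : 0 < lam) (c : ℝ) :
    ∑' N : ℕ, ENNReal.ofReal (widthWeight lam N * Real.exp (c * N)) ≤
      ENNReal.ofReal (Real.exp (lam * Real.exp c) / (Real.exp lam - 1)) := by
  have he : 0 < Real.exp lam - 1 := by linarith [Real.add_one_lt_exp hlam.ne']
  have hs : HasSum (fun N : ℕ => (lam * Real.exp c) ^ N / N.factorial / (Real.exp lam - 1))
      (Real.exp (lam * Real.exp c) / (Real.exp lam - 1)) := by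
    refine HasSum.div_const ?_ _
    have := NormedSpace.expSeries_div_hasSum_exp (lam * Real.exp c)
    rwa [← Real.exp_eq_exp_ℝ] at this
  rw [← hs.tsum_eq, ENNReal.ofReal_tsum_of_nonneg (fun N => by positivity) hs.summable]
  refine ENNReal.tsum_le_tsum fun N => ENNReal.ofReal_le_ofReal ?_
  unfold widthWeight
  split_ifs with h
  · rw [zero_mul]; positivity
  · rw [mul_pow, ← Real.exp_nat_mul]
    apply le_of_eq
    field_simp

theorem tsum_widthWeight_le {lam : ℝ} (hlam : 0 < lam) :
    ∑' N : ℕ, ENNReal.ofReal (widthWeight lam N) ≤ 1 := by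
  have he : 0 < Real.exp lam - 1 := by linarith [Real.add_one_lt_exp hlam.ne']
  have hs : HasSum (fun N : ℕ => lam ^ N / (N.factorial : ℝ)) (Real.exp lam) := by
    have := NormedSpace.expSeries_div_hasSum_exp lam
    rwa [← Real.exp_eq_exp_ℝ] at this
  have hs2 : HasSum (fun N : ℕ => widthWeight lam N) 1 := by
    rw [← hasSum_nat_add_iff' 1] at hs ⊢
    have := hs.div_const (Real.exp lam - 1)
    simp only [Finset.sum_range_one, pow_zero, Nat.factorial_zero, Nat.cast_one, div_one,
      div_self he.ne'] at this
    have e : ∀ N : ℕ, widthWeight lam (N + 1)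
        = lam ^ (N + 1) / ((N + 1).factorial : ℝ) / (Real.exp lam - 1) := by
      intro N
      simp only [widthWeight, Nat.add_eq_zero_iff, one_ne_zero, and_false, if_false]
      rw [div_div, mul_comm]
    simp_rw [e]
    simpa [widthWeight] using this
  rw [← ENNReal.ofReal_tsum_of_nonneg (fun N => widthWeight_nonneg hlam N) hs2.summable, hs2.tsum_eq]
  simp

theorem sparsityWeight_nonneg (lamS : ℝ) (p L N s : ℕ) : 0 ≤ sparsityWeight lamS p L N s := by
  unfold sparsityWeight; positivity

theorem sum_sparsityWeight_le (lamS : ℝ) (p L N : ℕ) :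
    ∑ s ∈ sparsityLevels p L N, ENNReal.ofReal (sparsityWeight lamS p L N s) ≤ 1 := by
  rw [← ENNReal.ofReal_sum_of_nonneg fun s _ => sparsityWeight_nonneg _ _ _ _ _,
    ENNReal.ofReal_le_one]
  simp only [sparsityWeight]
  rw [← Finset.sum_div]
  exact div_self_le_one _

/-- The sparsity has exponentially small tails. -/
theorem sum_sparsityWeight_tail_le {lamS : ℝ} (hlamS : 0 < lamS) (p L N s' : ℕ) :
    ∑ s ∈ (sparsityLevels p L N).filter (fun s => s' < s),
        ENNReal.ofReal (sparsityWeight lamS p L N s)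
      ≤ ENNReal.ofReal (Fintype.card (CoeffIdx p L N) *
          Real.exp (-lamS * (s' - (width p N L + 1)))) := by
  rw [← ENNReal.ofReal_sum_of_nonneg fun s _ => sparsityWeight_nonneg _ _ _ _ _]
  refine ENNReal.ofReal_le_ofReal ?_
  by_cases hT : width p N L + 1 ≤ Fintype.card (CoeffIdx p L N)
  swap
  · have : sparsityLevels p L N = ∅ := Finset.Icc_eq_empty hT
    rw [this]; simp; positivity
  have hden : Real.exp (-lamS * (width p N L + 1)) ≤
      ∑ r ∈ sparsityLevels p L N, Real.exp (-lamS * r) := by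
    have hmem : width p N L + 1 ∈ sparsityLevels p L N := Finset.mem_Icc.2 ⟨le_rfl, hT⟩
    have := Finset.single_le_sum (f := fun r : ℕ => Real.exp (-lamS * r))
      (fun r _ => (Real.exp_pos _).le) hmem
    push_cast at this
    exact this
  have hterm : ∀ s ∈ (sparsityLevels p L N).filter (fun s => s' < s),
      sparsityWeight lamS p L N s ≤ Real.exp (-lamS * (s' - (width p N L + 1))) := by
    intro s hs
    have hs' : (s' : ℝ) ≤ s := by exact_mod_cast (Finset.mem_filter.1 hs).2.le
    unfold sparsityWeight
    rw [div_le_iff₀ (lt_of_lt_of_le (Real.exp_pos _) hden)]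
    calc Real.exp (-lamS * s) ≤ Real.exp (-lamS * (s' - (width p N L + 1)))
          * Real.exp (-lamS * (width p N L + 1)) := by
          rw [← Real.exp_add]
          refine Real.exp_le_exp.2 ?_
          nlinarith
      _ ≤ _ := by gcongr
  refine (Finset.sum_le_card_nsmul _ _ _ hterm).trans ?_
  rw [nsmul_eq_mul]
  gcongr
  refine (Finset.card_filter_le _ _).trans ?_
  unfold sparsityLevels
  rw [Nat.card_Icc]
  omega

theorem card_inv_mul_sum_le {ι : Type*} (s : Finset ι) {f : ι → ℝ≥0∞} {c : ℝ≥0∞}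
    (h : ∀ i ∈ s, f i ≤ c) : (s.card : ℝ≥0∞)⁻¹ * ∑ i ∈ s, f i ≤ c := by
  refine (mul_le_mul_right (Finset.sum_le_card_nsmul s f c h) _).trans ?_
  rw [nsmul_eq_mul, ← mul_assoc]
  exact mul_le_of_le_one_left' (ENNReal.inv_mul_le_one _)

/-- The bound is split because the sparsity tail must be averaged over `s`, while the rest passes
through a total weight of at most one. The case `N = 0` has no weight. -/
theorem paramPrior_apply_le {lam lamS : ℝ} {p L : ℕ} {F : Set (Param p L)}
    (hF : MeasurableSet F) {c : ℕ → ℝ≥0∞} {d : ℕ → ℕ → ℝ≥0∞}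
    (h : ∀ N, N ≠ 0 → ∀ s ∈ sparsityLevels p L N, ∀ γ ∈ patterns p L N s,
      coeffPrior γ (mkParam N ⁻¹' F) ≤ c N + d N s) :
    paramPrior lam lamS p L F ≤ ∑' N : ℕ, ENNReal.ofReal (widthWeight lam N) *
      (c N + ∑ s ∈ sparsityLevels p L N, ENNReal.ofReal (sparsityWeight lamS p L N s) * d N s) := by
  rw [← lintegral_indicator_one hF, lintegral_paramPrior _ _ _ _ (measurable_one.indicator hF)]
  refine ENNReal.tsum_le_tsum fun N => ?_
  rcases eq_or_ne N 0 with rfl | hN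
  · simp [widthWeight]
  gcongr
  have h1 : ∀ s ∈ sparsityLevels p L N, ((patterns p L N s).card : ℝ≥0∞)⁻¹ *
      ∑ γ ∈ patterns p L N s, ∫⁻ B, F.indicator (1 : Param p L → ℝ≥0∞) ⟨N, B⟩ ∂(coeffPrior γ)
      ≤ c N + d N s := by
    intro s hs
    refine card_inv_mul_sum_le _ fun γ hγ => ?_
    refine le_trans (le_of_eq ?_) (h N hN s hs γ hγ)
    rw [← lintegral_indicator_one (measurable_mkParam N hF)]
    rfl
  calc _ ≤ ∑ s ∈ sparsityLevels p L N, ENNReal.ofReal (sparsityWeight lamS p L N s) *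
        (c N + d N s) := Finset.sum_le_sum fun s hs => mul_le_mul_right (h1 s hs) _
    _ ≤ _ := by
        simp_rw [mul_add]
        rw [Finset.sum_add_distrib, ← Finset.sum_mul]
        gcongr
        exact mul_le_of_le_one_left' (sum_sparsityWeight_le _ _ _ _)

theorem paramPrior_univ_le {lam : ℝ} (hlam : 0 < lam) (lamS : ℝ) (p L : ℕ) :
    paramPrior lam lamS p L Set.univ ≤ 1 := by
  refine (paramPrior_apply_le MeasurableSet.univ (c := fun _ => 1)
    (d := fun _ _ => 0) fun N _ s _ γ _ => ?_).trans ?_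
  · simp
  · simp only [mul_zero, Finset.sum_const_zero, add_zero, mul_one]
    exact tsum_widthWeight_le hlam

theorem isFiniteMeasure_paramPrior {lam : ℝ} (hlam : 0 < lam) (lamS : ℝ) (p L : ℕ) :
    IsFiniteMeasure (paramPrior lam lamS p L) :=
  ⟨(paramPrior_univ_le hlam lamS p L).trans_lt (by simp)⟩

/-- A single component of the mixture bounds the prior from below. -/
theorem le_paramPrior_apply {lam lamS : ℝ} {p L : ℕ} {F : Set (Param p L)}
    (hF : MeasurableSet F) {N s : ℕ} (hs : s ∈ sparsityLevels p L N)
    {γ : Finset (CoeffIdx p L N)} (hγ : γ ∈ patterns p L N s) :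
    ENNReal.ofReal (widthWeight lam N) * (ENNReal.ofReal (sparsityWeight lamS p L N s) *
      (((patterns p L N s).card : ℝ≥0∞)⁻¹ * coeffPrior γ (mkParam N ⁻¹' F)))
      ≤ paramPrior lam lamS p L F := by
  rw [← lintegral_indicator_one hF, lintegral_paramPrior _ _ _ _ (measurable_one.indicator hF)]
  refine le_trans ?_ (ENNReal.le_tsum N)
  gcongr
  refine le_trans ?_ (Finset.single_le_sum (fun _ _ => zero_le) hs)
  gcongr
  refine le_trans ?_ (Finset.single_le_sum (fun _ _ => zero_le) hγ)
  rw [← lintegral_indicator_one (measurable_mkParam N hF)]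
  exact le_rfl

/-! ### Transformations of the top layer -/

/-- Transform the top layer coefficients one by one. -/
def topMap {p L : ℕ} (τ : (N : ℕ) → TopIdx p L N → ℝ → ℝ) (ω : Param p L) : Param p L :=
  ⟨ω.1, Sum.elim (fun i => ω.2 (Sum.inl i)) fun k => τ ω.1 k (ω.2 (Sum.inr k))⟩

theorem measurable_topMap {p L : ℕ} {τ : (N : ℕ) → TopIdx p L N → ℝ → ℝ}
    (hτ : ∀ N k, Measurable (τ N k)) : Measurable (topMap (p := p) (L := L) τ) := by
  refine measurable_of_param fun N => ?_
  have h : Measurable fun (B : CoeffIdx p L N → ℝ) => (Sum.elim (fun i => B (Sum.inl i))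
      fun k => τ N k (B (Sum.inr k)) : CoeffIdx p L N → ℝ) := by
    refine measurable_pi_iff.2 fun j => ?_
    rcases j with j | k
    · exact measurable_pi_apply _
    · exact (hτ N k).comp (measurable_pi_apply _)
  exact (measurable_mkParam N).comp h

theorem measurable_prod_top {p L : ℕ} {ρ : (N : ℕ) → TopIdx p L N → ℝ → ℝ≥0∞}
    (hρ : ∀ N k, Measurable (ρ N k)) :
    Measurable fun ω : Param p L => ∏ k, ρ ω.1 k (ω.2 (Sum.inr k)) :=
  measurable_of_param fun N => by
    have h : Measurable fun B : CoeffIdx p L N → ℝ => ∏ k, ρ N k (B (Sum.inr k)) :=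
      Finset.measurable_fun_prod _ fun k _ => (hρ N k).comp (measurable_pi_apply _)
    exact h

open scoped Classical in
-- Admissible patterns contain the whole top layer, so its coefficients are standard normal under
-- each of them. The deep coordinates are left fixed and contribute density one.
theorem lintegral_coeffPrior_top {p L N s : ℕ} {γ : Finset (CoeffIdx p L N)}
    (hγ : γ ∈ patterns p L N s) {τ : TopIdx p L N → ℝ → ℝ}
    (hτ : ∀ k, Measurable (τ k)) {ρ : TopIdx p L N → ℝ → ℝ≥0∞} (hρ : ∀ k, Measurable (ρ k))
    (h : ∀ k, (gaussianReal 0 1).map (τ k) = (gaussianReal 0 1).withDensity (ρ k))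
    {g : (CoeffIdx p L N → ℝ) → ℝ≥0∞} (hg : Measurable g) :
    ∫⁻ B, g (Sum.elim (fun i => B (Sum.inl i)) fun k => τ k (B (Sum.inr k))) ∂(coeffPrior γ)
      = ∫⁻ B, g B * ∏ k, ρ k (B (Sum.inr k)) ∂(coeffPrior γ) := by
  let τ' : CoeffIdx p L N → ℝ → ℝ := Sum.elim (fun _ => id) τ
  let ρ' : CoeffIdx p L N → ℝ → ℝ≥0∞ := Sum.elim (fun _ => 1) ρ
  have hτ' : ∀ j, Measurable (τ' j) := by
    rintro (j | k)
    · exact measurable_id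
    · exact hτ k
  have hρ' : ∀ j, Measurable (ρ' j) := by
    rintro (j | k)
    · exact measurable_one
    · exact hρ k
  have hprob : ∀ j, IsProbabilityMeasure (if j ∈ γ then slab j else Measure.dirac (0 : ℝ)) := by
    intro j; split_ifs <;> infer_instance
  have hd : ∀ j, (if j ∈ γ then slab j else Measure.dirac (0 : ℝ)).map (τ' j)
      = (if j ∈ γ then slab j else Measure.dirac (0 : ℝ)).withDensity (ρ' j) := by
    rintro (j | k)
    · simp only [τ', ρ', Sum.elim_inl, Measure.map_id, withDensity_one]
    · have hk : Sum.inr k ∈ γ := (Finset.mem_filter.1 hγ).2.2 k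
      simp only [hk, if_true, τ', ρ', Sum.elim_inr]
      exact h k
  have key := pi_map_eq_withDensity_prod _ hτ' hρ' hd
  have hpm : Measurable fun (B : CoeffIdx p L N → ℝ) j => τ' j (B j) :=
    measurable_pi_iff.2 fun j => (hτ' j).comp (measurable_pi_apply j)
  have e1 : ∫⁻ B, g (Sum.elim (fun i => B (Sum.inl i)) fun k => τ k (B (Sum.inr k))) ∂(coeffPrior γ)
      = ∫⁻ B, g B ∂((coeffPrior γ).map fun B j => τ' j (B j)) := by
    rw [lintegral_map hg hpm]
    refine lintegral_congr fun B => ?_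
    congr 1
    ext (j | k) <;> rfl
  have hpr : Measurable fun B : CoeffIdx p L N → ℝ => ∏ j, ρ' j (B j) := by
    exact Finset.measurable_fun_prod _ fun j _ => (hρ' j).comp (measurable_pi_apply j)
  rw [e1, coeffPrior, key, lintegral_withDensity_eq_lintegral_mul _ hpr hg]
  refine lintegral_congr fun B => ?_
  simp only [Pi.mul_apply]
  rw [mul_comm, Fintype.prod_sum_type]
  simp [ρ']

/-- Change of variables in the top layer. -/
theorem lintegral_paramPrior_topMap (lam lamS : ℝ) {p L : ℕ}
    {τ : (N : ℕ) → TopIdx p L N → ℝ → ℝ}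
    (hτ : ∀ N k, Measurable (τ N k)) {ρ : (N : ℕ) → TopIdx p L N → ℝ → ℝ≥0∞}
    (hρ : ∀ N k, Measurable (ρ N k))
    (h : ∀ N k, (gaussianReal 0 1).map (τ N k) = (gaussianReal 0 1).withDensity (ρ N k))
    {g : Param p L → ℝ≥0∞} (hg : Measurable g) :
    ∫⁻ ω, g (topMap τ ω) ∂(paramPrior lam lamS p L)
      = ∫⁻ ω, g ω * ∏ k, ρ ω.1 k (ω.2 (Sum.inr k)) ∂(paramPrior lam lamS p L) := by
  have h1 : Measurable fun ω : Param p L => g (topMap τ ω) := hg.comp (measurable_topMap hτ)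
  have h2 : Measurable fun ω : Param p L => g ω * ∏ k, ρ ω.1 k (ω.2 (Sum.inr k)) :=
    hg.mul (measurable_prod_top hρ)
  rw [lintegral_paramPrior _ _ _ _ h1, lintegral_paramPrior _ _ _ _ h2]
  refine tsum_congr fun N => ?_
  congr 1
  refine Finset.sum_congr rfl fun s _ => ?_
  congr 2
  refine Finset.sum_congr rfl fun γ hγ => ?_
  exact lintegral_coeffPrior_top hγ (hτ N) (hρ N) (h N) (hg.comp (measurable_mkParam N))

/-! ### Networks depend on their coefficients in a Lipschitz fashion -/

theorem width_le {p N W : ℕ} (hp : p ≤ W) (hW : 12 * p * N ≤ W) (l : ℕ) : width p N l ≤ W := by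
  cases l <;> simpa [width]

theorem abs_sum_mul_le {m : ℕ} {W a c : ℝ} (hW : (m : ℝ) ≤ W) (hc : 0 ≤ c) (ha : 0 ≤ a)
    {f g : Fin m → ℝ} (hf : ∀ j, |f j| ≤ a) (hg : ∀ j, |g j| ≤ c) :
    |∑ j, f j * g j| ≤ W * (a * c) := by
  calc |∑ j, f j * g j| ≤ ∑ j, |f j * g j| := Finset.abs_sum_le_sum_abs _ _
    _ ≤ ∑ _j : Fin m, a * c := by
        refine Finset.sum_le_sum fun j _ => ?_
        rw [abs_mul]
        exact mul_le_mul (hf j) (hg j) (abs_nonneg _) ha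
    _ ≤ _ := by
        rw [Finset.sum_const, Finset.card_univ, Fintype.card_fin, nsmul_eq_mul]
        gcongr

theorem abs_hidden_le {p L N W : ℕ} (hp : p ≤ W) (hW : 12 * p * N ≤ W) {R : ℝ} (hR : 1 ≤ R)
    {B : CoeffIdx p L N → ℝ} (hB : ∀ j, |B j| ≤ R) {u : Fin p → ℝ} (hu : ∀ j, |u j| ≤ 1) :
    ∀ (l : ℕ) (h : l ≤ L) (i : Fin (width p N l)), |hidden B u l h i| ≤ ((W + 1) * R) ^ l
  | 0, _, i => by simpa [hidden] using hu i
  | l + 1, h, i => by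
      have ih := abs_hidden_le hp hW hR hB hu l (Nat.le_of_succ_le h)
      have hWl : (width p N l : ℝ) ≤ W := by exact_mod_cast width_le hp hW l
      have h1 : (1 : ℝ) ≤ ((W + 1) * R) ^ l := one_le_pow₀ (by nlinarith [Nat.cast_nonneg (α := ℝ) W])
      simp only [hidden]
      refine (abs_max_le_max_abs_abs).trans (max_le ?_ (by simp; positivity))
      refine (abs_add_le _ _).trans ?_
      have h2 := abs_sum_mul_le hWl (by positivity) (by positivity)
        (fun j => hB (Sum.inl ⟨⟨l, h⟩, i, some j⟩)) ih
      have h3 := hB (Sum.inl ⟨⟨l, h⟩, i, none⟩)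
      rw [pow_succ]
      nlinarith

/-- Each layer adds two errors: new weights on old activations, and the propagated error of the
activations. The layer index counts the first kind, and `(W + 1) * R` is the growth per layer. -/
theorem abs_hidden_sub_le {p L N W : ℕ} (hp : p ≤ W) (hW : 12 * p * N ≤ W) {R δ : ℝ} (hR : 1 ≤ R)
    (hδ : 0 ≤ δ) {B B' : CoeffIdx p L N → ℝ} (hB : ∀ j, |B j| ≤ R) (hB' : ∀ j, |B' j| ≤ R)
    (hBB : ∀ j, |B j - B' j| ≤ δ) {u : Fin p → ℝ} (hu : ∀ j, |u j| ≤ 1) :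
    ∀ (l : ℕ) (h : l ≤ L) (i : Fin (width p N l)),
      |hidden B u l h i - hidden B' u l h i| ≤ l * δ * ((W + 1) * R) ^ l
  | 0, _, i => by simp [hidden]
  | l + 1, h, i => by
      have ih := abs_hidden_sub_le hp hW hR hδ hB hB' hBB hu l (Nat.le_of_succ_le h)
      have hb := abs_hidden_le hp hW hR hB hu l (Nat.le_of_succ_le h)
      have hWl : (width p N l : ℝ) ≤ W := by exact_mod_cast width_le hp hW l
      have h1 : (1 : ℝ) ≤ ((W + 1) * R) ^ l := one_le_pow₀ (by nlinarith [Nat.cast_nonneg (α := ℝ) W])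
      simp only [hidden]
      refine (abs_max_sub_max_le_abs _ _ _).trans ?_
      have e : (∑ j, B (Sum.inl ⟨⟨l, h⟩, i, some j⟩) * hidden B u l (Nat.le_of_succ_le h) j
            + B (Sum.inl ⟨⟨l, h⟩, i, none⟩)
          - (∑ j, B' (Sum.inl ⟨⟨l, h⟩, i, some j⟩) * hidden B' u l (Nat.le_of_succ_le h) j
            + B' (Sum.inl ⟨⟨l, h⟩, i, none⟩)))
          = ∑ j, (B (Sum.inl ⟨⟨l, h⟩, i, some j⟩) - B' (Sum.inl ⟨⟨l, h⟩, i, some j⟩))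
              * hidden B u l (Nat.le_of_succ_le h) j
            + ∑ j, B' (Sum.inl ⟨⟨l, h⟩, i, some j⟩) *
              (hidden B u l (Nat.le_of_succ_le h) j - hidden B' u l (Nat.le_of_succ_le h) j)
            + (B (Sum.inl ⟨⟨l, h⟩, i, none⟩) - B' (Sum.inl ⟨⟨l, h⟩, i, none⟩)) := by
        simp only [sub_mul, mul_sub, Finset.sum_sub_distrib]; ring
      rw [e]
      have h2 := abs_sum_mul_le hWl (by positivity) hδ
        (fun j => hBB (Sum.inl ⟨⟨l, h⟩, i, some j⟩)) hb
      have h3 := abs_sum_mul_le hWl (by positivity) (by positivity)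
        (fun j => hB' (Sum.inl ⟨⟨l, h⟩, i, some j⟩)) ih
      have h4 := hBB (Sum.inl ⟨⟨l, h⟩, i, none⟩)
      refine (abs_add_three _ _ _).trans ((add_le_add (add_le_add h2 h3) h4).trans ?_)
      set H := ((W + 1) * R) ^ l
      have hW0 : (0 : ℝ) ≤ W := Nat.cast_nonneg _
      rw [pow_succ]
      push_cast
      have t1 : (W : ℝ) * (δ * H) + δ ≤ (W + 1) * R * (δ * H) := by
        have a1 : δ ≤ δ * H := le_mul_of_one_le_right hδ h1
        have a2 : (W + 1) * (δ * H) * 1 ≤ (W + 1) * (δ * H) * R := by gcongr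
        linarith
      have t2 : (W : ℝ) * (R * (l * δ * H)) ≤ (W + 1) * (R * (l * δ * H)) := by
        gcongr; linarith
      linarith

/-- The factor is exponential in the depth. For depth of order `log n` and polynomial `W` and `R` it
is `exp (O(log² n))`, so a mesh that compensates it costs only `O(log² n)` per coefficient in log
cardinality or log prior mass. -/
theorem abs_network_sub_le {p L N W : ℕ} (hp : p ≤ W) (hW : 12 * p * N ≤ W) {R δ : ℝ} (hR : 1 ≤ R)
    (hδ : 0 ≤ δ) {B B' : CoeffIdx p L N → ℝ} (hB : ∀ j, |B j| ≤ R) (hB' : ∀ j, |B' j| ≤ R)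
    (hBB : ∀ j, |B j - B' j| ≤ δ) {u : Fin p → ℝ} (hu : ∀ j, |u j| ≤ 1) :
    |network B u - network B' u| ≤ (L + 1) * δ * ((W + 1) * R) ^ (L + 1) := by
  have ih := abs_hidden_sub_le hp hW hR hδ hB hB' hBB hu L le_rfl
  have hb := abs_hidden_le hp hW hR hB hu L le_rfl
  have hWl : (width p N L : ℝ) ≤ W := by exact_mod_cast width_le hp hW L
  have h1 : (1 : ℝ) ≤ ((W + 1) * R) ^ L := one_le_pow₀ (by nlinarith [Nat.cast_nonneg (α := ℝ) W])
  simp only [network]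
  have e : (∑ j, B (Sum.inr (some j)) * hidden B u L le_rfl j + B (Sum.inr none)
      - (∑ j, B' (Sum.inr (some j)) * hidden B' u L le_rfl j + B' (Sum.inr none)))
      = ∑ j, (B (Sum.inr (some j)) - B' (Sum.inr (some j))) * hidden B u L le_rfl j
        + ∑ j, B' (Sum.inr (some j)) * (hidden B u L le_rfl j - hidden B' u L le_rfl j)
        + (B (Sum.inr none) - B' (Sum.inr none)) := by
    simp only [sub_mul, mul_sub, Finset.sum_sub_distrib]; ring
  rw [e]
  have h2 := abs_sum_mul_le hWl (by positivity) hδ (fun j => hBB (Sum.inr (some j))) hb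
  have h3 := abs_sum_mul_le hWl (by positivity) (by positivity)
    (fun j => hB' (Sum.inr (some j))) ih
  have h4 := hBB (Sum.inr none)
  refine (abs_add_three _ _ _).trans ((add_le_add (add_le_add h2 h3) h4).trans ?_)
  set H := ((W + 1) * R) ^ L
  have hW0 : (0 : ℝ) ≤ W := Nat.cast_nonneg _
  rw [pow_succ]
  have t1 : (W : ℝ) * (δ * H) + δ ≤ (W + 1) * R * (δ * H) := by
    have a1 : δ ≤ δ * H := le_mul_of_one_le_right hδ h1
    have a2 : (W + 1) * (δ * H) * 1 ≤ (W + 1) * (δ * H) * R := by gcongr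
    linarith
  have t2 : (W : ℝ) * (R * (L * δ * H)) ≤ (W + 1) * (R * (L * δ * H)) := by
    gcongr; linarith
  linarith

/-! ### Finite nets of sparse networks -/

theorem card_coeffIdx_le {p L N W : ℕ} (hp : p ≤ W) (hW : 12 * p * N ≤ W) :
    Fintype.card (CoeffIdx p L N) ≤ (L + 1) * (W + 1) ^ 2 := by
  simp only [CoeffIdx, DeepIdx, TopIdx, Fintype.card_sum, Fintype.card_sigma, Fintype.card_prod,
    Fintype.card_option, Fintype.card_fin]
  have h1 : ∑ l : Fin L, width p N (l + 1) * (width p N l + 1) ≤ L * (W * (W + 1)) := by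
    refine (Finset.sum_le_card_nsmul _ _ (W * (W + 1)) fun l _ => ?_).trans (by simp)
    exact Nat.mul_le_mul (width_le hp hW _) (Nat.succ_le_succ (width_le hp hW _))
  have h2 := width_le hp hW L
  nlinarith

/-- Listing with repetition allows supports with fewer than `s` elements to be coded by exactly `s`
entries. -/
theorem exists_range_superset {ι : Type*} [Inhabited ι] (S : Finset ι) {s : ℕ} (h : S.card ≤ s) :
    ∃ f : Fin s → ι, ∀ j ∈ S, ∃ i, f i = j := by
  refine ⟨fun i => if hi : (i : ℕ) < S.card then (S.equivFin.symm ⟨i, hi⟩ : ι) else default,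
    fun j hj => ?_⟩
  refine ⟨⟨S.equivFin ⟨j, hj⟩, (S.equivFin ⟨j, hj⟩).2.trans_le h⟩, ?_⟩
  simp

open scoped Classical in
-- A sparse coefficient vector is coded by `s'` positions and `s'` integers: values are rounded down
-- to multiples of `1 / m`. Rounding fixes zero, so coordinates off the support are reproduced
-- exactly.
theorem exists_net_of_width {p L N W s' R m : ℕ} (hp : p ≤ W) (hW : 12 * p * N ≤ W)
    (hR : 1 ≤ R) (hm : 1 ≤ m) {n : ℕ} {x : Fin n → Fin p → ℝ} (hx : ∀ i j, |x i j| ≤ 1) :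
    ∃ C : Finset (Fin n → ℝ), C.card ≤ ((L + 1) * (W + 1) ^ 2 * (2 * (R * m) + 1)) ^ s' ∧
      ∀ B : CoeffIdx p L N → ℝ, (∀ j, |B j| ≤ R) → (Finset.univ.filter fun j => B j ≠ 0).card ≤ s' →
        ∃ c ∈ C, ∀ i, |network B (x i) - c i| ≤ (L + 1) * (1 / m) * ((W + 1) * R) ^ (L + 1) := by
  -- If a position is listed twice, one occurrence is chosen; this is harmless, since the integers
  -- used below depend on the position only.
  let dec : (Fin s' → CoeffIdx p L N) × (Fin s' → Fin (2 * (R * m) + 1)) → CoeffIdx p L N → ℝ :=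
    fun fg j => if h : ∃ i, fg.1 i = j then (((fg.2 h.choose : ℕ) : ℝ) - (R * m : ℕ)) / m else 0
  refine ⟨Finset.univ.image fun fg i => network (dec fg) (x i), ?_, ?_⟩
  · refine Finset.card_image_le.trans ?_
    rw [Finset.card_univ, Fintype.card_prod, Fintype.card_fun, Fintype.card_fun, Fintype.card_fin,
      Fintype.card_fin, mul_pow]
    gcongr
    exact card_coeffIdx_le hp hW
  · intro B hB hs
    have hm0 : (0 : ℝ) < m := by exact_mod_cast hm
    have hR1 : (1 : ℝ) ≤ R := by exact_mod_cast hR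
    obtain ⟨f, hf⟩ := exists_range_superset (Finset.univ.filter fun j => B j ≠ 0) hs
    have hfl : ∀ j, -((R * m : ℕ) : ℤ) ≤ ⌊B j * m⌋ ∧ ⌊B j * m⌋ ≤ (R * m : ℕ) := by
      intro j
      have hj := abs_le.1 (hB j)
      constructor
      · rw [Int.le_floor]
        push_cast
        nlinarith
      · have : (⌊B j * m⌋ : ℝ) ≤ (R * m : ℕ) := by
          refine (Int.floor_le _).trans ?_
          push_cast
          nlinarith
        exact_mod_cast this
    -- The integer is shifted by `R * m` to become a natural number; the decoder subtracts the
    -- shift.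
    let g : Fin s' → Fin (2 * (R * m) + 1) := fun i =>
      ⟨(⌊B (f i) * m⌋ + (R * m : ℕ)).toNat, by have := hfl (f i); omega⟩
    have hdec : ∀ j, dec (f, g) j = (⌊B j * m⌋ : ℝ) / m := by
      intro j
      simp only [dec]
      split_ifs with h
      · have hc := h.choose_spec
        have h0 := hfl j
        simp only [g]
        rw [hc]
        congr 1
        have : (((⌊B j * m⌋ + (R * m : ℕ)).toNat : ℤ) : ℝ) = ((⌊B j * m⌋ + (R * m : ℕ) : ℤ) : ℝ) := by
          rw [Int.toNat_of_nonneg (by omega)]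
        push_cast at this ⊢
        linarith
      · have : B j = 0 := by
          by_contra hne
          exact h (hf j (by simp [hne]))
        simp [this]
    refine ⟨_, Finset.mem_image_of_mem _ (Finset.mem_univ (f, g)), fun i => ?_⟩
    refine abs_network_sub_le hp hW hR1 (by positivity) hB (fun j => ?_) (fun j => ?_) (hx i)
    · rw [hdec, abs_div, abs_of_pos hm0, div_le_iff₀ hm0, abs_le]
      have := hfl j
      constructor
      · have : ((-((R * m : ℕ) : ℤ) : ℤ) : ℝ) ≤ ⌊B j * m⌋ := by exact_mod_cast this.1
        push_cast at this ⊢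
        linarith
      · have : ((⌊B j * m⌋ : ℤ) : ℝ) ≤ ((R * m : ℕ) : ℤ) := by exact_mod_cast this.2
        push_cast at this ⊢
        linarith
    · rw [hdec]
      have h1 := Int.floor_le (B j * m)
      have h2 := Int.lt_floor_add_one (B j * m)
      have : B j - ⌊B j * m⌋ / m = (B j * m - ⌊B j * m⌋) / m := by field_simp
      rw [this, abs_div, abs_of_pos hm0]
      gcongr
      rw [abs_le]
      constructor <;> linarith

open scoped Classical in
/-- The number of active coefficients. -/
noncomputable def Param.active {p L : ℕ} (ω : Param p L) : ℕ :=
  (Finset.univ.filter fun j => ω.2 j ≠ 0).card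

open scoped Classical in
-- The net consists of vectors of values at the design points, so networks of different widths are
-- covered by one set, at the price of a factor `N' + 1`.
theorem exists_net {p L N' s' R m : ℕ} 
    (hR : 1 ≤ R) (hm : 1 ≤ m) {n : ℕ} {x : Fin n → Fin p → ℝ} (hx : ∀ i j, |x i j| ≤ 1) :
    ∃ C : Finset (Fin n → ℝ), C.card ≤
        (N' + 1) * ((L + 1) * (12 * p * N' + p + 1) ^ 2 * (2 * (R * m) + 1)) ^ s' ∧
      ∀ ω : Param p L, ω.1 ≤ N' → (∀ j, |ω.2 j| ≤ R) → ω.active ≤ s' →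
        ∃ c ∈ C, ∀ i, |paramNet ω (x i) - c i| ≤
          (L + 1) * (1 / m) * ((12 * p * N' + p + 1) * R) ^ (L + 1) := by
  have hex : ∀ N : ℕ, ∃ C : Finset (Fin n → ℝ), N ≤ N' →
      C.card ≤ ((L + 1) * (12 * p * N' + p + 1) ^ 2 * (2 * (R * m) + 1)) ^ s' ∧
      ∀ B : CoeffIdx p L N → ℝ, (∀ j, |B j| ≤ R) → (Finset.univ.filter fun j => B j ≠ 0).card ≤ s' →
        ∃ c ∈ C, ∀ i, |network B (x i) - c i| ≤
          (L + 1) * (1 / m) * ((12 * p * N' + p + 1) * R) ^ (L + 1) := by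
    intro N
    by_cases hN : N ≤ N'
    · have hle : 12 * p * N ≤ 12 * p * N' + p :=
        (Nat.mul_le_mul_left _ hN).trans (Nat.le_add_right _ _)
      obtain ⟨C, h1, h2⟩ := exists_net_of_width (L := L) (s' := s') (Nat.le_add_left p (12 * p * N'))
        hle hR hm hx
      refine ⟨C, fun _ => ⟨h1, ?_⟩⟩
      push_cast at h2
      exact h2
    · exact ⟨∅, fun h => absurd h hN⟩
  choose C hC using hex
  refine ⟨(Finset.range (N' + 1)).biUnion C, ?_, ?_⟩
  · refine Finset.card_biUnion_le.trans ?_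
    refine (Finset.sum_le_card_nsmul _ _ _ fun N hN => (hC N ?_).1).trans ?_
    · exact Nat.lt_succ_iff.1 (Finset.mem_range.1 hN)
    · simp
  · rintro ⟨N, B⟩ hN hB hs
    obtain ⟨c, hc, h⟩ := (hC N hN).2 B hB hs
    exact ⟨c, Finset.mem_biUnion.2 ⟨N, Finset.mem_range.2 (Nat.lt_succ_iff.2 hN), hc⟩, h⟩

/-! ### Uniform control of the noise on a net -/

theorem gaussLaw_net_le {n : ℕ} (θ₀ : Fin n → ℝ) (C : Finset (Fin n → ℝ)) (u : ℝ) :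
    gaussLaw θ₀ {y | ¬ ∀ c ∈ C, |(y - θ₀) ⬝ᵥ (c - θ₀)| ≤ (c - θ₀) ⬝ᵥ (c - θ₀) / 4 + u}
      ≤ ENNReal.ofReal (2 * C.card * Real.exp (-u / 2)) := by
  have hsub : {y : Fin n → ℝ | ¬ ∀ c ∈ C, |(y - θ₀) ⬝ᵥ (c - θ₀)| ≤ (c - θ₀) ⬝ᵥ (c - θ₀) / 4 + u} ⊆
      ⋃ c ∈ C, ({y | (c - θ₀) ⬝ᵥ (c - θ₀) / 4 + u < (y - θ₀) ⬝ᵥ (c - θ₀)} ∪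
       {y | (-(c - θ₀)) ⬝ᵥ (-(c - θ₀)) / 4 + u < (y - θ₀) ⬝ᵥ (-(c - θ₀))}) := by
    intro y hy
    simp only [Set.mem_ofPred_eq, not_forall, not_le] at hy
    obtain ⟨c, hc, hi⟩ := hy
    refine Set.mem_iUnion₂.2 ⟨c, hc, ?_⟩
    rcases abs_cases ((y - θ₀) ⬝ᵥ (c - θ₀)) with ⟨h1, -⟩ | ⟨h1, -⟩
    · left
      simp only [Set.mem_ofPred_eq]
      linarith
    · right
      simp only [Set.mem_ofPred_eq]
      rw [neg_dotProduct_neg, dotProduct_neg]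
      linarith
  refine (measure_mono hsub).trans ((measure_biUnion_finset_le _ _).trans ?_)
  calc _ ≤ ∑ c ∈ C, (ENNReal.ofReal (Real.exp (-u / 2)) + ENNReal.ofReal (Real.exp (-u / 2))) := by
        refine Finset.sum_le_sum fun i _ => (measure_union_le _ _).trans ?_
        exact add_le_add (gaussLaw_tail _ _ _) (gaussLaw_tail _ _ _)
    _ = _ := by
        rw [← ENNReal.ofReal_add (Real.exp_pos _).le (Real.exp_pos _).le, Finset.sum_const,
          nsmul_eq_mul, ← ENNReal.ofReal_natCast, ← ENNReal.ofReal_mul (by positivity)]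
        congr 1; ring

theorem abs_dotProduct_le {n : ℕ} {ε d : Fin n → ℝ} {a b : ℝ} (hε : ∀ i, |ε i| ≤ a)
    (hd : ∀ i, |d i| ≤ b) (ha : 0 ≤ a) (hb : 0 ≤ b) : |ε ⬝ᵥ d| ≤ n * (a * b) :=
  abs_sum_mul_le le_rfl hb ha hε hd

theorem dotProduct_self_nonneg' {n : ℕ} (v : Fin n → ℝ) : 0 ≤ v ⬝ᵥ v :=
  Finset.sum_nonneg fun _ _ => mul_self_nonneg _

theorem two_mul_abs_dotProduct_le {n : ℕ} (v w : Fin n → ℝ) {r : ℝ} (hr : 0 < r) :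
    2 * |v ⬝ᵥ w| ≤ r * (v ⬝ᵥ v) + r⁻¹ * (w ⬝ᵥ w) := by
  have h : ∀ s : ℝ, s ^ 2 = 1 → 0 ≤ r * (v ⬝ᵥ v) + r⁻¹ * (w ⬝ᵥ w) + 2 * s * (v ⬝ᵥ w) := by
    intro s hs
    have h0 := dotProduct_self_nonneg' (r • v + s • w)
    simp only [add_dotProduct, dotProduct_add, smul_dotProduct, dotProduct_smul, smul_eq_mul,
      dotProduct_comm w v] at h0
    have h1 : 0 ≤ r⁻¹ * (r * (r * (v ⬝ᵥ v)) + r * (s * (v ⬝ᵥ w)) +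
      (s * (r * (v ⬝ᵥ w)) + s * (s * (w ⬝ᵥ w)))) := mul_nonneg (inv_nonneg.2 hr.le) (by linarith)
    have e : r⁻¹ * (r * (r * (v ⬝ᵥ v)) + r * (s * (v ⬝ᵥ w)) +
      (s * (r * (v ⬝ᵥ w)) + s * (s * (w ⬝ᵥ w)))) =
      r * (v ⬝ᵥ v) + r⁻¹ * s ^ 2 * (w ⬝ᵥ w) + 2 * s * (v ⬝ᵥ w) := by
      field_simp; ring
    rw [e, hs] at h1
    linarith
  rcases abs_cases (v ⬝ᵥ w) with ⟨h1, -⟩ | ⟨h1, -⟩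
  · linarith [h (-1) (by norm_num)]
  · linarith [h 1 (by norm_num)]

theorem dotProduct_self_add_le {n : ℕ} (v w : Fin n → ℝ) {r : ℝ} (hr : 0 < r) :
    (v + w) ⬝ᵥ (v + w) ≤ (1 + r) * (v ⬝ᵥ v) + (1 + r⁻¹) * (w ⬝ᵥ w) := by
  have h := two_mul_abs_dotProduct_le v w hr
  have h2 := le_abs_self (v ⬝ᵥ w)
  simp only [add_dotProduct, dotProduct_add, dotProduct_comm w v]
  linarith

/-- Near a net on which the noise is controlled, the noise is controlled. -/
theorem abs_noise_le_of_net {n : ℕ} {θ₀ y θ c : Fin n → ℝ} {u δ : ℝ}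
    (hε : ∀ i, |y i - θ₀ i| ≤ n + 1)
    (hc : |(y - θ₀) ⬝ᵥ (c - θ₀)| ≤ (c - θ₀) ⬝ᵥ (c - θ₀) / 4 + u)
    (hδ : ∀ i, |θ i - c i| ≤ δ) (hδ0 : 0 ≤ δ) (hδ1 : n * (n + 1) * δ ≤ 1) :
    |(y - θ₀) ⬝ᵥ (θ - θ₀)| ≤ 3 / 8 * ((θ - θ₀) ⬝ᵥ (θ - θ₀)) + u + 2 := by
  have hn : (0 : ℝ) ≤ n := Nat.cast_nonneg n
  have hnδ : n * δ ≤ 1 := by nlinarith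
  have hnδ2 : n * (δ * δ) ≤ 1 := by
    rcases Nat.eq_zero_or_pos n with rfl | h
    · simp
    · have h1 : (1 : ℝ) ≤ n := by exact_mod_cast h
      have : δ ≤ 1 := by nlinarith
      nlinarith
  have e1 : (y - θ₀) ⬝ᵥ (θ - θ₀) = (y - θ₀) ⬝ᵥ (c - θ₀) + (y - θ₀) ⬝ᵥ (θ - c) := by
    rw [← dotProduct_add]; congr 1; abel
  have h1 : |(y - θ₀) ⬝ᵥ (θ - c)| ≤ n * ((n + 1) * δ) :=
    abs_dotProduct_le (fun i => hε i) hδ (by positivity) hδ0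
  have h2 : (θ - c) ⬝ᵥ (θ - c) ≤ n * (δ * δ) :=
    (le_abs_self _).trans (abs_dotProduct_le hδ hδ hδ0 hδ0)
  -- The weight `1/2` turns the constant `1/4` of the net into `3/8`, which is still below the `1/2`
  -- in the log likelihood ratio. The discretisation errors add up to at most `1 + 3/4`.
  have h3 : (c - θ₀) ⬝ᵥ (c - θ₀) ≤ (1 + 1 / 2) * ((θ - θ₀) ⬝ᵥ (θ - θ₀)) + 3 * ((θ - c) ⬝ᵥ (θ - c)) := by
    have := dotProduct_self_add_le (θ - θ₀) (-(θ - c)) (r := 1 / 2) (by norm_num)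
    rw [neg_dotProduct_neg] at this
    have e : θ - θ₀ + -(θ - c) = c - θ₀ := by abel
    rw [e] at this
    norm_num at this ⊢
    linarith
  rw [e1]
  refine (abs_add_le _ _).trans ?_
  nlinarith

/-! ### Laplace transforms of posteriors by change of variables -/

/-- The Gibbs measure with density proportional to `w`. -/
noncomputable def gibbs {Ω : Type*} [MeasurableSpace Ω] (Q : Measure Ω) (w : Ω → ℝ≥0∞) : Measure Ω :=
  (∫⁻ ω, w ω ∂Q)⁻¹ • Q.withDensity w

theorem isProbabilityMeasure_gibbs {Ω : Type*} [MeasurableSpace Ω] {Q : Measure Ω} {w : Ω → ℝ≥0∞}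
    (h0 : ∫⁻ ω, w ω ∂Q ≠ 0) (h1 : ∫⁻ ω, w ω ∂Q ≠ ⊤) : IsProbabilityMeasure (gibbs Q w) :=
  ⟨by
    simp only [gibbs, Measure.smul_apply, withDensity_apply _ MeasurableSet.univ,
      Measure.restrict_univ, smul_eq_mul]
    exact ENNReal.inv_mul_cancel h0 h1⟩

theorem ofReal_exp_mul (a b : ℝ) : ENNReal.ofReal (Real.exp a) * ENNReal.ofReal (Real.exp b)
    = ENNReal.ofReal (Real.exp (a + b)) := by
  rw [← ENNReal.ofReal_mul (Real.exp_pos _).le, ← Real.exp_add]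

theorem ofReal_exp_le {a b : ℝ} (h : a ≤ b) :
    ENNReal.ofReal (Real.exp a) ≤ ENNReal.ofReal (Real.exp b) :=
  ENNReal.ofReal_le_ofReal (Real.exp_le_exp.2 h)

section Tilt

variable {Ω : Type*} [MeasurableSpace Ω] {Q : Measure Ω} {ℓ X : Ω → ℝ} {T : Ω → Ω} {ρ : Ω → ℝ≥0∞}
  {A A₁ : Set Ω} {η a : ℝ}

/-- Upper bound for a Laplace transform under a posterior, by change of variables. -/
theorem setLIntegral_tilt_le (hℓ : Measurable ℓ) (hT : Measurable T) (hρ : Measurable ρ)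
    (hA : MeasurableSet A)
    (hcv : ∀ g : Ω → ℝ≥0∞, Measurable g → ∫⁻ ω, g (T ω) ∂Q = ∫⁻ ω, g ω * ρ ω ∂Q)
    (h1 : ∀ ω ∈ A, X ω ≤ ℓ (T ω) - ℓ ω + η)
    (h2 : ∀ ω ∈ A, ρ (T ω) ≤ ENNReal.ofReal (Real.exp η)) :
    ∫⁻ ω in A, ENNReal.ofReal (Real.exp (X ω)) * ENNReal.ofReal (Real.exp (ℓ ω)) ∂Q
      ≤ ENNReal.ofReal (Real.exp (2 * η)) * ∫⁻ ω, ENNReal.ofReal (Real.exp (ℓ ω)) ∂Q := by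
  -- The density is bounded only at points `T ω` with `ω ∈ A`. The set `S` keeps this information
  -- when `A` is dropped before the change of variables.
  set S := {ω | ρ ω ≤ ENNReal.ofReal (Real.exp η)}
  have hS : MeasurableSet S := measurableSet_le hρ measurable_const
  have hw : Measurable fun ω => ENNReal.ofReal (Real.exp (ℓ ω)) := by fun_prop
  calc ∫⁻ ω in A, ENNReal.ofReal (Real.exp (X ω)) * ENNReal.ofReal (Real.exp (ℓ ω)) ∂Q
      ≤ ∫⁻ ω in A, ENNReal.ofReal (Real.exp η) *
          S.indicator (fun ω => ENNReal.ofReal (Real.exp (ℓ ω))) (T ω) ∂Q := by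
        refine setLIntegral_mono' hA fun ω hω => ?_
        rw [Set.indicator_of_mem (show T ω ∈ S from h2 ω hω), ofReal_exp_mul, ofReal_exp_mul]
        exact ofReal_exp_le (by linarith [h1 ω hω])
    _ ≤ ∫⁻ ω, ENNReal.ofReal (Real.exp η) *
          S.indicator (fun ω => ENNReal.ofReal (Real.exp (ℓ ω))) (T ω) ∂Q :=
        setLIntegral_le_lintegral _ _
    _ = ENNReal.ofReal (Real.exp η) *
          ∫⁻ ω, S.indicator (fun ω => ENNReal.ofReal (Real.exp (ℓ ω))) ω * ρ ω ∂Q := by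
        have hm : Measurable fun ω => S.indicator (fun ω => ENNReal.ofReal (Real.exp (ℓ ω))) (T ω) :=
          (hw.indicator hS).comp hT
        rw [lintegral_const_mul _ hm, hcv _ (hw.indicator hS)]
    _ ≤ ENNReal.ofReal (Real.exp η) *
          ∫⁻ ω, ENNReal.ofReal (Real.exp (ℓ ω)) * ENNReal.ofReal (Real.exp η) ∂Q := by
        refine mul_le_mul_right (lintegral_mono fun ω => ?_) _
        by_cases hω : ω ∈ S
        · rw [Set.indicator_of_mem hω]; exact mul_le_mul_right hω _
        · rw [Set.indicator_of_notMem hω, zero_mul]; exact zero_le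
    _ = _ := by
        rw [lintegral_mul_const _ hw, mul_comm (∫⁻ ω, _ ∂Q), ← mul_assoc, ofReal_exp_mul, two_mul]

/-- Lower bound for a Laplace transform under a posterior, by change of variables. -/
theorem le_setLIntegral_tilt (hℓ : Measurable ℓ) (hT : Measurable T)
    (hA : MeasurableSet A) (hA₁ : MeasurableSet A₁)
    (hcv : ∀ g : Ω → ℝ≥0∞, Measurable g → ∫⁻ ω, g (T ω) ∂Q = ∫⁻ ω, g ω * ρ ω ∂Q)
    (h1 : ∀ ω ∈ A, ℓ (T ω) - ℓ ω - η ≤ X ω)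
    (h2 : ∀ ω ∈ A₁, ENNReal.ofReal (Real.exp (-η)) ≤ ρ ω)
    (h3 : ∀ ω, T ω ∈ A₁ → ω ∈ A) :
    ENNReal.ofReal (Real.exp (-(2 * η))) * ∫⁻ ω in A₁, ENNReal.ofReal (Real.exp (ℓ ω)) ∂Q
      ≤ ∫⁻ ω in A, ENNReal.ofReal (Real.exp (X ω)) * ENNReal.ofReal (Real.exp (ℓ ω)) ∂Q := by
  have hw : Measurable fun ω => ENNReal.ofReal (Real.exp (ℓ ω)) := by fun_prop
  calc ENNReal.ofReal (Real.exp (-(2 * η))) * ∫⁻ ω in A₁, ENNReal.ofReal (Real.exp (ℓ ω)) ∂Q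
      = ENNReal.ofReal (Real.exp (-η)) *
        ∫⁻ ω in A₁, ENNReal.ofReal (Real.exp (ℓ ω)) * ENNReal.ofReal (Real.exp (-η)) ∂Q := by
        rw [lintegral_mul_const _ hw, mul_comm (∫⁻ ω in A₁, _ ∂Q), ← mul_assoc, ofReal_exp_mul]
        ring_nf
    _ ≤ ENNReal.ofReal (Real.exp (-η)) *
          ∫⁻ ω, A₁.indicator (fun ω => ENNReal.ofReal (Real.exp (ℓ ω))) ω * ρ ω ∂Q := by
        refine mul_le_mul_right ?_ _
        rw [← lintegral_indicator hA₁]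
        refine lintegral_mono fun ω => ?_
        by_cases hω : ω ∈ A₁
        · rw [Set.indicator_of_mem hω, Set.indicator_of_mem hω]; gcongr; exact h2 ω hω
        · rw [Set.indicator_of_notMem hω]; exact zero_le
    _ = ∫⁻ ω, ENNReal.ofReal (Real.exp (-η)) *
          A₁.indicator (fun ω => ENNReal.ofReal (Real.exp (ℓ ω))) (T ω) ∂Q := by
        have hm : Measurable fun ω => A₁.indicator (fun ω => ENNReal.ofReal (Real.exp (ℓ ω))) (T ω) :=
          (hw.indicator hA₁).comp hT
        rw [lintegral_const_mul _ hm, hcv _ (hw.indicator hA₁)]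
    _ ≤ _ := by
        rw [← lintegral_indicator hA]
        refine lintegral_mono fun ω => ?_
        by_cases hω : T ω ∈ A₁
        · have hωA := h3 ω hω
          rw [Set.indicator_of_mem hω, Set.indicator_of_mem hωA, ofReal_exp_mul, ofReal_exp_mul]
          exact ofReal_exp_le (by linarith [h1 ω hωA])
        · rw [Set.indicator_of_notMem hω, mul_zero]; exact zero_le

end Tilt

theorem tendsto_ofReal_exp_one {η : ℕ → ℝ} (h : Tendsto η atTop (𝓝 0)) :
    Tendsto (fun n => ENNReal.ofReal (Real.exp (η n))) atTop (𝓝 1) := by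
  have := ENNReal.tendsto_ofReal ((Real.continuous_exp.tendsto _).comp h)
  simpa using this

/-- A criterion for asymptotic normality of posteriors `gibbs (Q n) (exp ∘ ℓ n)`: for every `t`
there are transformations of the parameter space that approximately shift the log likelihood by
`t * X - t ^ 2 * V / 2`. -/
theorem tendsto_blDist_gibbs {Ω : ℕ → Type*} [∀ n, MeasurableSpace (Ω n)]
    {Q : (n : ℕ) → Measure (Ω n)} {ℓ X : (n : ℕ) → Ω n → ℝ} {A : (n : ℕ) → Set (Ω n)}
    {V : ℕ → ℝ} {C : ℝ} (hV0 : ∀ n, 0 ≤ V n) (hVC : ∀ n, V n ≤ C)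
    (hℓ : ∀ n, Measurable (ℓ n)) (hX : ∀ n, Measurable (X n)) (hA : ∀ n, MeasurableSet (A n))
    (hD0 : ∀ᶠ n in atTop, ∫⁻ ω, ENNReal.ofReal (Real.exp (ℓ n ω)) ∂(Q n) ≠ 0)
    (hD1 : ∀ᶠ n in atTop, ∫⁻ ω, ENNReal.ofReal (Real.exp (ℓ n ω)) ∂(Q n) ≠ ⊤)
    (h : ∀ t : ℝ, ∃ (T : (n : ℕ) → Ω n → Ω n) (ρ : (n : ℕ) → Ω n → ℝ≥0∞) (A₁ : (n : ℕ) → Set (Ω n))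
      (η : ℕ → ℝ), Tendsto η atTop (𝓝 0) ∧
      Tendsto (fun n => gibbs (Q n) (fun ω => ENNReal.ofReal (Real.exp (ℓ n ω))) (A₁ n)ᶜ)
        atTop (𝓝 0) ∧
      ∀ᶠ n in atTop, Measurable (T n) ∧ Measurable (ρ n) ∧ MeasurableSet (A₁ n) ∧
        (∀ g : Ω n → ℝ≥0∞, Measurable g → ∫⁻ ω, g (T n ω) ∂(Q n) = ∫⁻ ω, g ω * ρ n ω ∂(Q n)) ∧
        (∀ ω ∈ A n, |t * X n ω - t ^ 2 * V n / 2 - (ℓ n (T n ω) - ℓ n ω)| ≤ η n) ∧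
        (∀ ω ∈ A n, ρ n (T n ω) ≤ ENNReal.ofReal (Real.exp (η n))) ∧
        (∀ ω ∈ A₁ n, ENNReal.ofReal (Real.exp (-η n)) ≤ ρ n ω) ∧
        (∀ ω, T n ω ∈ A₁ n → ω ∈ A n)) :
    Tendsto (fun n => blDist ((gibbs (Q n) fun ω => ENNReal.ofReal (Real.exp (ℓ n ω))).map (X n))
      (gaussianReal 0 (V n).toNNReal)) atTop (𝓝 0) := by
  classical
  set w : (n : ℕ) → Ω n → ℝ≥0∞ := fun n ω => ENNReal.ofReal (Real.exp (ℓ n ω)) with hw_def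
  have hw : ∀ n, Measurable (w n) := fun n => by have := hℓ n; simp only [w]; fun_prop
  set D : ℕ → ℝ≥0∞ := fun n => ∫⁻ ω, w n ω ∂(Q n) with hD_def
  set ok : ℕ → Prop := fun n => D n ≠ 0 ∧ D n ≠ ⊤ with hok_def
  have hok : ∀ᶠ n in atTop, ok n := hD0.and hD1
  -- For the finitely many `n` with degenerate evidence, the target Gaussian itself is a harmless
  -- default, which makes every term a probability measure.
  let μ : ℕ → Measure ℝ := fun n =>
    if ok n then (gibbs (Q n) (w n)).map (X n) else gaussianReal 0 (V n).toNNReal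
  -- Restriction to `A n` is essential: nothing controls exponential moments of the posterior
  -- outside.
  let ν : ℕ → Measure ℝ := fun n =>
    if ok n then ((gibbs (Q n) (w n)).restrict (A n)).map (X n) else 0
  have hμ : ∀ n, IsProbabilityMeasure (μ n) := by
    intro n
    by_cases hn : ok n
    · simp only [μ, hn, if_true]
      have := isProbabilityMeasure_gibbs hn.1 hn.2
      exact Measure.isProbabilityMeasure_map (hX n).aemeasurable
    · simp only [μ, hn, if_false]; infer_instance
  have hle : ∀ n, ν n ≤ μ n := by
    intro n
    by_cases hn : ok n
    · simp only [μ, ν, hn, if_true]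
      exact Measure.map_mono Measure.restrict_le_self (hX n)
    · simp only [ν, hn, if_false]; exact Measure.zero_le _
  have key := tendsto_blDist_of_laplace hle hV0 hVC ?_
  · refine key.congr' ?_
    filter_upwards [hok] with n hn
    simp only [μ, hn, if_true, w]
  intro t
  obtain ⟨T, ρ, A₁, η, hη, hA₁, hev⟩ := h t
  have hlap : ∀ᶠ n in atTop, ∫⁻ z, ENNReal.ofReal (Real.exp (t * z - t ^ 2 * V n / 2)) ∂(ν n)
      = (D n)⁻¹ * ∫⁻ ω in A n, ENNReal.ofReal (Real.exp (t * X n ω - t ^ 2 * V n / 2)) * w n ω ∂(Q n) := by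
    filter_upwards [hok] with n hn
    have hXn := hX n
    have hm : Measurable fun ω => ENNReal.ofReal (Real.exp (t * X n ω - t ^ 2 * V n / 2)) := by
      fun_prop
    simp only [ν, hn, if_true]
    rw [lintegral_map (by fun_prop) (hX n), gibbs, Measure.restrict_smul, lintegral_smul_measure,
      restrict_withDensity (hA n), lintegral_withDensity_eq_lintegral_mul _ (hw n) hm, smul_eq_mul]
    congr 1
    refine lintegral_congr fun ω => ?_
    rw [Pi.mul_apply, mul_comm]
  have hup : ∀ᶠ n in atTop, ∫⁻ z, ENNReal.ofReal (Real.exp (t * z - t ^ 2 * V n / 2)) ∂(ν n)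
      ≤ ENNReal.ofReal (Real.exp (2 * η n)) := by
    filter_upwards [hlap, hok, hev] with n h1 hn ⟨hT, hρ, hA₁m, hcv, e1, e2, e3, e4⟩
    rw [h1]
    have := setLIntegral_tilt_le (X := fun ω => t * X n ω - t ^ 2 * V n / 2) (hℓ n) hT hρ (hA n) hcv
      (fun ω hω => by linarith [(abs_le.1 (e1 ω hω)).2]) e2
    refine (mul_le_mul_right this _).trans (le_of_eq ?_)
    rw [mul_left_comm, ENNReal.inv_mul_cancel hn.1 hn.2, mul_one]
  have hlow : ∀ᶠ n in atTop, ENNReal.ofReal (Real.exp (-(2 * η n))) *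
      (1 - gibbs (Q n) (w n) (A₁ n)ᶜ)
      ≤ ∫⁻ z, ENNReal.ofReal (Real.exp (t * z - t ^ 2 * V n / 2)) ∂(ν n) := by
    filter_upwards [hlap, hok, hev] with n h1 hn ⟨hT, hρ, hA₁m, hcv, e1, e2, e3, e4⟩
    have hpr := isProbabilityMeasure_gibbs hn.1 hn.2
    rw [h1]
    have := le_setLIntegral_tilt (X := fun ω => t * X n ω - t ^ 2 * V n / 2) (hℓ n) hT (hA n) hA₁m hcv
      (fun ω hω => by linarith [(abs_le.1 (e1 ω hω)).1]) e3 e4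
    refine le_trans ?_ (mul_le_mul_right this _)
    rw [mul_left_comm]
    gcongr
    rw [← prob_compl_eq_one_sub hA₁m.compl, compl_compl, gibbs, Measure.smul_apply,
      withDensity_apply _ hA₁m, smul_eq_mul]
  refine tendsto_of_tendsto_of_tendsto_of_le_of_le' ?_ ?_ hlow hup
  · have h2 : Tendsto (fun n => (1 : ℝ≥0∞) - gibbs (Q n) (w n) (A₁ n)ᶜ) atTop (𝓝 1) := by
      simpa using ENNReal.Tendsto.sub (tendsto_const_nhds (x := (1 : ℝ≥0∞))) hA₁ (Or.inl (by simp))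
    have h1 : Tendsto (fun n => ENNReal.ofReal (Real.exp (-(2 * η n)))) atTop (𝓝 1) :=
      tendsto_ofReal_exp_one (by simpa using (hη.const_mul 2).neg)
    simpa using ENNReal.Tendsto.mul h1 (by simp) h2 (by simp)
  · exact tendsto_ofReal_exp_one (by simpa using hη.const_mul 2)

/-- Asymptotic normality follows from asymptotic normality along all data sequences in events of
probability tending to one. -/
theorem asymptoticallyNormal_of_forall_seq {p : ℕ} {P : (n : ℕ) → Measure (Fin n → ℝ)}
    (hP : ∀ n, IsProbabilityMeasure (P n))
    {post : (n : ℕ) → (Fin n → ℝ) → Measure ((Fin p → ℝ) → ℝ)}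
    {Ψ : ℕ → ((Fin p → ℝ) → ℝ) → ℝ} {center : (n : ℕ) → (Fin n → ℝ) → ℝ} {V : ℕ → ℝ}
    (G : (n : ℕ) → Set (Fin n → ℝ)) (hG : Tendsto (fun n => P n (G n)ᶜ) atTop (𝓝 0))
    (h : ∀ y : (n : ℕ) → Fin n → ℝ, (∀ᶠ n in atTop, y n ∈ G n) →
      Tendsto (fun n => blDist ((post n (y n)).map fun f => Real.sqrt n * (Ψ n f - center n (y n)))
        (gaussianReal 0 (V n).toNNReal)) atTop (𝓝 0)) :
    AsymptoticallyNormal P post Ψ center V := by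
  classical
  intro δ hδ
  set bad : (n : ℕ) → Set (Fin n → ℝ) := fun n => {y | δ <
    blDist ((post n y).map fun f => Real.sqrt n * (Ψ n f - center n y))
      (gaussianReal 0 (V n).toNNReal)} with hbad
  have hne : ∀ᶠ n in atTop, (G n).Nonempty := by
    filter_upwards [hG.eventually (gt_mem_nhds (zero_lt_one (α := ℝ≥0∞)))] with n hn
    by_contra hem
    rw [Set.not_nonempty_iff_eq_empty] at hem
    rw [hem, Set.compl_empty, (hP n).measure_univ] at hn
    exact lt_irrefl _ hn
  -- A worst case sequence: a point of `G n` violating the bound is chosen whenever there is one.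
  -- Convergence along this single sequence excludes violations in `G n` for large `n`, with no
  -- measurability of the bad event required.
  let y : (n : ℕ) → Fin n → ℝ := fun n =>
    if h1 : (G n ∩ bad n).Nonempty then h1.choose else if h2 : (G n).Nonempty then h2.choose else 0
  have hy : ∀ᶠ n in atTop, y n ∈ G n := by
    filter_upwards [hne] with n hn
    by_cases h1 : (G n ∩ bad n).Nonempty
    · simp only [y, dif_pos h1]; exact h1.choose_spec.1
    · simp only [y, dif_neg h1, dif_pos hn]; exact hn.choose_spec
  have hlim := (h y hy).eventually (gt_mem_nhds hδ)
  have hsub : ∀ᶠ n in atTop, P n (bad n) ≤ P n (G n)ᶜ := by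
    filter_upwards [hlim] with n hn
    refine measure_mono fun z hz hzG => ?_
    have h1 : (G n ∩ bad n).Nonempty := ⟨z, hzG, hz⟩
    have hyn : y n ∈ bad n := by
      simp only [y, dif_pos h1]; exact h1.choose_spec.2
    exact absurd hyn (not_lt.2 hn.le)
  exact tendsto_of_tendsto_of_tendsto_of_le_of_le' tendsto_const_nhds hG
    (Eventually.of_forall fun _ => zero_le) hsub

/-! ### The posterior on the parameter space -/

/-- The values of the network function at the design points. -/
noncomputable def evalNet {p L n : ℕ} (x : Fin n → Fin p → ℝ) (ω : Param p L) : Fin n → ℝ :=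
  fun i => paramNet ω (x i)

theorem measurable_evalNet {p L n : ℕ} (x : Fin n → Fin p → ℝ) :
    Measurable (evalNet x : Param p L → Fin n → ℝ) :=
  measurable_pi_iff.2 fun i => (measurable_pi_apply (x i)).comp measurable_paramNet

theorem measurable_likelihood {p n : ℕ} (x : Fin n → Fin p → ℝ) (y : Fin n → ℝ) :
    Measurable (likelihood x y) := by
  unfold likelihood
  refine Finset.measurable_fun_prod _ fun i _ => ?_
  simp only [gaussianPDF, gaussianPDFReal]
  have : Measurable fun f : (Fin p → ℝ) → ℝ => f (x i) := measurable_pi_apply (x i)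
  fun_prop

theorem likelihood_eq {p n : ℕ} (x : Fin n → Fin p → ℝ) (y : Fin n → ℝ) (f₀ f : (Fin p → ℝ) → ℝ) :
    likelihood x y f = likelihood x y f₀ *
      ENNReal.ofReal (Real.exp (logLR (fun i => f₀ (x i)) y fun i => f (x i))) := by
  have e : logLR (fun i => f₀ (x i)) y (fun i => f (x i)) = ∑ i, ((y i - f₀ (x i)) * (f (x i) - f₀ (x i))
      - (f (x i) - f₀ (x i)) * (f (x i) - f₀ (x i)) / 2) := by
    rw [Finset.sum_sub_distrib, ← Finset.sum_div]; rfl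
  rw [e, Real.exp_sum, ENNReal.ofReal_prod_of_nonneg fun i _ => (Real.exp_pos _).le, likelihood,
    likelihood, ← Finset.prod_mul_distrib]
  refine Finset.prod_congr rfl fun i _ => ?_
  simp only [gaussianPDF]
  rw [← ENNReal.ofReal_mul (gaussianPDFReal_nonneg _ _ _)]
  congr 1
  simp only [gaussianPDFReal]
  have : Real.exp (-(y i - f (x i)) ^ 2 / (2 * ((1 : ℝ≥0) : ℝ)))
      = Real.exp (-(y i - f₀ (x i)) ^ 2 / (2 * ((1 : ℝ≥0) : ℝ))) * Real.exp ((y i - f₀ (x i)) *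
        (f (x i) - f₀ (x i)) - (f (x i) - f₀ (x i)) * (f (x i) - f₀ (x i)) / 2) := by
    rw [← Real.exp_add]; congr 1; simp; ring
  rw [this]; ring

theorem likelihood_ne_zero {p n : ℕ} (x : Fin n → Fin p → ℝ) (y : Fin n → ℝ) (f : (Fin p → ℝ) → ℝ) :
    likelihood x y f ≠ 0 := by
  unfold likelihood
  rw [Finset.prod_ne_zero_iff]
  intro i _
  simp only [gaussianPDF, ne_eq, ENNReal.ofReal_eq_zero, not_le]
  exact gaussianPDFReal_pos _ _ _ one_ne_zero

theorem likelihood_ne_top {p n : ℕ} (x : Fin n → Fin p → ℝ) (y : Fin n → ℝ) (f : (Fin p → ℝ) → ℝ) :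
    likelihood x y f ≠ ⊤ := by
  unfold likelihood
  exact ENNReal.prod_ne_top fun i _ => by simp [gaussianPDF]

/-- The likelihood of `f₀` is a positive finite constant in the parameter and cancels in the
normalisation. -/
theorem posterior_prior_eq_map_gibbs (lam lamS : ℝ) {p L n : ℕ} (x : Fin n → Fin p → ℝ)
    (y : Fin n → ℝ) (f₀ : (Fin p → ℝ) → ℝ) :
    posterior (prior lam lamS p L) x y = (gibbs (paramPrior lam lamS p L) fun ω =>
      ENNReal.ofReal (Real.exp (logLR (fun i => f₀ (x i)) y (evalNet x ω)))).map paramNet := by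
  set c := likelihood x y f₀
  have hc0 : c ≠ 0 := likelihood_ne_zero x y f₀
  have hc1 : c ≠ ⊤ := likelihood_ne_top x y f₀
  have hm : Measurable fun ω : Param p L =>
      ENNReal.ofReal (Real.exp (logLR (fun i => f₀ (x i)) y (evalNet x ω))) :=
    measurable_ofReal_exp_logLR _ measurable_const (measurable_evalNet x)
  have hl : ∀ ω : Param p L, likelihood x y (paramNet ω) = c *
      ENNReal.ofReal (Real.exp (logLR (fun i => f₀ (x i)) y (evalNet x ω))) :=
    fun ω => likelihood_eq x y f₀ _
  ext S hS
  have hS' := measurable_paramNet (L := L) hS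
  rw [posterior, prior_eq_map, Measure.map_apply measurable_paramNet hS, gibbs, Measure.smul_apply,
    Measure.smul_apply, withDensity_apply _ hS, withDensity_apply _ hS',
    lintegral_map (measurable_likelihood x y) measurable_paramNet,
    setLIntegral_map hS (measurable_likelihood x y) measurable_paramNet]
  simp_rw [hl]
  rw [lintegral_const_mul _ hm, lintegral_const_mul _ hm, smul_eq_mul, smul_eq_mul,
    ENNReal.mul_inv (Or.inl hc0) (Or.inl hc1), mul_assoc, mul_left_comm, ← mul_assoc c⁻¹,
    ENNReal.inv_mul_cancel hc0 hc1, one_mul]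

/-! ### Tails of the prior -/

/-- Multiplying the standard normal density by `exp (b ^ 2 / 4)` gives `√2` times the density of
variance two. -/
theorem lintegral_exp_sq_gaussianReal_le :
    ∫⁻ b, ENNReal.ofReal (Real.exp (b ^ 2 / 4)) ∂(gaussianReal 0 1) ≤ 2 := by
  rw [gaussianReal_of_var_ne_zero _ one_ne_zero,
    lintegral_withDensity_eq_lintegral_mul _ (measurable_gaussianPDF _ _) (by fun_prop)]
  have h : ∀ b : ℝ, (gaussianPDF 0 1 * fun b => ENNReal.ofReal (Real.exp (b ^ 2 / 4))) b
      ≤ 2 * gaussianPDF 0 2 b := by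
    intro b
    simp only [Pi.mul_apply, gaussianPDF]
    rw [← ENNReal.ofReal_mul (gaussianPDFReal_nonneg _ _ _)]
    have e2 : (2 : ℝ≥0∞) = ENNReal.ofReal 2 := by simp
    rw [e2, ← ENNReal.ofReal_mul (by norm_num)]
    refine ENNReal.ofReal_le_ofReal ?_
    simp only [gaussianPDFReal]
    have e1 : Real.exp (-(b - 0) ^ 2 / (2 * ((1 : ℝ≥0) : ℝ))) * Real.exp (b ^ 2 / 4)
        = Real.exp (-(b - 0) ^ 2 / (2 * ((2 : ℝ≥0) : ℝ))) := by
      rw [← Real.exp_add]; congr 1; simp; ring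
    rw [mul_assoc, e1, ← mul_assoc]
    refine mul_le_mul_of_nonneg_right ?_ (Real.exp_pos _).le
    have h2 : √(2 * Real.pi * ((2 : ℝ≥0) : ℝ)) ≤ 2 * √(2 * Real.pi * ((1 : ℝ≥0) : ℝ)) := by
      rw [Real.sqrt_le_left (by positivity), mul_pow, Real.sq_sqrt (by positivity)]
      have := Real.pi_pos
      push_cast
      linarith
    have hp : 0 < √(2 * Real.pi * ((2 : ℝ≥0) : ℝ)) := Real.sqrt_pos.2 (by
      have := Real.pi_pos; push_cast; positivity)
    have hp1 : 0 < √(2 * Real.pi * ((1 : ℝ≥0) : ℝ)) := Real.sqrt_pos.2 (by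
      have := Real.pi_pos; push_cast; positivity)
    rw [inv_eq_one_div, ← div_eq_mul_inv, div_le_div_iff₀ hp1 hp]
    linarith
  refine (lintegral_mono h).trans ?_
  rw [lintegral_const_mul _ (measurable_gaussianPDF _ _), lintegral_gaussianPDF_eq_one _ two_ne_zero,
    mul_one]

open scoped Classical in
/-- The squared norm of top layer coefficients has exponentially small tails. -/
theorem coeffPrior_top_tail {p L N s : ℕ} {γ : Finset (CoeffIdx p L N)}
    (hγ : γ ∈ patterns p L N s) (S : Finset (TopIdx p L N)) (K : ℝ) :
    coeffPrior γ {B | K < ∑ k ∈ S, B (Sum.inr k) ^ 2}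
      ≤ ENNReal.ofReal (Real.exp (-K / 4)) * 2 ^ S.card := by
  have hprob : ∀ j, IsProbabilityMeasure (if j ∈ γ then slab j else Measure.dirac (0 : ℝ)) := by
    intro j; split_ifs <;> infer_instance
  let F : CoeffIdx p L N → ℝ → ℝ≥0∞ := Sum.elim (fun _ _ => 1) fun k b =>
    if k ∈ S then ENNReal.ofReal (Real.exp (b ^ 2 / 4)) else 1
  have hF : ∀ j, Measurable (F j) := by
    rintro (j | k)
    · exact measurable_const
    · simp only [F, Sum.elim_inr]
      by_cases hk : k ∈ S
      · simp only [hk, if_true]; fun_prop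
      · simp only [hk, if_false]; exact measurable_const
  have hprod : ∀ B : CoeffIdx p L N → ℝ, ∏ j, F j (B j)
      = ENNReal.ofReal (Real.exp ((∑ k ∈ S, B (Sum.inr k) ^ 2) / 4)) := by
    intro B
    rw [Fintype.prod_sum_type]
    simp only [F, Sum.elim_inl, Sum.elim_inr, Finset.prod_const_one, one_mul]
    rw [Finset.prod_ite_mem, Finset.univ_inter, Finset.sum_div, Real.exp_sum,
      ENNReal.ofReal_prod_of_nonneg fun _ _ => (Real.exp_pos _).le]
  have hint : ∫⁻ B, ∏ j, F j (B j) ∂(coeffPrior γ) ≤ 2 ^ S.card := by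
    rw [coeffPrior, lintegral_pi_prod _ hF, Fintype.prod_sum_type]
    have h1 : ∀ i : DeepIdx p L N, ∫⁻ t, F (Sum.inl i) t
        ∂(if Sum.inl i ∈ γ then slab (Sum.inl i) else Measure.dirac (0 : ℝ)) = 1 := by
      intro i
      have := hprob (Sum.inl i)
      simp only [F, Sum.elim_inl, lintegral_one]
      exact measure_univ
    have h2 : ∀ k : TopIdx p L N, ∫⁻ t, F (Sum.inr k) t
        ∂(if Sum.inr k ∈ γ then slab (Sum.inr k) else Measure.dirac (0 : ℝ)) ≤
          if k ∈ S then 2 else 1 := by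
      intro k
      have hk : Sum.inr k ∈ γ := (Finset.mem_filter.1 hγ).2.2 k
      simp only [hk, if_true, F, Sum.elim_inr, slab]
      by_cases hkS : k ∈ S
      · simp only [hkS, if_true]; exact lintegral_exp_sq_gaussianReal_le
      · simp [hkS]
    simp_rw [h1]
    rw [Finset.prod_const_one, one_mul]
    refine (Finset.prod_le_prod' fun k _ => h2 k).trans (le_of_eq ?_)
    rw [Finset.prod_ite_mem, Finset.univ_inter, Finset.prod_const]
  have hm : Measurable fun B : CoeffIdx p L N → ℝ => ∏ j, F j (B j) :=
    Finset.measurable_fun_prod _ fun j _ => (hF j).comp (measurable_pi_apply j)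
  have hmk := mul_meas_ge_le_lintegral (μ := coeffPrior γ) hm (ENNReal.ofReal (Real.exp (K / 4)))
  have hsub : {B : CoeffIdx p L N → ℝ | K < ∑ k ∈ S, B (Sum.inr k) ^ 2} ⊆
      {B | ENNReal.ofReal (Real.exp (K / 4)) ≤ ∏ j, F j (B j)} := by
    intro B hB
    simp only [Set.mem_ofPred_eq] at hB ⊢
    rw [hprod]
    exact ofReal_exp_le (by linarith)
  calc coeffPrior γ {B | K < ∑ k ∈ S, B (Sum.inr k) ^ 2}
      ≤ coeffPrior γ {B | ENNReal.ofReal (Real.exp (K / 4)) ≤ ∏ j, F j (B j)} := measure_mono hsub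
    _ = ENNReal.ofReal (Real.exp (-K / 4)) * (ENNReal.ofReal (Real.exp (K / 4)) *
        coeffPrior γ {B | ENNReal.ofReal (Real.exp (K / 4)) ≤ ∏ j, F j (B j)}) := by
        rw [← mul_assoc, ofReal_exp_mul]
        have : -K / 4 + K / 4 = 0 := by ring
        simp [this]
    _ ≤ _ := by gcongr; exact hmk.trans hint

open scoped Classical in
theorem coeffPrior_ae_eq_zero {p L N : ℕ} (γ : Finset (CoeffIdx p L N)) {j : CoeffIdx p L N}
    (hj : j ∉ γ) : ∀ᵐ B ∂(coeffPrior γ), B j = 0 := by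
  have hprob : ∀ j, IsProbabilityMeasure (if j ∈ γ then slab j else Measure.dirac (0 : ℝ)) := by
    intro j; split_ifs <;> infer_instance
  have h := (measurePreserving_eval (fun j => if j ∈ γ then slab j else Measure.dirac (0 : ℝ)) j)
  have h2 : ∀ᵐ b ∂(if j ∈ γ then slab j else Measure.dirac (0 : ℝ)), b = 0 := by
    simp only [hj, if_false]
    exact (ae_dirac_iff (p := fun b : ℝ => b = 0) (measurableSet_singleton 0)).2 rfl
  exact h.quasiMeasurePreserving.ae h2

open scoped Classical in
theorem coeffPrior_ae_abs_le {p L N : ℕ} (γ : Finset (CoeffIdx p L N)) (j : DeepIdx p L N) :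
    ∀ᵐ B ∂(coeffPrior γ), |B (Sum.inl j)| ≤ 1 := by
  by_cases hj : Sum.inl j ∈ γ
  · have hprob : ∀ j, IsProbabilityMeasure (if j ∈ γ then slab j else Measure.dirac (0 : ℝ)) := by
      intro j; split_ifs <;> infer_instance
    have h := (measurePreserving_eval (fun j => if j ∈ γ then slab j else Measure.dirac (0 : ℝ))
      (Sum.inl j))
    have h2 : ∀ᵐ b ∂(if Sum.inl j ∈ γ then slab (Sum.inl j) else Measure.dirac (0 : ℝ)), |b| ≤ 1 := by
      simp only [hj, if_true, slab]
      rw [ProbabilityTheory.cond]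
      refine Measure.ae_smul_measure ?_ _
      filter_upwards [ae_restrict_mem measurableSet_Icc] with b hb
      exact abs_le.2 hb
    exact h.quasiMeasurePreserving.ae h2
  · filter_upwards [coeffPrior_ae_eq_zero γ hj] with B hB
    rw [hB]; simp

/-- The bias of the top layer has Gaussian tails under the prior. -/
theorem paramPrior_bias_tail {lam : ℝ} (hlam : 0 < lam) (lamS : ℝ) (p L : ℕ) (K : ℝ) :
    paramPrior lam lamS p L {ω | K < ω.2 (Sum.inr none) ^ 2}
      ≤ ENNReal.ofReal (2 * Real.exp (-K / 4)) := by
  have hm : Measurable fun ω : Param p L => ω.2 (Sum.inr none) ^ 2 :=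
    measurable_of_param fun N => by
      have h : Measurable fun B : CoeffIdx p L N → ℝ => B (Sum.inr none) ^ 2 :=
        (measurable_pi_apply _).pow_const 2
      exact h
  refine (paramPrior_apply_le (measurableSet_lt measurable_const hm)
    (c := fun _ => ENNReal.ofReal (2 * Real.exp (-K / 4))) (d := fun _ _ => 0)
    fun N _ s _ γ hγ => ?_).trans ?_
  · have := coeffPrior_top_tail hγ {none} K
    simp only [Finset.sum_singleton, Finset.card_singleton, pow_one] at this
    rw [add_zero]
    refine le_trans this (le_of_eq ?_)
    rw [mul_comm, ENNReal.ofReal_mul (by norm_num)]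
    simp
  · simp only [mul_zero, Finset.sum_const_zero, add_zero]
    rw [ENNReal.tsum_mul_right]
    exact mul_le_of_le_one_left' (tsum_widthWeight_le hlam)

/-! ### The sieve and its prior mass -/

/-- The sieve of parameters of networks with restricted width, sparsity, and top layer. -/
def sieve (p L N' s' : ℕ) (K : ℝ) : Set (Param p L) :=
  {ω | ω.1 ≤ N' ∧ ω.active ≤ s' ∧ (∀ j, |ω.2 (Sum.inl j)| ≤ 1) ∧ ∑ k, ω.2 (Sum.inr k) ^ 2 ≤ K}

theorem measurableSet_param {p L : ℕ} {S : Set (Param p L)}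
    (h : ∀ N, MeasurableSet (mkParam N ⁻¹' S)) : MeasurableSet S :=
  MeasurableSpace.measurableSet_iInf.2 h

theorem measurable_active {p L N : ℕ} :
    Measurable fun B : CoeffIdx p L N → ℝ => (mkParam N B).active := by
  classical
  have h : Measurable fun B : CoeffIdx p L N → ℝ => ∑ j, if B j ≠ 0 then (1 : ℕ) else 0 := by
    refine Finset.measurable_fun_sum _ fun j _ => ?_
    refine Measurable.ite ?_ measurable_const measurable_const
    have h1 : Measurable fun B : CoeffIdx p L N → ℝ => B j := measurable_pi_apply j
    exact (h1 (measurableSet_singleton (0 : ℝ))).compl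
  simp only [Param.active, Finset.card_filter]
  convert h

theorem measurableSet_sieve (p L N' s' : ℕ) (K : ℝ) : MeasurableSet (sieve p L N' s' K) := by
  refine measurableSet_param fun N => ?_
  have e : mkParam N ⁻¹' sieve p L N' s' K = {_B | N ≤ N'} ∩ ({B | (mkParam N B).active ≤ s'} ∩
      ((⋂ j, {B | |B (Sum.inl j)| ≤ 1}) ∩ {B | ∑ k, B (Sum.inr k) ^ 2 ≤ K})) := by
    ext B; simp [sieve]
  rw [e]
  refine MeasurableSet.inter (by simp) (MeasurableSet.inter ?_ (MeasurableSet.inter ?_ ?_))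
  · exact measurableSet_le measurable_active measurable_const
  · exact MeasurableSet.iInter fun j => measurableSet_le (measurable_pi_apply _).abs measurable_const
  · exact measurableSet_le (Finset.measurable_fun_sum _ fun k _ => (measurable_pi_apply _).pow_const 2)
      measurable_const

/-- The three terms are the Poisson tail of the width and, for widths up to `N'`, the Gaussian tail
of the top layer and the geometric tail of the sparsity. The deep coefficients satisfy their
constraint almost surely. -/
theorem paramPrior_sieve_compl_le {lam lamS : ℝ} (hlam : 0 < lam) (hlamS : 0 < lamS)
    (p L N' s' : ℕ) (K : ℝ) :
    paramPrior lam lamS p L (sieve p L N' s' K)ᶜ ≤ ENNReal.ofReal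
      (Real.exp (lam * Real.exp 1) / (Real.exp lam - 1) * Real.exp (-N')
      + (Real.exp (-K / 4) * 2 ^ (12 * p * N' + p + 1)
        + ((L + 1) * (12 * p * N' + p + 1) ^ 2 : ℕ) *
            Real.exp (-lamS * (s' - (12 * p * N' + p + 1))))) := by
  classical
  set c₁ : ℝ := Real.exp (-K / 4) * 2 ^ (12 * p * N' + p + 1) with hc₁
  set c₂ : ℝ := ((L + 1) * (12 * p * N' + p + 1) ^ 2 : ℕ) *
            Real.exp (-lamS * (s' - (12 * p * N' + p + 1))) with hc₂
  have hc₁0 : 0 ≤ c₁ := by positivity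
  have hc₂0 : 0 ≤ c₂ := by positivity
  have hC0 : 0 ≤ Real.exp (lam * Real.exp 1) / (Real.exp lam - 1) := by
    have : 0 < Real.exp lam - 1 := by linarith [Real.add_one_lt_exp hlam.ne']
    positivity
  refine (paramPrior_apply_le (measurableSet_sieve p L N' s' K).compl
    (c := fun N => (if N ≤ N' then 0 else 1) + ENNReal.ofReal c₁)
    (d := fun N s => if N ≤ N' ∧ s' < s then 1 else 0) fun N hN s _ γ hγ => ?_).trans ?_
  · by_cases hNN : N ≤ N'
    swap
    · simp only [hNN, if_false]
      refine prob_le_one.trans ?_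
      rw [add_assoc]
      exact le_self_add
    simp only [hNN, if_true, zero_add, true_and]
    have hsub : mkParam N ⁻¹' (sieve p L N' s' K)ᶜ ⊆
        {B | K < ∑ k, B (Sum.inr k) ^ 2} ∪ ({B | ¬ ∀ j, |B (Sum.inl j)| ≤ 1} ∪
          {B | s' < (mkParam N B).active}) := by
      intro B hB
      by_contra hcon
      simp only [Set.mem_union, Set.mem_ofPred_eq, not_or, not_lt, not_not] at hcon
      exact hB ⟨hNN, hcon.2.2, hcon.2.1, hcon.1⟩
    refine (measure_mono hsub).trans ((measure_union_le _ _).trans ?_)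
    gcongr
    · refine (coeffPrior_top_tail hγ Finset.univ K).trans ?_
      rw [hc₁, ENNReal.ofReal_mul (Real.exp_pos _).le, ENNReal.ofReal_pow (by norm_num)]
      gcongr
      · simp
      · simp
      · rw [Finset.card_univ, Fintype.card_option, Fintype.card_fin]
        have := width_le (p := p) (N := N) (W := 12 * p * N' + p) (Nat.le_add_left _ _)
          ((Nat.mul_le_mul_left _ hNN).trans (Nat.le_add_right _ _)) L
        omega
    · refine (measure_union_le _ _).trans ?_
      have h1 : coeffPrior γ {B | ¬ ∀ j, |B (Sum.inl j)| ≤ 1} = 0 := by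
        have : ∀ᵐ B ∂(coeffPrior γ), ∀ j, |B (Sum.inl j)| ≤ 1 :=
          ae_all_iff.2 fun j => coeffPrior_ae_abs_le γ j
        exact this
      rw [h1, zero_add]
      by_cases hs : s' < s
      · simp only [hs, if_true]; exact prob_le_one
      · simp only [hs, if_false, nonpos_iff_eq_zero]
        have : ∀ᵐ B ∂(coeffPrior γ), (mkParam N B).active ≤ s' := by
          have h2 : ∀ᵐ B ∂(coeffPrior γ), ∀ j, j ∉ γ → B j = 0 := by
            rw [ae_all_iff]
            intro j
            by_cases hj : j ∈ γ
            · simp [hj]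
            · filter_upwards [coeffPrior_ae_eq_zero γ hj] with B hB _ using hB
          filter_upwards [h2] with B hB
          have hcard : γ.card = s := (Finset.mem_filter.1 hγ).2.1
          have : (Finset.univ.filter fun j => B j ≠ 0) ⊆ γ := by
            intro j hj
            by_contra hjγ
            exact (Finset.mem_filter.1 hj).2 (hB j hjγ)
          have := Finset.card_le_card this
          simp only [Param.active]
          omega
        have h3 : {B : CoeffIdx p L N → ℝ | s' < (mkParam N B).active}
            = {B | ¬ (mkParam N B).active ≤ s'} := by ext; simp
        rw [h3]
        exact this
  -- On `N > N'` the factor `exp (N - N')` is at least one, so the width tail is bounded by an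
  -- exponential moment.
  · have hterm : ∀ N : ℕ, ENNReal.ofReal (widthWeight lam N) *
        ((if N ≤ N' then 0 else 1) + ENNReal.ofReal c₁ +
          ∑ s ∈ sparsityLevels p L N, ENNReal.ofReal (sparsityWeight lamS p L N s) *
            (if N ≤ N' ∧ s' < s then 1 else 0))
        ≤ ENNReal.ofReal (Real.exp (-N')) * ENNReal.ofReal (widthWeight lam N * Real.exp (1 * N)) +
          ENNReal.ofReal (widthWeight lam N) * ENNReal.ofReal (c₁ + c₂) := by
      intro N
      rw [ENNReal.ofReal_add hc₁0 hc₂0]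
      by_cases hNN : N ≤ N'
      · simp only [hNN, if_true, zero_add, true_and]
        refine le_trans ?_ le_add_self
        gcongr
        have e : ∑ s ∈ sparsityLevels p L N, ENNReal.ofReal (sparsityWeight lamS p L N s) *
            (if s' < s then 1 else 0) = ∑ s ∈ (sparsityLevels p L N).filter (fun s => s' < s),
              ENNReal.ofReal (sparsityWeight lamS p L N s) := by
          rw [Finset.sum_filter]
          refine Finset.sum_congr rfl fun s _ => ?_
          split_ifs <;> simp
        rw [e]
        refine (sum_sparsityWeight_tail_le hlamS p L N s').trans (ENNReal.ofReal_le_ofReal ?_)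
        have h12 : 12 * p * N ≤ 12 * p * N' + p :=
          (Nat.mul_le_mul_left _ hNN).trans (Nat.le_add_right _ _)
        rw [hc₂]
        refine mul_le_mul ?_ (Real.exp_le_exp.2 ?_) (Real.exp_pos _).le (by positivity)
        · exact_mod_cast card_coeffIdx_le (L := L) (Nat.le_add_left p (12 * p * N')) h12
        · have : ((width p N L : ℕ) : ℝ) ≤ ((12 * p * N' + p : ℕ) : ℝ) := by
            exact_mod_cast width_le (Nat.le_add_left p (12 * p * N')) h12 L
          push_cast at this
          nlinarith
      · simp only [hNN, if_false, false_and, mul_zero, Finset.sum_const_zero, add_zero]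
        rw [mul_add, mul_one]
        refine add_le_add ?_ (mul_le_mul_right le_self_add _)
        · rw [← ENNReal.ofReal_mul (Real.exp_pos _).le]
          refine ENNReal.ofReal_le_ofReal ?_
          rw [mul_left_comm, ← Real.exp_add]
          refine le_mul_of_one_le_right (widthWeight_nonneg hlam N) ?_
          rw [Real.one_le_exp_iff]
          have : (N' : ℝ) ≤ N := by exact_mod_cast (not_le.1 hNN).le
          linarith
    refine (ENNReal.tsum_le_tsum hterm).trans ?_
    rw [ENNReal.tsum_add, ENNReal.tsum_mul_left, ENNReal.tsum_mul_right,
      ENNReal.ofReal_add (by positivity) (add_nonneg hc₁0 hc₂0)]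
    refine add_le_add ?_ (mul_le_of_le_one_left' (tsum_widthWeight_le hlam))
    · rw [mul_comm, ENNReal.ofReal_mul hC0]
      gcongr
      exact tsum_widthWeight_mul_exp_le hlam 1

/-! ### Comparison of scales -/

/-- All constants and logarithms in the argument are absorbed by strict inequalities between powers
of `n`. -/
theorem eventually_mul_log_pow_mul_rpow_le {a b : ℝ} (hab : a < b) (C : ℝ) (k : ℕ) :
    ∀ᶠ n : ℕ in atTop, C * (Real.log n ^ k * (n : ℝ) ^ a) ≤ (n : ℝ) ^ b := by
  have h := (isLittleO_log_rpow_rpow_atTop (k : ℝ) (sub_pos.2 hab)).bound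
    (show (0 : ℝ) < 1 / (|C| + 1) by positivity)
  filter_upwards [tendsto_natCast_atTop_atTop.eventually h, eventually_ge_atTop 1] with n hn hn1
  have hn0 : (0 : ℝ) < n := by exact_mod_cast hn1
  have hlog : 0 ≤ Real.log n := Real.log_nonneg (by exact_mod_cast hn1)
  rw [Real.rpow_natCast, Real.norm_of_nonneg (pow_nonneg hlog k),
    Real.norm_of_nonneg (Real.rpow_nonneg hn0.le _)] at hn
  have h2 : (n : ℝ) ^ b = (n : ℝ) ^ (b - a) * (n : ℝ) ^ a := by
    rw [← Real.rpow_add hn0]; congr 1; ring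
  have h3 : |C| * Real.log n ^ k ≤ (n : ℝ) ^ (b - a) := by
    have hpos : 0 < |C| + 1 := by positivity
    have hl := pow_nonneg hlog k
    calc |C| * Real.log n ^ k ≤ |C| * (1 / (|C| + 1) * (n : ℝ) ^ (b - a)) := by gcongr
      _ = (|C| / (|C| + 1)) * (n : ℝ) ^ (b - a) := by ring
      _ ≤ 1 * (n : ℝ) ^ (b - a) := by
          gcongr
          rw [div_le_one hpos]; linarith
      _ = _ := one_mul _
  rw [h2, ← mul_assoc]
  refine mul_le_mul_of_nonneg_right (le_trans ?_ h3) (Real.rpow_nonneg hn0.le _)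
  exact mul_le_mul_of_nonneg_right (le_abs_self C) (pow_nonneg hlog k)

theorem eventually_mul_rpow_le {a b : ℝ} (hab : a < b) (C : ℝ) :
    ∀ᶠ n : ℕ in atTop, C * (n : ℝ) ^ a ≤ (n : ℝ) ^ b := by
  filter_upwards [eventually_mul_log_pow_mul_rpow_le hab C 0] with n hn
  simpa using hn

theorem tendsto_exp_neg_rpow {a : ℝ} (ha : 0 < a) :
    Tendsto (fun n : ℕ => ENNReal.ofReal (Real.exp (-(n : ℝ) ^ a))) atTop (𝓝 0) := by
  have h : Tendsto (fun n : ℕ => Real.exp (-(n : ℝ) ^ a)) atTop (𝓝 0) :=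
    Real.tendsto_exp_neg_atTop_nhds_zero.comp
      ((tendsto_rpow_atTop ha).comp tendsto_natCast_atTop_atTop)
  simpa using ENNReal.tendsto_ofReal h

theorem tendsto_zero_of_eventually_le_exp_neg_rpow {a C : ℝ} (ha : 0 < a) {u : ℕ → ℝ≥0∞}
    (h : ∀ᶠ n in atTop, u n ≤ ENNReal.ofReal (C * Real.exp (-(n : ℝ) ^ a))) :
    Tendsto u atTop (𝓝 0) := by
  have h1 : Tendsto (fun n : ℕ => C * Real.exp (-(n : ℝ) ^ a)) atTop (𝓝 0) := by
    simpa using (Real.tendsto_exp_neg_atTop_nhds_zero.comp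
      ((tendsto_rpow_atTop ha).comp tendsto_natCast_atTop_atTop)).const_mul C
  have h2 := ENNReal.tendsto_ofReal h1
  rw [ENNReal.ofReal_zero] at h2
  exact tendsto_of_tendsto_of_tendsto_of_le_of_le' tendsto_const_nhds h2
    (Eventually.of_forall fun _ => zero_le) h

/-! ### Evidence -/

/-- The log likelihood ratio of a network with respect to the true regression function. -/
noncomputable def netLR {p L n : ℕ} (f₀ : (Fin p → ℝ) → ℝ) (x : Fin n → Fin p → ℝ) (y : Fin n → ℝ)
    (ω : Param p L) : ℝ := logLR (fun i => f₀ (x i)) y (evalNet x ω)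

theorem measurable_netLR {p L n : ℕ} (f₀ : (Fin p → ℝ) → ℝ) (x : Fin n → Fin p → ℝ)
    (y : Fin n → ℝ) : Measurable (netLR (L := L) f₀ x y) :=
  measurable_logLR _ measurable_const (measurable_evalNet x)

/-- Completing the square gives a bound independent of the parameter, hence finite evidence for
every data vector. -/
theorem netLR_le {p L n : ℕ} (f₀ : (Fin p → ℝ) → ℝ) (x : Fin n → Fin p → ℝ)
    (y : Fin n → ℝ) (ω : Param p L) :
    netLR f₀ x y ω ≤ (y - fun i => f₀ (x i)) ⬝ᵥ (y - fun i => f₀ (x i)) / 2 := by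
  have h := two_mul_abs_dotProduct_le (y - fun i => f₀ (x i)) (evalNet x ω - fun i => f₀ (x i)) one_pos
  have := le_abs_self ((y - fun i => f₀ (x i)) ⬝ᵥ (evalNet x ω - fun i => f₀ (x i)))
  simp only [netLR, logLR]
  linarith

theorem lintegral_netLR_ne_top {lam : ℝ} (hlam : 0 < lam) (lamS : ℝ) {p L n : ℕ}
    (f₀ : (Fin p → ℝ) → ℝ) (x : Fin n → Fin p → ℝ) (y : Fin n → ℝ) :
    ∫⁻ ω, ENNReal.ofReal (Real.exp (netLR f₀ x y ω)) ∂(paramPrior lam lamS p L) ≠ ⊤ := by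
  have := isFiniteMeasure_paramPrior hlam lamS p L
  refine ((lintegral_mono fun ω => ofReal_exp_le (netLR_le f₀ x y ω)).trans_lt ?_).ne
  rw [lintegral_const]
  exact ENNReal.mul_lt_top ENNReal.ofReal_lt_top (measure_lt_top _ _)

/-- With probability tending to one, the integrated likelihood ratio is at least
`exp (-n ^ γ)`. -/
def EvidenceBound (lam lamS : ℝ) {p : ℕ} (f₀ : (Fin p → ℝ) → ℝ) (x : (n : ℕ) → Fin n → Fin p → ℝ)
    (L : ℕ → ℕ) (γ : ℝ) : Prop :=
  Tendsto (fun n => dataLaw f₀ (x n) {y |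
    ∫⁻ ω, ENNReal.ofReal (Real.exp (netLR f₀ (x n) y ω)) ∂(paramPrior lam lamS p (L n))
      < ENNReal.ofReal (Real.exp (-(n : ℝ) ^ γ))}) atTop (𝓝 0)

theorem dataLaw_setLIntegral_ge_le {lam : ℝ} (hlam : 0 < lam) (lamS : ℝ) {p L n : ℕ}
    (f₀ : (Fin p → ℝ) → ℝ) (x : Fin n → Fin p → ℝ) (F : Set (Param p L)) {c b : ℝ}
    (hF : paramPrior lam lamS p L F ≤ ENNReal.ofReal b) :
    dataLaw f₀ x {y | ENNReal.ofReal (Real.exp (-c)) ≤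
      ∫⁻ ω in F, ENNReal.ofReal (Real.exp (netLR f₀ x y ω)) ∂(paramPrior lam lamS p L)}
      ≤ ENNReal.ofReal (Real.exp c * b) := by
  have := isFiniteMeasure_paramPrior hlam lamS p L
  refine (gaussLaw_setLIntegral_ge_le (fun i => f₀ (x i)) (paramPrior lam lamS p L)
    (measurable_evalNet x) F c).trans ?_
  rw [ENNReal.ofReal_mul (Real.exp_pos _).le]
  gcongr

/-- Numerator over denominator: the posterior mass is small when the integrated likelihood on `S` is
exponentially smaller than the evidence. -/
theorem gibbs_apply_le {Ω : Type*} [MeasurableSpace Ω] {Q : Measure Ω} {w : Ω → ℝ≥0∞}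
    {S : Set Ω} (hS : MeasurableSet S) {a b : ℝ}
    (hD : ENNReal.ofReal (Real.exp (-a)) ≤ ∫⁻ ω, w ω ∂Q)
    (hb : ∫⁻ ω in S, w ω ∂Q ≤ ENNReal.ofReal (Real.exp (-b))) :
    gibbs Q w S ≤ ENNReal.ofReal (Real.exp (a - b)) := by
  rw [gibbs, Measure.smul_apply, withDensity_apply _ hS, smul_eq_mul]
  have h1 : (∫⁻ ω, w ω ∂Q)⁻¹ ≤ ENNReal.ofReal (Real.exp a) := by
    refine (ENNReal.inv_le_inv.2 hD).trans (le_of_eq ?_)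
    rw [← ENNReal.ofReal_inv_of_pos (Real.exp_pos _), ← Real.exp_neg, neg_neg]
  calc _ ≤ ENNReal.ofReal (Real.exp a) * ENNReal.ofReal (Real.exp (-b)) := by gcongr
    _ = _ := by rw [ofReal_exp_mul, sub_eq_add_neg]

/-! ### Linear functionals: shifting the bias of the top layer -/

open scoped Classical in
/-- Translation of the bias of the top layer. -/
noncomputable def biasShift (σ : ℝ) {p L : ℕ} : (N : ℕ) → TopIdx p L N → ℝ → ℝ :=
  fun _ k b => if k = none then b + σ else b

theorem biasShift_none (σ : ℝ) {p L N : ℕ} :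
    biasShift σ (p := p) (L := L) N none = fun b => b + σ := by
  funext b; simp [biasShift]

theorem biasShift_some (σ : ℝ) {p L N : ℕ} (j : Fin (width p N L)) :
    biasShift σ (p := p) (L := L) N (some j) = fun b => b := by
  funext b; simp [biasShift]

theorem measurable_biasShift_apply (σ : ℝ) {p L : ℕ} (N : ℕ) (k : TopIdx p L N) :
    Measurable (biasShift σ N k) := by
  rcases k with _ | j
  · rw [biasShift_none]; exact measurable_id.add_const _
  · rw [biasShift_some]; exact measurable_id

theorem evalNet_biasShift {p L n : ℕ} (x : Fin n → Fin p → ℝ) (σ : ℝ) (ω : Param p L) :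
    evalNet x (topMap (biasShift σ) ω) = evalNet x ω + fun _ => σ := by
  have hh : ∀ (u : Fin p → ℝ) (l : ℕ) (h : l ≤ L),
      hidden (topMap (biasShift σ) ω).2 u l h = hidden ω.2 u l h := by
    intro u l
    induction l with
    | zero => intro h; rfl
    | succ l ih => intro h; funext i; simp only [hidden, ih]; rfl
  funext i
  have h2 := hh (x i) L le_rfl
  simp only [evalNet, paramNet, network, Pi.add_apply] at h2 ⊢
  have e : ∀ j, hidden (topMap (biasShift σ) ω).2 (x i) L le_rfl j = hidden ω.2 (x i) L le_rfl j :=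
    fun j => congrFun h2 j
  have e1 : (topMap (biasShift σ) ω).2 (Sum.inr none) = ω.2 (Sum.inr none) + σ := by
    simp [topMap, biasShift]
  have e2 : ∀ j, (topMap (biasShift σ) ω).2 (Sum.inr (some j)) = ω.2 (Sum.inr (some j)) := by
    intro j; simp [topMap, biasShift]
  rw [e1, ← add_assoc]
  congr 2
  refine Finset.sum_congr rfl fun j _ => ?_
  rw [e j]
  congr 1

/-- The density of the translated prior. -/
noncomputable def biasShiftDensity (σ : ℝ) {p L : ℕ} (ω : Param p L) : ℝ≥0∞ :=
  ENNReal.ofReal (Real.exp (σ * ω.2 (Sum.inr none) - σ ^ 2 / 2))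

theorem lintegral_biasShift (lam lamS : ℝ) {p L : ℕ} (σ : ℝ) {g : Param p L → ℝ≥0∞}
    (hg : Measurable g) :
    ∫⁻ ω, g (topMap (biasShift σ) ω) ∂(paramPrior lam lamS p L)
      = ∫⁻ ω, g ω * biasShiftDensity σ ω ∂(paramPrior lam lamS p L) := by
  classical
  let ρ : (N : ℕ) → TopIdx p L N → ℝ → ℝ≥0∞ := fun _ k b =>
    if k = none then ENNReal.ofReal (Real.exp (σ * b - σ ^ 2 / 2)) else 1
  rw [lintegral_paramPrior_topMap lam lamS (τ := biasShift σ) (ρ := ρ) ?_ ?_ ?_ hg]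
  · refine lintegral_congr fun ω => ?_
    congr 1
    rw [Fintype.prod_option]
    simp [ρ, biasShiftDensity]
  · exact measurable_biasShift_apply σ
  · rintro N (_ | j)
    · simp only [ρ, if_true]; fun_prop
    · simp [ρ]
  · rintro N (_ | j)
    · simp only [ρ, if_true, biasShift_none]; exact gaussianReal_map_add_eq_withDensity σ
    · have : ρ N (some j) = fun _ => 1 := by simp [ρ]
      rw [this, biasShift_some, withDensity_const, one_smul]
      exact Measure.map_id

theorem measurable_biasShift (σ : ℝ) {p L : ℕ} :
    Measurable (topMap (biasShift σ) : Param p L → Param p L) :=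
  measurable_topMap (measurable_biasShift_apply σ)

theorem measurable_bias {p L : ℕ} : Measurable fun ω : Param p L => ω.2 (Sum.inr none) :=
  measurable_of_param fun N => by
    have h : Measurable fun B : CoeffIdx p L N → ℝ => B (Sum.inr none) := measurable_pi_apply _
    exact h

/-- The log likelihood ratio is quadratic, and translating the function by a constant gives an exact
linear and quadratic term. No remainder appears, so the linear functional needs no contraction of
the posterior. -/
theorem netLR_biasShift {p L n : ℕ} (f₀ : (Fin p → ℝ) → ℝ) (x : Fin n → Fin p → ℝ)
    (y : Fin n → ℝ) (σ : ℝ) (ω : Param p L) :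
    netLR f₀ x y (topMap (biasShift σ) ω) - netLR f₀ x y ω
      = σ * (∑ i, (y i - f₀ (x i)) - ∑ i, (evalNet x ω i - f₀ (x i))) - n * σ ^ 2 / 2 := by
  have e : (n : ℝ) * σ ^ 2 / 2 = ∑ _i : Fin n, σ ^ 2 / 2 := by simp; ring
  rw [netLR, netLR, evalNet_biasShift, e]
  simp only [logLR, dotProduct, Pi.sub_apply, Pi.add_apply, Finset.sum_div, mul_sub, Finset.mul_sum,
    ← Finset.sum_sub_distrib]
  refine Finset.sum_congr rfl fun i _ => ?_
  ring

/-- The recentred functional is proportional to the very sum that multiplies `σ` in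
`netLR_biasShift`; this fixes the size of the shift. -/
theorem empInner_sub_eq {p n : ℕ} (hn : 0 < n) {a : (Fin p → ℝ) → ℝ} {c : ℝ} (x : Fin n → Fin p → ℝ)
    (ha : ∀ i, a (x i) = c) (f₀ f : (Fin p → ℝ) → ℝ) (y : Fin n → ℝ) :
    Real.sqrt n * (empInner x a f - (empInner x a f₀ + 1 / Real.sqrt n * noise f₀ x y a))
      = c / Real.sqrt n * (∑ i, (f (x i) - f₀ (x i)) - ∑ i, (y i - f₀ (x i))) := by
  have hn0 : (0 : ℝ) < n := by exact_mod_cast hn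
  have hs : 0 < Real.sqrt n := Real.sqrt_pos.2 hn0
  have hsq : Real.sqrt n * Real.sqrt n = n := Real.mul_self_sqrt hn0.le
  have e1 : ∀ g : (Fin p → ℝ) → ℝ, empInner x a g = c / n * ∑ i, g (x i) := by
    intro g
    simp only [empInner, ha, ← Finset.mul_sum]
    ring
  have e3 : noise f₀ x y a = Real.sqrt n * c / n * ∑ i, (y i - f₀ (x i)) := by
    simp only [noise, ha, ← Finset.mul_sum, ← Finset.sum_mul]
    ring
  rw [e1, e1, e3, Finset.sum_sub_distrib (fun i => f (x i))]
  generalize ∑ i, (y i - f₀ (x i)) = S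
  generalize ∑ i, f (x i) = S₁
  generalize ∑ i, f₀ (x i) = S₂
  have : (n : ℝ) = Real.sqrt n ^ 2 := by rw [sq, hsq]
  rw [this]
  field_simp
  rw [Real.sqrt_sq hs.le]
  field_simp
  ring

theorem empNormSq_const {p n : ℕ} (hn : 0 < n) {a : (Fin p → ℝ) → ℝ} {c : ℝ} (x : Fin n → Fin p → ℝ)
    (ha : ∀ i, a (x i) = c) : empNormSq x a = c ^ 2 := by
  have hn0 : (0 : ℝ) < n := by exact_mod_cast hn
  simp only [empNormSq, ha, Finset.sum_const, Finset.card_univ, Fintype.card_fin, nsmul_eq_mul]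
  field_simp

/-- Asymptotic normality of linear functionals with constant weight. -/
theorem asymptoticallyNormal_empInner {p : ℕ} {f₀ : (Fin p → ℝ) → ℝ}
    {x : (n : ℕ) → Fin n → Fin p → ℝ} {lam : ℝ} (hlam : 0 < lam) {lamS : ℝ} {L : ℕ → ℕ}
    {γ : ℝ} (hγ0 : 0 < γ) (hγ1 : γ < 1) (hE : EvidenceBound lam lamS f₀ x L γ)
    {a : (Fin p → ℝ) → ℝ} {c : ℝ} (ha : ∀ n i, a (x n i) = c) :
    AsymptoticallyNormal (fun n => dataLaw f₀ (x n))
        (fun n y => posterior (prior lam lamS p (L n)) (x n) y)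
        (fun n f => empInner (x n) a f)
        (fun n y => empInner (x n) a f₀ + 1 / Real.sqrt n * noise f₀ (x n) y a)
        (fun n => empNormSq (x n) a) := by
  -- Strictly between `γ` and one: a bias of square `n ^ κ` is rarer than the evidence allows, yet
  -- its product with a shift of order `1 / √n` vanishes.
  set κ : ℝ := (γ + 1) / 2 with hκ
  have hγκ : γ < κ := by rw [hκ]; linarith
  have hκ1 : κ < 1 := by rw [hκ]; linarith
  let B : (n : ℕ) → ℝ → Set (Param p (L n)) := fun n K => {ω | ω.2 (Sum.inr none) ^ 2 ≤ K}
  have hB : ∀ n K, MeasurableSet (B n K) := fun n K =>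
    measurableSet_le (measurable_bias.pow_const 2) measurable_const
  let G : (n : ℕ) → Set (Fin n → ℝ) := fun n =>
    {y | ENNReal.ofReal (Real.exp (-(n : ℝ) ^ γ)) ≤
      ∫⁻ ω, ENNReal.ofReal (Real.exp (netLR f₀ (x n) y ω)) ∂(paramPrior lam lamS p (L n))} ∩
    {y | ∫⁻ ω in (B n ((n : ℝ) ^ κ / 4))ᶜ, ENNReal.ofReal (Real.exp (netLR f₀ (x n) y ω))
      ∂(paramPrior lam lamS p (L n)) < ENNReal.ofReal (Real.exp (-(2 * (n : ℝ) ^ γ)))}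
  have hprior : ∀ n, paramPrior lam lamS p (L n) (B n ((n : ℝ) ^ κ / 4))ᶜ
      ≤ ENNReal.ofReal (2 * Real.exp (-(n : ℝ) ^ κ / 16)) := by
    intro n
    have := paramPrior_bias_tail hlam lamS p (L n) ((n : ℝ) ^ κ / 4)
    have e : (B n ((n : ℝ) ^ κ / 4))ᶜ = {ω | (n : ℝ) ^ κ / 4 < ω.2 (Sum.inr none) ^ 2} := by
      ext ω; simp [B]
    rw [e]
    refine this.trans (le_of_eq ?_)
    congr 3; ring
  have hG : Tendsto (fun n => dataLaw f₀ (x n) (G n)ᶜ) atTop (𝓝 0) := by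
    have h2 : Tendsto (fun n => dataLaw f₀ (x n) {y | ENNReal.ofReal (Real.exp (-(2 * (n : ℝ) ^ γ))) ≤
        ∫⁻ ω in (B n ((n : ℝ) ^ κ / 4))ᶜ, ENNReal.ofReal (Real.exp (netLR f₀ (x n) y ω))
          ∂(paramPrior lam lamS p (L n))}) atTop (𝓝 0) := by
      refine tendsto_zero_of_eventually_le_exp_neg_rpow (C := 2) hγ0 ?_
      -- The prior tail exponent `n ^ κ / 16` must reach `3 * n ^ γ`: two for the threshold, and one
      -- that is left over.
      filter_upwards [eventually_mul_rpow_le hγκ 48] with n hn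
      refine (dataLaw_setLIntegral_ge_le hlam lamS f₀ (x n) _ (hprior n)).trans
        (ENNReal.ofReal_le_ofReal ?_)
      rw [mul_left_comm, ← Real.exp_add]
      gcongr
      linarith
    have h3 := hE.add h2
    rw [add_zero] at h3
    refine tendsto_of_tendsto_of_tendsto_of_le_of_le tendsto_const_nhds h3 (fun _ => zero_le)
      fun n => ?_
    refine (measure_mono ?_).trans (measure_union_le _ _)
    intro y hy
    by_contra hcon
    simp only [Set.mem_union, Set.mem_ofPred_eq, not_or, not_le, not_lt] at hcon
    exact hy ⟨hcon.1, hcon.2⟩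
  refine asymptoticallyNormal_of_forall_seq (fun n => by unfold dataLaw; infer_instance) G hG
    fun y hy => ?_
  let Ψ : (n : ℕ) → ((Fin p → ℝ) → ℝ) → ℝ := fun n f => Real.sqrt n * (empInner (x n) a f -
    (empInner (x n) a f₀ + 1 / Real.sqrt n * noise f₀ (x n) (y n) a))
  have hΨ : ∀ n, Measurable (Ψ n) := by
    intro n
    refine Measurable.const_mul (Measurable.sub_const ?_ _) _
    refine Measurable.const_mul (Finset.measurable_fun_sum _ fun i _ => ?_) _
    exact (measurable_pi_apply (x n i)).const_mul _
  have hpost : ∀ n, (posterior (prior lam lamS p (L n)) (x n) (y n)).map (Ψ n) =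
      (gibbs (paramPrior lam lamS p (L n)) fun ω =>
        ENNReal.ofReal (Real.exp (netLR f₀ (x n) (y n) ω))).map (fun ω => Ψ n (paramNet ω)) := by
    intro n
    rw [posterior_prior_eq_map_gibbs lam lamS (x n) (y n) f₀,
      Measure.map_map (hΨ n) measurable_paramNet]
    rfl
  have hV : ∀ n, empNormSq (x n) a ≤ c ^ 2 := by
    intro n
    rcases Nat.eq_zero_or_pos n with rfl | hn
    · simp [empNormSq]; positivity
    · exact (empNormSq_const hn _ (ha n)).le
  change Tendsto (fun n => blDist ((posterior (prior lam lamS p (L n)) (x n) (y n)).map (Ψ n)) _) _ _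
  simp_rw [hpost]
  refine tendsto_blDist_gibbs (A := fun n => B n ((n : ℝ) ^ κ)) (C := c ^ 2)
    (fun n => by unfold empNormSq; positivity) hV (fun n => measurable_netLR f₀ (x n) (y n))
    (fun n => (hΨ n).comp measurable_paramNet) (fun n => hB n _) ?_
    (Eventually.of_forall fun n => lintegral_netLR_ne_top hlam lamS f₀ (x n) (y n)) ?_
  · filter_upwards [hy] with n hn h0
    have := hn.1
    simp only [Set.mem_ofPred_eq] at this
    rw [h0] at this
    simp at this
    exact absurd this (not_le.2 (Real.exp_pos _))
  intro t
  -- With this shift `t * X - t ^ 2 * V / 2` is exactly the increment of the log likelihood ratio.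
  let σ : ℕ → ℝ := fun n => -(t * c / Real.sqrt n)
  have hσ : ∀ n : ℕ, 0 < n → n * σ n ^ 2 = (t * c) ^ 2 := by
    intro n hn
    have hn0 : (0 : ℝ) < n := by exact_mod_cast hn
    simp only [σ]
    rw [neg_sq, div_pow, Real.sq_sqrt hn0.le]
    field_simp
  have habs : ∀ n : ℕ, 0 < n → |σ n| = |t * c| * (n : ℝ) ^ (-(1 / 2) : ℝ) := by
    intro n hn
    simp only [σ]
    rw [abs_neg, abs_div, abs_of_nonneg (Real.sqrt_nonneg _), Real.sqrt_eq_rpow, div_eq_mul_inv,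
      Real.rpow_neg (by positivity)]
  -- This bounds the log density of the translated prior where the bias is at most `n ^ (κ / 2)`.
  let η : ℕ → ℝ := fun n => |σ n| * (n : ℝ) ^ (κ / 2) + σ n ^ 2
  have hη : Tendsto η atTop (𝓝 0) := by
    have e1 : Tendsto (fun n : ℕ => |t * c| * (n : ℝ) ^ (-(1 / 2 - κ / 2)) +
        (t * c) ^ 2 * (n : ℝ)⁻¹) atTop (𝓝 0) := by
      have h1 := ((tendsto_rpow_neg_atTop (show 0 < 1 / 2 - κ / 2 by linarith)).comp
        (tendsto_natCast_atTop_atTop (R := ℝ))).const_mul |t * c|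
      have h2 := (tendsto_inv_atTop_nhds_zero_nat (𝕜 := ℝ)).const_mul ((t * c) ^ 2)
      simpa using h1.add h2
    refine e1.congr' ?_
    filter_upwards [eventually_gt_atTop 0] with n hn
    have hn0 : (0 : ℝ) < n := by exact_mod_cast hn
    simp only [η]
    have h3 : σ n ^ 2 = (t * c) ^ 2 * (n : ℝ)⁻¹ := by rw [← hσ n hn]; field_simp
    have h4 : -(1 / 2 : ℝ) + κ / 2 = -(1 / 2 - κ / 2) := by ring
    rw [habs n hn, mul_assoc, ← Real.rpow_add hn0, h3, h4]
  have hsq : ∀ n : ℕ, ((n : ℝ) ^ (κ / 2)) ^ 2 = (n : ℝ) ^ κ := by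
    intro n
    rw [← Real.rpow_natCast, ← Real.rpow_mul (Nat.cast_nonneg n)]
    congr 1; push_cast; ring
  -- The shift is eventually smaller than the gap between the radii `n ^ (κ / 2) / 2` and `n ^ (κ /
  -- 2)`, so the preimage of the small set lies in the large one.
  have hsmall : ∀ᶠ n in atTop, |σ n| ≤ (n : ℝ) ^ (κ / 2) / 2 := by
    have h1 : ∀ᶠ n in atTop, η n < 1 / 2 := hη.eventually (gt_mem_nhds (by norm_num))
    filter_upwards [h1, eventually_ge_atTop 1] with n hn hn1
    have hge : (1 : ℝ) ≤ (n : ℝ) ^ (κ / 2) :=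
      Real.one_le_rpow (by exact_mod_cast hn1) (by rw [hκ]; linarith)
    have h2 : |σ n| * 1 ≤ |σ n| * (n : ℝ) ^ (κ / 2) := by gcongr
    have h3 := sq_nonneg (σ n)
    simp only [η] at hn
    linarith
  refine ⟨fun n => topMap (biasShift (σ n)), fun n => biasShiftDensity (σ n),
    fun n => B n ((n : ℝ) ^ κ / 4), η, hη, ?_, ?_⟩
  · refine tendsto_of_tendsto_of_tendsto_of_le_of_le' tendsto_const_nhds (tendsto_exp_neg_rpow hγ0)
      (Eventually.of_forall fun _ => zero_le) ?_
    filter_upwards [hy] with n hn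
    refine (gibbs_apply_le (hB n _).compl hn.1 hn.2.le).trans (ofReal_exp_le ?_)
    linarith
  · filter_upwards [hsmall, eventually_gt_atTop 0] with n hs hn
    have hK : 0 ≤ (n : ℝ) ^ (κ / 2) := Real.rpow_nonneg (Nat.cast_nonneg n) _
    have hb : ∀ ω : Param p (L n), (topMap (biasShift (σ n)) ω).2 (Sum.inr none)
        = ω.2 (Sum.inr none) + σ n := by
      intro ω; simp [topMap, biasShift]
    have hmem : ∀ ω : Param p (L n), ω ∈ B n ((n : ℝ) ^ κ) →
        |ω.2 (Sum.inr none)| ≤ (n : ℝ) ^ (κ / 2) := by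
      intro ω hω
      refine abs_le_of_sq_le_sq ?_ hK
      rw [hsq]; exact hω
    have hmem1 : ∀ ω : Param p (L n), ω ∈ B n ((n : ℝ) ^ κ / 4) →
        |ω.2 (Sum.inr none)| ≤ (n : ℝ) ^ (κ / 2) / 2 := by
      intro ω hω
      refine abs_le_of_sq_le_sq ?_ (by positivity)
      rw [div_pow, hsq]
      exact hω.trans (by norm_num)
    refine ⟨measurable_biasShift _, ?_, hB n _, fun g hg => lintegral_biasShift lam lamS _ hg,
      ?_, ?_, ?_, ?_⟩
    · have := measurable_bias (p := p) (L := L n)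
      unfold biasShiftDensity
      fun_prop
    · intro ω _
      have e : t * Ψ n (paramNet ω) - t ^ 2 * empNormSq (x n) a / 2 -
          (netLR f₀ (x n) (y n) (topMap (biasShift (σ n)) ω) - netLR f₀ (x n) (y n) ω) = 0 := by
        rw [netLR_biasShift, hσ n hn, empNormSq_const hn _ (ha n)]
        simp only [Ψ]
        rw [empInner_sub_eq hn (x n) (ha n)]
        simp only [σ, evalNet]
        ring
      rw [e, abs_zero]
      positivity
    · intro ω hω
      unfold biasShiftDensity
      refine ofReal_exp_le ?_
      rw [hb]
      have h1 : σ n * ω.2 (Sum.inr none) ≤ |σ n| * (n : ℝ) ^ (κ / 2) :=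
        (le_abs_self _).trans (by rw [abs_mul]; gcongr; exact hmem ω hω)
      have h2 := sq_nonneg (σ n)
      simp only [η]
      nlinarith
    · intro ω hω
      unfold biasShiftDensity
      refine ofReal_exp_le ?_
      have h1 : |σ n * ω.2 (Sum.inr none)| ≤ |σ n| * ((n : ℝ) ^ (κ / 2) / 2) := by
        rw [abs_mul]; gcongr; exact hmem1 ω hω
      have h2 := neg_abs_le (σ n * ω.2 (Sum.inr none))
      have h3 := sq_nonneg (σ n)
      have h4 : 0 ≤ |σ n| * (n : ℝ) ^ (κ / 2) := by positivity
      simp only [η]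
      linarith
    · intro ω hω
      have h1 := hmem1 _ hω
      rw [hb] at h1
      have h2 : |ω.2 (Sum.inr none)| ≤ (n : ℝ) ^ (κ / 2) := by
        have h5 : ω.2 (Sum.inr none) = (ω.2 (Sum.inr none) + σ n) - σ n := by ring
        rw [h5]
        exact (abs_sub _ _).trans (by linarith)
      change ω.2 (Sum.inr none) ^ 2 ≤ (n : ℝ) ^ κ
      rw [← hsq, ← sq_abs]
      gcongr

/-! ### Control of the noise on the sieve -/

theorem eventually_natCeil_rpow_le {a b : ℝ} (ha : 0 < a) (hab : a < b) (C D : ℝ) :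
    ∀ᶠ n : ℕ in atTop, C * (⌈(n : ℝ) ^ a⌉₊ : ℝ) + D ≤ (n : ℝ) ^ b := by
  filter_upwards [eventually_mul_rpow_le hab (2 * |C| + |D|), eventually_ge_atTop 1] with n hn hn1
  have h1 : (1 : ℝ) ≤ (n : ℝ) ^ a := Real.one_le_rpow (by exact_mod_cast hn1) ha.le
  have h2 : (⌈(n : ℝ) ^ a⌉₊ : ℝ) ≤ 2 * (n : ℝ) ^ a := by
    linarith [Nat.ceil_lt_add_one (zero_le_one.trans h1)]
  have h3 : C * (⌈(n : ℝ) ^ a⌉₊ : ℝ) ≤ |C| * (2 * (n : ℝ) ^ a) :=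
    mul_le_mul (le_abs_self C) h2 (Nat.cast_nonneg _) (abs_nonneg C)
  have h4 : D ≤ |D| * (n : ℝ) ^ a :=
    (le_abs_self D).trans (le_mul_of_one_le_right (abs_nonneg D) h1)
  linarith

/-- Every factor is at most a power of `n`. The exponent is of order `L * s`, so the log cardinality
is of order `L * s * log n`. -/
theorem net_card_le {n N W L s m : ℕ} (hn : 3 ≤ n) (hN : N + 1 ≤ n) (hW : W ≤ n ^ 2) (hL : L + 1 ≤ n)
    (hs : 1 ≤ s) (hm : m = n * (n + 1) * (L + 1) * (W * n) ^ (L + 1)) :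
    (N + 1) * ((L + 1) * W ^ 2 * (2 * (n * m) + 1)) ^ s ≤ n ^ (15 * (L + 1) * s) := by
  have hn1 : 1 ≤ n := by omega
  have h1 : n + 1 ≤ n ^ 2 := by nlinarith
  have hm1 : m ≤ n ^ (4 + 3 * (L + 1)) := by
    calc m = n * (n + 1) * (L + 1) * (W * n) ^ (L + 1) := hm
      _ ≤ n * n ^ 2 * n * (n ^ 2 * n) ^ (L + 1) := by gcongr
      _ = _ := by rw [← pow_succ, ← pow_mul, pow_add]; ring
  have h2 : 2 * (n * m) + 1 ≤ n ^ 2 * n ^ (4 + 3 * (L + 1)) := by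
    calc 2 * (n * m) + 1 ≤ 2 * (n * n ^ (4 + 3 * (L + 1))) + 1 := by gcongr
      _ ≤ 3 * (n * n ^ (4 + 3 * (L + 1))) := by
          have : 1 ≤ n * n ^ (4 + 3 * (L + 1)) := Nat.one_le_iff_ne_zero.2 (by positivity)
          omega
      _ ≤ n * (n * n ^ (4 + 3 * (L + 1))) := by gcongr
      _ = _ := by ring
  calc (N + 1) * ((L + 1) * W ^ 2 * (2 * (n * m) + 1)) ^ s
      ≤ n * (n * (n ^ 2) ^ 2 * (n ^ 2 * n ^ (4 + 3 * (L + 1)))) ^ s := by gcongr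
    _ = n ^ (1 + (11 + 3 * (L + 1)) * s) := by
        rw [pow_add n 1, pow_one, pow_mul]; congr 2; ring
    _ ≤ _ := by
        refine Nat.pow_le_pow_right hn1 ?_
        nlinarith

theorem tendsto_ofReal_mul_exp_neg_half :
    Tendsto (fun n : ℕ => ENNReal.ofReal (2 * n * Real.exp (-n / 2))) atTop (𝓝 0) := by
  have h := ((Real.tendsto_pow_mul_exp_neg_atTop_nhds_zero 1).comp
    ((tendsto_natCast_atTop_atTop (R := ℝ)).atTop_div_const (zero_lt_two))).const_mul 4
  have h2 := ENNReal.tendsto_ofReal h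
  rw [mul_zero, ENNReal.ofReal_zero] at h2
  refine h2.congr fun n => ?_
  simp only [Function.comp, pow_one]
  congr 1
  rw [neg_div]; ring

/-- With probability tending to one, the noise is controlled on the sieve. -/
theorem exists_noise_control {p : ℕ} (f₀ : (Fin p → ℝ) → ℝ)
    {x : (n : ℕ) → Fin n → Fin p → ℝ} (hx : ∀ n i j, |x n i j| ≤ 1) {L : ℕ → ℕ} {CL : ℝ}
    (hL : ∀ᶠ n : ℕ in atTop, (L n : ℝ) ≤ CL * Real.log n) {a b c : ℝ} (ha : 0 < a) (ha1 : a < 1)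
    (hb : 0 < b) (hbc : b < c) {K : ℕ → ℝ} (hK : ∀ᶠ n : ℕ in atTop, K n ≤ (n : ℝ) ^ 2) :
    ∃ H : (n : ℕ) → Set (Fin n → ℝ), Tendsto (fun n => dataLaw f₀ (x n) (H n)ᶜ) atTop (𝓝 0) ∧
      ∀ᶠ n in atTop, ∀ y ∈ H n, ∀ ω ∈ sieve p (L n) ⌈(n : ℝ) ^ a⌉₊ ⌈(n : ℝ) ^ b⌉₊ (K n),
        |(y - fun i => f₀ (x n i)) ⬝ᵥ (evalNet (x n) ω - fun i => f₀ (x n i))| ≤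
          3 / 8 * ((evalNet (x n) ω - fun i => f₀ (x n i)) ⬝ᵥ
            (evalNet (x n) ω - fun i => f₀ (x n i))) + (n : ℝ) ^ c + 2 := by
  classical
  let W : ℕ → ℕ := fun n => 12 * p * ⌈(n : ℝ) ^ a⌉₊ + p + 1
  -- The mesh makes the error of the net exactly `1 / (n * (n + 1))`, as required by
  -- `abs_noise_le_of_net`.
  let m : ℕ → ℕ := fun n => n * (n + 1) * (L n + 1) * (W n * n) ^ (L n + 1)
  have hnet : ∀ n, ∃ C : Finset (Fin n → ℝ), 1 ≤ n → C.card ≤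
        (⌈(n : ℝ) ^ a⌉₊ + 1) * ((L n + 1) * W n ^ 2 * (2 * (n * m n) + 1)) ^ ⌈(n : ℝ) ^ b⌉₊ ∧
      ∀ ω : Param p (L n), ω.1 ≤ ⌈(n : ℝ) ^ a⌉₊ → (∀ j, |ω.2 j| ≤ n) →
        ω.active ≤ ⌈(n : ℝ) ^ b⌉₊ → ∃ c ∈ C, ∀ i, |paramNet ω (x n i) - c i| ≤
          (L n + 1) * (1 / m n) * ((12 * p * ⌈(n : ℝ) ^ a⌉₊ + p + 1) * n) ^ (L n + 1) := by
    intro n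
    by_cases hn : 1 ≤ n
    · have hm : 1 ≤ m n := Nat.one_le_iff_ne_zero.2 (by simp only [m, W]; positivity)
      obtain ⟨C, h1, h2⟩ := exists_net (p := p) (L := L n) (N' := ⌈(n : ℝ) ^ a⌉₊)
        (s' := ⌈(n : ℝ) ^ b⌉₊) hn hm (hx n)
      exact ⟨C, fun _ => ⟨h1, h2⟩⟩
    · exact ⟨∅, fun h => absurd h hn⟩
  choose C hC using hnet
  refine ⟨fun n => {y | ∀ i, |y i - f₀ (x n i)| ≤ n + 1} ∩ {y | ∀ c₁ ∈ C n,
    |(y - fun i => f₀ (x n i)) ⬝ᵥ (c₁ - fun i => f₀ (x n i))| ≤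
      (c₁ - fun i => f₀ (x n i)) ⬝ᵥ (c₁ - fun i => f₀ (x n i)) / 4 + (n : ℝ) ^ c}, ?_, ?_⟩
  · have t1 := tendsto_ofReal_mul_exp_neg_half
    have t2 : Tendsto (fun n : ℕ => ENNReal.ofReal (2 * (C n).card * Real.exp (-(n : ℝ) ^ c / 2)))
        atTop (𝓝 0) := by
      refine tendsto_zero_of_eventually_le_exp_neg_rpow (C := 2) hb ?_
      filter_upwards [eventually_natCeil_rpow_le ha ha1 1 1,
        eventually_natCeil_rpow_le ha ha1 (12 * p) (p + 1), hL,
        -- Here `120 = 4 * 15 * 2`: the exponent `15`, the factor `2` from rounding up `n ^ b`, and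
        -- the target `n ^ c / 4`.
        eventually_mul_log_pow_mul_rpow_le hbc (120 * (|CL| + 1)) 2,
        eventually_mul_log_pow_mul_rpow_le (zero_lt_one) (|CL| + 1) 1,
        eventually_mul_rpow_le hbc 4, eventually_ge_atTop 3] with n e1 e2 e3 e4 e5 e6 hn
      have hn1 : 1 ≤ n := by omega
      have hnr : (3 : ℝ) ≤ n := by exact_mod_cast hn
      have hlog : 1 ≤ Real.log n := by
        rw [Real.le_log_iff_exp_le (by linarith)]
        linarith [Real.exp_one_lt_d9]
      have hLn : ((L n + 1 : ℕ) : ℝ) ≤ (|CL| + 1) * Real.log n := by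
        push_cast
        nlinarith [le_abs_self CL]
      rw [Real.rpow_one] at e1 e2 e5
      rw [pow_one, Real.rpow_zero, mul_one] at e5
      have hW : W n ≤ n ^ 2 := by
        have : (W n : ℝ) ≤ n := by simp only [W]; push_cast; linarith
        have : W n ≤ n := by exact_mod_cast this
        nlinarith
      have hb1 : (1 : ℝ) ≤ (n : ℝ) ^ b := Real.one_le_rpow (by linarith) hb.le
      have hs : 1 ≤ ⌈(n : ℝ) ^ b⌉₊ := Nat.one_le_ceil_iff.2 (by linarith)
      have hs2 : (⌈(n : ℝ) ^ b⌉₊ : ℝ) ≤ 2 * (n : ℝ) ^ b := by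
        linarith [Nat.ceil_lt_add_one (zero_le_one.trans hb1)]
      have hcard := (hC n hn1).1.trans (net_card_le (m := m n) hn
        (by have : ((⌈(n : ℝ) ^ a⌉₊ + 1 : ℕ) : ℝ) ≤ n := by push_cast; linarith
            exact_mod_cast this) hW
        (by have : ((L n + 1 : ℕ) : ℝ) ≤ n := hLn.trans e5
            exact_mod_cast this) hs rfl)
      have hcard2 : ((C n).card : ℝ) ≤ Real.exp ((n : ℝ) ^ c / 4) := by
        calc ((C n).card : ℝ) ≤ ((n ^ (15 * (L n + 1) * ⌈(n : ℝ) ^ b⌉₊) : ℕ) : ℝ) := by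
              exact_mod_cast hcard
          _ = Real.exp (((15 * (L n + 1) * ⌈(n : ℝ) ^ b⌉₊ : ℕ) : ℝ) * Real.log n) := by
              rw [Real.exp_nat_mul, Real.exp_log (by linarith)]
              push_cast; rfl
          _ ≤ _ := by
              rw [Real.exp_le_exp]
              have : ((15 * (L n + 1) * ⌈(n : ℝ) ^ b⌉₊ : ℕ) : ℝ) * Real.log n
                  ≤ 15 * ((|CL| + 1) * Real.log n) * (2 * (n : ℝ) ^ b) * Real.log n := by
                rw [Nat.cast_mul, Nat.cast_mul]
                gcongr
                norm_num
              refine this.trans ?_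
              nlinarith
      refine ENNReal.ofReal_le_ofReal ?_
      calc 2 * ((C n).card : ℝ) * Real.exp (-(n : ℝ) ^ c / 2)
          ≤ 2 * Real.exp ((n : ℝ) ^ c / 4) * Real.exp (-(n : ℝ) ^ c / 2) := by gcongr
        _ = 2 * Real.exp (-((n : ℝ) ^ c / 4)) := by
            rw [mul_assoc, ← Real.exp_add]; congr 2; ring
        _ ≤ _ := by gcongr; linarith
    have t3 := t1.add t2
    rw [add_zero] at t3
    refine tendsto_of_tendsto_of_tendsto_of_le_of_le tendsto_const_nhds t3 (fun _ => zero_le)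
      fun n => ?_
    rw [Set.compl_inter]
    refine (measure_union_le _ _).trans (add_le_add ?_ ?_)
    · exact gaussLaw_exists_abs_gt (fun i => f₀ (x n i))
    · exact gaussLaw_net_le (fun i => f₀ (x n i)) (C n) _
  · filter_upwards [hK, eventually_ge_atTop 1] with n hKn hn y hy ω hω
    obtain ⟨hω1, hω2, hω3, hω4⟩ := hω
    have hn1 : (1 : ℝ) ≤ n := by exact_mod_cast hn
    -- The net covers coefficients up to `n`. Deep ones are at most one, and for the top layer the
    -- sum of squares is at most `n ^ 2`.
    have hcoef : ∀ j, |ω.2 j| ≤ n := by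
      rintro (j | k)
      · exact (hω3 j).trans hn1
      · refine abs_le_of_sq_le_sq ?_ (by linarith)
        refine le_trans ?_ (hω4.trans hKn)
        exact Finset.single_le_sum (f := fun k => ω.2 (Sum.inr k) ^ 2) (fun k _ => sq_nonneg _)
          (Finset.mem_univ k)
    obtain ⟨c₁, hc₁, hc₁'⟩ := (hC n hn).2 ω hω1 hcoef hω2
    refine abs_noise_le_of_net hy.1 (hy.2 c₁ hc₁) hc₁' (by positivity) (le_of_eq ?_)
    simp only [m, W]
    push_cast
    field_simp

/-! ### Quadratic functionals: scaling the top layer -/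

/-- Scaling of the top layer. -/
noncomputable def topScale (r : ℝ) {p L : ℕ} : (N : ℕ) → TopIdx p L N → ℝ → ℝ :=
  fun _ _ b => r * b

theorem evalNet_topScale {p L n : ℕ} (x : Fin n → Fin p → ℝ) (r : ℝ) (ω : Param p L) :
    evalNet x (topMap (topScale r) ω) = r • evalNet x ω := by
  have hh : ∀ (u : Fin p → ℝ) (l : ℕ) (h : l ≤ L),
      hidden (topMap (topScale r) ω).2 u l h = hidden ω.2 u l h := by
    intro u l
    induction l with
    | zero => intro h; rfl
    | succ l ih => intro h; funext i; simp only [hidden, ih]; rfl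
  funext i
  have h2 := hh (x i) L le_rfl
  have e : ∀ j, hidden (topMap (topScale r) ω).2 (x i) L le_rfl j = hidden ω.2 (x i) L le_rfl j :=
    fun j => congrFun h2 j
  have e1 : ∀ k, (topMap (topScale r) ω).2 (Sum.inr k) = r * ω.2 (Sum.inr k) := fun k => rfl
  simp only [evalNet, paramNet, network, Pi.smul_apply, smul_eq_mul]
  rw [e1, mul_add, Finset.mul_sum]
  congr 1
  refine Finset.sum_congr rfl fun j _ => ?_
  rw [e j, e1, mul_assoc]
  rfl

/-- The density of the scaled prior. -/
noncomputable def topScaleDensity (r : ℝ) {p L : ℕ} (ω : Param p L) : ℝ≥0∞ :=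
  ∏ k : TopIdx p L ω.1,
    ENNReal.ofReal (r⁻¹ * Real.exp (ω.2 (Sum.inr k) ^ 2 / 2 * (1 - (r⁻¹) ^ 2)))

theorem measurable_topScale (r : ℝ) {p L : ℕ} :
    Measurable (topMap (topScale r) : Param p L → Param p L) :=
  measurable_topMap fun _ _ => measurable_const.mul measurable_id

theorem measurable_topScaleDensity (r : ℝ) {p L : ℕ} :
    Measurable (topScaleDensity r : Param p L → ℝ≥0∞) :=
  measurable_prod_top (ρ := fun _ _ b =>
    ENNReal.ofReal (r⁻¹ * Real.exp (b ^ 2 / 2 * (1 - (r⁻¹) ^ 2)))) fun _ _ => by fun_prop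

theorem lintegral_topScale (lam lamS : ℝ) {p L : ℕ} {r : ℝ} (hr : 0 < r) {g : Param p L → ℝ≥0∞}
    (hg : Measurable g) :
    ∫⁻ ω, g (topMap (topScale r) ω) ∂(paramPrior lam lamS p L)
      = ∫⁻ ω, g ω * topScaleDensity r ω ∂(paramPrior lam lamS p L) :=
  lintegral_paramPrior_topMap lam lamS (τ := topScale r)
    (ρ := fun _ _ b => ENNReal.ofReal (r⁻¹ * Real.exp (b ^ 2 / 2 * (1 - (r⁻¹) ^ 2))))
    (fun _ _ => measurable_const.mul measurable_id) (fun _ _ => by fun_prop)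
    (fun _ _ => gaussianReal_map_mul_eq_withDensity hr) hg

theorem topScaleDensity_eq {r : ℝ} (hr : 0 < r) {p L : ℕ} (ω : Param p L) :
    topScaleDensity r ω = ENNReal.ofReal (Real.exp (-((width p ω.1 L + 1 : ℕ) * Real.log r) +
      (∑ k, ω.2 (Sum.inr k) ^ 2) / 2 * (1 - (r⁻¹) ^ 2))) := by
  have h : ∀ k : TopIdx p L ω.1, r⁻¹ * Real.exp (ω.2 (Sum.inr k) ^ 2 / 2 * (1 - (r⁻¹) ^ 2))
      = Real.exp (-Real.log r + ω.2 (Sum.inr k) ^ 2 / 2 * (1 - (r⁻¹) ^ 2)) := by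
    intro k
    rw [Real.exp_add, Real.exp_neg, Real.exp_log hr]
  rw [topScaleDensity]
  simp_rw [h]
  rw [← ENNReal.ofReal_prod_of_nonneg fun _ _ => (Real.exp_pos _).le, ← Real.exp_sum,
    Finset.sum_add_distrib, ← Finset.sum_mul, ← Finset.sum_div, Finset.sum_const, Finset.card_univ,
    Fintype.card_option, Fintype.card_fin]
  simp

theorem abs_log_one_sub_le {δ : ℝ} (h : |δ| ≤ 1 / 2) : |Real.log (1 - δ)| ≤ 2 * |δ| := by
  obtain ⟨h1, h2⟩ := abs_le.1 h
  have hpos : 0 < 1 - δ := by linarith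
  have hup := Real.log_le_sub_one_of_pos hpos
  have hlow := Real.one_sub_inv_le_log_of_pos hpos
  have h3 : -(2 * |δ|) ≤ 1 - (1 - δ)⁻¹ := by
    have : (1 - δ)⁻¹ ≤ 1 + 2 * |δ| := by
      rw [inv_le_iff_one_le_mul₀ hpos]
      rcases abs_cases δ with ⟨e, _⟩ | ⟨e, _⟩ <;> rw [e] at * <;> nlinarith
    linarith
  rw [abs_le]
  constructor
  · linarith
  · linarith [neg_abs_le δ, abs_nonneg δ]

theorem abs_one_sub_sq_le {δ : ℝ} (h : |δ| ≤ 1 / 2) : |(1 - δ) ^ 2 - 1| ≤ 3 * |δ| := by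
  have e : (1 - δ) ^ 2 - 1 = -δ * (2 - δ) := by ring
  have h2 : |2 - δ| ≤ 3 := (abs_sub _ _).trans (by rw [abs_two]; linarith)
  rw [e, abs_mul, abs_neg, mul_comm 3]
  gcongr

theorem abs_one_sub_inv_sq_le {δ : ℝ} (h : |δ| ≤ 1 / 2) :
    |1 - ((1 - δ)⁻¹) ^ 2| ≤ 12 * |δ| := by
  obtain ⟨h1, h2⟩ := abs_le.1 h
  have hpos : 1 / 2 ≤ 1 - δ := by linarith
  have e : 1 - ((1 - δ)⁻¹) ^ 2 = ((1 - δ) ^ 2 - 1) * ((1 - δ)⁻¹) ^ 2 := by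
    have : 1 - δ ≠ 0 := by linarith
    field_simp
  have hinv : (1 - δ)⁻¹ ≤ 2 := by
    rw [inv_le_comm₀ (by linarith) two_pos]; linarith
  have hinv0 : 0 ≤ (1 - δ)⁻¹ := inv_nonneg.2 (by linarith)
  rw [e, abs_mul, abs_of_nonneg (sq_nonneg (1 - δ)⁻¹)]
  have := abs_one_sub_sq_le h
  have h4 : ((1 - δ)⁻¹) ^ 2 ≤ 4 := by nlinarith
  calc _ ≤ 3 * |δ| * 4 := by gcongr
    _ = _ := by ring

/-- The log density is a multiple of `log (1 - δ)` for each top coefficient plus a multiple of their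
squared norm, each factor being `O(δ)`. It vanishes when the width and the squared norm are `o(1 /
δ)`. At the image point the squared norm carries a factor `(1 - δ) ^ 2`. -/
theorem topScaleDensity_topScale_le {δ : ℝ} (h : |δ| ≤ 1 / 2) {p L : ℕ} {ω : Param p L} {d K : ℝ}
    (hd : ((width p ω.1 L + 1 : ℕ) : ℝ) ≤ d) (hK : ∑ k, ω.2 (Sum.inr k) ^ 2 ≤ K) :
    topScaleDensity (1 - δ) (topMap (topScale (1 - δ)) ω)
      ≤ ENNReal.ofReal (Real.exp (|δ| * (2 * d + 6 * K))) := by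
  obtain ⟨h1, h2⟩ := abs_le.1 h
  have hpos : 0 < 1 - δ := by linarith
  rw [topScaleDensity_eq hpos]
  refine ofReal_exp_le ?_
  have e : ∀ k, (topMap (topScale (1 - δ)) ω).2 (Sum.inr k) = (1 - δ) * ω.2 (Sum.inr k) :=
    fun k => rfl
  have e2 : ∑ k, (topMap (topScale (1 - δ)) ω).2 (Sum.inr k) ^ 2
      = (1 - δ) ^ 2 * ∑ k, ω.2 (Sum.inr k) ^ 2 := by
    rw [Finset.mul_sum]
    exact Finset.sum_congr rfl fun k _ => by rw [e]; ring
  rw [e2]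
  set S := ∑ k, ω.2 (Sum.inr k) ^ 2
  have hS : 0 ≤ S := Finset.sum_nonneg fun _ _ => sq_nonneg _
  have e3 : (1 - δ) ^ 2 * S / 2 * (1 - ((1 - δ)⁻¹) ^ 2) = S / 2 * ((1 - δ) ^ 2 - 1) := by
    field_simp
  rw [e3]
  have i1 : S / 2 * ((1 - δ) ^ 2 - 1) ≤ K / 2 * (3 * |δ|) :=
    (mul_le_mul_of_nonneg_left ((le_abs_self _).trans (abs_one_sub_sq_le h)) (by linarith)).trans
        (mul_le_mul_of_nonneg_right (by linarith) (by positivity))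
  have i2 : -(((width p ω.1 L + 1 : ℕ) : ℝ) * Real.log (1 - δ)) ≤ d * (2 * |δ|) := by
    rw [← mul_neg]
    exact (mul_le_mul_of_nonneg_left ((neg_le_abs _).trans (abs_log_one_sub_le h))
      (Nat.cast_nonneg _)).trans (mul_le_mul_of_nonneg_right hd (by positivity))
  have hK0 : 0 ≤ |δ| * K := mul_nonneg (abs_nonneg δ) (hS.trans hK)
  have e4 : (topMap (topScale (1 - δ)) ω).1 = ω.1 := rfl
  rw [e4]
  nlinarith

theorem le_topScaleDensity {δ : ℝ} (h : |δ| ≤ 1 / 2) {p L : ℕ} {ω : Param p L} {d K : ℝ}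
    (hd : ((width p ω.1 L + 1 : ℕ) : ℝ) ≤ d) (hK : ∑ k, ω.2 (Sum.inr k) ^ 2 ≤ K) :
    ENNReal.ofReal (Real.exp (-(|δ| * (2 * d + 6 * K)))) ≤ topScaleDensity (1 - δ) ω := by
  obtain ⟨h1, h2⟩ := abs_le.1 h
  have hpos : 0 < 1 - δ := by linarith
  rw [topScaleDensity_eq hpos]
  refine ofReal_exp_le ?_
  set S := ∑ k, ω.2 (Sum.inr k) ^ 2
  have hS : 0 ≤ S := Finset.sum_nonneg fun _ _ => sq_nonneg _
  have i1 : S / 2 * -(1 - ((1 - δ)⁻¹) ^ 2) ≤ K / 2 * (12 * |δ|) :=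
    (mul_le_mul_of_nonneg_left ((neg_le_abs _).trans (abs_one_sub_inv_sq_le h)) (by linarith)).trans
        (mul_le_mul_of_nonneg_right (by linarith) (by positivity))
  have i2 : ((width p ω.1 L + 1 : ℕ) : ℝ) * Real.log (1 - δ) ≤ d * (2 * |δ|) :=
    (mul_le_mul_of_nonneg_left ((le_abs_self _).trans (abs_log_one_sub_le h))
      (Nat.cast_nonneg _)).trans (mul_le_mul_of_nonneg_right hd (by positivity))
  nlinarith

/-- Scaling the regression function shifts the log likelihood by the recentred quadratic
functional, up to a small remainder. -/
theorem logLR_smul_sub {n : ℕ} (θ₀ y θ : Fin n → ℝ) (δ : ℝ) :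
    δ / 2 * (θ ⬝ᵥ θ - θ₀ ⬝ᵥ θ₀ - 2 * ((y - θ₀) ⬝ᵥ θ₀)) - δ ^ 2 / 2 * (θ₀ ⬝ᵥ θ₀)
      - (logLR θ₀ y ((1 - δ) • θ) - logLR θ₀ y θ)
      = δ * ((y - θ₀) ⬝ᵥ (θ - θ₀)) + (δ ^ 2 / 2 - δ / 2) * ((θ - θ₀) ⬝ᵥ (θ - θ₀))
        + δ ^ 2 * ((θ - θ₀) ⬝ᵥ θ₀) := by
  simp only [logLR, sub_dotProduct, dotProduct_sub, smul_dotProduct, dotProduct_smul, smul_eq_mul,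
    dotProduct_comm θ₀ θ]
  ring

theorem active_topScale {r : ℝ} (hr : r ≠ 0) {p L : ℕ} (ω : Param p L) :
    (topMap (topScale r) ω).active = ω.active := by
  classical
  simp only [Param.active]
  refine congrArg Finset.card (Finset.filter_congr fun j _ => ?_)
  rcases j with j | k
  · rfl
  · change r * _ ≠ 0 ↔ _
    simp only [ne_eq, mul_eq_zero, hr, false_or]
    rfl

theorem empNormSq_sub_eq {p n : ℕ} (hn : 0 < n) (x : Fin n → Fin p → ℝ)
    (f₀ f : (Fin p → ℝ) → ℝ) (y : Fin n → ℝ) :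
    Real.sqrt n * (empNormSq x f - (empNormSq x f₀ + 2 / Real.sqrt n * noise f₀ x y f₀))
      = 1 / Real.sqrt n * ((fun i => f (x i)) ⬝ᵥ (fun i => f (x i))
        - (fun i => f₀ (x i)) ⬝ᵥ (fun i => f₀ (x i))
        - 2 * ((y - fun i => f₀ (x i)) ⬝ᵥ fun i => f₀ (x i))) := by
  have hn0 : (0 : ℝ) < n := by exact_mod_cast hn
  have hs : 0 < Real.sqrt n := Real.sqrt_pos.2 hn0
  have e1 : ∀ g : (Fin p → ℝ) → ℝ, empNormSq x g = 1 / n * ((fun i => g (x i)) ⬝ᵥ fun i => g (x i)) := by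
    intro g
    simp only [empNormSq, dotProduct, sq]
  have e3 : noise f₀ x y f₀ = Real.sqrt n / n * ((y - fun i => f₀ (x i)) ⬝ᵥ fun i => f₀ (x i)) := by
    simp only [noise, dotProduct, Pi.sub_apply, mul_assoc, ← Finset.mul_sum]
    ring
  rw [e1, e1, e3]
  generalize (fun i => f (x i)) ⬝ᵥ (fun i => f (x i)) = S₁
  generalize (fun i => f₀ (x i)) ⬝ᵥ (fun i => f₀ (x i)) = S₂
  generalize (y - fun i => f₀ (x i)) ⬝ᵥ (fun i => f₀ (x i)) = S₃
  have : (n : ℝ) = Real.sqrt n ^ 2 := (Real.sq_sqrt hn0.le).symm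
  rw [this]
  field_simp
  rw [Real.sqrt_sq hs.le]
  field_simp
  ring

theorem empNormSq_le {p n : ℕ} {f₀ : (Fin p → ℝ) → ℝ} {x : Fin n → Fin p → ℝ} {F : ℝ}
    (hF : ∀ i, |f₀ (x i)| ≤ F) : empNormSq x f₀ ≤ F ^ 2 := by
  rcases Nat.eq_zero_or_pos n with rfl | hn
  · simp [empNormSq]; positivity
  · have hn0 : (0 : ℝ) < n := by exact_mod_cast hn
    rw [empNormSq, one_div, inv_mul_le_iff₀ hn0]
    calc ∑ i, f₀ (x i) ^ 2 ≤ ∑ _i : Fin n, F ^ 2 := by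
          refine Finset.sum_le_sum fun i _ => ?_
          rw [← sq_abs]
          gcongr
          exact hF i
      _ = _ := by simp

/-- Closeness to the truth is first known for the scaled function; undoing the scaling costs a
factor and the term `δ ^ 2 * (θ₀ ⬝ᵥ θ₀)`, which is bounded for `δ` of order `1 / √n` and bounded
`f₀`. -/
theorem dotProduct_self_le_of_smul {n : ℕ} {θ θ₀ : Fin n → ℝ} {δ M R : ℝ} (h : |δ| ≤ 1 / 2)
    (hM : δ ^ 2 * (θ₀ ⬝ᵥ θ₀) ≤ M) (hR : ((1 - δ) • θ - θ₀) ⬝ᵥ ((1 - δ) • θ - θ₀) ≤ R) :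
    (θ - θ₀) ⬝ᵥ (θ - θ₀) ≤ 8 * R + 8 * M := by
  obtain ⟨h1, h2⟩ := abs_le.1 h
  have hr : 0 < 1 - δ := by linarith
  have hinv : (1 - δ)⁻¹ ≤ 2 := by
    rw [inv_le_comm₀ hr two_pos]; linarith
  have hinv0 : 0 ≤ (1 - δ)⁻¹ := inv_nonneg.2 hr.le
  have hinv4 : (1 - δ)⁻¹ ^ 2 ≤ 4 := by nlinarith
  have hdec : θ - θ₀ = (1 - δ)⁻¹ • ((1 - δ) • θ - θ₀) + ((1 - δ)⁻¹ * δ) • θ₀ := by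
    funext i
    simp only [Pi.sub_apply, Pi.add_apply, Pi.smul_apply, smul_eq_mul]
    field_simp
    ring
  set w := (1 - δ) • θ - θ₀
  have k7 := dotProduct_self_add_le ((1 - δ)⁻¹ • w) (((1 - δ)⁻¹ * δ) • θ₀) one_pos
  rw [← hdec] at k7
  simp only [smul_dotProduct, dotProduct_smul, smul_eq_mul] at k7
  have k8 : (1 - δ)⁻¹ ^ 2 * (w ⬝ᵥ w) ≤ 4 * R :=
    mul_le_mul hinv4 hR (dotProduct_self_nonneg' _) (by norm_num)
  have k9 : (1 - δ)⁻¹ ^ 2 * (δ ^ 2 * (θ₀ ⬝ᵥ θ₀)) ≤ 4 * M :=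
    mul_le_mul hinv4 hM (mul_nonneg (sq_nonneg _) (dotProduct_self_nonneg' _)) (by norm_num)
  refine k7.trans ?_
  norm_num
  linarith

/-! ### Posterior of the squared norm -/

/-- Three separated scales: widths up to `n ^ b` leave a tail that beats `n ^ a`; sparsity and top
radius at scale `n ^ c` dominate the number of top coefficients, which is of order `n ^ b`, and the
logarithm of the number of all coefficients. -/
theorem exists_paramPrior_sieve_compl_le (p : ℕ) {lam lamS : ℝ} (hlam : 0 < lam) (hlamS : 0 < lamS)
    {L : ℕ → ℕ} {CL : ℝ} (hL : ∀ᶠ n : ℕ in atTop, (L n : ℝ) ≤ CL * Real.log n)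
    {a b c : ℝ} (ha : 0 < a) (hab : a < b) (hbc : b < c) :
    ∃ C, ∀ᶠ n : ℕ in atTop, paramPrior lam lamS p (L n)
      (sieve p (L n) ⌈(n : ℝ) ^ b⌉₊ ⌈(n : ℝ) ^ c⌉₊ ((n : ℝ) ^ c * (1 / 4)))ᶜ
      ≤ ENNReal.ofReal (C * Real.exp (-(3 * (n : ℝ) ^ a))) := by
  have hb : 0 < b := ha.trans hab
  have hlam' : 0 < Real.exp lam - 1 := by linarith [Real.add_one_lt_exp hlam.ne']
  refine ⟨Real.exp (lam * Real.exp 1) / (Real.exp lam - 1) + (1 + 1), ?_⟩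
  filter_upwards [hL, eventually_mul_rpow_le hab 3, eventually_mul_rpow_le (hab.trans hbc) 96,
    eventually_mul_rpow_le (hab.trans hbc) (12 / lamS),
    eventually_natCeil_rpow_le hb hbc (32 * (12 * p)) (32 * (p + 1)),
    eventually_natCeil_rpow_le hb hbc (4 * (2 + lamS) / lamS * (12 * p))
      (4 * (2 + lamS) / lamS * (p + 1)),
    eventually_mul_log_pow_mul_rpow_le (hb.trans hbc) (4 / lamS * CL) 1]
    with n e0 e1 e2 e3 e4 e5 e6
  refine (paramPrior_sieve_compl_le hlam hlamS p (L n) _ _ _).trans (ENNReal.ofReal_le_ofReal ?_)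
  have hN := Nat.le_ceil ((n : ℝ) ^ b)
  have hs := Nat.le_ceil ((n : ℝ) ^ c)
  set N : ℕ := ⌈(n : ℝ) ^ b⌉₊
  set s : ℕ := ⌈(n : ℝ) ^ c⌉₊
  set D : ℝ := 12 * p * N + p + 1 with hD
  have hD0 : 0 ≤ D := by positivity
  have hDc : ((12 * p * N + p + 1 : ℕ) : ℝ) = D := by push_cast; rfl
  have f4 : 32 * D ≤ (n : ℝ) ^ c := by rw [hD]; linarith
  have f5 : 4 * (2 + lamS) * D ≤ (n : ℝ) ^ c * lamS := by
    have : 4 * (2 + lamS) / lamS * D ≤ (n : ℝ) ^ c := by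
      rw [hD]; linarith
    rwa [div_mul_eq_mul_div, div_le_iff₀ hlamS] at this
  have f3 : 12 * (n : ℝ) ^ a ≤ (n : ℝ) ^ c * lamS := by
    rwa [div_mul_eq_mul_div, div_le_iff₀ hlamS] at e3
  have f6 : 4 * (CL * Real.log n) ≤ (n : ℝ) ^ c * lamS := by
    rw [pow_one, Real.rpow_zero, mul_one, mul_assoc, div_mul_eq_mul_div, div_le_iff₀ hlamS] at e6
    exact e6
  have hsplit : ∀ c₁ e₁ : ℝ, (c₁ + (1 + 1)) * e₁ = c₁ * e₁ + (e₁ + e₁) := fun _ _ => by ring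
  rw [hsplit]
  refine add_le_add ?_ (add_le_add ?_ ?_)
  · gcongr
    linarith
  · calc Real.exp (-((n : ℝ) ^ c * (1 / 4)) / 4) * 2 ^ (12 * p * N + p + 1)
        ≤ Real.exp (-((n : ℝ) ^ c * (1 / 4)) / 4) * Real.exp D := by
          gcongr
          rw [← hDc, ← mul_one ((12 * p * N + p + 1 : ℕ) : ℝ), Real.exp_nat_mul]
          gcongr
          linarith [Real.add_one_le_exp (1 : ℝ)]
      _ ≤ _ := by
          rw [← Real.exp_add, Real.exp_le_exp]
          linarith
  · calc (((L n + 1) * (12 * p * N + p + 1) ^ 2 : ℕ) : ℝ) * Real.exp (-lamS * (s - (12 * p * N + p + 1)))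
        ≤ (Real.exp (L n) * (Real.exp D) ^ 2) * Real.exp (-lamS * (s - D)) := by
          rw [Nat.cast_mul, Nat.cast_pow, hDc]
          gcongr
          · push_cast; exact Real.add_one_le_exp _
          · linarith [Real.add_one_le_exp D]
      _ = Real.exp (L n + 2 * D + -lamS * (s - D)) := by
          rw [← Real.exp_nat_mul, ← Real.exp_add, ← Real.exp_add]; push_cast; rfl
      _ ≤ _ := by
          rw [Real.exp_le_exp]
          nlinarith

set_option maxHeartbeats 800000 in
/-- Asymptotic normality of the squared norm. -/
theorem asymptoticallyNormal_empNormSq {p : ℕ} {f₀ : (Fin p → ℝ) → ℝ}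
    {x : (n : ℕ) → Fin n → Fin p → ℝ} (hx : ∀ n i j, |x n i j| ≤ 1) {F : ℝ}
    (hF : ∀ n i, |f₀ (x n i)| ≤ F) {lam lamS : ℝ} (hlam : 0 < lam) (hlamS : 0 < lamS) {L : ℕ → ℕ}
    {CL : ℝ} (hL : ∀ᶠ n : ℕ in atTop, (L n : ℝ) ≤ CL * Real.log n)
    {γ : ℝ} (hγ0 : 0 < γ) (hγ1 : γ < 1 / 2) (hE : EvidenceBound lam lamS f₀ x L γ) :
    AsymptoticallyNormal (fun n => dataLaw f₀ (x n))
        (fun n y => posterior (prior lam lamS p (L n)) (x n) y)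
        (fun n f => empNormSq (x n) f)
        (fun n y => empNormSq (x n) f₀ + 2 / Real.sqrt n * noise f₀ (x n) y f₀)
        (fun n => 4 * empNormSq (x n) f₀) := by
  -- A ladder `γ < g2 < g3 < g4 < g5 < 1 / 2`: evidence, width, sparsity and top radius, noise level
  -- on the net, and squared distance to the truth. Each step absorbs constants and logarithms.
  obtain ⟨g2, h12, h2⟩ := exists_between hγ1
  obtain ⟨g3, h23, h3⟩ := exists_between h2
  obtain ⟨g4, h34, h4⟩ := exists_between h3
  obtain ⟨g5, h45, h5⟩ := exists_between h4
  have hg2 : 0 < g2 := hγ0.trans h12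
  have hg3 : 0 < g3 := hg2.trans h23
  have hg4 : 0 < g4 := hg3.trans h34
  have hg5 : 0 < g5 := hg4.trans h45
  let v : (n : ℕ) → Param p (L n) → Fin n → ℝ := fun n ω =>
    evalNet (x n) ω - fun i => f₀ (x n i)
  have hv : ∀ n, Measurable (v n) := fun n => (measurable_evalNet (x n)).sub_const _
  let S : (n : ℕ) → ℝ → Set (Param p (L n)) := fun n q =>
    sieve p (L n) ⌈(n : ℝ) ^ g2⌉₊ ⌈(n : ℝ) ^ g3⌉₊ ((n : ℝ) ^ g3 * q)
  have hS : ∀ n q, MeasurableSet (S n q) := fun n q => measurableSet_sieve _ _ _ _ _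
  -- The constants `q` and `q'` give an inner and an outer version, with room for the effect of
  -- scaling.
  let A : (n : ℕ) → ℝ → ℝ → Set (Param p (L n)) := fun n q q' =>
    S n q ∩ {ω | v n ω ⬝ᵥ v n ω ≤ (n : ℝ) ^ g5 * q'}
  have hA : ∀ n q q', MeasurableSet (A n q q') := fun n q q' => (hS n q).inter
    (measurableSet_le (measurable_dotProduct (hv n) (hv n)) measurable_const)
  obtain ⟨H, hH, hHc⟩ := exists_noise_control (p := p) f₀ hx hL hg2 (by linarith) hg3 h34
    (K := fun n => (n : ℝ) ^ g3 * 1) (by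
      filter_upwards [eventually_mul_rpow_le (show g3 < (2 : ℝ) by linarith) 1] with n hn
      rw [mul_comm]
      exact_mod_cast hn)
  let G : (n : ℕ) → Set (Fin n → ℝ) := fun n =>
    {y | ENNReal.ofReal (Real.exp (-(n : ℝ) ^ γ)) ≤
      ∫⁻ ω, ENNReal.ofReal (Real.exp (netLR f₀ (x n) y ω)) ∂(paramPrior lam lamS p (L n))} ∩
    {y | ∫⁻ ω in (S n (1 / 4))ᶜ, ENNReal.ofReal (Real.exp (netLR f₀ (x n) y ω))
      ∂(paramPrior lam lamS p (L n)) < ENNReal.ofReal (Real.exp (-(2 * (n : ℝ) ^ γ)))} ∩ H n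
  have hprior : ∃ C, ∀ᶠ n in atTop, paramPrior lam lamS p (L n) (S n (1 / 4))ᶜ
      ≤ ENNReal.ofReal (C * Real.exp (-(3 * (n : ℝ) ^ γ))) :=
    exists_paramPrior_sieve_compl_le p hlam hlamS hL hγ0 h12 h23
  obtain ⟨C₀, hprior⟩ := hprior
  have hG : Tendsto (fun n => dataLaw f₀ (x n) (G n)ᶜ) atTop (𝓝 0) := by
    have h2 : Tendsto (fun n => dataLaw f₀ (x n) {y | ENNReal.ofReal (Real.exp (-(2 * (n : ℝ) ^ γ))) ≤
        ∫⁻ ω in (S n (1 / 4))ᶜ, ENNReal.ofReal (Real.exp (netLR f₀ (x n) y ω))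
          ∂(paramPrior lam lamS p (L n))}) atTop (𝓝 0) := by
      refine tendsto_zero_of_eventually_le_exp_neg_rpow (C := C₀) hγ0 ?_
      filter_upwards [hprior] with n hn
      refine (dataLaw_setLIntegral_ge_le hlam lamS f₀ (x n) _ hn).trans
        (ENNReal.ofReal_le_ofReal (le_of_eq ?_))
      rw [mul_left_comm, ← Real.exp_add]
      congr 2
      ring
    have h3 := (hE.add h2).add hH
    rw [add_zero, add_zero] at h3
    refine tendsto_of_tendsto_of_tendsto_of_le_of_le tendsto_const_nhds h3 (fun _ => zero_le)
      fun n => ?_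
    refine le_trans (measure_mono ?_) ((measure_union_le _ _).trans
      (add_le_add (measure_union_le _ _) le_rfl))
    intro y hy
    by_contra hcon
    simp only [Set.mem_union, Set.mem_ofPred_eq, not_or, not_le, not_lt, Set.mem_compl_iff,
      not_not] at hcon
    exact hy ⟨⟨hcon.1.1, hcon.1.2⟩, hcon.2⟩
  refine asymptoticallyNormal_of_forall_seq (fun n => by unfold dataLaw; infer_instance) G hG
    fun y hy => ?_
  let Ψ : (n : ℕ) → ((Fin p → ℝ) → ℝ) → ℝ := fun n f => Real.sqrt n * (empNormSq (x n) f -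
    (empNormSq (x n) f₀ + 2 / Real.sqrt n * noise f₀ (x n) (y n) f₀))
  have hΨ : ∀ n, Measurable (Ψ n) := by
    intro n
    refine Measurable.const_mul (Measurable.sub_const ?_ _) _
    refine Measurable.const_mul (Finset.measurable_fun_sum _ fun i _ => ?_) _
    exact (measurable_pi_apply (x n i)).pow_const _
  have hpost : ∀ n, (posterior (prior lam lamS p (L n)) (x n) (y n)).map (Ψ n) =
      (gibbs (paramPrior lam lamS p (L n)) fun ω =>
        ENNReal.ofReal (Real.exp (netLR f₀ (x n) (y n) ω))).map (fun ω => Ψ n (paramNet ω)) := by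
    intro n
    rw [posterior_prior_eq_map_gibbs lam lamS (x n) (y n) f₀,
      Measure.map_map (hΨ n) measurable_paramNet]
    rfl
  change Tendsto (fun n => blDist ((posterior (prior lam lamS p (L n)) (x n) (y n)).map (Ψ n)) _) _ _
  simp_rw [hpost]
  have hconc : Tendsto (fun n => gibbs (paramPrior lam lamS p (L n))
      (fun ω => ENNReal.ofReal (Real.exp (netLR f₀ (x n) (y n) ω))) (A n (1 / 4) (1 / 16))ᶜ)
      atTop (𝓝 0) := by
    have hlim : Tendsto (fun n : ℕ => ENNReal.ofReal (Real.exp (-(n : ℝ) ^ γ)) +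
        ENNReal.ofReal (Real.exp (-(n : ℝ) ^ γ))) atTop (𝓝 0) := by
      simpa using (tendsto_exp_neg_rpow hγ0).add (tendsto_exp_neg_rpow hγ0)
    refine tendsto_of_tendsto_of_tendsto_of_le_of_le' tendsto_const_nhds hlim
      (Eventually.of_forall fun _ => zero_le) ?_
    filter_upwards [hy, hHc, eventually_mul_rpow_le h45 (3 * 256),
      eventually_mul_rpow_le (h12.trans (h23.trans (h34.trans h45))) (2 * 256),
      eventually_ge_atTop 1] with n hn hc e1 e2 hn1
    have hnr : (1 : ℝ) ≤ n := by exact_mod_cast hn1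
    have hg4n : (1 : ℝ) ≤ (n : ℝ) ^ g4 := Real.one_le_rpow hnr hg4.le
    -- On the sieve but far from `f₀`, the controlled noise leaves a log likelihood ratio of at most
    -- `-1/8` of the squared distance plus lower order terms. It is below `-2 * n ^ γ` uniformly, so
    -- no tests are needed.
    let E : Set (Param p (L n)) := S n (1 / 4) ∩ {ω | v n ω ⬝ᵥ v n ω ≤ (n : ℝ) ^ g5 * (1 / 16)}ᶜ
    have hE : MeasurableSet E := (hS n _).inter
      (measurableSet_le (measurable_dotProduct (hv n) (hv n)) measurable_const).compl
    have hsub : (A n (1 / 4) (1 / 16))ᶜ ⊆ (S n (1 / 4))ᶜ ∪ E := by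
      intro ω hω
      by_cases h : ω ∈ S n (1 / 4)
      · exact Or.inr ⟨h, fun h' => hω ⟨h, h'⟩⟩
      · exact Or.inl h
    refine (measure_mono hsub).trans ((measure_union_le _ _).trans (add_le_add ?_ ?_))
    · refine (gibbs_apply_le (hS n _).compl hn.1.1 hn.1.2.le).trans (ofReal_exp_le ?_)
      linarith
    · have hint : ∫⁻ ω in E, ENNReal.ofReal (Real.exp (netLR f₀ (x n) (y n) ω))
          ∂(paramPrior lam lamS p (L n)) ≤ ENNReal.ofReal (Real.exp (-(2 * (n : ℝ) ^ γ))) := by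
        calc _ ≤ ∫⁻ ω in E, ENNReal.ofReal (Real.exp (-(2 * (n : ℝ) ^ γ)))
              ∂(paramPrior lam lamS p (L n)) := by
              refine setLIntegral_mono' hE fun ω hω => ofReal_exp_le ?_
              have hω1 : ω ∈ S n 1 := by
                refine ⟨hω.1.1, hω.1.2.1, hω.1.2.2.1, hω.1.2.2.2.trans ?_⟩
                have : 0 ≤ (n : ℝ) ^ g3 := by positivity
                linarith
              have h1 := (le_abs_self _).trans (hc (y n) hn.2 ω hω1)
              have h2 : (n : ℝ) ^ g5 * (1 / 16) < v n ω ⬝ᵥ v n ω := not_le.1 hω.2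
              simp only [netLR, logLR]
              simp only [v] at h2
              linarith
          _ = ENNReal.ofReal (Real.exp (-(2 * (n : ℝ) ^ γ))) * paramPrior lam lamS p (L n) E :=
              setLIntegral_const _ _
          _ ≤ _ := mul_le_of_le_one_right' ((measure_mono (Set.subset_univ _)).trans
              (paramPrior_univ_le hlam lamS p (L n)))
      refine (gibbs_apply_le hE hn.1.1 hint).trans (ofReal_exp_le ?_)
      linarith
  refine tendsto_blDist_gibbs (A := fun n => A n 1 1) (C := 4 * F ^ 2)
    (fun n => by unfold empNormSq; positivity)
    (fun n => mul_le_mul_of_nonneg_left (empNormSq_le (hF n)) (by norm_num))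
    (fun n => measurable_netLR f₀ (x n) (y n))
    (fun n => (hΨ n).comp measurable_paramNet) (fun n => hA n _ _) ?_
    (Eventually.of_forall fun n => lintegral_netLR_ne_top hlam lamS f₀ (x n) (y n)) ?_
  · filter_upwards [hy] with n hn h0
    have := hn.1.1
    simp only [Set.mem_ofPred_eq] at this
    rw [h0] at this
    simp at this
    exact absurd this (not_le.2 (Real.exp_pos _))
  intro t
  -- The scaling whose first order effect on the log likelihood ratio is `t` times the recentred
  -- squared norm.
  let δ : ℕ → ℝ := fun n => 2 * t / Real.sqrt n
  have hδsq : ∀ n : ℕ, 0 < n → n * δ n ^ 2 = 4 * t ^ 2 := by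
    intro n hn
    have hn0 : (0 : ℝ) < n := by exact_mod_cast hn
    simp only [δ]
    rw [div_pow, Real.sq_sqrt hn0.le]
    field_simp
    ring
  have habs : ∀ n : ℕ, 0 < n → |δ n| = 2 * |t| * (n : ℝ) ^ (-(1 / 2) : ℝ) := by
    intro n hn
    simp only [δ]
    rw [abs_div, abs_of_nonneg (Real.sqrt_nonneg _), Real.sqrt_eq_rpow, div_eq_mul_inv,
      Real.rpow_neg (by positivity), abs_mul, abs_two]
  -- The first term bounds noise, squared error and log density. The second bounds the cross term
  -- with `f₀` by a weighted square inequality; any weight `n ^ w` with `0 < w < 1 - g5` would do,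
  -- and `w = 1 / 4` is one choice.
  let η : ℕ → ℝ := fun n => |δ n| * (8 * (n : ℝ) ^ g5) +
    δ n ^ 2 * ((n : ℝ) ^ (1 / 4 : ℝ) * (n : ℝ) ^ g5 + ((n : ℝ) ^ (1 / 4 : ℝ))⁻¹ * (n * F ^ 2))
  have hη : Tendsto η atTop (𝓝 0) := by
    have hlim : ∀ (c : ℝ) {e : ℝ}, 0 < e →
        Tendsto (fun n : ℕ => c * (n : ℝ) ^ (-e)) atTop (𝓝 0) := by
      intro c e he
      simpa using ((tendsto_rpow_neg_atTop he).comp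
        (tendsto_natCast_atTop_atTop (R := ℝ))).const_mul c
    have e1 := ((hlim (16 * |t|) (show 0 < 1 / 2 - g5 by linarith)).add
      (hlim (4 * t ^ 2) (show 0 < 3 / 4 - g5 by linarith))).add
      (hlim (4 * t ^ 2 * F ^ 2) (show (0 : ℝ) < 1 / 4 by norm_num))
    rw [add_zero, add_zero] at e1
    refine e1.congr' ?_
    filter_upwards [eventually_gt_atTop 0] with n hn
    have hn0 : (0 : ℝ) < n := by exact_mod_cast hn
    have h3 : δ n ^ 2 = 4 * t ^ 2 * (n : ℝ) ^ (-1 : ℝ) := by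
      rw [← hδsq n hn, Real.rpow_neg_one]; field_simp
    have i1 : (n : ℝ) ^ (-(1 / 2 - g5)) = (n : ℝ) ^ (-(1 / 2) : ℝ) * (n : ℝ) ^ g5 := by
      rw [← Real.rpow_add hn0]; congr 1; ring
    have i2 : (n : ℝ) ^ (-(3 / 4 - g5)) = (n : ℝ) ^ (-1 : ℝ) * (n : ℝ) ^ (1 / 4 : ℝ) * (n : ℝ) ^ g5 := by
      rw [← Real.rpow_add hn0, ← Real.rpow_add hn0]; congr 1; ring
    have i3 : (n : ℝ) ^ (-1 : ℝ) * n = 1 := by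
      rw [Real.rpow_neg_one]; field_simp
    simp only [η]
    rw [habs n hn, h3, ← Real.rpow_neg hn0.le, i1, i2]
    linear_combination (-4 * t ^ 2 * F ^ 2 * (n : ℝ) ^ (-(1 / 4) : ℝ)) * i3
  have hδ0 : Tendsto (fun n => |δ n|) atTop (𝓝 0) := by
    have := ((tendsto_rpow_neg_atTop (show (0 : ℝ) < 1 / 2 by norm_num)).comp
        (tendsto_natCast_atTop_atTop (R := ℝ))).const_mul (2 * |t|)
    rw [mul_zero] at this
    refine this.congr' ?_
    filter_upwards [eventually_gt_atTop 0] with n hn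
    rw [habs n hn]; rfl
  refine ⟨fun n => topMap (topScale (1 - δ n)), fun n => topScaleDensity (1 - δ n),
    fun n => A n (1 / 4) (1 / 16), η, hη, hconc, ?_⟩
  filter_upwards [hy, hHc, hδ0.eventually (ge_mem_nhds (show (0 : ℝ) < 1 / 2 by norm_num)),
    eventually_mul_rpow_le h45 1, eventually_mul_rpow_le (h34.trans h45) 1,
    eventually_natCeil_rpow_le hg2 (h23.trans (h34.trans h45)) (12 * p) (p + 1),
    -- Makes `8 * (4 * t ^ 2 * F ^ 2)` at most half of `n ^ g5`; together with `8 / 16` this closes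
    -- the passage from the inner to the outer set. The summand `2` absorbs the constant in the
    -- noise bound.
    eventually_mul_rpow_le hg5 (64 * t ^ 2 * F ^ 2 + 2), eventually_gt_atTop 0]
    with n hn hc hδ e1 e2 e3 e4 hn0
  rw [Real.rpow_zero, mul_one] at e4
  rw [one_mul] at e1 e2
  have hnr : (0 : ℝ) < n := by exact_mod_cast hn0
  obtain ⟨hδ1, hδ2⟩ := abs_le.1 hδ
  have hr : 0 < 1 - δ n := by linarith
  have hsqF : 0 ≤ t ^ 2 * F ^ 2 := by positivity
  have hθ₀ : (fun i => f₀ (x n i)) ⬝ᵥ (fun i => f₀ (x n i)) ≤ n * F ^ 2 := by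
    have := empNormSq_le (hF n)
    rw [empNormSq, one_div, inv_mul_le_iff₀ hnr] at this
    simpa [dotProduct, sq] using this
  have hηnn : 0 ≤ δ n ^ 2 *
      ((n : ℝ) ^ (1 / 4 : ℝ) * (n : ℝ) ^ g5 + ((n : ℝ) ^ (1 / 4 : ℝ))⁻¹ * (n * F ^ 2)) := by
    positivity
  have hwidth : ∀ ω ∈ S n 1, ((width p ω.1 (L n) + 1 : ℕ) : ℝ) ≤ (n : ℝ) ^ g5 := by
    intro ω hω
    refine le_trans ?_ e3
    have := width_le (p := p) (N := ω.1) (W := 12 * p * ⌈(n : ℝ) ^ g2⌉₊ + p) (Nat.le_add_left _ _)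
      ((Nat.mul_le_mul_left _ hω.1).trans (Nat.le_add_right _ _)) (L n)
    have h2 : ((width p ω.1 (L n) : ℕ) : ℝ) ≤ ((12 * p * ⌈(n : ℝ) ^ g2⌉₊ + p : ℕ) : ℝ) := by
      exact_mod_cast this
    push_cast at h2 ⊢
    linarith
  have hSmono : S n (1 / 4) ⊆ S n 1 := by
    intro ω hω
    refine ⟨hω.1, hω.2.1, hω.2.2.1, hω.2.2.2.trans ?_⟩
    have : 0 ≤ (n : ℝ) ^ g3 := by positivity
    linarith
  have htop : ∀ ω ∈ S n 1, ∑ k, ω.2 (Sum.inr k) ^ 2 ≤ (n : ℝ) ^ g5 := fun ω hω =>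
    hω.2.2.2.trans (by rw [mul_one]; exact e2)
  have hρη : |δ n| * (2 * (n : ℝ) ^ g5 + 6 * (n : ℝ) ^ g5) ≤ η n := by
    simp only [η]; linarith
  refine ⟨measurable_topScale _, measurable_topScaleDensity _, hA n _ _,
    fun g hg => lintegral_topScale lam lamS hr hg, ?_, ?_, ?_, ?_⟩
  · intro ω hω
    have hvv : v n ω ⬝ᵥ v n ω ≤ (n : ℝ) ^ g5 := by
      have := hω.2
      simpa using this
    have hvv0 : 0 ≤ v n ω ⬝ᵥ v n ω := dotProduct_self_nonneg' _
    have hnoise : |(y n - fun i => f₀ (x n i)) ⬝ᵥ v n ω| ≤ 3 / 8 * (v n ω ⬝ᵥ v n ω) + (n : ℝ) ^ g4 + 2 :=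
      hc (y n) hn.2 ω hω.1
    have e : t * Ψ n (paramNet ω) - t ^ 2 * (4 * empNormSq (x n) f₀) / 2 -
        (netLR f₀ (x n) (y n) (topMap (topScale (1 - δ n)) ω) - netLR f₀ (x n) (y n) ω)
        = δ n * ((y n - fun i => f₀ (x n i)) ⬝ᵥ v n ω) + (δ n ^ 2 / 2 - δ n / 2) * (v n ω ⬝ᵥ v n ω)
          + δ n ^ 2 * (v n ω ⬝ᵥ fun i => f₀ (x n i)) := by
      rw [← logLR_smul_sub, netLR, netLR, evalNet_topScale]
      congr 1
      have i1 : t * Ψ n (paramNet ω) = δ n / 2 * (evalNet (x n) ω ⬝ᵥ evalNet (x n) ω -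
          (fun i => f₀ (x n i)) ⬝ᵥ (fun i => f₀ (x n i)) -
          2 * ((y n - fun i => f₀ (x n i)) ⬝ᵥ fun i => f₀ (x n i))) := by
        simp only [Ψ]
        rw [empNormSq_sub_eq hn0]
        simp only [δ]
        change t * (1 / Real.sqrt n * (evalNet (x n) ω ⬝ᵥ evalNet (x n) ω - _ - _)) = _
        ring
      have i2 : t ^ 2 * (4 * empNormSq (x n) f₀) / 2
          = δ n ^ 2 / 2 * ((fun i => f₀ (x n i)) ⬝ᵥ fun i => f₀ (x n i)) := by
        have : 4 * t ^ 2 = n * δ n ^ 2 := (hδsq n hn0).symm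
        have i3 : empNormSq (x n) f₀ = 1 / n * ((fun i => f₀ (x n i)) ⬝ᵥ fun i => f₀ (x n i)) := by
          simp only [empNormSq, dotProduct, sq]
        rw [i3]
        calc _ = (4 * t ^ 2) * (1 / n * ((fun i => f₀ (x n i)) ⬝ᵥ fun i => f₀ (x n i))) / 2 := by ring
          _ = _ := by rw [this]; field_simp
      rw [i1, i2]
    rw [e]
    have j1 : |δ n * ((y n - fun i => f₀ (x n i)) ⬝ᵥ v n ω)| ≤ |δ n| * (4 * (n : ℝ) ^ g5) := by
      rw [abs_mul]
      gcongr
      linarith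
    have j2 : |(δ n ^ 2 / 2 - δ n / 2) * (v n ω ⬝ᵥ v n ω)| ≤ |δ n| * (n : ℝ) ^ g5 := by
      rw [abs_mul, abs_of_nonneg hvv0]
      refine mul_le_mul ?_ hvv hvv0 (abs_nonneg _)
      have : δ n ^ 2 / 2 - δ n / 2 = δ n * ((δ n - 1) / 2) := by ring
      rw [this, abs_mul]
      refine mul_le_of_le_one_right (abs_nonneg _) ?_
      rw [abs_le]; constructor <;> linarith
    have j3 : |δ n ^ 2 * (v n ω ⬝ᵥ fun i => f₀ (x n i))| ≤ δ n ^ 2 *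
        ((n : ℝ) ^ (1 / 4 : ℝ) * (n : ℝ) ^ g5 + ((n : ℝ) ^ (1 / 4 : ℝ))⁻¹ * (n * F ^ 2)) := by
      rw [abs_mul, abs_of_nonneg (sq_nonneg (δ n))]
      refine mul_le_mul_of_nonneg_left ?_ (sq_nonneg _)
      have hq : 0 < (n : ℝ) ^ (1 / 4 : ℝ) := Real.rpow_pos_of_pos hnr _
      have h1 := two_mul_abs_dotProduct_le (v n ω) (fun i => f₀ (x n i)) hq
      have h2 : (n : ℝ) ^ (1 / 4 : ℝ) * (v n ω ⬝ᵥ v n ω) ≤ (n : ℝ) ^ (1 / 4 : ℝ) * (n : ℝ) ^ g5 := by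
        gcongr
      have h3 : ((n : ℝ) ^ (1 / 4 : ℝ))⁻¹ * ((fun i => f₀ (x n i)) ⬝ᵥ fun i => f₀ (x n i))
          ≤ ((n : ℝ) ^ (1 / 4 : ℝ))⁻¹ * (n * F ^ 2) := by gcongr
      have := abs_nonneg (v n ω ⬝ᵥ fun i => f₀ (x n i))
      linarith
    refine (abs_add_three _ _ _).trans ?_
    have j4 : 0 ≤ |δ n| * (n : ℝ) ^ g5 := by positivity
    simp only [η]
    linarith
  · intro ω hω
    exact (topScaleDensity_topScale_le hδ (hwidth ω hω.1) (htop ω hω.1)).trans (ofReal_exp_le hρη)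
  · intro ω hω
    exact (ofReal_exp_le (neg_le_neg hρη)).trans
      (le_topScaleDensity hδ (hwidth ω (hSmono hω.1)) (htop ω (hSmono hω.1)))
  · rintro ω ⟨⟨k1, k2, k3, k4⟩, k5⟩
    refine ⟨⟨k1, ?_, k3, ?_⟩, ?_⟩
    · rwa [active_topScale hr.ne'] at k2
    · have e2 : ∑ k, (topMap (topScale (1 - δ n)) ω).2 (Sum.inr k) ^ 2
          = (1 - δ n) ^ 2 * ∑ k, ω.2 (Sum.inr k) ^ 2 := by
        rw [Finset.mul_sum]
        exact Finset.sum_congr rfl fun k _ => mul_pow _ _ 2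
      rw [e2] at k4
      have hS0 : 0 ≤ ∑ k, ω.2 (Sum.inr k) ^ 2 := Finset.sum_nonneg fun _ _ => sq_nonneg _
      have h5 : (1 / 4 : ℝ) ≤ (1 - δ n) ^ 2 := by nlinarith only [hδ2]
      have h6 := mul_le_mul_of_nonneg_right h5 hS0
      linarith
    · have k6 : v n (topMap (topScale (1 - δ n)) ω) ⬝ᵥ v n (topMap (topScale (1 - δ n)) ω)
          ≤ (n : ℝ) ^ g5 * (1 / 16) := k5
      simp only [v, evalNet_topScale] at k6
      have k7 : δ n ^ 2 * ((fun i => f₀ (x n i)) ⬝ᵥ fun i => f₀ (x n i)) ≤ 4 * t ^ 2 * F ^ 2 := by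
        rw [← hδsq n hn0]
        refine (mul_le_mul_of_nonneg_left hθ₀ (sq_nonneg _)).trans (le_of_eq ?_)
        ring
      have k8 := dotProduct_self_le_of_smul hδ k7 k6
      change v n ω ⬝ᵥ v n ω ≤ (n : ℝ) ^ g5 * 1
      simp only [v]
      linarith

/-! ### Local approximation by ridge polynomials -/

/-- The product of indicators keeps only surjective index maps, that is permutations, and each of
them gives the same product. -/
theorem sum_surjective_prod_eq {j : ℕ} (y : Fin j → ℝ) :
    ∑ g : Fin j → Fin j, (∏ k, y (g k)) * (∏ i, if i ∈ Set.range g then (1 : ℝ) else 0)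
      = (j.factorial : ℝ) * ∏ i, y i := by
  classical
  have h1 : ∀ g : Fin j → Fin j, (∏ i, if i ∈ Set.range g then (1 : ℝ) else 0)
      = if Function.Bijective g then 1 else 0 := by
    intro g
    by_cases hg : Function.Surjective g
    · rw [if_pos (Finite.injective_iff_surjective.2 hg |>.bijective_of_finite)]
      exact Finset.prod_eq_one fun i _ => if_pos (hg i)
    · rw [if_neg fun h => hg h.2]
      rw [Function.Surjective] at hg
      push Not at hg
      obtain ⟨i, hi⟩ := hg
      exact Finset.prod_eq_zero (Finset.mem_univ i) (if_neg fun ⟨k, hk⟩ => hi k hk)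
  simp_rw [h1, mul_ite, mul_one, mul_zero]
  rw [← Finset.sum_filter]
  have h2 : ∑ g ∈ Finset.univ.filter (fun g : Fin j → Fin j => Function.Bijective g), ∏ k, y (g k)
      = ∑ _e : Equiv.Perm (Fin j), ∏ i, y i := by
    refine Finset.sum_bij' (fun g hg => Equiv.ofBijective g (Finset.mem_filter.1 hg).2)
      (fun e _ => e) (fun _ _ => Finset.mem_univ _)
      (fun e _ => Finset.mem_filter.2 ⟨Finset.mem_univ _, e.bijective⟩) (fun _ _ => rfl)
      (fun _ _ => by ext; rfl) fun g hg => ?_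
    exact Equiv.prod_comp (Equiv.ofBijective g (Finset.mem_filter.1 hg).2) y
  rw [h2, Finset.sum_const, Finset.card_univ, Fintype.card_perm, Fintype.card_fin, nsmul_eq_mul]

/-- The polarization identity. -/
theorem sum_powerset_sum_pow_eq {j : ℕ} (y : Fin j → ℝ) :
    ∑ S : Finset (Fin j), (-1) ^ (Sᶜ.card) * (∑ i ∈ S, y i) ^ j
      = (j.factorial : ℝ) * ∏ i, y i := by
  classical
  rw [← sum_surjective_prod_eq]
  have h1 : ∀ S : Finset (Fin j), (∑ i ∈ S, y i) ^ j
      = ∑ g : Fin j → Fin j, if ∀ k, g k ∈ S then ∏ k, y (g k) else 0 := by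
    intro S
    have := Finset.prod_univ_sum (fun _ : Fin j => S) (fun _ i => y i)
    rw [Finset.prod_const, Finset.card_univ, Fintype.card_fin] at this
    rw [this, ← Finset.sum_filter]
    refine Finset.sum_congr ?_ fun _ _ => rfl
    ext g
    simp [Fintype.mem_piFinset]
  simp_rw [h1, Finset.mul_sum]
  rw [Finset.sum_comm]
  refine Finset.sum_congr rfl fun g _ => ?_
  -- Inclusion and exclusion: expanding the product over `i` gives a signed sum over the sets `S`
  -- that contain the range of `g`.
  have h2 : ∀ i : Fin j, (if i ∈ Set.range g then (1 : ℝ) else 0)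
      = 1 + (if i ∈ Set.range g then (0 : ℝ) else -1) := by
    intro i; split_ifs <;> norm_num
  simp_rw [h2]
  rw [Finset.prod_add, Finset.mul_sum, Finset.powerset_univ]
  refine Finset.sum_congr rfl fun S _ => ?_
  rw [Finset.prod_const_one, one_mul, ← Finset.compl_eq_univ_sdiff]
  by_cases hg : ∀ k, g k ∈ S
  · rw [if_pos hg, mul_comm]
    congr 1
    rw [← Finset.prod_const]
    refine Finset.prod_congr rfl fun i hi => (if_neg ?_).symm
    rintro ⟨k, rfl⟩
    exact Finset.mem_compl.1 hi (hg k)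
  · rw [if_neg hg, mul_zero]
    push Not at hg
    obtain ⟨k, hk⟩ := hg
    have h0 : ∏ i ∈ Sᶜ, (if i ∈ Set.range g then (0 : ℝ) else -1) = 0 :=
      Finset.prod_eq_zero (Finset.mem_compl.2 hk) (if_pos ⟨k, rfl⟩)
    rw [h0, mul_zero]

/-- `F a` is a combination of ridge powers, from a finite family that does not depend on `a`, with
bounded coefficients that may depend on `a`. -/
def RidgeRep {p : ℕ} (F : (Fin p → ℝ) → (Fin p → ℝ) → ℝ) : Prop :=
  ∃ (Q : Type) (_ : Fintype Q) (w : Q → Fin p → ℝ) (ℓ : Q → ℕ) (C : ℝ),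
    (∀ q j, 0 ≤ w q j) ∧ (∀ q, ∑ j, w q j ≤ 1) ∧
    ∀ a ∈ Set.Icc (0 : Fin p → ℝ) 1, ∃ c : Q → ℝ, (∀ q, |c q| ≤ C) ∧
      ∀ x, F a x = ∑ q, c q * (∑ j, w q j * x j) ^ ℓ q

theorem RidgeRep.sum {p : ℕ} {ι : Type} [Fintype ι] {F : ι → (Fin p → ℝ) → (Fin p → ℝ) → ℝ}
    (h : ∀ i, RidgeRep (F i)) : RidgeRep fun a x => ∑ i, F i a x := by
  choose Q inst w ℓ C hw hw1 hc using h
  refine ⟨Σ i, Q i, inferInstance, fun q => w q.1 q.2, fun q => ℓ q.1 q.2, ∑ i, |C i|,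
    fun q => hw q.1 q.2, fun q => hw1 q.1 q.2, fun a ha => ?_⟩
  choose c hcb hcx using fun i => hc i a ha
  refine ⟨fun q => c q.1 q.2, fun q => ?_, fun x => ?_⟩
  · refine (hcb q.1 q.2).trans ((le_abs_self _).trans ?_)
    exact Finset.single_le_sum (f := fun i => |C i|) (fun i _ => abs_nonneg _) (Finset.mem_univ q.1)
  · rw [Fintype.sum_sigma]
    exact Finset.sum_congr rfl fun i _ => hcx i x

theorem RidgeRep.mul {p : ℕ} {F : (Fin p → ℝ) → (Fin p → ℝ) → ℝ} (h : RidgeRep F)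
    {b : (Fin p → ℝ) → ℝ} {C : ℝ} (hb : ∀ a ∈ Set.Icc (0 : Fin p → ℝ) 1, |b a| ≤ C) :
    RidgeRep fun a x => b a * F a x := by
  obtain ⟨Q, inst, w, ℓ, C', hw, hw1, hc⟩ := h
  refine ⟨Q, inst, w, ℓ, C * C', hw, hw1, fun a ha => ?_⟩
  obtain ⟨c, hcb, hcx⟩ := hc a ha
  refine ⟨fun q => b a * c q, fun q => ?_, fun x => ?_⟩
  · rw [abs_mul]
    exact mul_le_mul (hb a ha) (hcb q) (abs_nonneg _) ((abs_nonneg _).trans (hb a ha))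
  · beta_reduce
    rw [hcx x, Finset.mul_sum]
    exact Finset.sum_congr rfl fun q _ => (mul_assoc _ _ _).symm

/-- The binomial theorem separates `a` from `x`. Division by `m + 1` keeps the weights of total mass
at most one, so that the linear form maps the cube into `[0,1]`, and it is harmless for `m = 0`. -/
theorem RidgeRep.sub_pow {p m : ℕ} (σ : Fin m → Fin p) (S : Finset (Fin m)) (j : ℕ) :
    RidgeRep fun (a x : Fin p → ℝ) => (∑ i ∈ S, (x (σ i) - a (σ i))) ^ j := by
  classical
  let w : Fin p → ℝ := fun r => (S.filter fun i => σ i = r).card / ((m : ℝ) + 1)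
  have hm : (0 : ℝ) < m + 1 := by positivity
  have hwx : ∀ x : Fin p → ℝ, ∑ i ∈ S, x (σ i) = (m + 1) * ∑ r, w r * x r := by
    intro x
    rw [← Finset.sum_fiberwise (s := S) (g := σ), Finset.mul_sum]
    refine Finset.sum_congr rfl fun r _ => ?_
    rw [Finset.sum_congr rfl fun i hi => by rw [(Finset.mem_filter.1 hi).2], Finset.sum_const,
      nsmul_eq_mul]
    simp only [w]
    field_simp
  have hw1 : ∑ r, w r ≤ 1 := by
    have h := hwx fun _ => 1
    simp only [Finset.sum_const, nsmul_eq_mul, mul_one] at h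
    have h2 : (S.card : ℝ) ≤ m := by
      exact_mod_cast (Finset.card_le_univ S).trans (by simp)
    rw [h] at h2
    by_contra hcon
    push Not at hcon
    nlinarith
  refine ⟨Fin (j + 1), inferInstance, fun _ => w, fun l => l,
    ((m : ℝ) + 1) ^ j * ((m : ℝ) + 1) ^ j * 2 ^ j, fun _ r => by positivity, fun _ => hw1, fun a ha => ?_⟩
  refine ⟨fun l => ((m : ℝ) + 1) ^ (l : ℕ) * (-∑ i ∈ S, a (σ i)) ^ (j - l) * (j.choose l : ℝ),
    fun l => ?_, fun x => ?_⟩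
  · have hl : (l : ℕ) ≤ j := Nat.lt_succ_iff.1 l.2
    have hm1 : (1 : ℝ) ≤ m + 1 := by linarith [Nat.cast_nonneg (α := ℝ) m]
    have h1 : |-∑ i ∈ S, a (σ i)| ≤ m + 1 := by
      rw [abs_neg]
      refine (Finset.abs_sum_le_sum_abs _ _).trans ?_
      refine (Finset.sum_le_sum fun i _ => (abs_le.2 ⟨by linarith [ha.1 (σ i), show (0 : Fin p → ℝ) (σ i) = 0 from rfl], ha.2 (σ i)⟩ : |a (σ i)| ≤ 1)).trans ?_
      rw [Finset.sum_const, nsmul_eq_mul, mul_one]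
      have h2 : (S.card : ℝ) ≤ m := by
        exact_mod_cast (Finset.card_le_univ S).trans (by simp)
      linarith
    rw [abs_mul, abs_mul, abs_pow, abs_pow, abs_of_pos hm, Nat.abs_cast]
    gcongr
    · calc |-∑ i ∈ S, a (σ i)| ^ (j - (l : ℕ)) ≤ ((m : ℝ) + 1) ^ (j - (l : ℕ)) := by gcongr
        _ ≤ _ := pow_le_pow_right₀ hm1 (Nat.sub_le _ _)
    · exact_mod_cast Nat.choose_le_two_pow j l
  · beta_reduce
    rw [Finset.sum_sub_distrib, hwx x, sub_eq_add_neg, add_pow, Finset.sum_range]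
    refine Finset.sum_congr rfl fun l _ => ?_
    rw [mul_pow]
    ring

theorem RidgeRep.congr {p : ℕ} {F G : (Fin p → ℝ) → (Fin p → ℝ) → ℝ} (h : RidgeRep F)
    (hFG : ∀ a x, G a x = F a x) : RidgeRep G := by
  have : G = F := by funext a x; exact hFG a x
  rwa [this]

/-- Polarization replaces products of coordinates by powers of linear forms, which a network can
approximate by interpolating functions of one variable. -/
theorem RidgeRep.prod_sub {p m : ℕ} (σ : Fin m → Fin p) :
    RidgeRep fun (a x : Fin p → ℝ) => ∏ i, (x (σ i) - a (σ i)) := by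
  refine (RidgeRep.sum fun S : Finset (Fin m) => (RidgeRep.sub_pow σ S m).mul
    (b := fun _ => (m.factorial : ℝ)⁻¹ * (-1) ^ (Sᶜ.card)) (C := 1) fun a _ => ?_).congr fun a x => ?_
  · rw [abs_mul, abs_pow, abs_neg, abs_one, one_pow, mul_one, abs_inv, Nat.abs_cast]
    exact inv_le_one_of_one_le₀ (by exact_mod_cast Nat.one_le_iff_ne_zero.2 (Nat.factorial_ne_zero m))
  · have h := sum_powerset_sum_pow_eq fun i => x (σ i) - a (σ i)
    simp_rw [mul_assoc, ← Finset.mul_sum]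
    rw [h, inv_mul_cancel_left₀]
    exact_mod_cast Nat.factorial_ne_zero m

/-! ### Taylor expansion on the cube -/

theorem uniqueDiffOn_cube (p : ℕ) : UniqueDiffOn ℝ (Set.Icc (0 : Fin p → ℝ) 1) := by
  rw [← Set.pi_univ_Icc]
  exact UniqueDiffOn.univ_pi fun _ => uniqueDiffOn_Icc zero_lt_one

theorem add_smul_mem_cube {p : ℕ} {a x : Fin p → ℝ} (ha : a ∈ Set.Icc (0 : Fin p → ℝ) 1)
    (hx : x ∈ Set.Icc (0 : Fin p → ℝ) 1) {t : ℝ} (ht : t ∈ Set.Icc (0 : ℝ) 1) :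
    a + t • (x - a) ∈ Set.Icc (0 : Fin p → ℝ) 1 :=
  (convex_Icc (0 : Fin p → ℝ) 1).add_smul_sub_mem ha hx ht

/-- Iterated chain rule along a segment; it reduces the Taylor formula on the cube to one variable.
-/
theorem iteratedDerivWithin_comp_add_smul {E : Type*} [NormedAddCommGroup E] [NormedSpace ℝ E]
    {f : E → ℝ} {s : Set E} {k : ℕ} (hs : UniqueDiffOn ℝ s) (hf : ContDiffOn ℝ k f s) {a h : E}
    (hline : ∀ t ∈ Set.Icc (0 : ℝ) 1, a + t • h ∈ s) :
    ∀ j ≤ k, ∀ t ∈ Set.Icc (0 : ℝ) 1,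
      iteratedDerivWithin j (fun t : ℝ => f (a + t • h)) (Set.Icc 0 1) t
        = iteratedFDerivWithin ℝ j f s (a + t • h) fun _ => h := by
  intro j
  induction j with
  | zero => intro _ t _; simp
  | succ j ih =>
    intro hj t ht
    rw [iteratedDerivWithin_succ]
    have hcongr : ∀ u ∈ Set.Icc (0 : ℝ) 1,
        iteratedDerivWithin j (fun t : ℝ => f (a + t • h)) (Set.Icc 0 1) u
          = iteratedFDerivWithin ℝ j f s (a + u • h) fun _ => h :=
      fun u hu => ih (Nat.le_of_succ_le hj) u hu
    rw [derivWithin_congr hcongr (hcongr t ht)]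
    have h1 := (hf.ftaylorSeriesWithin hs).fderivWithin j (by exact_mod_cast hj) (a + t • h) (hline t ht)
    have h2 : HasDerivWithinAt (fun t : ℝ => a + t • h) h (Set.Icc 0 1) t := by
      simpa using (((hasDerivAt_id t).smul_const h).const_add a).hasDerivWithinAt
    have h3 := h1.comp_hasDerivWithinAt t h2 hline
    have h4 := (ContinuousMultilinearMap.apply ℝ (fun _ : Fin j => E) ℝ fun _ => h).hasFDerivAt.comp_hasDerivWithinAt
      t h3
    have h5 := h4.derivWithin (uniqueDiffOn_Icc zero_lt_one t ht)
    refine Eq.trans h5 ?_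
    rfl

/-- Taylor's formula along a segment. -/
theorem exists_taylor_remainder {E : Type*} [NormedAddCommGroup E] [NormedSpace ℝ E]
    {f : E → ℝ} {s : Set E} {k : ℕ} (hs : UniqueDiffOn ℝ s) (hf : ContDiffOn ℝ k f s) {a h : E}
    (hline : ∀ t ∈ Set.Icc (0 : ℝ) 1, a + t • h ∈ s) :
    ∃ t ∈ Set.Icc (0 : ℝ) 1, f (a + h) - ∑ j ∈ Finset.range (k + 1),
      (j.factorial : ℝ)⁻¹ * iteratedFDerivWithin ℝ j f s a (fun _ => h)
        = (iteratedFDerivWithin ℝ k f s (a + t • h) - iteratedFDerivWithin ℝ k f s a) (fun _ => h)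
          / k.factorial := by
  have hder := iteratedDerivWithin_comp_add_smul hs hf hline
  rcases k with _ | m
  · exact ⟨1, by simp, by simp⟩
  · have huI : Set.uIcc (0 : ℝ) 1 = Set.Icc 0 1 := Set.uIcc_of_le zero_le_one
    have huO : Set.uIoo (0 : ℝ) 1 = Set.Ioo 0 1 := by rw [Set.uIoo]; simp
    have hg : ContDiffOn ℝ (m + 1 : ℕ) (fun t : ℝ => f (a + t • h)) (Set.Icc 0 1) := by
      refine hf.comp (g := f) ?_ hline
      exact ContDiff.contDiffOn (by fun_prop)
    obtain ⟨t, ht, htx⟩ := taylor_mean_remainder_lagrange (f := fun t : ℝ => f (a + t • h)) (n := m)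
      (zero_ne_one' ℝ) (by rw [huI]; exact hg.of_le (by exact_mod_cast Nat.le_succ m)) (by
        rw [huI, huO]
        refine DifferentiableOn.mono ?_ Set.Ioo_subset_Icc_self
        exact hg.differentiableOn_iteratedDerivWithin (by exact_mod_cast Nat.lt_succ_self m)
          (uniqueDiffOn_Icc zero_lt_one))
    rw [huO] at ht
    have ht' := Set.Ioo_subset_Icc_self ht
    refine ⟨t, ht', ?_⟩
    rw [huI, taylor_within_apply, hder (m + 1) le_rfl t ht'] at htx
    have h0 : (0 : ℝ) ∈ Set.Icc (0 : ℝ) 1 := by simp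
    have hsum : ∑ j ∈ Finset.range (m + 1), ((j.factorial : ℝ)⁻¹ * (1 - 0) ^ j) •
        iteratedDerivWithin j (fun t : ℝ => f (a + t • h)) (Set.Icc 0 1) 0
        = ∑ j ∈ Finset.range (m + 1), (j.factorial : ℝ)⁻¹ *
          iteratedFDerivWithin ℝ j f s a fun _ => h := by
      refine Finset.sum_congr rfl fun j hj => ?_
      rw [hder j (Finset.mem_range.1 hj).le 0 h0]
      simp
    rw [hsum] at htx
    simp only [one_smul, sub_zero, one_pow, mul_one] at htx
    -- The Lagrange remainder is the derivative of order `k` at an intermediate point. Subtracting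
    -- the last Taylor term turns it into an increment of that derivative, to which the Hölder
    -- condition applies.
    rw [Finset.sum_range_succ, ← sub_sub, htx, _root_.sub_apply]
    ring

/-- Expansion of `x - a` in the standard basis; the coefficients are partial derivatives, bounded on
the compact cube. -/
theorem ridgeRep_iteratedFDerivWithin {p k : ℕ} {f : (Fin p → ℝ) → ℝ}
    (hf : ContDiffOn ℝ k f (Set.Icc 0 1)) {j : ℕ} (hj : j ≤ k) :
    RidgeRep fun (a x : Fin p → ℝ) =>
      iteratedFDerivWithin ℝ j f (Set.Icc 0 1) a fun _ => x - a := by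
  have hcont := hf.continuousOn_iteratedFDerivWithin (m := j) (by exact_mod_cast hj) (uniqueDiffOn_cube p)
  obtain ⟨C, hC⟩ := isCompact_Icc.exists_bound_of_continuousOn hcont
  refine (RidgeRep.sum fun σ : Fin j → Fin p => (RidgeRep.prod_sub σ).mul
    (b := fun a => iteratedFDerivWithin ℝ j f (Set.Icc 0 1) a fun i => Pi.single (σ i) 1)
    (C := C) fun a ha => ?_).congr fun a x => ?_
  · have h := (iteratedFDerivWithin ℝ j f (Set.Icc 0 1) a).le_opNorm fun i => Pi.single (σ i) 1
    rw [Real.norm_eq_abs] at h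
    refine h.trans ?_
    simp only [Pi.norm_single, norm_one, Finset.prod_const_one, mul_one]
    exact hC a ha
  · have hx : x - a = ∑ r, (x - a) r • (Pi.single r 1 : Fin p → ℝ) := by
      funext i
      simp [Finset.sum_apply, Pi.single_apply]
    conv_lhs => rw [hx]
    rw [ContinuousMultilinearMap.map_sum]
    refine Finset.sum_congr rfl fun σ _ => ?_
    rw [ContinuousMultilinearMap.map_smul_univ, smul_eq_mul, mul_comm]
    rfl

/-- Hölder functions are locally approximated by ridge polynomials. -/
theorem IsHolder.exists_ridgeRep {p : ℕ} {α : ℝ} {f : (Fin p → ℝ) → ℝ}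
    (hf : IsHolder α f) :
    ∃ (F : (Fin p → ℝ) → (Fin p → ℝ) → ℝ) (C : ℝ), RidgeRep F ∧ 0 ≤ C ∧
      ∀ a ∈ Set.Icc (0 : Fin p → ℝ) 1, ∀ x ∈ Set.Icc (0 : Fin p → ℝ) 1,
        |f x - F a x| ≤ C * ‖x - a‖ ^ α := by
  obtain ⟨k, hkα, hαk, hfk, C, hC⟩ := hf
  refine ⟨fun a x => ∑ j : Fin (k + 1), ((j : ℕ).factorial : ℝ)⁻¹ *
    iteratedFDerivWithin ℝ j f (Set.Icc 0 1) a fun _ => x - a, |C|, ?_, abs_nonneg C, ?_⟩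
  · refine RidgeRep.sum fun j => (ridgeRep_iteratedFDerivWithin hfk (Nat.lt_succ_iff.1 j.2)).mul
      (b := fun _ => ((j : ℕ).factorial : ℝ)⁻¹) (C := 1) fun a _ => ?_
    rw [abs_inv, Nat.abs_cast]
    exact inv_le_one_of_one_le₀ (by exact_mod_cast Nat.one_le_iff_ne_zero.2 (Nat.factorial_ne_zero _))
  · intro a ha x hx
    obtain ⟨t, ht, h⟩ := exists_taylor_remainder (uniqueDiffOn_cube p) hfk
      fun t ht => add_smul_mem_cube ha hx ht
    rw [add_sub_cancel, Finset.sum_range] at h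
    rw [h, abs_div, Nat.abs_cast]
    refine (div_le_self (abs_nonneg _) (by exact_mod_cast Nat.one_le_iff_ne_zero.2 (Nat.factorial_ne_zero _))).trans ?_
    refine (((iteratedFDerivWithin ℝ k f (Set.Icc 0 1) (a + t • (x - a)) -
      iteratedFDerivWithin ℝ k f (Set.Icc 0 1) a)).le_opNorm fun _ => x - a).trans ?_
    rw [Finset.prod_const, Finset.card_univ, Fintype.card_fin]
    have hα0 : 0 < α - k := by linarith
    have h1 : ‖iteratedFDerivWithin ℝ k f (Set.Icc 0 1) (a + t • (x - a)) -
        iteratedFDerivWithin ℝ k f (Set.Icc 0 1) a‖ ≤ |C| * ‖x - a‖ ^ (α - k) := by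
      refine (hC _ (add_smul_mem_cube ha hx ht) a ha).trans ?_
      refine mul_le_mul (le_abs_self C) ?_ (Real.rpow_nonneg (norm_nonneg _) _) (abs_nonneg C)
      refine Real.rpow_le_rpow (norm_nonneg _) ?_ hα0.le
      rw [add_sub_cancel_left, norm_smul, Real.norm_of_nonneg ht.1]
      exact mul_le_of_le_one_left (norm_nonneg _) ht.2
    have h2 : ‖x - a‖ ^ α = ‖x - a‖ ^ (α - k) * ‖x - a‖ ^ k := by
      rw [← Real.rpow_natCast, ← Real.rpow_add_of_nonneg (norm_nonneg _) hα0.le (Nat.cast_nonneg k)]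
      congr 1; ring
    rw [h2, ← mul_assoc]
    gcongr

/-! ### Piecewise linear functions as sums of ramps -/

/-- The ramp `t ↦ min (max t 0) 1`, written with rectifiers. -/
noncomputable def ramp (t : ℝ) : ℝ := max t 0 - max (t - 1) 0

theorem ramp_of_nonpos {t : ℝ} (h : t ≤ 0) : ramp t = 0 := by
  rw [ramp, max_eq_right h, max_eq_right (by linarith), sub_zero]

theorem ramp_of_one_le {t : ℝ} (h : 1 ≤ t) : ramp t = 1 := by
  rw [ramp, max_eq_left (by linarith), max_eq_left (by linarith)]; ring

theorem ramp_of_mem {t : ℝ} (h0 : 0 ≤ t) (h1 : t ≤ 1) : ramp t = t := by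
  rw [ramp, max_eq_left h0, max_eq_right (by linarith), sub_zero]

/-- Linear interpolation of the values `a` at the natural numbers. -/
theorem add_sum_mul_ramp (a : ℕ → ℝ) {m j : ℕ} (hj : j < m) {θ : ℝ} (h0 : 0 ≤ θ) (h1 : θ ≤ 1) :
    a 0 + ∑ r ∈ Finset.range m, (a (r + 1) - a r) * ramp (j + θ - r)
      = a j + θ * (a (j + 1) - a j) := by
  obtain ⟨d, rfl⟩ := Nat.exists_eq_add_of_le (Nat.succ_le_of_lt hj)
  rw [Finset.sum_range_add, Finset.sum_range_succ]
  have e1 : ∑ r ∈ Finset.range j, (a (r + 1) - a r) * ramp (j + θ - r) = a j - a 0 := by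
    rw [← Finset.sum_range_sub]
    refine Finset.sum_congr rfl fun r hr => ?_
    have : (r : ℝ) + 1 ≤ j := by exact_mod_cast Finset.mem_range.1 hr
    rw [ramp_of_one_le (by linarith), mul_one]
  have e2 : ∑ r ∈ Finset.range d, (a (j + 1 + r + 1) - a (j + 1 + r)) *
      ramp (j + θ - (j + 1 + r : ℕ)) = 0 := by
    refine Finset.sum_eq_zero fun r _ => ?_
    rw [ramp_of_nonpos, mul_zero]
    push_cast
    linarith [Nat.cast_nonneg (α := ℝ) r]
  have e3 : ramp (j + θ - j) = θ := by
    rw [add_sub_cancel_left]; exact ramp_of_mem h0 h1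
  rw [e1, e3]
  simp only [Nat.succ_eq_add_one] at e2 ⊢
  rw [e2]
  ring

theorem exists_eq_natCast_add {J : ℕ} {t : ℝ} (hJ : 1 ≤ J) (h0 : 0 ≤ t) (h1 : t ≤ J) :
    ∃ (j : ℕ) (θ : ℝ), j < J ∧ 0 ≤ θ ∧ θ ≤ 1 ∧ t = j + θ := by
  rcases h1.lt_or_eq with h | h
  · refine ⟨⌊t⌋₊, t - ⌊t⌋₊, (Nat.floor_lt h0).2 h, ?_, ?_, by ring⟩
    · linarith [Nat.floor_le h0]
    · linarith [Nat.lt_floor_add_one t]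
  · refine ⟨J - 1, 1, by omega, zero_le_one, le_rfl, ?_⟩
    rw [h, Nat.cast_sub hJ]; simp

/-- The interpolation of `y ↦ y ^ l` on `J` intervals. -/
noncomputable def powInterp (l J : ℕ) (y : ℝ) : ℝ :=
  (0 : ℝ) ^ l + ∑ r ∈ Finset.range J, ((((r + 1 : ℕ) : ℝ) / J) ^ l - ((r : ℝ) / J) ^ l) *
    ramp (J * y - r)

/-- Interpolant and power lie between the same two neighbouring grid values, which differ by at most
`l / J`. The range `[0,1]` matters because the value later serves as the fractional part next to an
even integer that codes a cell. -/
theorem powInterp_mem {l J : ℕ} (hJ : 1 ≤ J) {y : ℝ} (h0 : 0 ≤ y) (h1 : y ≤ 1) :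
    powInterp l J y ∈ Set.Icc (0 : ℝ) 1 ∧ |powInterp l J y - y ^ l| ≤ l / J := by
  have hJ0 : (0 : ℝ) < J := by exact_mod_cast hJ
  obtain ⟨j, θ, hj, hθ0, hθ1, ht⟩ := exists_eq_natCast_add hJ (t := J * y) (by positivity) (by nlinarith)
  have h := add_sum_mul_ramp (fun r => ((r : ℝ) / J) ^ l) hj hθ0 hθ1
  have e : powInterp l J y = ((j : ℝ) / J) ^ l + θ * ((((j + 1 : ℕ) : ℝ) / J) ^ l - ((j : ℝ) / J) ^ l) := by
    rw [powInterp, ht, ← h]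
    simp
  have hj1 : ((j + 1 : ℕ) : ℝ) ≤ J := by exact_mod_cast hj
  have a0 : (0 : ℝ) ≤ (j : ℝ) / J := by positivity
  have b1 : ((j + 1 : ℕ) : ℝ) / J ≤ 1 := (div_le_one hJ0).2 hj1
  have hab : (j : ℝ) / J ≤ ((j + 1 : ℕ) : ℝ) / J := by
    gcongr; simp
  have hdiff : ((j + 1 : ℕ) : ℝ) / J - (j : ℝ) / J = 1 / J := by push_cast; ring
  have hy1 : (j : ℝ) / J ≤ y := by rw [div_le_iff₀ hJ0]; linarith
  have hy2 : y ≤ ((j + 1 : ℕ) : ℝ) / J := by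
    rw [le_div_iff₀ hJ0]; push_cast; linarith
  have p1 : ((j : ℝ) / J) ^ l ≤ y ^ l := by gcongr
  have p2 : y ^ l ≤ (((j + 1 : ℕ) : ℝ) / J) ^ l := by gcongr
  have p3 : (((j + 1 : ℕ) : ℝ) / J) ^ l ≤ 1 := pow_le_one₀ (a0.trans hab) b1
  have p0 : 0 ≤ ((j : ℝ) / J) ^ l := by positivity
  have p4 : (((j + 1 : ℕ) : ℝ) / J) ^ l - ((j : ℝ) / J) ^ l ≤ l / J := by
    have h2 := abs_pow_sub_pow_le (((j + 1 : ℕ) : ℝ) / J) ((j : ℝ) / J) l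
    rw [hdiff, abs_of_nonneg (show (0 : ℝ) ≤ 1 / J by positivity)] at h2
    have h3 : max |((j + 1 : ℕ) : ℝ) / J| |(j : ℝ) / J| ≤ 1 := by
      rw [abs_of_nonneg (a0.trans hab), abs_of_nonneg a0]
      exact max_le b1 (hab.trans b1)
    have h4 : max |((j + 1 : ℕ) : ℝ) / J| |(j : ℝ) / J| ^ (l - 1) ≤ 1 :=
      pow_le_one₀ ((abs_nonneg _).trans (le_max_left _ _)) h3
    refine (le_abs_self _).trans (h2.trans ?_)
    calc (1 : ℝ) / J * l * _ ≤ 1 / J * l * 1 := by gcongr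
      _ = _ := by ring
  have q1 : ((j : ℝ) / J) ^ l ≤ powInterp l J y := by
    rw [e]; exact le_add_of_nonneg_right (mul_nonneg hθ0 (by linarith))
  have q2 : powInterp l J y ≤ (((j + 1 : ℕ) : ℝ) / J) ^ l := by
    rw [e]; nlinarith
  refine ⟨⟨p0.trans q1, q2.trans p3⟩, ?_⟩
  rw [abs_le]
  constructor <;> linarith

/-! ### Cells -/

/-- A staircase with poly-size slopes that is integer valued at given data points. -/
theorem exists_staircase {n p M : ℕ} (hM : 1 ≤ M) {x : Fin n → Fin p → ℝ}
    (hx : ∀ i j, x i j ∈ Set.Icc (0 : ℝ) 1) :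
    ∃ (k : Fin M → ℕ) (dig : Fin n → Fin p → ℕ), (∀ m, k m ≤ (n * p + 1) * M) ∧
      (∀ i j, dig i j ≤ M) ∧
      (∀ i j, ∑ m, ramp (((n * p + 1) * M : ℕ) * x i j - k m) = dig i j) ∧
      ∀ i i', dig i = dig i' → ∀ j, |x i j - x i' j| ≤ 2 / M := by
  classical
  set K : ℕ := n * p + 1 with hK
  have hK0 : (0 : ℝ) < K := by positivity
  have hM0 : (0 : ℝ) < M := by exact_mod_cast hM
  -- Pigeonhole: each of the `M` intervals is cut into `n * p + 1` pieces, and the `n * p`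
  -- coordinates cannot meet the interiors of all of them. The staircase climbs in a free piece.
  have hex : ∀ m : Fin M, ∃ q : Fin K, ∀ i j,
      ¬ (((K * m + q : ℕ) : ℝ) < (K * M : ℕ) * x i j ∧ ((K * M : ℕ) : ℝ) * x i j < (K * m + q : ℕ) + 1) := by
    intro m
    by_contra hcon
    push Not at hcon
    choose i j hlo hhi using hcon
    have hinj : Function.Injective fun q : Fin K => (i q, j q) := by
      intro q q' hqq
      have h1 : i q = i q' := congrArg Prod.fst hqq
      have h2 : j q = j q' := congrArg Prod.snd hqq
      have a1 := hlo q
      have a2 := hhi q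
      rw [h1, h2] at a1 a2
      have b1 := a1.trans (hhi q')
      have b2 := (hlo q').trans a2
      have c1 : K * (m : ℕ) + (q : ℕ) < K * (m : ℕ) + (q' : ℕ) + 1 := by exact_mod_cast b1
      have c2 : K * (m : ℕ) + (q' : ℕ) < K * (m : ℕ) + (q : ℕ) + 1 := by exact_mod_cast b2
      ext; omega
    have := Fintype.card_le_of_injective _ hinj
    simp [hK] at this
  choose q hq using hex
  let k : Fin M → ℕ := fun m => K * m + q m
  have hk1 : ∀ m : Fin M, ((K * m : ℕ) : ℝ) ≤ k m := fun m => by exact_mod_cast Nat.le_add_right _ _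
  have hk2 : ∀ m : Fin M, (k m : ℝ) + 1 ≤ (K * (m + 1) : ℕ) := fun m => by
    have := (q m).2
    have h : k m + 1 ≤ K * (m + 1) := by simp only [k]; rw [mul_add, mul_one]; omega
    exact_mod_cast h
  let S : Fin n → Fin p → Finset (Fin M) := fun i j =>
    Finset.univ.filter fun m => (k m : ℝ) < (K * M : ℕ) * x i j
  refine ⟨k, fun i j => (S i j).card, fun m => ?_, fun i j => ?_, fun i j => ?_, ?_⟩
  · have h1 := hk2 m
    have h2 : K * ((m : ℕ) + 1) ≤ K * M := Nat.mul_le_mul_left _ m.2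
    have h3 : ((K * ((m : ℕ) + 1) : ℕ) : ℝ) ≤ (K * M : ℕ) := by exact_mod_cast h2
    have h4 : (k m : ℝ) ≤ (K * M : ℕ) := by linarith
    exact_mod_cast h4
  · exact (Finset.card_le_univ _).trans (by simp)
  · simp only [S, Finset.card_filter, Nat.cast_sum]
    refine Finset.sum_congr rfl fun m _ => ?_
    by_cases h : (k m : ℝ) < (K * M : ℕ) * x i j
    · rw [if_pos h]
      have := hq m i j
      rw [not_and, not_lt] at this
      have h2 := this h
      rw [ramp_of_one_le (by simp only [k] at *; linarith)]
      simp
    · rw [if_neg h, ramp_of_nonpos (by linarith)]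
      simp
  · have key : ∀ i i' j, (S i j).card = (S i' j).card → x i' j - x i j ≤ 2 / M := by
      intro i i' j hcard
      by_contra hcon
      rw [not_le] at hcon
      have hlt : x i j < x i' j := by
        have : (0 : ℝ) < 2 / M := by positivity
        linarith
      have hsub : S i j ⊆ S i' j := by
        intro m hm
        have h1 := (Finset.mem_filter.1 hm).2
        refine Finset.mem_filter.2 ⟨Finset.mem_univ _, h1.trans_le ?_⟩
        gcongr
      have heq := Finset.eq_of_subset_of_card_le hsub hcard.ge
      have hx0 := (hx i j).1
      -- Two coordinates more than `2 / M` apart have a full interval of length `1 / M` between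
      -- them, hence a step.
      set m : ℕ := ⌈M * x i j⌉₊ with hm
      have hm1 : M * x i j ≤ m := Nat.le_ceil _
      have hm2 : (m : ℝ) < M * x i j + 1 := Nat.ceil_lt_add_one (by positivity)
      have hgap : M * x i j + 2 < M * x i' j := by
        rw [div_lt_iff₀ hM0] at hcon
        linarith
      have hx1 : M * x i' j ≤ M := by nlinarith [(hx i' j).2]
      have hmM : m < M := by
        have : (m : ℝ) < M := by linarith
        exact_mod_cast this
      have g1 := hk1 ⟨m, hmM⟩
      have g2 := hk2 ⟨m, hmM⟩
      push_cast at g1 g2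
      have i1 : (⟨m, hmM⟩ : Fin M) ∈ S i' j := by
        refine Finset.mem_filter.2 ⟨Finset.mem_univ _, ?_⟩
        push_cast
        nlinarith
      have i2 : (⟨m, hmM⟩ : Fin M) ∉ S i j := by
        intro h
        have h2 := (Finset.mem_filter.1 h).2
        push_cast at h2
        nlinarith
      rw [heq] at i2
      exact i2 i1
    intro i i' hdig j
    have h := congrFun hdig j
    rw [abs_le]
    constructor
    · linarith [key i i' j h]
    · exact key i' i j h.symm

/-! ### Functions computed by rectifier layers -/

/-- `ReluComp x d c m v`: the `m` functions with values `v` at the design points `x` are computed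
by `d` rectifier layers with `c` coefficients, all of absolute value at most one. -/
inductive ReluComp {n p : ℕ} (x : Fin n → Fin p → ℝ) :
    ℕ → ℕ → (m : ℕ) → (Fin n → Fin m → ℝ) → Prop
  | input : ReluComp x 0 0 p x
  | layer {d c m : ℕ} {v : Fin n → Fin m → ℝ} (h : ReluComp x d c m v) (m' : ℕ)
      (A : Fin m' → Fin m → ℝ) (b : Fin m' → ℝ) (hA : ∀ a j, |A a j| ≤ 1) (hb : ∀ a, |b a| ≤ 1) :
      ReluComp x (d + 1) (c + m' * (m + 1)) m' fun i a => max ((∑ j, A a j * v i j) + b a) 0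

theorem sum_fin_dite {m W : ℕ} (h : m ≤ W) (g : Fin m → ℝ) :
    ∑ j : Fin W, (if hj : (j : ℕ) < m then g ⟨j, hj⟩ else 0) = ∑ j, g j := by
  rw [Fin.sum_univ_eq_sum_range (fun j => if hj : j < m then g ⟨j, hj⟩ else 0) W,
    ← Finset.sum_subset (Finset.range_subset_range.2 h)]
  · rw [← Fin.sum_univ_eq_sum_range (fun j => if hj : j < m then g ⟨j, hj⟩ else 0) m]
    exact Finset.sum_congr rfl fun j _ => dif_pos j.2
  · intro j _ hj
    exact dif_neg fun h => hj (Finset.mem_range.2 h)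

/-- Weights indexed by natural numbers, with one support `S`, implement the computation in every
network that is deep and wide enough. Surplus nodes get zero coefficients and carry the value zero.
The budget `c ≤ 12 * p * N` also guarantees that the layers fit, since a layer has at least as many
coefficients as nodes. -/
theorem ReluComp.exists_coeff {n p : ℕ} {x : Fin n → Fin p → ℝ} {d c m : ℕ} {v : Fin n → Fin m → ℝ}
    (h : ReluComp x d c m v) :
    ∃ (β : ℕ → ℕ → Option ℕ → ℝ) (S : Finset (ℕ × ℕ × Option ℕ)), S.card ≤ c ∧
      (∀ l i j, (l, i, j) ∉ S → β l i j = 0) ∧ (∀ t ∈ S, t.1 < d) ∧ (∀ l i j, |β l i j| ≤ 1) ∧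
      (∀ N, c ≤ 12 * p * N → m ≤ width p N d) ∧
      ∀ (L N : ℕ) (_ : c ≤ 12 * p * N) (hL : d ≤ L) (B : CoeffIdx p L N → ℝ),
        (∀ (l : Fin L) i j, (l : ℕ) < d → B (Sum.inl ⟨l, i, j⟩) = β l i (j.map Fin.val)) →
        ∀ i a, hidden B (x i) d hL a = if h : (a : ℕ) < m then v i ⟨a, h⟩ else 0 := by
  classical
  induction h with
  | input =>
    refine ⟨fun _ _ _ => 0, ∅, by simp, by simp, by simp, by simp, fun N _ => le_rfl, ?_⟩
    intro L N _ _ B _ i a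
    have ha : (a : ℕ) < p := a.2
    rw [dif_pos ha]
    rfl
  | @layer d c m v h m' A b hA hb ih =>
    obtain ⟨β, S, hS, hβS, hSd, hβ1, hm, hhid⟩ := ih
    let A' : ℕ → Option ℕ → ℝ := fun i j => if hi : i < m' then
      (match j with
        | none => b ⟨i, hi⟩
        | some j => if hj : j < m then A ⟨i, hi⟩ ⟨j, hj⟩ else 0) else 0
    let S' : Finset (ℕ × ℕ × Option ℕ) := Finset.univ.image fun t : Fin m' × Option (Fin m) =>
      (d, (t.1 : ℕ), t.2.map Fin.val)
    have hS' : S'.card ≤ m' * (m + 1) := Finset.card_image_le.trans (by simp)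
    refine ⟨fun l => if l = d then A' else β l, S ∪ S', (Finset.card_union_le _ _).trans
      (add_le_add hS hS'), ?_, ?_, ?_, ?_, ?_⟩
    · intro l i j hlij
      rw [Finset.mem_union, not_or] at hlij
      by_cases hl : l = d
      · simp only [hl, if_true, A']
        split_ifs with hi
        · rcases j with _ | j
          · exact absurd (Finset.mem_image.2 ⟨(⟨i, hi⟩, none), Finset.mem_univ _, by simp [hl]⟩) hlij.2
          · simp only
            split_ifs with hj
            · exact absurd (Finset.mem_image.2 ⟨(⟨i, hi⟩, some ⟨j, hj⟩), Finset.mem_univ _,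
                by simp [hl]⟩) hlij.2
            · rfl
        · rfl
      · simp only [hl, if_false]
        exact hβS l i j hlij.1
    · intro t ht
      rcases Finset.mem_union.1 ht with ht | ht
      · exact (hSd t ht).trans (Nat.lt_succ_self d)
      · obtain ⟨u, _, rfl⟩ := Finset.mem_image.1 ht
        exact Nat.lt_succ_self d
    · intro l i j
      by_cases hl : l = d
      · simp only [hl, if_true, A']
        split_ifs with hi
        · rcases j with _ | j
          · exact hb _
          · simp only
            split_ifs
            · exact hA _ _
            · simp
        · simp
      · simp only [hl, if_false]
        exact hβ1 l i j
    · intro N hN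
      have : m' ≤ m' * (m + 1) := Nat.le_mul_of_pos_right _ (Nat.succ_pos m)
      change m' ≤ 12 * p * N
      omega
    · intro L N hN hL B hB i a
      have hN' : c ≤ 12 * p * N := by omega
      have hprev := hhid L N hN' (Nat.le_of_succ_le hL) B (fun l i j hl => by
        rw [hB l i j (hl.trans (Nat.lt_succ_self d))]
        simp only [hl.ne, if_false]) i
      have hBd : ∀ j, B (Sum.inl ⟨⟨d, hL⟩, a, j⟩) = A' a (j.map Fin.val) := by
        intro j
        rw [hB ⟨d, hL⟩ a j (Nat.lt_succ_self d)]
        simp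
      rw [hidden]
      simp only [hBd, hprev, Option.map_some, Option.map_none]
      by_cases ha : (a : ℕ) < m'
      · simp only [A', ha, dif_pos]
        rw [← sum_fin_dite (hm N hN') fun j => A ⟨a, ha⟩ j * v i j]
        congr 2
        refine Finset.sum_congr rfl fun j _ => ?_
        by_cases hj : (j : ℕ) < m
        · simp [hj]
        · simp [hj]
      · simp [A', ha]

/-- As `ReluComp`, for families of functions indexed by a finite type. -/
def Computes {n p : ℕ} (x : Fin n → Fin p → ℝ) (d c : ℕ) {ι : Type} [Fintype ι]
    (v : Fin n → ι → ℝ) : Prop :=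
  ∃ (m : ℕ) (e : ι ≃ Fin m), ReluComp x d c m fun i a => v i (e.symm a)

theorem Computes.input {n p : ℕ} (x : Fin n → Fin p → ℝ) : Computes x 0 0 x :=
  ⟨p, Equiv.refl _, ReluComp.input⟩

theorem Computes.congr {n p : ℕ} {x : Fin n → Fin p → ℝ} {d c : ℕ} {ι : Type} [Fintype ι]
    {v v' : Fin n → ι → ℝ} (h : Computes x d c v) (hv : ∀ i a, v' i a = v i a) :
    Computes x d c v' := by
  have : v' = v := by funext i a; exact hv i a
  rwa [this]

theorem Computes.layer {n p : ℕ} {x : Fin n → Fin p → ℝ} {d c : ℕ} {ι κ : Type} [Fintype ι]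
    [Fintype κ] {v : Fin n → ι → ℝ} (h : Computes x d c v) (A : κ → ι → ℝ) (b : κ → ℝ)
    (hA : ∀ a j, |A a j| ≤ 1) (hb : ∀ a, |b a| ≤ 1) :
    Computes x (d + 1) (c + Fintype.card κ * (Fintype.card ι + 1))
      fun i a => max ((∑ j, A a j * v i j) + b a) 0 := by
  obtain ⟨m, e, h⟩ := h
  have hm : Fintype.card ι = m := by rw [Fintype.card_congr e, Fintype.card_fin]
  have h2 := h.layer (Fintype.card κ)
    (fun a j => A ((Fintype.equivFin κ).symm a) (e.symm j)) (fun a => b ((Fintype.equivFin κ).symm a))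
    (fun a j => hA _ _) fun a => hb _
  rw [hm]
  refine ⟨_, Fintype.equivFin κ, ?_⟩
  convert h2 using 4
  congr 1
  exact (Equiv.sum_comp e.symm fun j => _).symm

/-- Layers with large coefficients, after rescaling. -/
theorem Computes.layer_div {n p : ℕ} {x : Fin n → Fin p → ℝ} {d c : ℕ} {ι κ : Type} [Fintype ι]
    [Fintype κ] {v : Fin n → ι → ℝ} {r R : ℝ} (hr : 0 < r) (hR : 0 < R)
    (h : Computes x d c fun i a => v i a / r) (A : κ → ι → ℝ) (b : κ → ℝ)
    (hA : ∀ a j, |A a j| ≤ R) (hb : ∀ a, |b a| ≤ r * R) :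
    Computes x (d + 1) (c + Fintype.card κ * (Fintype.card ι + 1))
      fun i a => max ((∑ j, A a j * v i j) + b a) 0 / (r * R) := by
  have hrR : 0 < r * R := mul_pos hr hR
  refine (h.layer (fun a j => A a j / R) (fun a => b a / (r * R)) (fun a j => ?_) fun a => ?_).congr
    fun i a => ?_
  · rw [abs_div, abs_of_pos hR, div_le_one hR]; exact hA a j
  · rw [abs_div, abs_of_pos hrR, div_le_one hrR]; exact hb a
  · have e : (∑ j, A a j / R * (v i j / r)) + b a / (r * R) = ((∑ j, A a j * v i j) + b a) / (r * R) := by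
      rw [add_div, Finset.sum_div]
      congr 1
      refine Finset.sum_congr rfl fun j _ => ?_
      field_simp
    rw [e, ← max_div_div_right hrR.le, zero_div]

/-- Multiplication by powers of `K` with coefficients equal to one. -/
theorem Computes.amplify {n p : ℕ} {x : Fin n → Fin p → ℝ} {d c : ℕ} {z : Fin n → ℝ}
    (hz : ∀ i, 0 ≤ z i) (h : Computes x d c fun i (_ : Unit) => z i) (K m : ℕ) :
    Computes x (d + 1 + m) (c + 2 * K + m * (K * (K + 1)))
      fun i (_ : Fin K) => (K : ℝ) ^ m * z i := by
  induction m with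
  | zero =>
    -- The first layer makes `K` copies; every further layer sums the copies and so multiplies by
    -- `K` with unit coefficients.
    have h2 := h.layer (κ := Fin K) (fun _ _ => 1) (fun _ => 0) (by simp) (by simp)
    simp only [Fintype.card_fin, Fintype.card_unit] at h2
    rw [zero_mul, add_zero, add_zero, mul_comm 2 K]
    refine h2.congr fun i a => ?_
    simp [hz i]
  | succ m ih =>
    have h2 := ih.layer (κ := Fin K) (fun _ _ => 1) (fun _ => 0) (by simp) (by simp)
    simp only [Fintype.card_fin] at h2
    have e : c + 2 * K + (m + 1) * (K * (K + 1)) = c + 2 * K + m * (K * (K + 1)) + K * (K + 1) := by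
      ring
    rw [e, ← add_assoc]
    refine h2.congr fun i a => ?_
    have h0 : 0 ≤ (K : ℝ) * ((K : ℝ) ^ m * z i) := mul_nonneg (Nat.cast_nonneg K) (mul_nonneg (by positivity) (hz i))
    simp only [one_mul, add_zero, Finset.sum_const, Finset.card_univ, Fintype.card_fin, nsmul_eq_mul]
    rw [max_eq_left h0, pow_succ]
    ring

/-! ### Networks for cellwise ridge polynomials -/

/-- Sign of the two rectifiers of a ramp. -/
def rampSign (s : Bool) : ℝ := if s then 1 else -1

/-- Offset of the two rectifiers of a ramp. -/
def rampOffset (s : Bool) : ℝ := if s then 0 else 1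

theorem sum_rampSign_mul (t : ℝ) : ∑ s, rampSign s * max (t - rampOffset s) 0 = ramp t := by
  simp [rampSign, rampOffset, ramp, sub_eq_add_neg]

theorem abs_rampSign (s : Bool) : |rampSign s| = 1 := by
  cases s <;> simp [rampSign]

theorem rampOffset_mem (s : Bool) : rampOffset s ∈ Set.Icc (0 : ℝ) 1 := by
  cases s <;> simp [rampOffset]

/-- Table lookup without multiplication: the function equal to `g z` at `2 * z + 1` and to zero at
even integers is linear on `[2 * z, 2 * z + 1]`, so at `2 * z + θ` it equals the product `θ * g z`.
Thus a coefficient depending on the cell multiplies an interpolated power. -/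
theorem sum_mul_ramp_interlaced (g : ℕ → ℝ) {z J : ℕ} (hz : z < J) {θ : ℝ} (h0 : 0 ≤ θ) (h1 : θ ≤ 1) :
    ∑ r ∈ Finset.range (2 * J), ((if (r + 1) % 2 = 1 then g ((r + 1) / 2) else 0) -
      (if r % 2 = 1 then g (r / 2) else 0)) * ramp (2 * z + θ - r) = θ * g z := by
  have h := add_sum_mul_ramp (fun r => if r % 2 = 1 then g (r / 2) else 0)
    (show 2 * z < 2 * J by omega) h0 h1
  have e1 : (2 * z + 1) % 2 = 1 := by omega
  have e2 : (2 * z + 1) / 2 = z := by omega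
  have e3 : ¬ (2 * z) % 2 = 1 := by omega
  simp only [e1, e2, e3, if_true, if_false, sub_zero, zero_add] at h
  norm_num at h
  exact h

/-- A layer of rectifier pairs computing ramps of affine functions. -/
theorem Computes.toRamps {n p : ℕ} {x : Fin n → Fin p → ℝ} {d c : ℕ} {ι κ : Type} [Fintype ι]
    [Fintype κ] {v : Fin n → ι → ℝ} {r R : ℝ} (hr : 0 < r) (hR : 0 < R)
    (h : Computes x d c fun i a => v i a / r) (A : κ → ι → ℝ) (b : κ → ℝ)
    (hA : ∀ a j, |A a j| ≤ R) (hb : ∀ a, |b a| + 1 ≤ r * R) :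
    Computes x (d + 1) (c + Fintype.card κ * 2 * (Fintype.card ι + 1))
      fun i (t : κ × Bool) => max ((∑ j, A t.1 j * v i j) + b t.1 - rampOffset t.2) 0 / (r * R) := by
  have h2 := h.layer_div hr hR (κ := κ × Bool) (fun t => A t.1) (fun t => b t.1 - rampOffset t.2)
    (fun t => hA t.1) (fun t => by
      have h1 := rampOffset_mem t.2
      have h3 := hb t.1
      rw [abs_le]
      constructor <;> linarith [h1.1, h1.2, neg_abs_le (b t.1), le_abs_self (b t.1)])
  simp only [Fintype.card_prod, Fintype.card_bool] at h2
  exact h2.congr fun i t => by rw [add_sub_assoc]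

/-- A layer on top of ramps. -/
theorem Computes.ofRamps {n p : ℕ} {x : Fin n → Fin p → ℝ} {d c : ℕ} {ι κ : Type} [Fintype ι]
    [Fintype κ] {u : Fin n → ι → ℝ} {r R : ℝ} (hr : 0 < r) (hR : 0 < R)
    (h : Computes x d c fun i (t : ι × Bool) => max (u i t.1 - rampOffset t.2) 0 / r)
    (A : κ → ι → ℝ) (b : κ → ℝ) (hA : ∀ a j, |A a j| ≤ R) (hb : ∀ a, |b a| ≤ r * R) :
    Computes x (d + 1) (c + Fintype.card κ * (Fintype.card ι * 2 + 1))
      fun i a => max ((∑ j, A a j * ramp (u i j)) + b a) 0 / (r * R) := by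
  have h2 := h.layer_div hr hR (κ := κ) (fun a t => A a t.1 * rampSign t.2) b
    (fun a t => by rw [abs_mul, abs_rampSign, mul_one]; exact hA a t.1) hb
  simp only [Fintype.card_prod, Fintype.card_bool] at h2
  refine h2.congr fun i a => ?_
  rw [Fintype.sum_prod_type]
  congr 3
  refine Finset.sum_congr rfl fun j _ => ?_
  simp only [mul_assoc]
  rw [← Finset.mul_sum, sum_rampSign_mul]

/-- Four layers: ramps of coordinates and directions; twice the cell number plus an interpolated
power; ramps of this number; the interlaced lookup of the Taylor coefficients. The Taylor centre is
a design point `rep` of the same cell. Taking `(M + 1) ^ p` both as the number of cells and as the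
number of interpolation intervals keeps the cost proportional to it. Each layer is divided by `R` to
bring its coefficients into `[-1, 1]`, and adding `D` keeps the output nonnegative. -/
theorem exists_computes_cellwise {p : ℕ} (hp : 0 < p) {F : (Fin p → ℝ) → (Fin p → ℝ) → ℝ}
    (hF : RidgeRep F) :
    ∃ D : ℕ, 1 ≤ D ∧ ∀ {n : ℕ} (_ : 0 < n) {M : ℕ} (_ : 1 ≤ M) {x : Fin n → Fin p → ℝ}
      (_ : ∀ i, x i ∈ Set.Icc (0 : Fin p → ℝ) 1) {R : ℝ}
      (_ : (D * ((n * p + 1) * M * (M + 1) ^ p) : ℕ) ≤ R),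
      ∃ (g : Fin n → ℝ) (rep : Fin n → Fin n) (c : ℕ), c ≤ D * (M + 1) ^ p ∧
        (∀ i j, |x i j - x (rep i) j| ≤ 2 / M) ∧
        (∀ i, |g i - F (x (rep i)) (x i)| ≤ D / ((M + 1) ^ p : ℕ)) ∧ (∀ i, |g i| ≤ D) ∧
        Computes x 4 c fun i (_ : Unit) => (g i + D) / R ^ 4 := by
  classical
  obtain ⟨Q, inst, w, ℓ, C, hw, hw1, hc⟩ := hF
  obtain ⟨C', hC'⟩ := exists_nat_ge |C|
  set q := Fintype.card Q with hq
  obtain ⟨D₁, hD₁⟩ : ∃ D₁ : ℕ, ∀ i : Q, ℓ i ≤ D₁ :=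
    ⟨∑ i, ℓ i, fun i => Finset.single_le_sum (f := ℓ) (fun _ _ => Nat.zero_le _) (Finset.mem_univ i)⟩
  refine ⟨(p * 2 + q * 2) * (p + 1) + q * (p * 2 + q * 2 + 1) + q * 4 * (q + 1) + (q * 4 + 1)
    + (q * C') * (D₁ + 1) + 2 * C' + 2, by omega, ?_⟩
  intro n hn M hM x hx R hR
  set D : ℕ := (p * 2 + q * 2) * (p + 1) + q * (p * 2 + q * 2 + 1) + q * 4 * (q + 1) + (q * 4 + 1)
    + (q * C') * (D₁ + 1) + 2 * C' + 2 with hD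
  set J : ℕ := (M + 1) ^ p with hJ
  set K : ℕ := (n * p + 1) * M with hK
  have hJ1 : 1 ≤ J := Nat.one_le_pow _ _ (Nat.succ_pos M)
  have hMJ : M ≤ J := (Nat.le_succ M).trans (Nat.le_self_pow hp.ne' _)
  have hK1 : 1 ≤ K := Nat.one_le_iff_ne_zero.2 (by positivity)
  have hD2 : 2 ≤ D := by omega
  have hKJ : K * J ≤ D * (K * J) := Nat.le_mul_of_pos_left _ (by omega)
  have hbound : ∀ m : ℕ, m ≤ D * (K * J) → (m : ℝ) ≤ R := fun m hm =>
    le_trans (by exact_mod_cast hm) hR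
  have hDKJ : D ≤ D * (K * J) := Nat.le_mul_of_pos_right _ (Nat.mul_pos hK1 hJ1)
  have hKR : ((2 * K : ℕ) : ℝ) ≤ R := hbound _ (by
    calc 2 * K ≤ D * K := Nat.mul_le_mul_right _ hD2
      _ ≤ _ := Nat.mul_le_mul_left _ (Nat.le_mul_of_pos_right _ hJ1))
  have hJR : ((2 * J : ℕ) : ℝ) ≤ R := hbound _ (by
    calc 2 * J ≤ D * J := Nat.mul_le_mul_right _ hD2
      _ ≤ _ := Nat.mul_le_mul_left _ (Nat.le_mul_of_pos_left _ hK1))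
  have hDR : (D : ℝ) ≤ R := hbound _ hDKJ
  have hR2 : (2 : ℝ) ≤ R := le_trans (by exact_mod_cast hD2) hDR
  have hR0 : 0 < R := by linarith
  have hR1 : 1 ≤ R := by linarith
  obtain ⟨k, dig, hk, hdig, hstair, hcell⟩ := exists_staircase hM fun i j => ⟨(hx i).1 j, (hx i).2 j⟩
  replace hstair : ∀ i j, ∑ m, ramp ((K : ℝ) * x i j - k m) = dig i j := hstair
  -- cells
  let dig' : Fin n → Fin p → Fin (M + 1) := fun i j => ⟨dig i j, Nat.lt_succ_of_le (hdig i j)⟩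
  -- The staircase values are read as digits in base `M + 1`, so the cell number is linear in them.
  let Z : Fin n → ℕ := fun i => (finFunctionFinEquiv (dig' i) : ℕ)
  have hZJ : ∀ i, Z i < J := fun i => (finFunctionFinEquiv (dig' i)).2
  have hZ : ∀ i, Z i = ∑ j, dig i j * (M + 1) ^ (j : ℕ) := fun i => finFunctionFinEquiv_apply _
  have hZinj : ∀ i i', Z i = Z i' → dig i = dig i' := by
    intro i i' h
    have h2 := finFunctionFinEquiv.injective (Fin.ext h)
    funext j
    exact congrArg Fin.val (congrFun h2 j)
  have : Nonempty (Fin n) := ⟨⟨0, hn⟩⟩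
  choose cf hcf hcfx using fun i : Fin n => hc (x i) (hx i)
  -- Some design point with the given cell number; the value for empty cells is arbitrary and never
  -- used.
  let rp : ℕ → Fin n := Function.invFun Z
  have hrp : ∀ i, Z (rp (Z i)) = Z i := fun i => Function.invFun_eq ⟨i, rfl⟩
  -- ridge functions
  let y : Fin n → Q → ℝ := fun i a => ∑ j, w a j * x i j
  have hy0 : ∀ i a, 0 ≤ y i a := fun i a => Finset.sum_nonneg fun j _ => mul_nonneg (hw a j) ((hx i).1 j)
  have hy1 : ∀ i a, y i a ≤ 1 := fun i a => (Finset.sum_le_sum fun j _ =>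
    mul_le_of_le_one_right (hw a j) ((hx i).2 j)).trans (hw1 a)
  have hs := fun i a => powInterp_mem (l := ℓ a) hJ1 (hy0 i a) (hy1 i a)
  have hCC : ∀ i a, |cf i a| ≤ C' := fun i a => (hcf i a).trans ((le_abs_self C).trans hC')
  let g : Fin n → ℝ := fun i => ∑ a, powInterp (ℓ a) J (y i a) * cf (rp (Z i)) a
  have hJ0 : (0 : ℝ) < J := by exact_mod_cast hJ1
  have hgD : ∀ i, |g i| ≤ D := by
    intro i
    calc |g i| ≤ ∑ a : Q, (C' : ℝ) := by
          refine (Finset.abs_sum_le_sum_abs _ _).trans (Finset.sum_le_sum fun a _ => ?_)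
          rw [abs_mul, abs_of_nonneg (hs i a).1.1, ← one_mul (C' : ℝ)]
          exact mul_le_mul (hs i a).1.2 (hCC _ _) (abs_nonneg _) zero_le_one
      _ = ((q * C' : ℕ) : ℝ) := by simp [hq]
      _ ≤ D := by
          have : q * C' ≤ q * C' * (D₁ + 1) := Nat.le_mul_of_pos_right _ (Nat.succ_pos _)
          exact_mod_cast (show q * C' ≤ D by omega)
  have hpow : ∀ j : Fin p, 2 * (M + 1) ^ (j : ℕ) ≤ 2 * J := fun j =>
    Nat.mul_le_mul_left _ (Nat.pow_le_pow_right (Nat.succ_pos M) j.2.le)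
  -- ramps of the coordinates and of the directions
  have c1 := Computes.toRamps (κ := (Fin p × Fin M) ⊕ (Q × Fin J)) one_pos hR0
    ((Computes.input x).congr fun i a => div_one _)
    (Sum.elim (fun (t : Fin p × Fin M) (j : Fin p) => if j = t.1 then (K : ℝ) else 0) fun (t : Q × Fin J) j => J * w t.1 j)
    (Sum.elim (fun t : Fin p × Fin M => -(k t.2 : ℝ)) fun t : Q × Fin J => -((t.2 : ℕ) : ℝ))
    (by
      rintro (t | t) j
      · simp only [Sum.elim_inl]
        split_ifs
        · rw [Nat.abs_cast]
          exact le_trans (by exact_mod_cast (show K ≤ 2 * K by omega)) hKR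
        · simpa using hR0.le
      · simp only [Sum.elim_inr]
        have hwj : w t.1 j ≤ 1 := (Finset.single_le_sum (f := fun j => w t.1 j)
          (fun j _ => hw t.1 j) (Finset.mem_univ j)).trans (hw1 t.1)
        rw [abs_of_nonneg (mul_nonneg hJ0.le (hw _ _))]
        push_cast at hJR
        nlinarith [hw t.1 j])
    (by
      rintro (t | t)
      · simp only [Sum.elim_inl, one_mul, abs_neg, Nat.abs_cast]
        refine le_trans ?_ hKR
        have := hk t.2
        exact_mod_cast (show k t.2 + 1 ≤ 2 * K by omega)
      · simp only [Sum.elim_inr, one_mul, abs_neg, Nat.abs_cast]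
        refine le_trans ?_ hJR
        have := t.2.2
        exact_mod_cast (show (t.2 : ℕ) + 1 ≤ 2 * J by omega))
  rw [one_mul] at c1
  let U₁ : Fin n → (Fin p × Fin M) ⊕ (Q × Fin J) → ℝ := fun i =>
    Sum.elim (fun t => (K : ℝ) * x i t.1 - k t.2) fun t => J * y i t.1 - ((t.2 : ℕ) : ℝ)
  have v1 : ∀ i, ∀ t : ((Fin p × Fin M) ⊕ (Q × Fin J)) × Bool, max (U₁ i t.1 - rampOffset t.2) 0 / R =
      max ((∑ j, (Sum.elim (fun (t : Fin p × Fin M) (j : Fin p) => if j = t.1 then (K : ℝ) else 0)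
          fun (t : Q × Fin J) j => J * w t.1 j) t.1 j * x i j) +
        (Sum.elim (fun t : Fin p × Fin M => -(k t.2 : ℝ)) fun t : Q × Fin J => -((t.2 : ℕ) : ℝ)) t.1 -
          rampOffset t.2) 0 / R := by
    rintro i ⟨t | t, s⟩
    · simp only [U₁, Sum.elim_inl, ite_mul, zero_mul, Finset.sum_ite_eq', Finset.mem_univ, if_true,
        sub_eq_add_neg]
    · simp only [U₁, y, Sum.elim_inr, mul_assoc, ← Finset.mul_sum, sub_eq_add_neg]
  -- cell numbers plus interpolated powers
  have c2 := Computes.ofRamps (κ := Q) (u := U₁) hR0 hR0 (c1.congr v1)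
    (fun a => Sum.elim (fun t : Fin p × Fin M => ((2 * (M + 1) ^ (t.1 : ℕ) : ℕ) : ℝ))
      fun t : Q × Fin J => if t.1 = a then ((((t.2 : ℕ) + 1 : ℕ) : ℝ) / J) ^ ℓ a - (((t.2 : ℕ) : ℝ) / J) ^ ℓ a else 0)
    (fun a => 0 ^ ℓ a)
    (by
      rintro a (t | t)
      · simp only [Sum.elim_inl, Nat.abs_cast]
        exact le_trans (by exact_mod_cast hpow t.1) hJR
      · simp only [Sum.elim_inr]
        split_ifs
        · have h1 : (((t.2 : ℕ) + 1 : ℕ) : ℝ) / J ≤ 1 :=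
            (div_le_one hJ0).2 (by exact_mod_cast t.2.2)
          have h2 : ((t.2 : ℕ) : ℝ) / J ≤ 1 :=
            (div_le_one hJ0).2 (by exact_mod_cast t.2.2.le)
          have h3 := pow_le_one₀ (n := ℓ a) (by positivity) h1
          have h4 := pow_le_one₀ (n := ℓ a) (by positivity) h2
          have h5 : 0 ≤ ((((t.2 : ℕ) + 1 : ℕ) : ℝ) / J) ^ ℓ a := by positivity
          have h6 : 0 ≤ (((t.2 : ℕ) : ℝ) / J) ^ ℓ a := by positivity
          rw [abs_le]
          constructor <;> linarith
        · simpa using hR0.le)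
    (fun a => by
      rw [abs_of_nonneg (by positivity)]
      exact (pow_le_one₀ le_rfl zero_le_one).trans (one_le_mul_of_one_le_of_one_le hR1 hR1))
  have v2 : ∀ i a, (2 * (Z i : ℝ) + powInterp (ℓ a) J (y i a)) / (R * R) =
      max ((∑ t : (Fin p × Fin M) ⊕ (Q × Fin J),
        (Sum.elim (fun t : Fin p × Fin M => ((2 * (M + 1) ^ (t.1 : ℕ) : ℕ) : ℝ))
          (fun t : Q × Fin J => if t.1 = a then ((((t.2 : ℕ) + 1 : ℕ) : ℝ) / J) ^ ℓ a - (((t.2 : ℕ) : ℝ) / J) ^ ℓ a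
            else 0) : (Fin p × Fin M) ⊕ (Q × Fin J) → ℝ) t *
        ramp (U₁ i t)) + 0 ^ ℓ a) 0 / (R * R) := by
    intro i a
    have e1 : ∑ j : Fin p, ∑ m : Fin M, ((2 * (M + 1) ^ (j : ℕ) : ℕ) : ℝ) * ramp (K * x i j - k m) =
        2 * (Z i : ℝ) := by
      simp only [← Finset.mul_sum, hstair, hZ i]
      push_cast
      rw [Finset.mul_sum]
      exact Finset.sum_congr rfl fun j _ => by ring
    have e2 : ∑ a' : Q, ∑ r : Fin J, (if a' = a then ((((r : ℕ) + 1 : ℕ) : ℝ) / J) ^ ℓ a -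
        (((r : ℕ) : ℝ) / J) ^ ℓ a else 0) * ramp (J * y i a' - ((r : ℕ) : ℝ)) =
        ∑ r ∈ Finset.range J, ((((r + 1 : ℕ) : ℝ) / J) ^ ℓ a - ((r : ℝ) / J) ^ ℓ a) *
          ramp (J * y i a - r) := by
      rw [Finset.sum_comm, ← Fin.sum_univ_eq_sum_range (fun r : ℕ => ((((r + 1 : ℕ) : ℝ) / J) ^ ℓ a -
        ((r : ℝ) / J) ^ ℓ a) * ramp (J * y i a - r)) J]
      refine Finset.sum_congr rfl fun r _ => ?_
      simp only [ite_mul, zero_mul, Finset.sum_ite_eq', Finset.mem_univ, if_true]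
    rw [Fintype.sum_sum_type]
    simp only [U₁, Sum.elim_inl, Sum.elim_inr, Fintype.sum_prod_type]
    rw [e1, e2, add_assoc, max_eq_left]
    · rw [powInterp]; ring
    · have := (hs i a).1.1
      rw [powInterp] at this
      have h0 : (0 : ℝ) ≤ Z i := Nat.cast_nonneg _
      linarith
  have c3 := Computes.toRamps (κ := Q × Fin (2 * J)) (mul_pos hR0 hR0) hR0 (c2.congr v2)
    (fun t a => if a = t.1 then 1 else 0) (fun t => -((t.2 : ℕ) : ℝ))
    (fun t a => by
      split_ifs
      · simpa using hR1
      · simpa using hR0.le)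
    (fun t => by
      rw [abs_neg, Nat.abs_cast]
      have h1 : (((t.2 : ℕ) : ℝ) + 1) ≤ R := le_trans (by exact_mod_cast t.2.2) hJR
      nlinarith [one_le_mul_of_one_le_of_one_le hR1 hR1])
  let U₃ : Fin n → Q × Fin (2 * J) → ℝ := fun i t =>
    2 * (Z i : ℝ) + powInterp (ℓ t.1) J (y i t.1) - ((t.2 : ℕ) : ℝ)
  have v3 : ∀ i, ∀ t : (Q × Fin (2 * J)) × Bool, max (U₃ i t.1 - rampOffset t.2) 0 / (R * R * R) =
      max ((∑ a, (if a = t.1.1 then 1 else 0) * (2 * (Z i : ℝ) + powInterp (ℓ a) J (y i a))) +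
        -((t.1.2 : ℕ) : ℝ) - rampOffset t.2) 0 / (R * R * R) := by
    intro i t
    simp only [U₃, ite_mul, one_mul, zero_mul, Finset.sum_ite_eq', Finset.mem_univ, if_true,
      sub_eq_add_neg]
  have c4 := Computes.ofRamps (κ := Unit) (u := U₃) (mul_pos (mul_pos hR0 hR0) hR0) hR0 (c3.congr v3)
    (fun _ t => (if ((t.2 : ℕ) + 1) % 2 = 1 then cf (rp (((t.2 : ℕ) + 1) / 2)) t.1 else 0) -
      (if (t.2 : ℕ) % 2 = 1 then cf (rp ((t.2 : ℕ) / 2)) t.1 else 0))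
    (fun _ => D)
    (fun _ t => by
      have hDC : ((2 * C' : ℕ) : ℝ) ≤ R := le_trans (by exact_mod_cast (show 2 * C' ≤ D by omega)) hDR
      push_cast at hDC
      have h1 := hCC (rp (((t.2 : ℕ) + 1) / 2)) t.1
      have h2 := hCC (rp ((t.2 : ℕ) / 2)) t.1
      have h3 : (0 : ℝ) ≤ C' := Nat.cast_nonneg _
      rw [abs_le] at h1 h2 ⊢
      split_ifs <;> constructor <;> linarith [h1.1, h1.2, h2.1, h2.2])
    (fun _ => by
      rw [Nat.abs_cast]
      refine hDR.trans ?_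
      nlinarith [one_le_mul_of_one_le_of_one_le (one_le_mul_of_one_le_of_one_le hR1 hR1) hR1])
  have v4 : ∀ i, ∀ _ : Unit, (g i + D) / R ^ 4 = max ((∑ t : Q × Fin (2 * J),
      ((if ((t.2 : ℕ) + 1) % 2 = 1 then cf (rp (((t.2 : ℕ) + 1) / 2)) t.1 else 0) -
        (if (t.2 : ℕ) % 2 = 1 then cf (rp ((t.2 : ℕ) / 2)) t.1 else 0)) *
      ramp (U₃ i t)) + D) 0 / (R * R * R * R) := by
    intro i _
    have e : ∑ t : Q × Fin (2 * J),
        ((if ((t.2 : ℕ) + 1) % 2 = 1 then cf (rp (((t.2 : ℕ) + 1) / 2)) t.1 else 0) -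
          (if (t.2 : ℕ) % 2 = 1 then cf (rp ((t.2 : ℕ) / 2)) t.1 else 0)) *
        ramp (U₃ i t) = g i := by
      rw [Fintype.sum_prod_type]
      refine Finset.sum_congr rfl fun a _ => ?_
      rw [← sum_mul_ramp_interlaced (fun z => cf (rp z) a) (hZJ i) (hs i a).1.1 (hs i a).1.2]
      exact Fin.sum_univ_eq_sum_range (fun r : ℕ =>
        ((if (r + 1) % 2 = 1 then cf (rp ((r + 1) / 2)) a else 0) -
          (if r % 2 = 1 then cf (rp (r / 2)) a else 0)) *
          ramp (2 * (Z i : ℝ) + powInterp (ℓ a) J (y i a) - (r : ℝ))) (2 * J)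
    rw [e, max_eq_left]
    · congr 1; ring
    · linarith [neg_abs_le (g i), hgD i]
  refine ⟨g, fun i => rp (Z i), _, ?_, fun i j => hcell _ _ (hZinj _ _ (hrp i).symm) j, ?_, hgD,
    c4.congr v4⟩
  · simp only [Fintype.card_sum, Fintype.card_prod, Fintype.card_fin, Fintype.card_unit, ← hq]
    have h1 : p * M ≤ p * J := Nat.mul_le_mul_left _ hMJ
    calc _ ≤ 0 + (p * J + q * J) * 2 * (p + 1) + q * ((p * J + q * J) * 2 + J) +
          q * (2 * J) * 2 * (q + 1) + 1 * (q * (2 * J) * 2 + J) := by gcongr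
      _ = ((p * 2 + q * 2) * (p + 1) + q * (p * 2 + q * 2 + 1) + q * 4 * (q + 1) + (q * 4 + 1)) * J := by
          ring
      _ ≤ D * J := Nat.mul_le_mul_right _ (by omega)
  · intro i
    rw [hcfx, ← Finset.sum_sub_distrib]
    calc |∑ a, (powInterp (ℓ a) J (y i a) * cf (rp (Z i)) a
          - cf (rp (Z i)) a * (∑ j, w a j * x i j) ^ ℓ a)| ≤ ∑ a : Q, (D₁ / J * C' : ℝ) := by
          refine (Finset.abs_sum_le_sum_abs _ _).trans (Finset.sum_le_sum fun a _ => ?_)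
          rw [mul_comm (cf _ _), ← sub_mul, abs_mul]
          refine mul_le_mul ((hs i a).2.trans ?_) (hCC _ _) (abs_nonneg _) (by positivity)
          gcongr
          exact hD₁ a
      _ = ((q * C' * D₁ : ℕ) : ℝ) / J := by simp [hq]; ring
      _ ≤ D / J := by
          gcongr
          have : q * C' * D₁ ≤ q * C' * (D₁ + 1) := Nat.mul_le_mul_left _ (Nat.le_succ _)
          omega

/-! ### Sparse networks approximating a Hölder function at the design points -/

/-- A small positive multiple of a function computed by a shallow network is rescaled by the
remaining layers. -/
theorem Computes.exists_network {p n m c K : ℕ} {x : Fin n → Fin p → ℝ} {g : Fin n → ℝ} {D R : ℝ}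
    (hg : ∀ i, |g i| ≤ D) (hR : 0 < R) (hRK : R ^ 4 ≤ (K : ℝ) ^ (m + 1))
    (h : Computes x 4 c fun i (_ : Unit) => (g i + D) / R ^ 4) {N : ℕ}
    (hN : c + 2 * K + m * (K * (K + 1)) ≤ 12 * p * N) :
    ∃ (B : CoeffIdx p (4 + 1 + m) N → ℝ) (γ : Finset (DeepIdx p (4 + 1 + m) N)),
      γ.card ≤ c + 2 * K + m * (K * (K + 1)) ∧ (∀ k, k ∉ γ → B (Sum.inl k) = 0) ∧
      (∀ k, |B (Sum.inl k)| ≤ 1) ∧ (∀ k, |B (Sum.inr k)| ≤ max 1 |D|) ∧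
      ∀ i, network B (x i) = g i := by
  classical
  have hR4 : 0 < R ^ 4 := pow_pos hR 4
  have hz : ∀ i, 0 ≤ (g i + D) / R ^ 4 := fun i =>
    div_nonneg (by linarith [neg_abs_le (g i), hg i]) hR4.le
  obtain ⟨m', e, hcomp⟩ := Computes.amplify hz h K m
  obtain rfl : m' = K := by simpa using (Fintype.card_congr e).symm
  obtain ⟨β, S, hSc, hβS, -, hβ1, hw, hhid⟩ := hcomp.exists_coeff
  have hK : (0 : ℝ) < (m' : ℝ) ^ (m + 1) := hR4.trans_le hRK
  -- The `K` copies, each amplified by `K ^ m`, are averaged with weights of at most one to restore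
  -- exactly the factor `R ^ 4`; the bias removes the offset `D`.
  let B : CoeffIdx p (4 + 1 + m) N → ℝ := Sum.elim (fun k => β k.1 k.2.1 (k.2.2.map Fin.val))
    fun t => t.elim (-D) fun j => if (j : ℕ) < m' then R ^ 4 / (m' : ℝ) ^ (m + 1) else 0
  refine ⟨B, Finset.univ.filter fun k => ((k.1 : ℕ), (k.2.1 : ℕ), k.2.2.map Fin.val) ∈ S, ?_, ?_, ?_,
    ?_, ?_⟩
  · refine (Finset.card_le_card_of_injOn
      (fun k : DeepIdx p (4 + 1 + m) N => ((k.1 : ℕ), (k.2.1 : ℕ), k.2.2.map Fin.val))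
      (fun k hk => (Finset.mem_filter.1 hk).2) ?_).trans hSc
    rintro ⟨l, i, j⟩ - ⟨l', i', j'⟩ - hll
    simp only [Prod.mk.injEq] at hll
    obtain ⟨h1, h2, h3⟩ := hll
    obtain rfl := Fin.ext h1
    obtain rfl := Fin.ext h2
    obtain rfl := Option.map_injective Fin.val_injective h3
    rfl
  · intro k hk
    exact hβS _ _ _ fun h => hk (Finset.mem_filter.2 ⟨Finset.mem_univ _, h⟩)
  · intro k
    exact hβ1 _ _ _
  · rintro (_ | j)
    · simp [B]
    · simp only [B, Sum.elim_inr, Option.elim]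
      split_ifs
      · rw [abs_of_nonneg (by positivity)]
        exact ((div_le_one hK).2 hRK).trans (le_max_left _ _)
      · simp
  · intro i
    have hh := hhid (4 + 1 + m) N hN le_rfl B (fun l i j _ => rfl) i
    rw [network]
    have e1 : ∀ j : Fin (width p N (4 + 1 + m)), B (Sum.inr (some j)) * hidden B (x i) (4 + 1 + m) le_rfl j =
        if h : (j : ℕ) < m' then
          (fun _ : Fin m' => R ^ 4 / (m' : ℝ) ^ (m + 1) * ((m' : ℝ) ^ m * ((g i + D) / R ^ 4))) ⟨j, h⟩
        else 0 := by
      intro j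
      rw [hh j]
      simp only [B, Sum.elim_inr, Option.elim]
      split_ifs <;> simp
    rw [(Finset.sum_congr rfl fun j _ => e1 j).trans (sum_fin_dite (hw N hN)
      fun _ : Fin m' => R ^ 4 / (m' : ℝ) ^ (m + 1) * ((m' : ℝ) ^ m * ((g i + D) / R ^ 4)))]
    simp only [B, Sum.elim_inr, Option.elim, Finset.sum_const, Finset.card_univ, Fintype.card_fin,
      nsmul_eq_mul]
    have h1 : (m' : ℝ) ^ (m + 1) = (m' : ℝ) ^ m * m' := pow_succ _ _
    have h2 : (m' : ℝ) * (R ^ 4 / (m' : ℝ) ^ (m + 1) * ((m' : ℝ) ^ m * ((g i + D) / R ^ 4))) = g i + D := by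
      have h3 : (m' : ℝ) ≠ 0 := by rintro h0; rw [h0] at hK; simp at hK
      rw [h1]
      field_simp
    rw [h2]; ring

/-- The Taylor error on cells of diameter at most `2 / M` is of order `M ^ (-α)`, and the
interpolation error `1 / (M + 1) ^ p` is no larger, since `α ≤ p`. The lower bound on the depth
enters through amplification: `R` is polynomial in `n`, so a constant base `K` raised to a power of
order `log n` dominates `R ^ 4`. -/
theorem exists_network_approx {p : ℕ} (hp : 0 < p) {α : ℝ} (hα0 : 0 < α) (hαp : α ≤ p)
    {f₀ : (Fin p → ℝ) → ℝ} (hf₀ : IsHolder α f₀) {c₀ : ℝ} (hc₀ : 0 < c₀) :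
    ∃ A : ℕ, 1 ≤ A ∧ ∀ᶠ n : ℕ in atTop, ∀ (M L N : ℕ) (x : Fin n → Fin p → ℝ), 1 ≤ M → M ≤ n →
      c₀ * Real.log n ≤ L → (∀ i, x i ∈ Set.Icc (0 : Fin p → ℝ) 1) →
      A * ((M + 1) ^ p + L) ≤ N →
      ∃ (B : CoeffIdx p L N → ℝ) (γ : Finset (DeepIdx p L N)),
        γ.card ≤ A * ((M + 1) ^ p + L) ∧ (∀ k, k ∉ γ → B (Sum.inl k) = 0) ∧
        (∀ k, |B (Sum.inl k)| ≤ 1) ∧ (∀ k, |B (Sum.inr k)| ≤ A) ∧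
        ∀ i, |network B (x i) - f₀ (x i)| ≤ A * (M : ℝ) ^ (-α) := by
  obtain ⟨F, C, hF, hC0, hFf⟩ := hf₀.exists_ridgeRep
  obtain ⟨D, hD1, hcell⟩ := exists_computes_cellwise hp hF
  -- `R ^ 4` is at most `n ^ (4 * (2 * p + 4))`; the extra factor `2` pays for the layers already
  -- spent, because `L - 4` is at least `L / 2` for `L ≥ 10`.
  obtain ⟨K, hK⟩ := exists_nat_ge (Real.exp (2 * (4 * (2 * p + 4)) / c₀))
  obtain ⟨C', hC'⟩ := exists_nat_ge (C * 2 ^ α)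
  refine ⟨D + 2 * K + K * (K + 1) + C', by omega, ?_⟩
  set A : ℕ := D + 2 * K + K * (K + 1) + C' with hA
  have hlog : Tendsto (fun n : ℕ => c₀ * Real.log n) atTop atTop :=
    (Real.tendsto_log_atTop.comp tendsto_natCast_atTop_atTop).const_mul_atTop hc₀
  filter_upwards [hlog.eventually_ge_atTop 10, eventually_ge_atTop (D + p + 2)] with n hn10 hnD
  intro M L N x hM hMn hL hx hN
  have hL10 : (10 : ℝ) ≤ L := hn10.trans hL
  have hL10' : 10 ≤ L := by exact_mod_cast hL10
  obtain ⟨m, hm⟩ := Nat.exists_eq_add_of_le (show 5 ≤ L by omega)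
  obtain rfl : L = 4 + 1 + m := hm
  set R : ℕ := D * ((n * p + 1) * M * (M + 1) ^ p) with hR
  have hn0 : 0 < n := by omega
  have hRn : R ≤ n ^ (2 * p + 4) := by
    have h1 : n * p + 1 ≤ n ^ 2 := by nlinarith
    have h2 : M + 1 ≤ n ^ 2 := by nlinarith
    calc R ≤ n * (n ^ 2 * n * (n ^ 2) ^ p) := by
          rw [hR]
          gcongr
          omega
      _ = n ^ (2 * p + 4) := by rw [← pow_mul]; ring
  have hR0 : 0 < R := by rw [hR]; positivity
  obtain ⟨g, rep, c, hc, hrep, hgF, hgD, hcomp⟩ := hcell hn0 hM hx (R := R) le_rfl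
  have hRK : (R : ℝ) ^ 4 ≤ (K : ℝ) ^ (m + 1) := by
    have hn0' : (0 : ℝ) < n := by exact_mod_cast hn0
    have hlogn : 0 ≤ Real.log n := Real.log_natCast_nonneg n
    calc (R : ℝ) ^ 4 ≤ ((n : ℝ) ^ (2 * p + 4)) ^ 4 := by
          gcongr; exact_mod_cast hRn
      _ = Real.exp ((4 * (2 * p + 4)) * Real.log n) := by
          rw [← pow_mul, ← Real.exp_log (pow_pos hn0' _), Real.log_pow]
          push_cast; ring_nf
      _ ≤ Real.exp ((m + 1 : ℕ) * (2 * (4 * (2 * p + 4)) / c₀)) := by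
          refine Real.exp_le_exp.2 ?_
          rw [mul_div_assoc', le_div_iff₀ hc₀]
          push_cast at hL hL10 ⊢
          have h1 : c₀ * Real.log n ≤ 2 * (m + 1) := by linarith
          have h2 : (0 : ℝ) ≤ 4 * (2 * p + 4) := by positivity
          nlinarith
      _ = Real.exp (2 * (4 * (2 * p + 4)) / c₀) ^ (m + 1) := by rw [← Real.exp_nat_mul]
      _ ≤ _ := by gcongr
  have hcost : c + 2 * K + m * (K * (K + 1)) ≤ A * ((M + 1) ^ p + (4 + 1 + m)) := by
    have h1 : 1 ≤ (M + 1) ^ p := Nat.one_le_pow _ _ (Nat.succ_pos M)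
    rw [hA]
    nlinarith [Nat.zero_le (C' * ((M + 1) ^ p + (4 + 1 + m))), Nat.zero_le (D * (4 + 1 + m)),
      Nat.zero_le (K * (4 + 1 + m)), Nat.zero_le (K * (K + 1) * (M + 1) ^ p),
      Nat.mul_le_mul_left (2 * K) h1]
  have hpN : A * ((M + 1) ^ p + (4 + 1 + m)) ≤ 12 * p * N :=
    hN.trans (Nat.le_mul_of_pos_left _ (by omega))
  obtain ⟨B, γ, hγ, hγ0, hB1, hBt, hnet⟩ :=
    hcomp.exists_network hgD (by exact_mod_cast hR0) hRK (hcost.trans hpN)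
  have hDA : (D : ℝ) ≤ A := by exact_mod_cast (show D ≤ A by omega)
  have hA1 : (1 : ℝ) ≤ A := by exact_mod_cast (show 1 ≤ A by omega)
  refine ⟨B, γ, hγ.trans hcost, hγ0, hB1, fun k => (hBt k).trans (max_le hA1 (by simpa using hDA)), ?_⟩
  intro i
  have hM0 : (0 : ℝ) < M := by exact_mod_cast hM
  have h1 : (D : ℝ) / ((M + 1) ^ p : ℕ) ≤ D * (M : ℝ) ^ (-α) := by
    rw [div_eq_mul_inv, Real.rpow_neg hM0.le]
    gcongr
    calc (M : ℝ) ^ α ≤ (M : ℝ) ^ (p : ℝ) :=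
          Real.rpow_le_rpow_of_exponent_le (by exact_mod_cast hM) hαp
      _ ≤ ((M + 1) ^ p : ℕ) := by
          rw [Real.rpow_natCast]; push_cast; gcongr; linarith
  have h2 : |f₀ (x i) - F (x (rep i)) (x i)| ≤ C' * (M : ℝ) ^ (-α) := by
    refine (hFf _ (hx _) _ (hx i)).trans ?_
    have h3 : ‖x i - x (rep i)‖ ≤ 2 / M := by
      refine (pi_norm_le_iff_of_nonneg (by positivity)).2 fun j => ?_
      exact hrep i j
    calc C * ‖x i - x (rep i)‖ ^ α ≤ C * (2 / M) ^ α := by gcongr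
      _ = C * 2 ^ α * (M : ℝ) ^ (-α) := by
          rw [Real.div_rpow (by norm_num) hM0.le, Real.rpow_neg hM0.le]; ring
      _ ≤ _ := by gcongr
  rw [hnet]
  have h4 : g i - f₀ (x i) = (g i - F (x (rep i)) (x i)) - (f₀ (x i) - F (x (rep i)) (x i)) := by ring
  have h5 : (0 : ℝ) ≤ (M : ℝ) ^ (-α) := by positivity
  have h6 : ((D + C' : ℕ) : ℝ) ≤ A := by exact_mod_cast (show D + C' ≤ A by omega)
  push_cast at h6
  calc |g i - f₀ (x i)| ≤ |g i - F (x (rep i)) (x i)| + |f₀ (x i) - F (x (rep i)) (x i)| := by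
        rw [h4]; exact abs_sub _ _
    _ ≤ D * (M : ℝ) ^ (-α) + C' * (M : ℝ) ^ (-α) := add_le_add ((hgF i).trans h1) h2
    _ = (D + C') * (M : ℝ) ^ (-α) := by ring
    _ ≤ _ := by gcongr

/-! ### Prior mass of small balls -/

/-- On the side of `b` facing the origin an interval of length `δ` stays inside `[-1, 1]`, even if
`b` is an endpoint. -/
theorem le_cond_volume_Icc {b δ : ℝ} (hb : |b| ≤ 1) (hδ0 : 0 ≤ δ) (hδ1 : δ ≤ 1) :
    ENNReal.ofReal (δ / 2) ≤
      ProbabilityTheory.cond volume (Set.Icc (-1 : ℝ) 1) (Set.Icc (b - δ) (b + δ)) := by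
  rw [ProbabilityTheory.cond_apply measurableSet_Icc, Real.volume_Icc]
  have h1 : ENNReal.ofReal δ ≤ volume (Set.Icc (-1 : ℝ) 1 ∩ Set.Icc (b - δ) (b + δ)) := by
    rw [abs_le] at hb
    rcases le_total 0 b with h | h
    · have e : ENNReal.ofReal δ = volume (Set.Icc (b - δ) b) := by
        rw [Real.volume_Icc, sub_sub_cancel]
      rw [e]
      refine measure_mono fun t ht => ⟨⟨?_, ?_⟩, ht.1, ?_⟩ <;> linarith [ht.1, ht.2]
    · have e : ENNReal.ofReal δ = volume (Set.Icc b (b + δ)) := by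
        rw [Real.volume_Icc, add_sub_cancel_left]
      rw [e]
      refine measure_mono fun t ht => ⟨⟨?_, ?_⟩, ?_, ht.2⟩ <;> linarith [ht.1, ht.2]
  calc ENNReal.ofReal (δ / 2) = (ENNReal.ofReal (1 - -1))⁻¹ * ENNReal.ofReal δ := by
        rw [← ENNReal.ofReal_inv_of_pos (by norm_num), ← ENNReal.ofReal_mul (by norm_num)]
        congr 1; ring
    _ ≤ _ := by gcongr

theorem le_gaussianReal_Icc {b δ A : ℝ} (hb : |b| ≤ A) (hδ1 : δ ≤ 1) :
    ENNReal.ofReal (δ / 2 * Real.exp (-(A + 1) ^ 2 / 2)) ≤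
      gaussianReal 0 1 (Set.Icc (b - δ) (b + δ)) := by
  rw [gaussianReal_apply _ one_ne_zero]
  have h1 : ∀ t ∈ Set.Icc (b - δ) (b + δ),
      ENNReal.ofReal (1 / 4 * Real.exp (-(A + 1) ^ 2 / 2)) ≤ gaussianPDF 0 1 t := by
    intro t ht
    rw [gaussianPDF]
    refine ENNReal.ofReal_le_ofReal ?_
    rw [gaussianPDFReal]
    have hs : (1 : ℝ) / 4 ≤ (√(2 * Real.pi * (1 : ℝ≥0)))⁻¹ := by
      rw [one_div]
      refine inv_anti₀ (Real.sqrt_pos.2 (by simp [Real.pi_pos])) ?_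
      rw [Real.sqrt_le_left (by norm_num)]
      simp only [NNReal.coe_one, mul_one]
      nlinarith [Real.pi_le_four]
    refine mul_le_mul hs (Real.exp_le_exp.2 ?_) (Real.exp_pos _).le (by positivity)
    rw [abs_le] at hb
    have h2 : t ^ 2 ≤ (A + 1) ^ 2 := sq_le_sq' (by linarith [ht.1]) (by linarith [ht.2])
    simp only [sub_zero, NNReal.coe_one, mul_one]
    linarith
  calc _ = ∫⁻ _ in Set.Icc (b - δ) (b + δ), ENNReal.ofReal (1 / 4 * Real.exp (-(A + 1) ^ 2 / 2)) := by
        rw [setLIntegral_const, Real.volume_Icc, ← ENNReal.ofReal_mul (by positivity)]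
        congr 1; ring
    _ ≤ _ := setLIntegral_mono' measurableSet_Icc h1

open scoped Classical in
-- The mass factorises; inactive coordinates cost nothing because both `B` and the prior vanish
-- there, and one lower bound serves uniform and normal coefficients alike.
theorem le_coeffPrior_ball {p L N : ℕ} {γ : Finset (CoeffIdx p L N)} {B : CoeffIdx p L N → ℝ}
    {A δ : ℝ} (hB0 : ∀ j, j ∉ γ → B j = 0) (hB1 : ∀ k, |B (Sum.inl k)| ≤ 1)
    (hBA : ∀ k, |B (Sum.inr k)| ≤ A) (hδ0 : 0 ≤ δ) (hδ1 : δ ≤ 1) :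
    ENNReal.ofReal ((δ / 2 * Real.exp (-(A + 1) ^ 2 / 2)) ^ γ.card) ≤
      coeffPrior γ {B' | ∀ j, |B' j - B j| ≤ δ} := by
  have hset : {B' : CoeffIdx p L N → ℝ | ∀ j, |B' j - B j| ≤ δ} =
      Set.univ.pi fun j => Set.Icc (B j - δ) (B j + δ) := by
    ext B'
    simp only [Set.mem_ofPred_eq, Set.mem_univ_pi, Set.mem_Icc, abs_le]
    refine forall_congr' fun j => ⟨fun h => ⟨?_, ?_⟩, fun h => ⟨?_, ?_⟩⟩ <;> linarith [h.1, h.2]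
  have hprob : ∀ j, IsProbabilityMeasure (if j ∈ γ then slab j else Measure.dirac (0 : ℝ)) := by
    intro j; split_ifs <;> infer_instance
  rw [hset, coeffPrior, Measure.pi_pi, ENNReal.ofReal_pow (by positivity), ← Finset.prod_const]
  rw [← Finset.prod_subset (Finset.subset_univ γ)]
  · refine Finset.prod_le_prod' fun j hj => ?_
    rw [if_pos hj]
    rcases j with k | k
    · refine le_trans (ENNReal.ofReal_le_ofReal ?_) (le_cond_volume_Icc (hB1 k) hδ0 hδ1)
      exact mul_le_of_le_one_right (by positivity) (Real.exp_le_one_iff.2 (by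
        have := sq_nonneg (A + 1)
        linarith))
    · exact le_gaussianReal_Icc (hBA k) hδ1
  · intro j _ hj
    rw [if_neg hj, hB0 j hj, Measure.dirac_apply' _ measurableSet_Icc, Set.indicator_of_mem]
    · rfl
    · constructor <;> linarith

/-! ### Lower bounds for the mixture weights -/

theorem le_sparsityWeight {lamS : ℝ} (hlamS : 0 < lamS) {p L N s : ℕ} (hs : s ∈ sparsityLevels p L N) :
    Real.exp (-lamS * s) / Fintype.card (CoeffIdx p L N) ≤ sparsityWeight lamS p L N s := by
  rw [sparsityWeight]
  have hpos : 0 < ∑ r ∈ sparsityLevels p L N, Real.exp (-lamS * r) :=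
    Finset.sum_pos (fun _ _ => Real.exp_pos _) ⟨s, hs⟩
  refine div_le_div_of_nonneg_left (Real.exp_pos _).le hpos ?_
  calc ∑ r ∈ sparsityLevels p L N, Real.exp (-lamS * r) ≤ ∑ r ∈ sparsityLevels p L N, (1 : ℝ) := by
        refine Finset.sum_le_sum fun r _ => Real.exp_le_one_iff.2 ?_
        have : 0 ≤ lamS * r := by positivity
        linarith
    _ = ((sparsityLevels p L N).card : ℝ) := by simp
    _ ≤ _ := by
        have : (sparsityLevels p L N).card ≤ Fintype.card (CoeffIdx p L N) := by
          rw [sparsityLevels, Nat.card_Icc]; omega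
        exact_mod_cast this

theorem card_patterns_le (p L N s : ℕ) :
    (patterns p L N s).card ≤ Fintype.card (CoeffIdx p L N) ^ s := by
  classical
  refine le_trans ?_ (Nat.choose_le_pow (Fintype.card (CoeffIdx p L N)) s)
  rw [← Finset.card_univ, ← Finset.card_powersetCard]
  refine Finset.card_le_card fun γ hγ => ?_
  rw [Finset.mem_powersetCard]
  rw [patterns, Finset.mem_filter] at hγ
  exact ⟨Finset.subset_univ _, hγ.2.1⟩

/-- Lower bound for the prior mass of a neighbourhood of a sparse network. -/
theorem le_paramPrior_ball {lam lamS : ℝ} (hlam : 0 < lam) (hlamS : 0 < lamS) {p L N : ℕ}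
    {γ : Finset (CoeffIdx p L N)} {B : CoeffIdx p L N → ℝ} (hγ : ∀ k, Sum.inr k ∈ γ)
    {A δ : ℝ} (hB0 : ∀ j, j ∉ γ → B j = 0) (hB1 : ∀ k, |B (Sum.inl k)| ≤ 1)
    (hBA : ∀ k, |B (Sum.inr k)| ≤ A) (hδ0 : 0 ≤ δ) (hδ1 : δ ≤ 1)
    {F : Set (Param p L)} (hF : MeasurableSet F)
    (hBF : ∀ B' : CoeffIdx p L N → ℝ, (∀ j, |B' j - B j| ≤ δ) → mkParam N B' ∈ F) :
    ENNReal.ofReal (widthWeight lam N * (Real.exp (-lamS * γ.card) / Fintype.card (CoeffIdx p L N) *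
      (((Fintype.card (CoeffIdx p L N) : ℝ) ^ γ.card)⁻¹ *
        (δ / 2 * Real.exp (-(A + 1) ^ 2 / 2)) ^ γ.card)))
      ≤ paramPrior lam lamS p L F := by
  classical
  have hcard : width p N L + 1 ≤ γ.card := by
    have h1 : (Finset.univ.image fun k : TopIdx p L N => (Sum.inr k : CoeffIdx p L N)).card =
        width p N L + 1 := by
      rw [Finset.card_image_of_injective _ Sum.inr_injective]
      simp
    rw [← h1]
    refine Finset.card_le_card fun j hj => ?_
    obtain ⟨k, -, rfl⟩ := Finset.mem_image.1 hj
    exact hγ k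
  have hs : γ.card ∈ sparsityLevels p L N := Finset.mem_Icc.2 ⟨hcard, Finset.card_le_univ γ⟩
  have hpat : γ ∈ patterns p L N γ.card := Finset.mem_filter.2 ⟨Finset.mem_univ _, rfl, hγ⟩
  have hT : 0 < Fintype.card (CoeffIdx p L N) := by
    have := Finset.card_le_univ γ
    omega
  refine le_trans ?_ (le_paramPrior_apply hF hs hpat)
  rw [ENNReal.ofReal_mul (widthWeight_nonneg hlam N), ENNReal.ofReal_mul (by positivity),
    ENNReal.ofReal_mul (by positivity)]
  gcongr
  · exact le_sparsityWeight hlamS hs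
  · rw [ENNReal.ofReal_inv_of_pos (by positivity), ENNReal.ofReal_pow (by positivity),
      ENNReal.ofReal_natCast]
    refine ENNReal.inv_le_inv.2 ?_
    exact_mod_cast card_patterns_le p L N γ.card
  · refine (le_coeffPrior_ball hB0 hB1 hBA hδ0 hδ1).trans (measure_mono fun B' hB' => hBF B' hB')

/-- `N!` is at most `n ^ N`, and every constant is absorbed into a power of `n`, so the cost is of
order `N * log n` in the exponent. -/
theorem le_widthWeight {lam : ℝ} (hlam : 0 < lam) {n N : ℕ} (hn : 1 ≤ n) (hN : 1 ≤ N) (hNn : N ≤ n)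
    (h1 : 1 ≤ lam * n) (h2 : Real.exp lam - 1 ≤ n) :
    ((n : ℝ) ^ (2 * N + 1))⁻¹ ≤ widthWeight lam N := by
  have hn0 : (0 : ℝ) < n := by exact_mod_cast hn
  have he : 0 < Real.exp lam - 1 := by linarith [Real.add_one_lt_exp hlam.ne']
  rw [widthWeight, if_neg (by omega)]
  have hf : (N.factorial : ℝ) ≤ (n : ℝ) ^ N := by
    have : N.factorial ≤ n ^ N := (Nat.factorial_le_pow N).trans (Nat.pow_le_pow_left hNn N)
    exact_mod_cast this
  have hl : 1 ≤ lam ^ N * (n : ℝ) ^ N := by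
    rw [← mul_pow]; exact one_le_pow₀ h1
  have hf0 : (0 : ℝ) < N.factorial := by exact_mod_cast Nat.factorial_pos N
  rw [le_div_iff₀ (by positivity), inv_mul_le_iff₀ (by positivity)]
  calc (Real.exp lam - 1) * (N.factorial : ℝ) ≤ n * (n : ℝ) ^ N := by gcongr
    _ ≤ n * (n : ℝ) ^ N * (lam ^ N * (n : ℝ) ^ N) := le_mul_of_one_le_right (by positivity) hl
    _ = _ := by ring

/-! ### Lower bound for the evidence -/

/-- Prior mass of the networks close to a given sparse network at the design points. -/
theorem le_paramPrior_evalNet {lam lamS : ℝ} (hlam : 0 < lam) (hlamS : 0 < lamS) {p L N n : ℕ}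
    {γ : Finset (CoeffIdx p L N)} {B : CoeffIdx p L N → ℝ} (hγ : ∀ k, Sum.inr k ∈ γ)
    {A : ℝ} (hA : 1 ≤ A) (hB0 : ∀ j, j ∉ γ → B j = 0) (hB1 : ∀ k, |B (Sum.inl k)| ≤ 1)
    (hBA : ∀ k, |B (Sum.inr k)| ≤ A) {x : Fin n → Fin p → ℝ} (hx : ∀ i j, |x i j| ≤ 1)
    (hN : 1 ≤ N) (hNn : N ≤ n) (hW : p + 12 * p * N + 1 ≤ n) (hLn : L + 1 ≤ n) (hAn : A + 1 ≤ n)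
    (h1 : 1 ≤ lam * n) (h2 : Real.exp lam - 1 ≤ n) (h3 : Real.exp lamS ≤ n)
    (h4 : 2 * Real.exp ((A + 1) ^ 2 / 2) ≤ n) :
    ENNReal.ofReal ((n : ℝ) ^ (2 * N + 4 + (2 * L + 11) * γ.card))⁻¹ ≤
      paramPrior lam lamS p L {ω | ∀ i, |evalNet x ω i - network B (x i)| ≤ ((n : ℝ) ^ 3)⁻¹} := by
  have hn1 : 1 ≤ n := by omega
  have hnr : (1 : ℝ) ≤ n := by exact_mod_cast hn1
  have hn0 : (0 : ℝ) < n := by linarith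
  -- The Lipschitz factor is at most `n * (n * n) ^ (L + 1)`, which leaves an error of `n⁻³` at the
  -- design points.
  set δ : ℝ := ((n : ℝ) ^ (2 * (L + 1) + 4))⁻¹ with hδ
  have hδ0 : 0 ≤ δ := by positivity
  have hδ1 : δ ≤ 1 := inv_le_one_of_one_le₀ (one_le_pow₀ hnr)
  have hF : MeasurableSet {ω : Param p L | ∀ i, |evalNet x ω i - network B (x i)| ≤ ((n : ℝ) ^ 3)⁻¹} := by
    have e : {ω : Param p L | ∀ i, |evalNet x ω i - network B (x i)| ≤ ((n : ℝ) ^ 3)⁻¹} =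
        ⋂ i, {ω | |evalNet x ω i - network B (x i)| ≤ ((n : ℝ) ^ 3)⁻¹} := by
      ext ω; simp
    rw [e]
    refine MeasurableSet.iInter fun i => measurableSet_le ?_ measurable_const
    have hm : Measurable fun ω : Param p L => evalNet x ω i :=
      (measurable_pi_apply i).comp (measurable_evalNet x)
    exact (hm.sub_const _).abs
  refine le_trans (ENNReal.ofReal_le_ofReal ?_)
    (le_paramPrior_ball hlam hlamS hγ hB0 hB1 hBA hδ0 hδ1 hF ?_)
  · have hT0 : 0 < Fintype.card (CoeffIdx p L N) :=
      Finset.card_pos.2 ⟨Sum.inr none, Finset.mem_univ _⟩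
    have hT : (Fintype.card (CoeffIdx p L N) : ℝ) ≤ (n : ℝ) ^ 3 := by
      have := card_coeffIdx_le (p := p) (L := L) (N := N) (W := p + 12 * p * N)
        (Nat.le_add_right _ _) (Nat.le_add_left _ _)
      have h5 : Fintype.card (CoeffIdx p L N) ≤ n ^ 3 := by
        calc _ ≤ (L + 1) * (p + 12 * p * N + 1) ^ 2 := this
          _ ≤ n * n ^ 2 := by gcongr
          _ = n ^ 3 := by ring
      exact_mod_cast h5
    have hT0' : (0 : ℝ) < Fintype.card (CoeffIdx p L N) := by exact_mod_cast hT0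
    have e1 : ((n : ℝ) ^ γ.card)⁻¹ ≤ Real.exp (-lamS * γ.card) := by
      rw [mul_comm, Real.exp_nat_mul, Real.exp_neg, inv_pow]
      exact inv_anti₀ (pow_pos (Real.exp_pos _) _) (by gcongr)
    have e2 : ((n : ℝ) ^ γ.card)⁻¹ * ((n : ℝ) ^ 3)⁻¹ ≤
        Real.exp (-lamS * γ.card) / Fintype.card (CoeffIdx p L N) := by
      rw [div_eq_mul_inv]
      exact mul_le_mul e1 (inv_anti₀ hT0' hT) (by positivity) (Real.exp_pos _).le
    have e3 : (((n : ℝ) ^ 3) ^ γ.card)⁻¹ ≤ ((Fintype.card (CoeffIdx p L N) : ℝ) ^ γ.card)⁻¹ :=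
      inv_anti₀ (pow_pos hT0' _) (by gcongr)
    have e4 : ((n : ℝ) ^ (2 * (L + 1) + 5))⁻¹ ≤ δ / 2 * Real.exp (-(A + 1) ^ 2 / 2) := by
      have e : δ / 2 * Real.exp (-(A + 1) ^ 2 / 2) =
          ((n : ℝ) ^ (2 * (L + 1) + 4) * (2 * Real.exp ((A + 1) ^ 2 / 2)))⁻¹ := by
        rw [hδ, neg_div, Real.exp_neg, mul_inv, mul_inv]; ring
      rw [e, show 2 * (L + 1) + 5 = 2 * (L + 1) + 4 + 1 from rfl, pow_succ]
      exact inv_anti₀ (by positivity) (by gcongr)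
    -- The width weight and the number of levels account for `(2 * N + 1) + 3`. Each active
    -- coefficient pays `1` for sparsity, `3` for the choice of pattern and `2 * L + 7` for the
    -- ball.
    calc ((n : ℝ) ^ (2 * N + 4 + (2 * L + 11) * γ.card))⁻¹
        = ((n : ℝ) ^ (2 * N + 1))⁻¹ * (((n : ℝ) ^ γ.card)⁻¹ * ((n : ℝ) ^ 3)⁻¹ *
          ((((n : ℝ) ^ 3) ^ γ.card)⁻¹ * (((n : ℝ) ^ (2 * (L + 1) + 5))⁻¹) ^ γ.card)) := by
          rw [inv_pow, ← pow_mul, ← pow_mul]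
          simp only [← mul_inv, ← pow_add]
          congr 2
          ring
      _ ≤ _ := by
          refine mul_le_mul (le_widthWeight hlam hn1 hN hNn h1 h2) ?_ (by positivity)
            (widthWeight_nonneg hlam N)
          refine mul_le_mul e2 ?_ (by positivity) (by positivity)
          exact mul_le_mul e3 (pow_le_pow_left₀ (by positivity) e4 _) (by positivity) (by positivity)
  · intro B' hB' i
    have hBR : ∀ j, |B j| ≤ A := by
      rintro (k | k)
      · exact (hB1 k).trans hA
      · exact hBA k
    have hBR' : ∀ j, |B' j| ≤ A + 1 := fun j => by
      have : B' j = (B' j - B j) + B j := by ring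
      rw [this]
      refine (abs_add_le _ _).trans ?_
      linarith [hB' j, hBR j]
    have hdiff := abs_network_sub_le (W := p + 12 * p * N) (Nat.le_add_right _ _)
      (Nat.le_add_left _ _) (R := A + 1) (by linarith) hδ0 hBR' (fun j => (hBR j).trans (by linarith))
      hB' (u := x i) (hx i)
    refine hdiff.trans ?_
    have hW' : ((p + 12 * p * N : ℕ) : ℝ) + 1 ≤ n := by exact_mod_cast hW
    have hL' : (L : ℝ) + 1 ≤ n := by exact_mod_cast hLn
    calc ((L : ℝ) + 1) * δ * ((((p + 12 * p * N : ℕ) : ℝ) + 1) * (A + 1)) ^ (L + 1)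
        ≤ n * δ * ((n : ℝ) * n) ^ (L + 1) := by gcongr
      _ = ((n : ℝ) ^ 3)⁻¹ := by
          rw [hδ, ← sq, ← pow_mul]
          field_simp
          ring

/-- On the event that the noise is controlled, prior mass near the truth bounds the evidence. -/
theorem le_lintegral_netLR {lam lamS : ℝ} {p L n : ℕ} {f₀ : (Fin p → ℝ) → ℝ}
    {x : Fin n → Fin p → ℝ} {y θ : Fin n → ℝ} (hn : 2 ≤ n)
    (hε : ∀ i, |y i - f₀ (x i)| ≤ n + 1) {u : ℝ}
    (hθ : |(y - fun i => f₀ (x i)) ⬝ᵥ (θ - fun i => f₀ (x i))| ≤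
      (θ - fun i => f₀ (x i)) ⬝ᵥ (θ - fun i => f₀ (x i)) / 4 + u) {b : ℝ≥0∞}
    (hb : b ≤ paramPrior lam lamS p L {ω | ∀ i, |evalNet x ω i - θ i| ≤ ((n : ℝ) ^ 3)⁻¹}) :
    ENNReal.ofReal (Real.exp (-(2 * ((θ - fun i => f₀ (x i)) ⬝ᵥ (θ - fun i => f₀ (x i))) + u + 4))) * b ≤
      ∫⁻ ω, ENNReal.ofReal (Real.exp (netLR f₀ x y ω)) ∂(paramPrior lam lamS p L) := by
  have hnr : (2 : ℝ) ≤ n := by exact_mod_cast hn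
  set δ : ℝ := ((n : ℝ) ^ 3)⁻¹ with hδ
  have hδ0 : 0 ≤ δ := by positivity
  have hδn : n * (n + 1) * δ ≤ 1 := by
    rw [hδ, mul_inv_le_iff₀ (by positivity)]
    nlinarith [sq_nonneg ((n : ℝ) - 2)]
  have hδ1 : n * (δ * δ) ≤ 1 := by
    have : δ ≤ 1 := inv_le_one_of_one_le₀ (one_le_pow₀ (by linarith))
    nlinarith
  set v := θ - fun i => f₀ (x i) with hv
  refine le_trans ?_ (mul_meas_ge_le_lintegral (measurable_netLR f₀ x y).exp.ennreal_ofReal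
    (ENNReal.ofReal (Real.exp (-(2 * (v ⬝ᵥ v) + u + 4)))))
  gcongr
  refine hb.trans (measure_mono fun ω hω => ?_)
  refine ENNReal.ofReal_le_ofReal (Real.exp_le_exp.2 ?_)
  have h1 := abs_noise_le_of_net (θ₀ := fun i => f₀ (x i)) hε hθ hω hδ0 hδn
  have h2 : (evalNet x ω - θ) ⬝ᵥ (evalNet x ω - θ) ≤ n * (δ * δ) :=
    (le_abs_self _).trans (abs_dotProduct_le hω hω hδ0 hδ0)
  -- The squared error at most doubles up to a constant, and the likelihood ratio loses `1/2 + 3/8`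
  -- of it, which is less than `2 * (v ⬝ᵥ v)` plus a constant.
  have h3 := dotProduct_self_add_le v (evalNet x ω - θ) one_pos
  have e : v + (evalNet x ω - θ) = evalNet x ω - fun i => f₀ (x i) := by rw [hv]; abel
  rw [e] at h3
  have h4 := neg_abs_le ((y - fun i => f₀ (x i)) ⬝ᵥ (evalNet x ω - fun i => f₀ (x i)))
  have h5 := dotProduct_self_nonneg' v
  simp only [netLR, logLR]
  linarith

theorem card_deep_union_top_le {p L N : ℕ} [DecidableEq (CoeffIdx p L N)] (γ : Finset (DeepIdx p L N)) :
    (γ.image (Sum.inl : DeepIdx p L N → CoeffIdx p L N) ∪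
      Finset.univ.image (Sum.inr : TopIdx p L N → CoeffIdx p L N)).card ≤
      γ.card + (p + 12 * p * N + 1) := by
  refine (Finset.card_union_le _ _).trans (add_le_add Finset.card_image_le
    (Finset.card_image_le.trans ?_))
  simp only [Finset.card_univ, Fintype.card_option, Fintype.card_fin]
  exact Nat.succ_le_succ (width_le (Nat.le_add_right _ _) (Nat.le_add_left _ _) L)

theorem add_mul_add_one_le {p N : ℕ} (hp : 0 < p) (hN : 1 ≤ N) :
    p + 12 * p * N + 1 ≤ 14 * p * N := by
  have h1 : p ≤ p * N := Nat.le_mul_of_pos_right _ hN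
  have h2 : 1 ≤ p * N := hp.trans_le h1
  have h3 : 12 * p * N = 12 * (p * N) := by ring
  have h4 : 14 * p * N = 14 * (p * N) := by ring
  omega

/-- The exponent of the prior mass is of smaller order than `t`. -/
theorem exp_neg_le_inv_pow {n p l N s : ℕ} (hp : 0 < p) (hn : 1 ≤ n) (hN : 1 ≤ N)
    (hs : s ≤ 15 * p * N) {K C r t : ℝ} (hK : 0 ≤ K) (hl : ((l + 1 : ℕ) : ℝ) ≤ K * Real.log n)
    (hNC : (N : ℝ) ≤ C * (Real.log n * r)) (ht : 4 * (171 * p * K * C) * (Real.log n ^ 3 * r) ≤ t) :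
    Real.exp (-(t / 4)) ≤ ((n : ℝ) ^ (2 * N + 4 + (2 * l + 11) * s))⁻¹ := by
  have hn0 : (0 : ℝ) < n := by exact_mod_cast hn
  have hlog : 0 ≤ Real.log n := Real.log_natCast_nonneg n
  rw [Real.exp_neg]
  refine inv_anti₀ (by positivity) ?_
  -- Here `171 = 6 + 11 * 15`.
  have h1 : 2 * N + 4 + (2 * l + 11) * s ≤ 171 * p * ((l + 1) * N) := by
    calc 2 * N + 4 + (2 * l + 11) * s ≤ 6 * N + (11 * (l + 1)) * (15 * p * N) := by
          refine add_le_add (by omega) (Nat.mul_le_mul (by omega) hs)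
      _ ≤ 6 * (p * ((l + 1) * N)) + (11 * (l + 1)) * (15 * p * N) := by
          have : N ≤ p * ((l + 1) * N) := by
            calc N = 1 * (1 * N) := by ring
              _ ≤ p * ((l + 1) * N) := by gcongr <;> omega
          omega
      _ = _ := by ring
  calc (n : ℝ) ^ (2 * N + 4 + (2 * l + 11) * s)
      = Real.exp (((2 * N + 4 + (2 * l + 11) * s : ℕ) : ℝ) * Real.log n) := by
        rw [Real.exp_nat_mul, Real.exp_log hn0]
    _ ≤ _ := by
        refine Real.exp_le_exp.2 ?_
        calc ((2 * N + 4 + (2 * l + 11) * s : ℕ) : ℝ) * Real.log n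
            ≤ ((171 * p * ((l + 1) * N) : ℕ) : ℝ) * Real.log n := by gcongr
          _ = 171 * p * (((l + 1 : ℕ) : ℝ) * N) * Real.log n := by push_cast; ring
          _ ≤ 171 * p * ((K * Real.log n) * (C * (Real.log n * r))) * Real.log n := by gcongr
          _ = 4 * (171 * p * K * C) * (Real.log n ^ 3 * r) / 4 := by ring
          _ ≤ _ := by gcongr

/-- The squared approximation error at the design points. -/
theorem dotProduct_self_le_rpow {n M : ℕ} (hn : 1 ≤ n) {v : Fin n → ℝ} {A α e : ℝ} (hA : 0 ≤ A)
    (hα : 0 ≤ α) (hM : (n : ℝ) ^ e ≤ M) (hv : ∀ i, |v i| ≤ A * (M : ℝ) ^ (-α)) :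
    v ⬝ᵥ v ≤ A ^ 2 * (n : ℝ) ^ (1 - 2 * (α * e)) := by
  have hn0 : (0 : ℝ) < n := by exact_mod_cast hn
  have hb : ∀ i, |v i| ≤ A * (n : ℝ) ^ (-(α * e)) := fun i => by
    refine (hv i).trans ?_
    gcongr
    rw [Real.rpow_neg (Nat.cast_nonneg M), Real.rpow_neg hn0.le]
    refine inv_anti₀ (by positivity) ?_
    rw [mul_comm α e, Real.rpow_mul hn0.le]
    gcongr
  refine (le_abs_self _).trans ((abs_dotProduct_le hb hb (by positivity) (by positivity)).trans
    (le_of_eq ?_))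
  have : (n : ℝ) ^ (1 - 2 * (α * e)) = n * ((n : ℝ) ^ (-(α * e)) * (n : ℝ) ^ (-(α * e))) := by
    rw [← Real.rpow_add hn0, sub_eq_add_neg, Real.rpow_add hn0, Real.rpow_one]
    congr 2; ring
  rw [this]; ring

/-- The evidence is bounded below with large probability, given a good sparse network. -/
theorem dataLaw_evidence_lt_le {lam lamS : ℝ} {p l n : ℕ} {f₀ : (Fin p → ℝ) → ℝ}
    {x : Fin n → Fin p → ℝ} {θ : Fin n → ℝ} (hn : 2 ≤ n) {t : ℝ} (ht : 32 ≤ t)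
    (hv : 16 * ((θ - fun i => f₀ (x i)) ⬝ᵥ (θ - fun i => f₀ (x i))) ≤ t)
    (hmass : ENNReal.ofReal (Real.exp (-(t / 4))) ≤
      paramPrior lam lamS p l {ω | ∀ i, |evalNet x ω i - θ i| ≤ ((n : ℝ) ^ 3)⁻¹}) :
    dataLaw f₀ x {y : Fin n → ℝ | ∫⁻ ω, ENNReal.ofReal (Real.exp (netLR f₀ x y ω))
      ∂(paramPrior lam lamS p l) < ENNReal.ofReal (Real.exp (-t))} ≤
      ENNReal.ofReal (2 * n * Real.exp (-n / 2)) + ENNReal.ofReal (2 * Real.exp (-(t / 4) / 2)) := by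
  -- Only the single direction of the approximating network needs noise control. The budget: at most
  -- `t / 8` each for squared error and constant, `t / 4` each for noise and prior mass.
  have hsub : {y : Fin n → ℝ | ∫⁻ ω, ENNReal.ofReal (Real.exp (netLR f₀ x y ω))
      ∂(paramPrior lam lamS p l) < ENNReal.ofReal (Real.exp (-t))} ⊆
      {y | ¬ ∀ i, |y i - f₀ (x i)| ≤ n + 1} ∪ {y | ¬ ∀ c ∈ ({θ} : Finset (Fin n → ℝ)),
        |(y - fun i => f₀ (x i)) ⬝ᵥ (c - fun i => f₀ (x i))| ≤
          (c - fun i => f₀ (x i)) ⬝ᵥ (c - fun i => f₀ (x i)) / 4 + t / 4} := by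
    intro y hy
    by_contra hcon
    rw [Set.mem_union, not_or] at hcon
    simp only [Set.mem_ofPred_eq, not_not, Finset.mem_singleton, forall_eq] at hcon
    rw [Set.mem_ofPred_eq] at hy
    refine absurd hy (not_lt.2 ?_)
    refine le_trans ?_ (le_lintegral_netLR hn hcon.1 hcon.2 hmass)
    rw [ofReal_exp_mul]
    refine ofReal_exp_le ?_
    linarith
  refine (measure_mono hsub).trans ((measure_union_le _ _).trans (add_le_add ?_ ?_))
  · exact gaussLaw_exists_abs_gt fun i => f₀ (x i)
  · refine (gaussLaw_net_le (fun i => f₀ (x i)) {θ} _).trans (le_of_eq ?_)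
    simp

/-- The evidence is bounded below when the approximation error and the complexity of the
approximating networks are balanced. -/
theorem evidenceBound {p : ℕ} (hp : 0 < p) {α : ℝ} (hα0 : 0 < α) (hαp : α ≤ p)
    {f₀ : (Fin p → ℝ) → ℝ} (hf₀ : IsHolder α f₀) {x : (n : ℕ) → Fin n → Fin p → ℝ}
    (hx : ∀ n i, x n i ∈ Set.Icc (0 : Fin p → ℝ) 1) {lam lamS : ℝ} (hlam : 0 < lam) (hlamS : 0 < lamS)
    {L : ℕ → ℕ} {c₀ CL : ℝ} (hc₀ : 0 < c₀) (hL0 : ∀ᶠ n : ℕ in atTop, c₀ * Real.log n ≤ L n)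
    (hL1 : ∀ᶠ n : ℕ in atTop, (L n : ℝ) ≤ CL * Real.log n) {e γ : ℝ} (he : 0 < e)
    (hep : e * p < γ) (heα : 1 - 2 * (α * e) < γ) (hγ1 : γ < 1) :
    EvidenceBound lam lamS f₀ x L γ := by
  classical
  obtain ⟨A, hA1, happ⟩ := exists_network_approx hp hα0 hαp hf₀ hc₀
  have hep0 : 0 < e * p := by positivity
  have hγ0 : 0 < γ := hep0.trans hep
  have hA1' : (1 : ℝ) ≤ A := by exact_mod_cast hA1
  have hp1 : (1 : ℝ) ≤ p := by exact_mod_cast hp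
  set C₁ : ℝ := A * (3 ^ p + |CL|) with hC₁
  have hC₁0 : 0 ≤ C₁ := by positivity
  have hcast : ∀ C : ℝ, ∀ᶠ n : ℕ in atTop, C ≤ (n : ℝ) := fun C =>
    tendsto_natCast_atTop_atTop.eventually_ge_atTop C
  have t1 := tendsto_ofReal_mul_exp_neg_half
  have t2 : Tendsto (fun n : ℕ => ENNReal.ofReal (2 * Real.exp (-((n : ℝ) ^ γ / 4) / 2))) atTop (𝓝 0) := by
    refine tendsto_zero_of_eventually_le_exp_neg_rpow (a := γ / 2) (C := 2) (by linarith) ?_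
    filter_upwards [eventually_mul_rpow_le (show γ / 2 < γ by linarith) 8] with n h
    gcongr
    linarith
  have t3 := t1.add t2
  rw [add_zero] at t3
  refine tendsto_of_tendsto_of_tendsto_of_le_of_le' tendsto_const_nhds t3
    (Eventually.of_forall fun _ => zero_le) ?_
  filter_upwards [happ, hL0, hL1, eventually_ge_atTop 3,
    eventually_mul_log_pow_mul_rpow_le (show e * p < 1 by linarith) (14 * p * C₁) 1,
    eventually_mul_log_pow_mul_rpow_le hep (4 * (171 * p * (|CL| + 1) * C₁)) 3,
    eventually_mul_log_pow_mul_rpow_le (zero_lt_one) (|CL| + 1) 1,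
    eventually_mul_rpow_le heα (16 * A ^ 2), eventually_mul_rpow_le hγ0 32,
    hcast (A + 1), hcast lam⁻¹, hcast (Real.exp lam - 1), hcast (Real.exp lamS),
    hcast (2 * Real.exp (((A : ℝ) + 1) ^ 2 / 2))] with
    n happ hL0 hL1 hn e1 e2 e3 e4 e5 a1 a2 a3 a4 a5
  have hnr : (3 : ℝ) ≤ n := by exact_mod_cast hn
  have hn0 : (0 : ℝ) < n := by linarith
  have hlog : 1 ≤ Real.log n := by
    rw [Real.le_log_iff_exp_le hn0]
    linarith [Real.exp_one_lt_d9]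
  rw [Real.rpow_one, pow_one] at e1
  rw [Real.rpow_one, pow_one, Real.rpow_zero, mul_one] at e3
  rw [Real.rpow_zero, mul_one] at e5
  have hL2 : ((L n + 1 : ℕ) : ℝ) ≤ (|CL| + 1) * Real.log n := by
    push_cast
    nlinarith [le_abs_self CL]
  -- the number of cells
  obtain ⟨M, hM⟩ : ∃ M : ℕ, M = ⌈(n : ℝ) ^ e⌉₊ := ⟨_, rfl⟩
  have hne1 : (1 : ℝ) ≤ (n : ℝ) ^ e := Real.one_le_rpow (by linarith) he.le
  have hM1 : 1 ≤ M := hM ▸ Nat.one_le_ceil_iff.2 (by linarith)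
  have he1 : e ≤ 1 := by nlinarith
  have hMn : M ≤ n := hM ▸ Nat.ceil_le.2 (by
    calc (n : ℝ) ^ e ≤ (n : ℝ) ^ (1 : ℝ) := Real.rpow_le_rpow_of_exponent_le (by linarith) he1
      _ = n := Real.rpow_one _)
  have hM3 : (M : ℝ) + 1 ≤ 3 * (n : ℝ) ^ e := by
    rw [hM]
    linarith [Nat.ceil_lt_add_one (zero_le_one.trans hne1)]
  have hMp : (((M + 1) ^ p : ℕ) : ℝ) ≤ 3 ^ p * (n : ℝ) ^ (e * p) := by
    push_cast
    calc ((M : ℝ) + 1) ^ p ≤ (3 * (n : ℝ) ^ e) ^ p := by gcongr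
      _ = _ := by rw [mul_pow, Real.rpow_mul_natCast hn0.le]
  -- the width parameter
  obtain ⟨N, hN⟩ : ∃ N : ℕ, N = A * ((M + 1) ^ p + L n) := ⟨_, rfl⟩
  have hN1 : 1 ≤ N := Nat.one_le_iff_ne_zero.2 (by rw [hN]; positivity)
  have hnep : 1 ≤ (n : ℝ) ^ (e * p) := Real.one_le_rpow (by linarith) hep0.le
  have hNC : (N : ℝ) ≤ C₁ * (Real.log n * (n : ℝ) ^ (e * p)) := by
    rw [hN, hC₁, Nat.cast_mul, Nat.cast_add, mul_assoc]
    refine mul_le_mul_of_nonneg_left ?_ (by positivity)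
    have b1 : (3 : ℝ) ^ p * (n : ℝ) ^ (e * p) ≤ 3 ^ p * (Real.log n * (n : ℝ) ^ (e * p)) := by
      gcongr
      exact le_mul_of_one_le_left (by positivity) hlog
    have b2 : (L n : ℝ) ≤ |CL| * (Real.log n * (n : ℝ) ^ (e * p)) := by
      calc (L n : ℝ) ≤ |CL| * Real.log n := hL1.trans (by gcongr; exact le_abs_self CL)
        _ ≤ _ := by
          gcongr
          exact le_mul_of_one_le_right (by linarith) hnep
    linarith
  have hW : p + 12 * p * N + 1 ≤ n := by
    have h1 := add_mul_add_one_le hp hN1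
    have h2 : (14 * p * N : ℝ) ≤ n := by
      calc (14 * p * N : ℝ) ≤ 14 * p * (C₁ * (Real.log n * (n : ℝ) ^ (e * p))) := by gcongr
        _ = 14 * p * C₁ * (Real.log n * (n : ℝ) ^ (e * p)) := by ring
        _ ≤ n := e1
    have h3 : 14 * p * N ≤ n := by exact_mod_cast h2
    exact h1.trans h3
  have hNn : N ≤ n := (Nat.le_mul_of_pos_left N (show 0 < 12 * p by omega)).trans
    ((Nat.le_add_left _ p).trans ((Nat.le_succ _).trans hW))
  have hLn : L n + 1 ≤ n := by exact_mod_cast hL2.trans e3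
  obtain ⟨B, γd, hγd, hB0, hB1, hBA, hBerr⟩ := happ M (L n) N (x n) hM1 hMn hL0 (hx n) hN.ge
  -- Admissible patterns contain the top layer, whose size is of order `N`; the number of active
  -- coefficients is therefore still of that order.
  set γ' : Finset (CoeffIdx p (L n) N) := γd.image Sum.inl ∪ Finset.univ.image Sum.inr with hγ'
  have hs : γ'.card ≤ 15 * p * N := by
    have h1 : N ≤ p * N := Nat.le_mul_of_pos_left _ hp
    calc γ'.card ≤ γd.card + (p + 12 * p * N + 1) := card_deep_union_top_le γd
      _ ≤ p * N + 14 * p * N :=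
        add_le_add ((hγd.trans_eq hN.symm).trans h1) (add_mul_add_one_le hp hN1)
      _ = 15 * p * N := by ring
  have hx1 : ∀ i j, |x n i j| ≤ 1 := fun i j => by
    rw [abs_of_nonneg ((hx n i).1 j)]; exact (hx n i).2 j
  have hmass := le_paramPrior_evalNet hlam hlamS (γ := γ') (B := B)
    (fun k => Finset.mem_union_right _ (Finset.mem_image_of_mem _ (Finset.mem_univ k))) hA1'
    (by
      rintro (k | k) hk
      · exact hB0 k fun h => hk (Finset.mem_union_left _ (Finset.mem_image_of_mem _ h))
      · exact absurd (Finset.mem_union_right _ (Finset.mem_image_of_mem _ (Finset.mem_univ k))) hk)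
    hB1 hBA hx1 hN1 hNn hW hLn a1
    (by rw [← inv_mul_le_iff₀ hlam, mul_one]; exact a2) a3 a4 a5
  have hmass' := exp_neg_le_inv_pow hp (by omega) hN1 hs (by positivity) hL2 hNC e2
  have hv := dotProduct_self_le_rpow (v := (fun i => network B (x n i)) - fun i => f₀ (x n i)) (by omega)
    (by positivity) hα0.le (hM ▸ Nat.le_ceil _) hBerr
  exact dataLaw_evidence_lt_le (by omega) e5 (by linarith)
    ((ENNReal.ofReal_le_ofReal hmass').trans hmass)

end SparseBvM

/-! ### Choice of exponents and conclusion -/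

theorem theorem4p1 (p : ℕ) (α : ℝ) (hα0 : 0 < α) (hαp : α < p)
    (f₀ : (Fin p → ℝ) → ℝ) (hf₀ : IsHolder α f₀)
    (x : (n : ℕ) → Fin n → Fin p → ℝ) (hx : ∀ n i, x n i ∈ Set.Icc (0 : Fin p → ℝ) 1)
    (lam lamS : ℝ) (hlam : 0 < lam) (hlamS : 0 < lamS)
    (L : ℕ → ℕ) (hL : (fun n => (L n : ℝ)) =Θ[atTop] fun n => Real.log (n : ℝ)) :
    (∀ a : (Fin p → ℝ) → ℝ, (∃ c : ℝ, ∀ u ∈ Set.Icc (0 : Fin p → ℝ) 1, a u = c) →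
      AsymptoticallyNormal (fun n => dataLaw f₀ (x n))
        (fun n y => posterior (prior lam lamS p (L n)) (x n) y)
        (fun n f => empInner (x n) a f)
        (fun n y => empInner (x n) a f₀ + 1 / Real.sqrt n * noise f₀ (x n) y a)
        (fun n => empNormSq (x n) a)) ∧
    ((p : ℝ) / 2 < α →
      AsymptoticallyNormal (fun n => dataLaw f₀ (x n))
        (fun n y => posterior (prior lam lamS p (L n)) (x n) y)
        (fun n f => empNormSq (x n) f)
        (fun n y => empNormSq (x n) f₀ + 2 / Real.sqrt n * noise f₀ (x n) y f₀)
        (fun n => 4 * empNormSq (x n) f₀)) := by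
  have hp : 0 < p := by
    have : (0 : ℝ) < p := hα0.trans hαp
    exact_mod_cast this
  have hp0 : (0 : ℝ) < p := by exact_mod_cast hp
  have hx1 : ∀ n i j, |x n i j| ≤ 1 := fun n i j => by
    rw [abs_of_nonneg ((hx n i).1 j)]; exact (hx n i).2 j
  obtain ⟨CL, hCL⟩ := hL.1.bound
  obtain ⟨c, hc0, hc⟩ := hL.2.exists_pos
  have hL1 : ∀ᶠ n : ℕ in atTop, (L n : ℝ) ≤ CL * Real.log n := by
    filter_upwards [hCL] with n hn
    rwa [Real.norm_natCast, Real.norm_of_nonneg (Real.log_natCast_nonneg n)] at hn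
  have hL0 : ∀ᶠ n : ℕ in atTop, c⁻¹ * Real.log n ≤ L n := by
    filter_upwards [hc.bound] with n hn
    rw [Real.norm_natCast, Real.norm_of_nonneg (Real.log_natCast_nonneg n)] at hn
    rwa [inv_mul_le_iff₀ hc0]
  have hE : ∀ {e γ : ℝ}, 0 < e → e * p < γ → 1 - 2 * (α * e) < γ → γ < 1 →
      EvidenceBound lam lamS f₀ x L γ := fun he h1 h2 h3 =>
    evidenceBound hp hα0 hαp.le hf₀ hx hlam hlamS (inv_pos.2 hc0) hL0 hL1 he h1 h2 h3
  refine ⟨?_, fun hα => ?_⟩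
  · rintro a ⟨b, hb⟩
    -- Only `γ < 1` is needed here, so any positive `e` below `1 / p` would serve.
    have he : (0 : ℝ) < 1 / (2 * p) := by positivity
    have h1 : 1 / (2 * (p : ℝ)) * p < 1 := by
      field_simp
      norm_num
    have h2 : 1 - 2 * (α * (1 / (2 * (p : ℝ)))) < 1 := by
      have := mul_pos hα0 he
      linarith
    obtain ⟨γ, hγ, hγ1⟩ := exists_between (max_lt h1 h2)
    have hγe := (le_max_left _ _).trans_lt hγ
    exact asymptoticallyNormal_empInner hlam ((mul_pos he hp0).trans hγe) hγ1
      (hE he hγe ((le_max_right _ _).trans_lt hγ) hγ1) fun n i => hb _ (hx n i)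
  · obtain ⟨F, hF⟩ : ∃ F, ∀ u ∈ Set.Icc (0 : Fin p → ℝ) 1, ‖f₀ u‖ ≤ F := by
      obtain ⟨k, -, -, hk, -⟩ := hf₀
      exact isCompact_Icc.exists_bound_of_continuousOn hk.continuousOn
    -- The conditions `1 - 2 * (α * e) < 1 / 2` and `e * p < 1 / 2` confine `e` to this interval,
    -- which is nonempty exactly because `α > p / 2`.
    have h12 : 1 / (4 * α) < 1 / (2 * (p : ℝ)) :=
      one_div_lt_one_div_of_lt (by positivity) (by linarith)
    obtain ⟨e, he1, he2⟩ := exists_between h12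
    have he : 0 < e := lt_trans (by positivity) he1
    have h1 : e * p < 1 / 2 := by
      rw [lt_div_iff₀ (by positivity)] at he2 ⊢
      linarith
    have h2 : 1 - 2 * (α * e) < 1 / 2 := by
      rw [div_lt_iff₀ (by positivity)] at he1
      linarith
    obtain ⟨γ, hγ, hγ1⟩ := exists_between (max_lt h1 h2)
    have hγe := (le_max_left _ _).trans_lt hγ
    exact asymptoticallyNormal_empNormSq hx1 (fun n i => hF _ (hx n i)) hlam hlamS hL1
      ((mul_pos he hp0).trans hγe) hγ1
      (hE he hγe ((le_max_right _ _).trans_lt hγ) (hγ1.trans (by norm_num)))
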